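/- Let $\alpha\in(0,1)$, $b_1,b_2>0$, $d>b_1+b_2$ and $\gamma_1\in\mathbb R$. Let $\mathbb T$ be the unit circle, and $f'=df/dw$ the derivative along $\mathbb T$ (so that $\frac{d}{d\theta}f(e^{i\theta})=ie^{i\theta}f'(e^{i\theta})$). Contour integrals over $\mathbb T$ are taken counterclockwise. Let $X_1$ be the real Banach space of all $f\in C^{1+\alpha}(\mathbb T)$ of the form $f(w)=\sum_{n\ge1}a_n\overline w^{\,n}$ with $a_n\in\mathbb R$, with norm $\|f\|_\infty+\|f'\|_\infty+\sup_{\tau\ne w}\frac{|f'(\tau)-f'(w)|}{|\tau-w|^\alpha}$; let $X=X_1\times X_1$ with the maximum norm, and $B_1=\{f\in X:\|f\|\le1\}$. For $\varepsilon,U,\gamma_2\in\mathbb R$, $(f_1,f_2)\in X$ and $w\in\mathbb T$ set $F=(F_1,F_2)$, where for $j=1,2$, with $A=\tau-w$ and $B_j=f_j(\tau)-f_j(w)$, $$F_j(\varepsilon,U,\gamma_2,f_1,f_2)(w)=\operatorname{Im}\Big\{2Uw\big(1+\varepsilon b_jf_j'(w)\big)-\gamma_jf_j'(w)+\varepsilon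 b_j\gamma_jw\big(1+\varepsilon b_jf_j'(w)\big)\frac1{2\pi i}\int_{\mathbb T}\frac{A\overline{B_j}-\overline AB_j}{A(A+\varepsilon b_jB_j)}\Big[f_j'(\tau)-\frac{B_j}{A}\Big]d\tau$$ $$+\gamma_{3-j}w\big(1+\varepsilon b_jf_j'(w)\big)\frac1{2\pi i}\int_{\mathbb T}\frac{\big(\overline\tau+\varepsilon b_{3-j}\overline{f_{3-j}(\tau)}\big)\big(1+\varepsilon b_{3-j}f_{3-j}'(\tau)\big)}{\varepsilon(b_{3-j}\tau+b_jw)+\varepsilon^2\big(b_{3-j}^2f_{3-j}(\tau)+b_j^2f_j(w)\big)-d}\,d\tau\Big\}.$$ For $f\in X_1$ let $\tilde f(w)=f(-w)$. Then the following hold. 1. There are $\varepsilon_0\in(0,\frac12)$ and a $C^1$ function $g=(U,\gamma_2,f_1,f_2):[-\varepsilon_0,\varepsilon_0]\to\mathbb R\times\mathbb R\times B_1$ with $$F\big(\varepsilon,U(\varepsilon),\gamma_2(\varepsilon),f_1(\varepsilon),f_2(\varepsilon)\big)=0\ \text{ on }\mathbb T\text{ for all }\varepsilon\in[-\varepsilon_0,\varepsilon_0],\qquad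 \big(U,\gamma_2,f_1,f_2\big)(0)=\Big(\frac{\gamma_1}{2d},\gamma_1,0,0\Big).$$ If $\gamma_1\ne0$, then $g$ is the only $C^1$ function $[-\varepsilon_0,\varepsilon_0]\to\mathbb R\times\mathbb R\times B_1$ with these two properties. 2. If $F(\varepsilon,U,\gamma_2,f_1,f_2)=0$ on $\mathbb T$, then $F(-\varepsilon,U,\gamma_2,\tilde f_1,\tilde f_2)=0$ on $\mathbb T$. The curve $g$ of part 1 (some such curve, if $\gamma_1=0$) moreover satisfies $g(-\varepsilon)=\big(U(\varepsilon),\gamma_2(\varepsilon),\tilde f_1(\varepsilon),\tilde f_2(\varepsilon)\big)$ for all $\varepsilon\in[-\varepsilon_0,\varepsilon_0]$. 3. For this curve and every $\varepsilon\in[-\varepsilon_0,\varepsilon_0]\setminus\{0\}$, the maps $\phi_j(w)=w+\varepsilon b_jf_j(\varepsilon)(w)$, $j=1,2$, are regular $C^1$ parametrizations of Jordan curves. The domains $D_j^\varepsilon$ enclosed by these curves have boundary $\phi_j(\mathbb T)$, contain $0$, lie in $B(0,2)$ and are strictly convex. The patches $\tilde D_1^\varepsilon=\varepsilon b_1D_1^\varepsilon$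 and $\tilde D_2^\varepsilon=-\varepsilon b_2D_2^\varepsilon+d$ have disjoint closures and form a translating vortex pair with velocity $iU(\varepsilon)$: if $$\omega=\frac{\gamma_1}{\varepsilon^2b_1^2}\chi_{\tilde D_1^\varepsilon}-\frac{\gamma_2(\varepsilon)}{\varepsilon^2b_2^2}\chi_{\tilde D_2^\varepsilon},\qquad v(z)=\frac{i}{2\pi}\int_{\mathbb C}\frac{\omega(\zeta)}{\overline z-\overline\zeta}\,dA(\zeta)$$ are its vorticity and its Biot--Savart velocity, and $\vec n$ is the exterior unit normal, then $$\operatorname{Re}\big\{\big(\overline{v(z)}+iU(\varepsilon)\big)\vec n(z)\big\}=0\qquad\text{for all }z\in\partial\tilde D_1^\varepsilon\cup\partial\tilde D_2^\varepsilon.$$ -/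

import Mathlib

open scoped NNReal ComplexConjugate Real

noncomputable section

namespace VortexPair

/-- The derivative `f'(w) = df/dw` of a function on the unit circle, normalised so that
`d/dt f(w e^{it}) = i w e^{it} f'(w e^{it})`. -/
def circleDeriv (f : Circle → ℂ) (w : Circle) : ℂ :=
  deriv (fun t : ℝ => f (w * Circle.exp t)) 0 / (Complex.I * w)

/-- `f` is differentiable along the circle at every point. -/
def CircleDifferentiable (f : Circle → ℂ) : Prop :=
  ∀ w : Circle, DifferentiableAt ℝ (fun t : ℝ => f (w * Circle.exp t)) 0

/-- `f` belongs to `C^{1+α}(𝕋)`. -/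
def IsC1Holder (α : ℝ≥0) (f : Circle → ℂ) : Prop :=
  CircleDifferentiable f ∧ MemHolder α (circleDeriv f)

/-- The norm of `C^{1+α}(𝕋)`: `‖f‖_∞ + ‖f'‖_∞ + sup_{τ ≠ w} |f'(τ) - f'(w)| / |τ - w|^α`. -/
def c1HolderNorm (α : ℝ≥0) (f : Circle → ℂ) : ℝ :=
  (⨆ w, ‖f w‖) + (⨆ w, ‖circleDeriv f w‖) + nnHolderNorm α (circleDeriv f)

/-- `f(w) = ∑_{n ≥ 1} a_n w̄ ^ n` on the unit circle, with real coefficients `a_n`. -/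
def HasRealNegSeries (f : Circle → ℂ) : Prop :=
  ∃ a : ℕ → ℝ, ∀ w : Circle, HasSum (fun n : ℕ => (a n : ℂ) * conj (w : ℂ) ^ (n + 1)) (f w)

lemma circleDeriv_add {f g : Circle → ℂ} (hf : CircleDifferentiable f)
    (hg : CircleDifferentiable g) : circleDeriv (f + g) = circleDeriv f + circleDeriv g := by
  funext w
  have h := deriv_fun_add (hf w) (hg w)
  simp only [circleDeriv, Pi.add_apply, h, add_div]

lemma circleDeriv_smul {f : Circle → ℂ} (c : ℝ) (hf : CircleDifferentiable f) :
    circleDeriv (c • f) = c • circleDeriv f := by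
  funext w
  have h := deriv_fun_const_smul c (hf w)
  simp only [circleDeriv, Pi.smul_apply, h, smul_div_assoc]

lemma circleDeriv_zero : circleDeriv (0 : Circle → ℂ) = 0 := by
  funext w
  simp [circleDeriv]

lemma CircleDifferentiable.continuous {f : Circle → ℂ} (hf : CircleDifferentiable f) :
    Continuous f := by
  rw [continuous_iff_continuousAt]
  intro w
  have h1 : ContinuousAt (fun t : ℝ => f (w * Circle.exp t)) 0 := (hf w).continuousAt
  have harg : ContinuousAt (fun z : Circle => Complex.arg ((w⁻¹ * z : Circle) : ℂ)) w := by
    have h2 : ContinuousAt Complex.arg (((w⁻¹ * w : Circle)) : ℂ) := by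
      apply Complex.continuousAt_arg
      simp
    have h3 : ContinuousAt (fun z : Circle => ((w⁻¹ * z : Circle) : ℂ)) w := by
      fun_prop
    exact ContinuousAt.comp (f := fun z : Circle => ((w⁻¹ * z : Circle) : ℂ)) h2 h3
  have h0 : Complex.arg ((w⁻¹ * w : Circle) : ℂ) = 0 := by simp
  have h4 : ContinuousAt ((fun t : ℝ => f (w * Circle.exp t)) ∘
      (fun z : Circle => Complex.arg ((w⁻¹ * z : Circle) : ℂ))) w := by
    apply ContinuousAt.comp _ harg
    rw [h0]
    exact h1
  have h5 : ((fun t : ℝ => f (w * Circle.exp t)) ∘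
      (fun z : Circle => Complex.arg ((w⁻¹ * z : Circle) : ℂ))) = f := by
    funext z
    simp only [Function.comp_apply, Circle.exp_arg, mul_inv_cancel_left]
  rwa [h5] at h4

lemma MemHolder.bddAbove_norm {α : ℝ≥0} {f : Circle → ℂ} (hf : MemHolder α f) :
    BddAbove (Set.range fun w => ‖f w‖) := by
  obtain ⟨C, hC⟩ := hf
  refine ⟨‖f 1‖ + C * 2 ^ (α : ℝ), ?_⟩
  rintro _ ⟨w, rfl⟩
  have h2 : dist w (1 : Circle) ≤ 2 := by
    have : dist w (1 : Circle) = ‖(w : ℂ) - 1‖ := by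
      rw [← Circle.coe_one, ← dist_eq_norm]; rfl
    rw [this]
    refine (norm_sub_le _ _).trans ?_
    rw [Circle.norm_coe, norm_one]
    norm_num
  have h1 := hC.dist_le_of_le h2
  have h3 : ‖f w‖ ≤ ‖f 1‖ + dist (f w) (f 1) := by
    rw [dist_eq_norm]
    calc ‖f w‖ = ‖f 1 + (f w - f 1)‖ := by ring_nf
      _ ≤ _ := norm_add_le _ _
  have h4 : dist (f w) (f 1) ≤ C * 2 ^ (α : ℝ) := by simpa using h1
  linarith

lemma CircleDifferentiable.bddAbove_norm {f : Circle → ℂ} (hf : CircleDifferentiable f) :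
    BddAbove (Set.range fun w => ‖f w‖) := by
  have h : IsCompact (Set.range fun w => ‖f w‖) :=
    isCompact_range hf.continuous.norm
  exact h.bddAbove

/-- The functions of `C^{1+α}(𝕋)` of the form `∑_{n ≥ 1} a_n w̄ ^ n`, `a_n` real, as a real
vector space. -/
def holderSubmodule (α : ℝ≥0) : Submodule ℝ (Circle → ℂ) where
  carrier := {f | IsC1Holder α f ∧ HasRealNegSeries f}
  zero_mem' := by
    refine ⟨⟨fun w => by simp, ?_⟩, 0, fun w => by simp⟩
    rw [circleDeriv_zero]
    exact memHolder_zero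
  add_mem' := by
    rintro f g ⟨⟨hf, hf'⟩, a, ha⟩ ⟨⟨hg, hg'⟩, b, hb⟩
    refine ⟨⟨fun w => (hf w).fun_add (hg w), ?_⟩, a + b, fun w => ?_⟩
    · rw [circleDeriv_add hf hg]
      exact hf'.add hg'
    · simpa [add_mul] using (ha w).add (hb w)
  smul_mem' := by
    rintro c f ⟨⟨hf, hf'⟩, a, ha⟩
    refine ⟨⟨fun w => (hf w).fun_const_smul c, ?_⟩, c • a, fun w => ?_⟩
    · rw [circleDeriv_smul c hf]
      exact hf'.smul
    · simpa [mul_assoc] using (ha w).mul_left (c : ℂ)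

/-- The Banach space of `f ∈ C^{1+α}(𝕋)` with `f(w) = ∑_{n ≥ 1} a_n w̄ ^ n`, `a_n` real,
with the norm of `C^{1+α}(𝕋)`. -/
def HolderSpace (α : ℝ≥0) : Type := holderSubmodule α

namespace HolderSpace

variable {α : ℝ≥0}

instance : AddCommGroup (HolderSpace α) := inferInstanceAs (AddCommGroup (holderSubmodule α))

instance : Module ℝ (HolderSpace α) := inferInstanceAs (Module ℝ (holderSubmodule α))

instance : CoeFun (HolderSpace α) (fun _ => Circle → ℂ) := ⟨fun f => f.1⟩

instance : Norm (HolderSpace α) := ⟨fun f => c1HolderNorm α f⟩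

lemma coe_add (f g : HolderSpace α) : ((f + g : HolderSpace α) : Circle → ℂ) = f.1 + g.1 := rfl

lemma coe_smul (c : ℝ) (f : HolderSpace α) :
    ((c • f : HolderSpace α) : Circle → ℂ) = c • f.1 := rfl

lemma norm_def (f : HolderSpace α) : ‖f‖ = c1HolderNorm α f.1 := rfl

lemma core (α : ℝ≥0) : NormedSpace.Core ℝ (HolderSpace α) where
  norm_nonneg f := by
    rw [norm_def, c1HolderNorm]
    have h1 : 0 ≤ ⨆ w, ‖f.1 w‖ := Real.iSup_nonneg fun _ => norm_nonneg _
    have h2 : 0 ≤ ⨆ w, ‖circleDeriv f.1 w‖ := Real.iSup_nonneg fun _ => norm_nonneg _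
    positivity
  norm_smul c f := by
    obtain ⟨⟨hf, hf'⟩, -⟩ := f.2
    rw [norm_def, norm_def, coe_smul, c1HolderNorm, c1HolderNorm, circleDeriv_smul c hf,
      hf'.nnHolderNorm_smul c]
    simp only [Pi.smul_apply, norm_smul, ← Real.mul_iSup_of_nonneg (norm_nonneg c)]
    push_cast
    ring
  norm_triangle f g := by
    obtain ⟨⟨hf, hf'⟩, -⟩ := f.2
    obtain ⟨⟨hg, hg'⟩, -⟩ := g.2
    rw [norm_def, norm_def, norm_def, coe_add, c1HolderNorm, c1HolderNorm, c1HolderNorm,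
      circleDeriv_add hf hg]
    have h1 : (⨆ w, ‖(f.1 + g.1) w‖) ≤ (⨆ w, ‖f.1 w‖) + ⨆ w, ‖g.1 w‖ :=
      ciSup_le fun w => (norm_add_le _ _).trans
        (add_le_add (le_ciSup hf.bddAbove_norm w) (le_ciSup hg.bddAbove_norm w))
    have h2 : (⨆ w, ‖(circleDeriv f.1 + circleDeriv g.1) w‖) ≤
        (⨆ w, ‖circleDeriv f.1 w‖) + ⨆ w, ‖circleDeriv g.1 w‖ :=
      ciSup_le fun w => (norm_add_le _ _).trans
        (add_le_add (le_ciSup (MemHolder.bddAbove_norm hf') w)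
          (le_ciSup (MemHolder.bddAbove_norm hg') w))
    have h3 : (nnHolderNorm α (circleDeriv f.1 + circleDeriv g.1) : ℝ) ≤
        nnHolderNorm α (circleDeriv f.1) + nnHolderNorm α (circleDeriv g.1) := by
      exact_mod_cast hf'.nnHolderNorm_add_le hg'
    linarith
  norm_eq_zero_iff f := by
    obtain ⟨⟨hf, hf'⟩, -⟩ := f.2
    constructor
    · intro h
      rw [norm_def, c1HolderNorm] at h
      have h2 : 0 ≤ ⨆ w, ‖circleDeriv f.1 w‖ := Real.iSup_nonneg fun _ => norm_nonneg _
      have h3 : (0 : ℝ) ≤ nnHolderNorm α (circleDeriv f.1) := NNReal.coe_nonneg _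
      apply Subtype.ext
      funext w
      have h4 := le_ciSup hf.bddAbove_norm w
      have h5 : ‖f.1 w‖ ≤ 0 := by linarith
      exact norm_le_zero_iff.1 h5
    · rintro rfl
      have h0 : ((0 : HolderSpace α) : Circle → ℂ) = 0 := rfl
      rw [norm_def, h0, c1HolderNorm, circleDeriv_zero]
      simp

instance : NormedAddCommGroup (HolderSpace α) := NormedAddCommGroup.ofCore (core α)

instance : NormedSpace ℝ (HolderSpace α) := NormedSpace.ofCore (core α)

lemma circleDeriv_comp_neg (f : Circle → ℂ) (w : Circle) :
    circleDeriv (fun z => f (-z)) w = -circleDeriv f (-w) := by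
  have h : ∀ t : ℝ, -(w * Circle.exp t) = -w * Circle.exp t := fun t => (neg_mul _ _).symm
  simp only [circleDeriv, h, Circle.coe_neg, mul_neg, div_neg, neg_neg]

/-- The reflected function `f̃(w) = f(-w)`. -/
def reflect (f : HolderSpace α) : HolderSpace α :=
  ⟨fun w => f (-w), by
    obtain ⟨⟨hf, C, hC⟩, a, ha⟩ := f.2
    refine ⟨⟨fun w => ?_, C, fun x y => ?_⟩, fun n => (-1) ^ (n + 1) * a n, fun w => ?_⟩
    · have h := hf (-w)
      simp only [neg_mul] at h
      exact h
    · rw [circleDeriv_comp_neg, circleDeriv_comp_neg, edist_neg_neg]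
      have h := hC (-x) (-y)
      have hxy : edist (-x) (-y) = edist x y := by
        have h1 : ∀ u v : Circle, edist u v = edist (u : ℂ) (v : ℂ) := fun _ _ => rfl
        rw [h1, h1, Circle.coe_neg, Circle.coe_neg, edist_neg_neg]
      rwa [hxy] at h
    · convert ha (-w) using 2 with n
      rw [Circle.coe_neg, map_neg, neg_pow]
      push_cast
      ring⟩

end HolderSpace

/-- The normalised contour integral `(1 / 2πi) ∫_𝕋 h(τ) dτ`. -/
def circleMean (h : Circle → ℂ) : ℂ :=
  (2 * π * Complex.I)⁻¹ *
    ∫ θ in (0 : ℝ)..(2 * π), h (Circle.exp θ) * (Complex.I * (Circle.exp θ : ℂ))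

/-- One component of the translating-pair functional. The data of the patch under consideration
are its strength `γ`, size `b` and perturbation `f`; those of the other patch are `γ'`, `b'`, `f'`.
Here `A = τ - w` and `B = f(τ) - f(w)`. -/
def component (d ε U γ γ' b b' : ℝ) (f f' : Circle → ℂ) (w : Circle) : ℝ :=
  (2 * U * w * (1 + ε * b * circleDeriv f w) - γ * circleDeriv f w
    + ε * b * γ * w * (1 + ε * b * circleDeriv f w) *
      circleMean (fun τ =>
        let A : ℂ := τ - w
        let B : ℂ := f τ - f w
        (A * conj B - conj A * B) / (A * (A + ε * b * B)) * (circleDeriv f τ - B / A))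
    + γ' * w * (1 + ε * b * circleDeriv f w) *
      circleMean (fun τ =>
        (conj (τ : ℂ) + ε * b' * conj (f' τ)) * (1 + ε * b' * circleDeriv f' τ) /
          (ε * (b' * τ + b * w) + ε ^ 2 * (b' ^ 2 * f' τ + b ^ 2 * f w) - d)) : ℂ).im

/-- The translating-pair functional `F(ε, U, γ₂, f₁, f₂) = (F₁, F₂)`. -/
def pairFunctional (b₁ b₂ d γ₁ ε U γ₂ : ℝ) (f₁ f₂ : Circle → ℂ) (w : Circle) : ℝ × ℝ :=
  (component d ε U γ₁ γ₂ b₁ b₂ f₁ f₂ w, component d ε U γ₂ γ₁ b₂ b₁ f₂ f₁ w)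

/-- `(ε, U, γ₂, f₁, f₂)` solves the translating-pair system `F = 0` on the unit circle. -/
def IsSolution (b₁ b₂ d γ₁ ε U γ₂ : ℝ) (f₁ f₂ : Circle → ℂ) : Prop :=
  ∀ w : Circle, pairFunctional b₁ b₂ d γ₁ ε U γ₂ f₁ f₂ w = 0

/-- `g = (U, γ₂, (f₁, f₂))` is a `C¹` curve on `[-ε₀, ε₀]`, with `(f₁, f₂)` in the unit ball,
which solves `F(ε, g(ε)) = 0` and starts at the point vortex pair. -/
structure IsSolutionCurve {α : ℝ≥0} (b₁ b₂ d γ₁ ε₀ : ℝ)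
    (g : ℝ → ℝ × ℝ × (HolderSpace α × HolderSpace α)) : Prop where
  contDiffOn : ContDiffOn ℝ 1 g (Set.Icc (-ε₀) ε₀)
  norm_le_one : ∀ ε ∈ Set.Icc (-ε₀) ε₀, ‖(g ε).2.2‖ ≤ 1
  isSolution : ∀ ε ∈ Set.Icc (-ε₀) ε₀,
    IsSolution b₁ b₂ d γ₁ ε (g ε).1 (g ε).2.1 (g ε).2.2.1 (g ε).2.2.2
  initial : g 0 = (γ₁ / (2 * d), γ₁, (0, 0))

/-- The boundary parametrization `φ(w) = w + ε b f(w)`. -/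
def boundaryMap (ε b : ℝ) (f : Circle → ℂ) (w : Circle) : ℂ := w + ε * b * f w

/-- The region enclosed by a closed curve: the union of the bounded connected components of the
complement of its image. -/
def enclosedDomain (φ : Circle → ℂ) : Set ℂ :=
  {z | z ∉ Set.range φ ∧ Bornology.IsBounded (connectedComponentIn (Set.range φ)ᶜ z)}

/-- `φ` is a regular `C¹` parametrization of a Jordan curve, the boundary of the domain `D`. -/
structure IsC1BoundaryOf (φ : Circle → ℂ) (D : Set ℂ) : Prop where
  injective : Function.Injective φ
  differentiable : CircleDifferentiable φ
  continuous_deriv : Continuous (circleDeriv φ)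
  deriv_ne_zero : ∀ w, circleDeriv φ w ≠ 0
  frontier_eq : frontier D = Set.range φ

/-- A strictly convex domain. Mathlib's `StrictConvex` says that open segments between points of
the set lie in its interior, which has content for the closure, not for an open set. -/
structure IsStrictlyConvexDomain (D : Set ℂ) : Prop where
  isOpen : IsOpen D
  nonempty : D.Nonempty
  convex : Convex ℝ D
  strictConvex_closure : StrictConvex ℝ (closure D)

/-- The first rescaled patch `ε b₁ D₁`. -/
def patch₁ (ε b₁ : ℝ) (D₁ : Set ℂ) : Set ℂ := (fun z : ℂ => ε * b₁ * z) '' D₁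

/-- The second rescaled patch `-ε b₂ D₂ + d`. -/
def patch₂ (ε b₂ d : ℝ) (D₂ : Set ℂ) : Set ℂ := (fun z : ℂ => -(ε * b₂ * z) + d) '' D₂

/-- The vorticity `γ₁ / (ε² b₁²) χ_{P₁} - γ₂ / (ε² b₂²) χ_{P₂}`. -/
def vorticity (ε b₁ b₂ γ₁ γ₂ : ℝ) (P₁ P₂ : Set ℂ) (z : ℂ) : ℝ :=
  P₁.indicator (fun _ => γ₁ / (ε ^ 2 * b₁ ^ 2)) z - P₂.indicator (fun _ => γ₂ / (ε ^ 2 * b₂ ^ 2)) z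

/-- The Biot-Savart velocity `v₁ + i v₂` of a vorticity `ω`, that is
`v(z) = (i / 2π) ∫ ω(ζ) / (z̄ - ζ̄) dA(ζ)`. -/
def velocity (ω : ℂ → ℝ) (z : ℂ) : ℂ :=
  Complex.I / (2 * π) * ∫ ζ : ℂ, (ω ζ : ℂ) / (conj z - conj ζ)

/-- The exterior unit normal at `c(w)` of a positively oriented regular closed curve `c`: the unit
tangent `i w c'(w) / |c'(w)|` turned clockwise by a right angle. -/
def outerNormal (c : Circle → ℂ) (w : Circle) : ℂ :=
  w * circleDeriv c w / (‖circleDeriv c w‖ : ℂ)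

/-- The pair of disjoint patches `P₁ = ε b₁ D₁` and `P₂ = -ε b₂ D₂ + d`, where `∂D₁` and `∂D₂` are
parametrized by `φ₁` and `φ₂`, translates with velocity `i U`: in the moving frame the velocity
`v - i U` of the pair is tangent to the boundaries,
`Re ((conj (v(z)) + i U) n(z)) = 0` for all `z ∈ ∂P₁ ∪ ∂P₂`. -/
structure IsTranslatingPair (b₁ b₂ d γ₁ ε U γ₂ : ℝ) (φ₁ φ₂ : Circle → ℂ) (D₁ D₂ : Set ℂ) :
    Prop where
  disjoint : Disjoint (closure (patch₁ ε b₁ D₁)) (closure (patch₂ ε b₂ d D₂))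
  boundary₁ : ∀ w : Circle,
    ((conj (velocity (vorticity ε b₁ b₂ γ₁ γ₂ (patch₁ ε b₁ D₁) (patch₂ ε b₂ d D₂))
        (ε * b₁ * φ₁ w)) + Complex.I * U) *
      outerNormal (fun w => ε * b₁ * φ₁ w) w).re = 0
  boundary₂ : ∀ w : Circle,
    ((conj (velocity (vorticity ε b₁ b₂ γ₁ γ₂ (patch₁ ε b₁ D₁) (patch₂ ε b₂ d D₂))
        (-(ε * b₂ * φ₂ w) + d)) + Complex.I * U) *
      outerNormal (fun w => -(ε * b₂ * φ₂ w) + d) w).re = 0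

end VortexPair

end

open scoped NNReal ComplexConjugate Real

noncomputable section

namespace VortexPair

/-! ### Bounded linear maps out of `ℓ¹` -/

section SummableCoefficients

variable {ι 𝕜 E F : Type*} [RCLike 𝕜] [NormedAddCommGroup E] [NormedSpace 𝕜 E] [CompleteSpace E]
  [NormedAddCommGroup F] [NormedSpace 𝕜 F]

/-! Existence comes from the implicit function theorem, applied not in the Hölder space but in a
smaller space where no singular integral has to be estimated. The profiles are `f = ∑ x_n /
((n+1)(n+3)) w̄^(n+1)` with `x` in `ℓ¹` (`Coef`). After the substitution `τ = w σ`, the difference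
quotients of `f` and of its conjugate in `σ - 1`, the rotated derivative and the remaining
ingredients are bounded linear in `x` with values in the Banach algebra `C(Circle, Wiener)`, where
`Wiener` consists of Fourier series with `∑ (1 + |k|) |c_k| < ∞`. The functional is then composed of
products, averages and inverses of elements that are units at `ε = 0`, hence it is `C¹` there. The
weights are chosen so that the normalised Fourier coefficients of `f'` are exactly `-x_n`, and no
derivative is lost.

All Fourier coefficients are real, so the imaginary part of the functional is a sine series, and its
sine coefficients (`sineCoeff`) form the target space. At `ε = 0` the functional reduces to `Im ((2U
- γ'/d) w - γ f')`. Its linearisation at the point vortex pair is invertible when `γ₁ ≠ 0`: the two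
first modes determine `U` and `γ₂`, the higher modes determine the profiles. This gives
`exists_coef_curve`; the bounds `c11Bound_profile` carry the curve into `C^{1+α}`. When `γ₁ = 0`,
the constant curve zero serves.

Uniqueness has to hold in the larger Hölder space, where the implicit function theorem was not
applied. For two solutions near the point vortex pair at the same `ε`,
`norm_complexComponent_sub_le` shows that the difference of the functionals is its linear part `s w
- γ g'` up to a small multiple of the differences of the parameters, the `L²` norms of the
differences of the derivatives, and `|g'|` at the point. Since `g'` has only frequencies at most
`-2`, the integral of `Im (s w - γ g')²` is exactly `π s² + (γ²/2) ‖g'‖²` (`integral_sq_sub_im`).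
The linear part is thus controlled from below in `L²`, and smallness forces the solutions to agree
(`exists_local_uniqueness`). A competing curve starts at the same point and by continuity cannot
leave the ball in which this applies (`norm_le_of_gap`).

Changing the signs of `ε`, `τ` and `w` only changes the sign of the functional
(`component_reflect`). Hence the reflected curve is again a solution curve, and uniqueness gives the
symmetry of the curve.

For the patches, the perturbed circle extends radially to a homeomorphism of the plane, and strict
convexity follows from a quantitative supporting line inequality (`C11Bound.support_lower_bound`).
The Cauchy integral of a patch becomes a contour integral in cone coordinates, with the apex at the
pole for a boundary pole and at `0` for an exterior pole. Together with `circleMean_self` this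
identifies the tangential component of the moving-frame velocity condition with the functional: up
to a nonzero real scalar, the real part of the velocity times the normal is `Im` of the functional
minus a real constant (`cauchy_combination`), so zeros of the functional are translating pairs. -/

lemma l1_hasSum_norm (x : lp (fun _ : ι => 𝕜) 1) : HasSum (fun i => ‖x i‖) ‖x‖ := by
  have h := lp.hasSum_norm (p := 1) (by simp) x
  simpa using h

omit [CompleteSpace E] in
lemma l1_hasSum_smul_norm_le {v : ι → E} {C : ℝ} (hv : ∀ i, ‖v i‖ ≤ C)
    (x : lp (fun _ : ι => 𝕜) 1) (i : ι) : ‖x i • v i‖ ≤ ‖x i‖ * C := by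
  rw [norm_smul]
  exact mul_le_mul_of_nonneg_left (hv i) (norm_nonneg _)

lemma l1_summable_smul {v : ι → E} {C : ℝ} (hv : ∀ i, ‖v i‖ ≤ C)
    (x : lp (fun _ : ι => 𝕜) 1) : Summable fun i => x i • v i :=
  Summable.of_norm_bounded ((l1_hasSum_norm x).summable.mul_right C)
    (l1_hasSum_smul_norm_le hv x)

/-- The continuous linear map on `ℓ¹` with prescribed bounded values on the standard basis. -/
def l1Lift (v : ι → E) (C : ℝ) (hv : ∀ i, ‖v i‖ ≤ C) : lp (fun _ : ι => 𝕜) 1 →L[𝕜] E :=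
  LinearMap.mkContinuous
    { toFun := fun x => ∑' i, x i • v i
      map_add' := fun x y => by
        rw [← (l1_summable_smul hv x).tsum_add (l1_summable_smul hv y)]
        exact tsum_congr fun i => add_smul _ _ _
      map_smul' := fun c x => by
        rw [RingHom.id_apply, ← (l1_summable_smul hv x).tsum_const_smul]
        exact tsum_congr fun i => by rw [lp.coeFn_smul, Pi.smul_apply, smul_assoc] } C
    (fun x => by
      have h := (l1_hasSum_norm x).mul_right C
      rw [mul_comm] at h
      exact tsum_of_norm_bounded h (l1_hasSum_smul_norm_le hv x))

lemma l1Lift_apply (v : ι → E) (C : ℝ) (hv : ∀ i, ‖v i‖ ≤ C) (x : lp (fun _ : ι => 𝕜) 1) :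
    l1Lift v C hv x = ∑' i, x i • v i := rfl

lemma l1Lift_hasSum (v : ι → E) (C : ℝ) (hv : ∀ i, ‖v i‖ ≤ C) (x : lp (fun _ : ι => 𝕜) 1) :
    HasSum (fun i => x i • v i) (l1Lift v C hv x) := (l1_summable_smul hv x).hasSum

lemma norm_l1Lift_apply_le (v : ι → E) (C : ℝ) (hv : ∀ i, ‖v i‖ ≤ C)
    (x : lp (fun _ : ι => 𝕜) 1) : ‖l1Lift v C hv x‖ ≤ C * ‖x‖ := by
  have h := (l1_hasSum_norm x).mul_right C
  rw [mul_comm] at h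
  exact tsum_of_norm_bounded h (l1_hasSum_smul_norm_le hv x)

variable [DecidableEq ι]

lemma l1Lift_single (v : ι → E) (C : ℝ) (hv : ∀ i, ‖v i‖ ≤ C) (i : ι) (a : 𝕜) :
    l1Lift v C hv (lp.single 1 i a) = a • v i := by
  rw [l1Lift_apply, tsum_eq_single i]
  · rw [lp.single_apply_self]
  · intro j hj
    rw [lp.single_apply_ne _ _ _ hj, zero_smul]

lemma l1_hasSum_single (x : lp (fun _ : ι => 𝕜) 1) :
    HasSum (fun i => lp.single 1 i (x i)) x :=
  lp.hasSum_single (by simp) x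

/-- Every sequence is the sum of its multiples of basis vectors. Identities between linear
operations on the Wiener algebra are therefore checked on monomials only. -/
lemma l1_clm_ext {S T : lp (fun _ : ι => 𝕜) 1 →L[𝕜] F}
    (h : ∀ i, S (lp.single 1 i 1) = T (lp.single 1 i 1)) : S = T := by
  ext x
  have hx := l1_hasSum_single x
  have h1 := S.hasSum hx
  have h2 := T.hasSum hx
  refine h1.unique ?_
  convert h2 using 2 with i
  have h3 : lp.single 1 i (x i) = x i • (lp.single 1 i (1 : 𝕜) : lp (fun _ : ι => 𝕜) 1) := by
    rw [← lp.single_smul, smul_eq_mul, mul_one]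
  rw [h3, map_smul, map_smul, h i]

end SummableCoefficients

/-! ### Averages over the circle with values in a Banach space -/

section Mean

variable {E F : Type*} [NormedAddCommGroup E] [NormedSpace ℂ E] [CompleteSpace E]
  [NormedAddCommGroup F] [NormedSpace ℂ F] [CompleteSpace F]

omit [NormedSpace ℂ E] [CompleteSpace E] in
lemma continuous_comp_circleExp (h : C(Circle, E)) : Continuous fun θ : ℝ => h (Circle.exp θ) :=
  h.continuous.comp Circle.exp.continuous

/-- The average `(1 / 2π) ∫ h(e^{iθ}) dθ` of a continuous function on the circle. -/
def average : C(Circle, E) →L[ℂ] E :=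
  LinearMap.mkContinuous
    { toFun := fun h => (2 * π : ℂ)⁻¹ • ∫ θ in (0 : ℝ)..(2 * π), h (Circle.exp θ)
      map_add' := fun f g => by
        rw [← smul_add, ← intervalIntegral.integral_add
          ((continuous_comp_circleExp f).intervalIntegrable _ _)
          ((continuous_comp_circleExp g).intervalIntegrable _ _)]
        rfl
      map_smul' := fun c f => by
        rw [RingHom.id_apply, smul_comm c, ← intervalIntegral.integral_smul c]
        rfl } 1
    (fun h => by
      have h1 : ‖∫ θ in (0 : ℝ)..(2 * π), h (Circle.exp θ)‖ ≤ ‖h‖ * |2 * π - 0| :=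
        intervalIntegral.norm_integral_le_of_norm_le_const fun θ _ => h.norm_coe_le_norm _
      have h2 : (0 : ℝ) < 2 * π := Real.two_pi_pos
      have h3 : ‖(2 * π : ℂ)⁻¹‖ = (2 * π)⁻¹ := by
        rw [norm_inv, ← Complex.ofReal_ofNat, ← Complex.ofReal_mul, Complex.norm_real,
          Real.norm_of_nonneg h2.le]
      rw [sub_zero, abs_of_pos h2] at h1
      simp only [LinearMap.coe_mk, AddHom.coe_mk]
      rw [norm_smul, h3, one_mul]
      calc (2 * π)⁻¹ * _ ≤ (2 * π)⁻¹ * (‖h‖ * (2 * π)) := by gcongr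
        _ = ‖h‖ := by field_simp)

omit [CompleteSpace E] in
lemma average_apply (h : C(Circle, E)) :
    average h = (2 * π : ℂ)⁻¹ • ∫ θ in (0 : ℝ)..(2 * π), h (Circle.exp θ) := rfl

/-- Taking `L` to be evaluation at a point, averages formed in the Wiener algebra can be computed
pointwise. -/
lemma clm_average (L : E →L[ℂ] F) (h : C(Circle, E)) :
    L (average h) = average ((⟨L, L.continuous⟩ : C(E, F)).comp h) := by
  rw [average_apply, average_apply, map_smul]
  congr 1
  exact (L.intervalIntegral_comp_comm
    ((continuous_comp_circleExp h).intervalIntegrable _ _)).symm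

end Mean

/-! ### The weighted Wiener algebra -/

section Wiener

/-- The weight `1 + |k|`. -/
def weight (k : ℤ) : ℝ := 1 + |(k : ℝ)|

lemma weight_pos (k : ℤ) : 0 < weight k := by unfold weight; positivity

lemma one_le_weight (k : ℤ) : 1 ≤ weight k := by
  have := abs_nonneg (k : ℝ); unfold weight; linarith

/-- Submultiplicativity of the weight is what makes the weighted summable sequences a Banach algebra
under convolution. -/
lemma weight_add_le (j k : ℤ) : weight (j + k) ≤ weight j * weight k := by
  have h1 := abs_add_le (j : ℝ) k
  have h2 := mul_nonneg (abs_nonneg (j : ℝ)) (abs_nonneg (k : ℝ))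
  unfold weight
  push_cast
  nlinarith

lemma weight_zero : weight 0 = 1 := by simp [weight]

/-- The Wiener algebra of the functions `∑ c_k w ^ k` on the circle with
`∑ (1 + |k|) |c_k| < ∞`, represented by the sequences `((1 + |k|) c_k)`. -/
def Wiener : Type := lp (fun _ : ℤ => ℂ) 1

namespace Wiener

instance : NormedAddCommGroup Wiener := inferInstanceAs (NormedAddCommGroup (lp (fun _ : ℤ => ℂ) 1))
instance : NormedSpace ℂ Wiener := inferInstanceAs (NormedSpace ℂ (lp (fun _ : ℤ => ℂ) 1))
instance : CompleteSpace Wiener := inferInstanceAs (CompleteSpace (lp (fun _ : ℤ => ℂ) 1))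

/-- The normalised coefficient `(1 + |k|) c_k`. -/
def coeff (k : ℤ) : Wiener →L[ℂ] ℂ := lp.evalCLM ℂ (fun _ : ℤ => ℂ) 1 k

/-- The linear map with prescribed bounded values on the normalised monomials. -/
def lift {E : Type*} [NormedAddCommGroup E] [NormedSpace ℂ E] [CompleteSpace E] (v : ℤ → E)
    (C : ℝ) (hv : ∀ i, ‖v i‖ ≤ C) : Wiener →L[ℂ] E := l1Lift v C hv

lemma lift_hasSum {E : Type*} [NormedAddCommGroup E] [NormedSpace ℂ E] [CompleteSpace E]
    (v : ℤ → E) (C : ℝ) (hv : ∀ i, ‖v i‖ ≤ C) (x : Wiener) :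
    HasSum (fun i => coeff i x • v i) (lift v C hv x) := l1Lift_hasSum v C hv x

/-- The normalised monomial `w ^ k / (1 + |k|)`. -/
def basis (k : ℤ) : Wiener := lp.single 1 k (1 : ℂ)

lemma norm_basis (k : ℤ) : ‖basis k‖ = 1 := by
  have h := lp.norm_single (p := 1) (E := fun _ : ℤ => ℂ) (by simp) k (1 : ℂ)
  rw [norm_one] at h
  exact h

lemma lift_basis {E : Type*} [NormedAddCommGroup E] [NormedSpace ℂ E] [CompleteSpace E]
    (v : ℤ → E) (C : ℝ) (hv : ∀ i, ‖v i‖ ≤ C) (k : ℤ) : lift v C hv (basis k) = v k := by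
  have := l1Lift_single (𝕜 := ℂ) v C hv k 1
  rw [one_smul] at this
  exact this

lemma coeff_basis (j k : ℤ) : coeff j (basis k) = if j = k then 1 else 0 := by
  have : coeff j (basis k) = (lp.single 1 k (1 : ℂ) : lp (fun _ : ℤ => ℂ) 1) j := rfl
  rw [this]
  split_ifs with h
  · rw [h, lp.single_apply_self]
  · rw [lp.single_apply_ne _ _ _ h]

lemma clm_ext {F : Type*} [NormedAddCommGroup F] [NormedSpace ℂ F] {S T : Wiener →L[ℂ] F}
    (h : ∀ i, S (basis i) = T (basis i)) : S = T := l1_clm_ext h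

lemma ext_coeff {x y : Wiener} (h : ∀ k, coeff k x = coeff k y) : x = y :=
  lp.ext (funext h)

lemma norm_lift_apply_le {E : Type*} [NormedAddCommGroup E] [NormedSpace ℂ E] [CompleteSpace E]
    (v : ℤ → E) (C : ℝ) (hv : ∀ i, ‖v i‖ ≤ C) (x : Wiener) : ‖lift v C hv x‖ ≤ C * ‖x‖ :=
  norm_l1Lift_apply_le v C hv x

/-- The monomial `w ^ k` as a continuous function on the circle. -/
def zpowMap (k : ℤ) : C(Circle, ℂ) := 
  ⟨fun w => ((w ^ k : Circle) : ℂ), continuous_subtype_val.comp (continuous_zpow k)⟩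

lemma zpowMap_apply (k : ℤ) (w : Circle) : zpowMap k w = ((w ^ k : Circle) : ℂ) := rfl

lemma norm_zpowMap_le (k : ℤ) : ‖zpowMap k‖ ≤ 1 :=
  (ContinuousMap.norm_le _ zero_le_one).2 fun w => by rw [zpowMap_apply, Circle.norm_coe]

lemma average_zpowMap (k : ℤ) : average (zpowMap k) = if k = 0 then 1 else 0 := by
  rw [average_apply]
  have h2 : (2 * π : ℂ) ≠ 0 := by exact_mod_cast Real.two_pi_pos.ne'
  split_ifs with h
  · subst h
    simp only [zpowMap_apply, zpow_zero, Circle.coe_one, intervalIntegral.integral_const, sub_zero,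
      Complex.real_smul, mul_one, smul_eq_mul]
    push_cast
    exact inv_mul_cancel₀ h2
  · have h3 : ∀ θ : ℝ, zpowMap k (Circle.exp θ) = Complex.exp ((k * Complex.I) * θ) := by
      intro θ
      rw [zpowMap_apply, ← Circle.exp_zsmul, Circle.coe_exp]
      congr 1
      push_cast [zsmul_eq_mul]
      ring
    have h4 : (k * Complex.I : ℂ) ≠ 0 := mul_ne_zero (by exact_mod_cast h) Complex.I_ne_zero
    simp only [h3]
    rw [integral_exp_mul_complex h4]
    have h5 : (k * Complex.I : ℂ) * ((2 * π : ℝ) : ℂ) = k * (2 * π * Complex.I) := by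
      push_cast; ring
    rw [h5, Complex.exp_int_mul_two_pi_mul_I]
    simp

lemma norm_weight_inv_smul_le {E : Type*} [NormedAddCommGroup E] [NormedSpace ℂ E] (k : ℤ) {v : E}
    (hv : ‖v‖ ≤ 1) : ‖((weight k)⁻¹ : ℂ) • v‖ ≤ 1 := by
  rw [norm_smul, norm_inv, Complex.norm_real, Real.norm_of_nonneg (weight_pos k).le]
  have h1 : (weight k)⁻¹ ≤ 1 := inv_le_one_of_one_le₀ (one_le_weight k)
  exact mul_le_one₀ h1 (norm_nonneg _) hv

/-- The function on the circle given by an element of the Wiener algebra. -/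
def toFun : Wiener →L[ℂ] C(Circle, ℂ) :=
  lift (fun k => ((weight k)⁻¹ : ℂ) • zpowMap k) 1
    fun k => norm_weight_inv_smul_le k (norm_zpowMap_le k)

lemma toFun_basis (k : ℤ) : toFun (basis k) = ((weight k)⁻¹ : ℂ) • zpowMap k := lift_basis _ _ _ _

lemma average_mul_toFun (x : Wiener) (k : ℤ) :
    average (zpowMap (-k) * toFun x) = ((weight k)⁻¹ : ℂ) * coeff k x := by
  have h : average.comp ((ContinuousLinearMap.mul ℂ C(Circle, ℂ) (zpowMap (-k))).comp toFun) =
      ((weight k)⁻¹ : ℂ) • coeff k := by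
    apply clm_ext
    intro i
    simp only [ContinuousLinearMap.comp_apply, ContinuousLinearMap.mul_apply', toFun_basis,
      smul_apply, coeff_basis, smul_eq_mul]
    have h1 : zpowMap (-k) * ((weight i)⁻¹ : ℂ) • zpowMap i =
        ((weight i)⁻¹ : ℂ) • zpowMap (i - k) := by
      ext w
      simp only [ContinuousMap.mul_apply, ContinuousMap.smul_apply, zpowMap_apply, smul_eq_mul]
      rw [mul_left_comm, ← Circle.coe_mul, ← zpow_add, neg_add_eq_sub]
    rw [h1, map_smul, average_zpowMap, smul_eq_mul]
    by_cases hik : k = i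
    · simp [hik]
    · have : ¬ (i - k = 0) := fun h => hik (by omega)
      simp [hik, this]
  exact DFunLike.congr_fun h x

/-- Coefficients are recovered as averages against `w ^ (-k)`. Injectivity lets the ring axioms of
convolution be pulled back from pointwise multiplication, so that no double series has to be
rearranged. -/
lemma toFun_injective : Function.Injective toFun := by
  intro x y hxy
  apply ext_coeff
  intro k
  have h1 := average_mul_toFun x k
  have h2 := average_mul_toFun y k
  rw [hxy, h2] at h1
  have h3 : ((weight k)⁻¹ : ℂ) ≠ 0 := inv_ne_zero (by exact_mod_cast (weight_pos k).ne')
  exact (mul_left_cancel₀ h3 h1).symm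

/-- Convolution of coefficients. -/
def mulCLM : Wiener →L[ℂ] Wiener →L[ℂ] Wiener :=
  lift (fun j => lift (fun k => ((weight (j + k) / (weight j * weight k) : ℝ) : ℂ) • basis (j + k)) 1
    (fun k => by
      rw [norm_smul, norm_basis, mul_one, Complex.norm_real, Real.norm_of_nonneg
        (div_nonneg (weight_pos _).le (mul_pos (weight_pos _) (weight_pos _)).le)]
      exact div_le_one_of_le₀ (weight_add_le j k) (mul_pos (weight_pos _) (weight_pos _)).le)) 1
    (fun j => ContinuousLinearMap.opNorm_le_bound _ zero_le_one (norm_lift_apply_le _ _ _))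

/-- Both sides are continuous and bilinear, so it suffices to compare products of monomials, where
the weights in `mulCLM` cancel the normalisations. -/
lemma toFun_mulCLM (x y : Wiener) : toFun (mulCLM x y) = toFun x * toFun y := by
  have h : (ContinuousLinearMap.compL ℂ Wiener Wiener C(Circle, ℂ) toFun).comp mulCLM =
      ((ContinuousLinearMap.compL ℂ Wiener C(Circle, ℂ) C(Circle, ℂ)).flip toFun).comp
        ((ContinuousLinearMap.mul ℂ C(Circle, ℂ)).comp toFun) := by
    apply clm_ext
    intro j
    apply clm_ext
    intro k
    change toFun (mulCLM (basis j) (basis k)) = toFun (basis j) * toFun (basis k)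
    simp only [toFun_basis, mulCLM, lift_basis, map_smul]
    ext w
    simp only [ContinuousMap.mul_apply, ContinuousMap.smul_apply, zpowMap_apply, smul_eq_mul]
    rw [zpow_add, Circle.coe_mul]
    have h1 : (weight j : ℂ) ≠ 0 := by exact_mod_cast (weight_pos j).ne'
    have h2 : (weight k : ℂ) ≠ 0 := by exact_mod_cast (weight_pos k).ne'
    have h3 : (weight (j + k) : ℂ) ≠ 0 := by exact_mod_cast (weight_pos (j + k)).ne'
    push_cast
    field_simp
  exact DFunLike.congr_fun (DFunLike.congr_fun h x) y

lemma norm_mulCLM_le (x y : Wiener) : ‖mulCLM x y‖ ≤ ‖x‖ * ‖y‖ := by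
  have h : ‖mulCLM x‖ ≤ 1 * ‖x‖ := norm_lift_apply_le _ _ _ x
  rw [one_mul] at h
  exact (mulCLM x).le_of_opNorm_le h y

instance : Mul Wiener := ⟨fun x y => mulCLM x y⟩
instance : One Wiener := ⟨basis 0⟩

lemma toFun_mul (x y : Wiener) : toFun (x * y) = toFun x * toFun y := toFun_mulCLM x y

lemma toFun_one : toFun 1 = 1 := by
  have h : toFun 1 = toFun (basis 0) := rfl
  rw [h, toFun_basis]
  ext w
  simp [weight_zero, zpowMap_apply]

instance : NormedCommRing Wiener where
  __ := (inferInstance : NormedAddCommGroup Wiener)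
  mul_assoc x y z := toFun_injective (by simp only [toFun_mul, mul_assoc])
  mul_comm x y := toFun_injective (by simp only [toFun_mul, mul_comm])
  one_mul x := toFun_injective (by rw [toFun_mul, toFun_one, one_mul])
  mul_one x := toFun_injective (by rw [toFun_mul, toFun_one, mul_one])
  left_distrib x y z := toFun_injective (by simp only [toFun_mul, map_add, mul_add])
  right_distrib x y z := toFun_injective (by simp only [toFun_mul, map_add, add_mul])
  zero_mul x := toFun_injective (by rw [toFun_mul, map_zero, zero_mul])
  mul_zero x := toFun_injective (by rw [toFun_mul, map_zero, mul_zero])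
  norm_mul_le := norm_mulCLM_le
  dist_eq := NormedAddCommGroup.dist_eq

instance : Algebra ℂ Wiener := Algebra.ofModule
  (fun c x y => toFun_injective (by simp only [toFun_mul, map_smul, smul_mul_assoc]))
  (fun c x y => toFun_injective (by simp only [toFun_mul, map_smul, mul_smul_comm]))

instance : NormedAlgebra ℂ Wiener where
  norm_smul_le := norm_smul_le

/-- The monomial `w ^ k`. -/
def mon (k : ℤ) : Wiener := (weight k : ℂ) • basis k

lemma toFun_mon (k : ℤ) : toFun (mon k) = zpowMap k := by
  have h1 : (weight k : ℂ) ≠ 0 := by exact_mod_cast (weight_pos k).ne'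
  rw [mon, map_smul, toFun_basis, smul_smul, mul_inv_cancel₀ h1, one_smul]

end Wiener
end Wiener

end VortexPair

/-! ### Profiles and their difference quotients as families in the Wiener algebra -/

namespace VortexPair

/-- Summable real coefficient sequences `x`, representing `f = ∑ x_n / ((n+1)(n+3)) w̄^(n+1)`. -/
abbrev Coef : Type := lp (fun _ : ℕ => ℝ) 1

lemma hasSum_congr {ι : Type*} {f g : ι → ℂ} {a : ℂ} (h : ∀ n, f n = g n) :
    HasSum f a ↔ HasSum g a := by rw [funext h]

namespace Wiener

/-- The family `σ ↦ ∑ x_n c_n(σ) w^(k n) / (1 + |k n|)` of elements of the Wiener algebra. -/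
def family (k : ℕ → ℤ) (c : ℕ → C(Circle, ℂ)) (hc : ∀ n, ‖c n‖ ≤ 1) :
    Coef →L[ℝ] C(Circle, Wiener) :=
  l1Lift (fun n => (⟨fun σ => c n σ • basis (k n),
      (c n).continuous.smul continuous_const⟩ : C(Circle, Wiener))) 1
    (fun n => (ContinuousMap.norm_le _ zero_le_one).2 fun σ => by
      rw [ContinuousMap.coe_mk, norm_smul, norm_basis, mul_one]
      exact ((c n).norm_coe_le_norm σ).trans (hc n))

lemma toFun_family (k : ℕ → ℤ) (c : ℕ → C(Circle, ℂ)) (hc : ∀ n, ‖c n‖ ≤ 1) (x : Coef)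
    (σ w : Circle) :
    HasSum (fun n => (x n : ℂ) * (c n σ * ((weight (k n) : ℂ)⁻¹ * ((w ^ k n : Circle) : ℂ))))
      (toFun (family k c hc x σ) w) := by
  let T : C(Circle, Wiener) →L[ℝ] ℂ :=
    (ContinuousMap.evalCLM ℝ w).comp ((toFun.restrictScalars ℝ).comp (ContinuousMap.evalCLM ℝ σ))
  have h := T.hasSum (l1Lift_hasSum (𝕜 := ℝ) (fun n => (⟨fun σ => c n σ • basis (k n),
      (c n).continuous.smul continuous_const⟩ : C(Circle, Wiener))) 1
    (fun n => (ContinuousMap.norm_le _ zero_le_one).2 fun σ => by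
      rw [ContinuousMap.coe_mk, norm_smul, norm_basis, mul_one]
      exact ((c n).norm_coe_le_norm σ).trans (hc n)) x)
  refine (hasSum_congr fun n => ?_).2 h
  rw [map_smul, Complex.real_smul]
  congr 1
  change _ = toFun (c n σ • basis (k n)) w
  rw [map_smul, toFun_basis]
  rfl

end Wiener

open Wiener

lemma weight_neg (k : ℤ) : weight (-k) = weight k := by simp [weight]

lemma weight_natCast (n : ℕ) : weight (n : ℤ) = 1 + n := by
  simp [weight]

/-- The function `∑ x_n / ((n+1)(n+3)) w̄^(n+1)`. -/
def profile (x : Coef) (w : Circle) : ℂ :=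
  ∑' n : ℕ, ((x n / ((n + 1) * (n + 3)) : ℝ) : ℂ) * conj (w : ℂ) ^ (n + 1)

/-- The derivative `-∑ x_n / (n+3) w̄^(n+2)` of `profile x`. -/
def profileDeriv (x : Coef) (w : Circle) : ℂ :=
  ∑' n : ℕ, ((-x n / (n + 3) : ℝ) : ℂ) * conj (w : ℂ) ^ (n + 2)

lemma Coef.summable_abs (x : Coef) : Summable fun n => |x n| := by
  simpa using (l1_hasSum_norm x).summable

lemma Coef.tsum_abs (x : Coef) : ∑' n, |x n| = ‖x‖ := by
  simpa using (l1_hasSum_norm x).tsum_eq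

lemma abs_div_le_of_one_le {a b : ℝ} (hb : 1 ≤ b) : |a / b| ≤ |a| := by
  rw [abs_div, abs_of_pos (zero_lt_one.trans_le hb)]
  exact div_le_self (abs_nonneg _) hb

lemma norm_conj_circle (w : Circle) : ‖conj (w : ℂ)‖ = 1 := by
  rw [Complex.norm_conj, Circle.norm_coe]

lemma profile_hasSum (x : Coef) (w : Circle) :
    HasSum (fun n : ℕ => ((x n / ((n + 1) * (n + 3)) : ℝ) : ℂ) * conj (w : ℂ) ^ (n + 1))
      (profile x w) := by
  refine (Summable.of_norm_bounded x.summable_abs fun n => ?_).hasSum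
  rw [norm_mul, norm_pow, norm_conj_circle, one_pow, mul_one, Complex.norm_real, Real.norm_eq_abs]
  exact abs_div_le_of_one_le (by have : (0 : ℝ) ≤ n := n.cast_nonneg; nlinarith)

lemma profileDeriv_hasSum (x : Coef) (w : Circle) :
    HasSum (fun n : ℕ => ((-x n / (n + 3) : ℝ) : ℂ) * conj (w : ℂ) ^ (n + 2))
      (profileDeriv x w) := by
  refine (Summable.of_norm_bounded x.summable_abs fun n => ?_).hasSum
  rw [norm_mul, norm_pow, norm_conj_circle, one_pow, mul_one, Complex.norm_real, Real.norm_eq_abs,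
    ← abs_neg (x n)]
  exact abs_div_le_of_one_le (by have : (0 : ℝ) ≤ n := n.cast_nonneg; linarith)

lemma norm_real_smul_zpowMap_le {r : ℝ} (k : ℤ) (hr : |r| ≤ 1) : ‖(r : ℂ) • zpowMap k‖ ≤ 1 := by
  rw [norm_smul, Complex.norm_real, Real.norm_eq_abs]
  exact mul_le_one₀ hr (norm_nonneg _) (norm_zpowMap_le k)

/-- The difference quotient of a power of degree `n+1` is a sum of `n+1` powers of `σ`, and the
monomial in `w` has weight `n+2`. The denominators `(n+1)(n+3)` of the profile pay for both. -/
lemma norm_real_smul_sum_zpowMap_le (n : ℕ) (s : ℝ) (hs : |s| = 1) (k : ℕ → ℤ) :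
    ‖((s * ((n + 2) / ((n + 1) * (n + 3))) : ℝ) : ℂ) •
      ∑ i ∈ Finset.range (n + 1), zpowMap (k i)‖ ≤ 1 := by
  have hn : (0 : ℝ) ≤ n := n.cast_nonneg
  have h1 : ‖∑ i ∈ Finset.range (n + 1), zpowMap (k i)‖ ≤ n + 1 := by
    refine (norm_sum_le_of_le _ fun i _ => norm_zpowMap_le (k i)).trans ?_
    simp
  rw [norm_smul, Complex.norm_real, Real.norm_eq_abs, abs_mul, hs, one_mul,
    abs_of_nonneg (by positivity)]
  calc _ ≤ ((n : ℝ) + 2) / ((n + 1) * (n + 3)) * (n + 1) := by gcongr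
    _ = (n + 2) / (n + 3) := by field_simp
    _ ≤ 1 := div_le_one_of_le₀ (by linarith) (by linarith)

lemma abs_inv_mul_le_one (n : ℕ) : |(1 / ((n + 1) * (n + 3)) : ℝ)| ≤ 1 := by
  have hn : (0 : ℝ) ≤ n := n.cast_nonneg
  rw [abs_of_nonneg (by positivity)]
  exact div_le_one_of_le₀ (by nlinarith) (by positivity)

lemma abs_neg_inv_le_one (n : ℕ) : |(-(1 / (n + 3)) : ℝ)| ≤ 1 := by
  have hn : (0 : ℝ) ≤ n := n.cast_nonneg
  rw [abs_neg, abs_of_nonneg (by positivity)]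
  exact div_le_one_of_le₀ (by linarith) (by positivity)

/-- The difference quotient `(f(wσ) - f(w)) / (σ - 1)`. -/
def quotMap : Coef →L[ℝ] C(Circle, Wiener) :=
  family (fun n => -((n + 1 : ℕ) : ℤ))
    (fun n => ((-1 * ((n + 2) / ((n + 1) * (n + 3))) : ℝ) : ℂ) •
      ∑ i ∈ Finset.range (n + 1), zpowMap (-((i + 1 : ℕ) : ℤ)))
    (fun n => norm_real_smul_sum_zpowMap_le n (-1) (by simp) _)

/-- The conjugate difference quotient `conj (f(wσ) - f(w)) / (σ - 1)`. -/
def conjQuotMap : Coef →L[ℝ] C(Circle, Wiener) :=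
  family (fun n => ((n + 1 : ℕ) : ℤ))
    (fun n => ((1 * ((n + 2) / ((n + 1) * (n + 3))) : ℝ) : ℂ) •
      ∑ i ∈ Finset.range (n + 1), zpowMap (i : ℤ))
    (fun n => norm_real_smul_sum_zpowMap_le n 1 (by simp) _)

/-- The rotated derivative `f'(wσ)`. -/
def rotDerivMap : Coef →L[ℝ] C(Circle, Wiener) :=
  family (fun n => -((n + 2 : ℕ) : ℤ)) (fun n => ((-1 : ℝ) : ℂ) • zpowMap (-((n + 2 : ℕ) : ℤ)))
    (fun n => norm_real_smul_zpowMap_le _ (by simp))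

/-- The function `f(w)`, independent of the parameter. -/
def valueMap : Coef →L[ℝ] C(Circle, Wiener) :=
  family (fun n => -((n + 1 : ℕ) : ℤ))
    (fun n => (((n + 2) / ((n + 1) * (n + 3)) : ℝ) : ℂ) • zpowMap 0)
    (fun n => norm_real_smul_zpowMap_le _ (by
      have hn : (0 : ℝ) ≤ n := n.cast_nonneg
      rw [abs_of_nonneg (by positivity)]
      exact div_le_one_of_le₀ (by nlinarith) (by positivity)))

/-- The constants `f(τ)`. -/
def constMap : Coef →L[ℝ] C(Circle, Wiener) :=
  family (fun _ => 0)
    (fun n => ((1 / ((n + 1) * (n + 3)) : ℝ) : ℂ) • zpowMap (-((n + 1 : ℕ) : ℤ)))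
    (fun n => norm_real_smul_zpowMap_le _ (abs_inv_mul_le_one n))

/-- The constants `conj (f(τ))`. -/
def conjConstMap : Coef →L[ℝ] C(Circle, Wiener) :=
  family (fun _ => 0)
    (fun n => ((1 / ((n + 1) * (n + 3)) : ℝ) : ℂ) • zpowMap ((n + 1 : ℕ) : ℤ))
    (fun n => norm_real_smul_zpowMap_le _ (abs_inv_mul_le_one n))

/-- The constants `f'(τ)`. -/
def constDerivMap : Coef →L[ℝ] C(Circle, Wiener) :=
  family (fun _ => 0)
    (fun n => ((-(1 / (n + 3)) : ℝ) : ℂ) • zpowMap (-((n + 2 : ℕ) : ℤ)))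
    (fun n => norm_real_smul_zpowMap_le _ (abs_neg_inv_le_one n))

lemma coe_zpow_neg_natCast (w : Circle) (n : ℕ) :
    ((w ^ (-(n : ℤ)) : Circle) : ℂ) = conj (w : ℂ) ^ n := by
  rw [zpow_neg, zpow_natCast, Circle.coe_inv_eq_conj, Circle.coe_pow, map_pow]

lemma coe_zpow_natCast (w : Circle) (n : ℕ) : ((w ^ (n : ℤ) : Circle) : ℂ) = (w : ℂ) ^ n := by
  rw [zpow_natCast, Circle.coe_pow]

lemma conj_profile_hasSum (x : Coef) (w : Circle) :
    HasSum (fun n : ℕ => ((x n / ((n + 1) * (n + 3)) : ℝ) : ℂ) * (w : ℂ) ^ (n + 1))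
      (conj (profile x w)) := by
  have h := (profile_hasSum x w).map (starRingEnd ℂ) Complex.continuous_conj
  convert h using 2 with n
  simp only [Function.comp_apply, map_mul, map_pow, Complex.conj_conj, Complex.conj_ofReal]

lemma toFun_constMap (x : Coef) (σ w : Circle) : toFun (constMap x σ) w = profile x σ := by
  refine (toFun_family _ _ _ x σ w).unique ?_
  convert profile_hasSum x σ using 2 with n
  simp only [ContinuousMap.smul_apply, zpowMap_apply, coe_zpow_neg_natCast, smul_eq_mul,
    weight_zero, zpow_zero, Circle.coe_one]
  push_cast
  ring

lemma toFun_conjConstMap (x : Coef) (σ w : Circle) :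
    toFun (conjConstMap x σ) w = conj (profile x σ) := by
  refine (toFun_family _ _ _ x σ w).unique ?_
  convert conj_profile_hasSum x σ using 2 with n
  simp only [ContinuousMap.smul_apply, zpowMap_apply, coe_zpow_natCast, smul_eq_mul,
    weight_zero, zpow_zero, Circle.coe_one]
  push_cast
  ring

lemma toFun_constDerivMap (x : Coef) (σ w : Circle) :
    toFun (constDerivMap x σ) w = profileDeriv x σ := by
  refine (toFun_family _ _ _ x σ w).unique ?_
  convert profileDeriv_hasSum x σ using 2 with n
  simp only [ContinuousMap.smul_apply, zpowMap_apply, coe_zpow_neg_natCast, smul_eq_mul,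
    weight_zero, zpow_zero, Circle.coe_one]
  push_cast
  ring

lemma natCast_add_ne_zero (n k : ℕ) : (n : ℂ) + (k + 1 : ℕ) ≠ 0 := by
  exact_mod_cast (by omega : n + (k + 1) ≠ 0)

lemma toFun_valueMap (x : Coef) (σ w : Circle) : toFun (valueMap x σ) w = profile x w := by
  refine (toFun_family _ _ _ x σ w).unique ?_
  convert profile_hasSum x w using 2 with n
  simp only [ContinuousMap.smul_apply, zpowMap_apply, coe_zpow_neg_natCast, smul_eq_mul,
    weight_neg, weight_natCast, zpow_zero, Circle.coe_one]
  have h1 := natCast_add_ne_zero n 0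
  have h2 := natCast_add_ne_zero n 1
  have h3 := natCast_add_ne_zero n 2
  push_cast at h1 h2 h3 ⊢
  have h4 : (1 : ℂ) + (n + 1) ≠ 0 := by convert h2 using 1; ring
  norm_num at h1 h2 h3 
  field_simp
  ring

lemma toFun_rotDerivMap (x : Coef) (σ w : Circle) :
    toFun (rotDerivMap x σ) w = profileDeriv x (w * σ) := by
  refine (toFun_family _ _ _ x σ w).unique ?_
  convert profileDeriv_hasSum x (w * σ) using 2 with n
  simp only [ContinuousMap.smul_apply, zpowMap_apply, coe_zpow_neg_natCast, smul_eq_mul,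
    weight_neg, weight_natCast, Circle.coe_mul, map_mul, mul_pow]
  have h3 := natCast_add_ne_zero n 2
  push_cast at h3 ⊢
  have h4 : (1 : ℂ) + (n + 2) ≠ 0 := by convert h3 using 1; ring
  norm_num at h3
  field_simp
  ring

/-- The geometric sum factors `σ - 1` out of `σ^(n+1) - 1`. The product form of the identity stays
valid at `σ = 1`, where the quotient itself would not make sense. -/
lemma toFun_conjQuotMap (x : Coef) (σ w : Circle) :
    ((σ : ℂ) - 1) * toFun (conjQuotMap x σ) w = conj (profile x (w * σ)) - conj (profile x w) := by
  refine ((toFun_family _ _ _ x σ w).mul_left ((σ : ℂ) - 1)).unique ?_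
  refine (hasSum_congr fun n => ?_).2 ((conj_profile_hasSum x (w * σ)).sub (conj_profile_hasSum x w))
  simp only [ContinuousMap.smul_apply, ContinuousMap.sum_apply, zpowMap_apply, coe_zpow_natCast,
    smul_eq_mul, weight_natCast, Circle.coe_mul, mul_pow]
  have hg := mul_geom_sum (σ : ℂ) (n + 1)
  have h1 := natCast_add_ne_zero n 0
  have h2 := natCast_add_ne_zero n 1
  have h3 := natCast_add_ne_zero n 2
  push_cast at h1 h2 h3 ⊢
  have h4 : (1 : ℂ) + (n + 1) ≠ 0 := by convert h2 using 1; ring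
  norm_num at h1 h2 h3 
  rw [show (σ : ℂ) ^ (n + 1) = (σ - 1) * ∑ i ∈ Finset.range (n + 1), (σ : ℂ) ^ i + 1 by
    rw [hg]; ring]
  field_simp
  ring

lemma circle_conj_mul_self (w : Circle) : conj (w : ℂ) * w = 1 := by
  rw [← Circle.coe_inv_eq_conj, ← Circle.coe_mul, inv_mul_cancel, Circle.coe_one]

lemma toFun_quotMap (x : Coef) (σ w : Circle) :
    ((σ : ℂ) - 1) * toFun (quotMap x σ) w = profile x (w * σ) - profile x w := by
  refine ((toFun_family _ _ _ x σ w).mul_left ((σ : ℂ) - 1)).unique ?_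
  refine (hasSum_congr fun n => ?_).2 ((profile_hasSum x (w * σ)).sub (profile_hasSum x w))
  simp only [ContinuousMap.smul_apply, ContinuousMap.sum_apply, zpowMap_apply,
    coe_zpow_neg_natCast, smul_eq_mul, weight_neg, weight_natCast, Circle.coe_mul, map_mul, mul_pow]
  have hg := mul_geom_sum (conj (σ : ℂ)) (n + 1)
  have hs : ((σ : ℂ) - 1) * ∑ i ∈ Finset.range (n + 1), conj (σ : ℂ) ^ (i + 1) =
      1 - conj (σ : ℂ) ^ (n + 1) := by
    have h5 : ∑ i ∈ Finset.range (n + 1), conj (σ : ℂ) ^ (i + 1) =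
        conj (σ : ℂ) * ∑ i ∈ Finset.range (n + 1), conj (σ : ℂ) ^ i := by
      rw [Finset.mul_sum]
      exact Finset.sum_congr rfl fun i _ => pow_succ' _ _
    rw [h5]
    linear_combination (∑ i ∈ Finset.range (n + 1), conj (σ : ℂ) ^ i) * circle_conj_mul_self σ - hg
  have h1 := natCast_add_ne_zero n 0
  have h2 := natCast_add_ne_zero n 1
  have h3 := natCast_add_ne_zero n 2
  push_cast at h1 h2 h3 ⊢
  have h4 : (1 : ℂ) + (n + 1) ≠ 0 := by convert h2 using 1; ring
  norm_num at h1 h2 h3 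
  rw [show conj (σ : ℂ) ^ (n + 1) =
    1 - (σ - 1) * ∑ i ∈ Finset.range (n + 1), conj (σ : ℂ) ^ (i + 1) by rw [hs]; ring]
  field_simp
  ring

end VortexPair

/-! ### The functional as a smooth map into the Wiener algebra -/

namespace VortexPair
open Wiener

/-- The parameter `σ` as a family of constants. -/
def paramMap : C(Circle, Wiener) := ⟨fun σ => (σ : ℂ) • (1 : Wiener), by fun_prop⟩

/-- The conjugate parameter `σ̄` as a family of constants. -/
def conjParamMap : C(Circle, Wiener) := ⟨fun σ => conj (σ : ℂ) • (1 : Wiener), by fun_prop⟩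

/-- The monomial `w ^ k`, independent of the parameter. -/
def monMap (k : ℤ) : C(Circle, Wiener) := ContinuousMap.const Circle (mon k)

lemma monMap_apply (k : ℤ) (σ : Circle) : monMap k σ = mon k := rfl

/-- The integrand of the self-interaction term, in the rotated variable `τ = w σ`. -/
def selfIntegrand (s : ℝ) (x : Coef) : C(Circle, Wiener) :=
  -- Put `A = w (σ - 1)`, so that `Ā = -(σ - 1) / (w σ)`, and write `B`, `B̄` as `σ - 1` times their
  -- difference quotients. All factors `σ - 1` cancel and the powers `w⁻¹` and `w⁻³ σ̄` remain. The
  -- leading `σ` comes from `dτ = i w σ dθ`; its companion `w` is restored in `wienerComponent`.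
  paramMap * ((monMap (-1) * conjQuotMap x + monMap (-3) * conjParamMap * quotMap x) *
    Ring.inverse (1 + s • (monMap (-1) * quotMap x)) * (rotDerivMap x - monMap (-1) * quotMap x))

/-- The denominator of the mutual interaction term. -/
def mutualDenom (d b b' ε : ℝ) (x x' : Coef) : C(Circle, Wiener) :=
  ε • (b' • paramMap + b • monMap 1) + ε ^ 2 • (b' ^ 2 • constMap x' + b ^ 2 • valueMap x)
    - d • (1 : C(Circle, Wiener))

/-- The integrand of the mutual interaction term. -/
def mutualIntegrand (d b b' ε : ℝ) (x x' : Coef) : C(Circle, Wiener) :=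
  paramMap * ((conjParamMap + (ε * b') • conjConstMap x') * (1 + (ε * b') • constDerivMap x') *
    Ring.inverse (mutualDenom d b b' ε x x'))

/-- The derivative `f'` as an element of the Wiener algebra. -/
def derivMap : Coef →L[ℝ] Wiener := (ContinuousMap.evalCLM ℝ (1 : Circle)).comp rotDerivMap

/-- The complex function whose imaginary part is a component of the translating-pair functional. -/
def wienerComponent (d b b' ε U γ γ' : ℝ) (x x' : Coef) : Wiener :=
  (2 * U) • (mon 1 * (1 + (ε * b) • derivMap x)) - γ • derivMap x
    + (ε * b * γ) • (mon 1 * (1 + (ε * b) • derivMap x) *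
      (mon 1 * average (selfIntegrand (ε * b) x)))
    + γ' • (mon 1 * (1 + (ε * b) • derivMap x) * average (mutualIntegrand d b b' ε x x'))

/-- The expression whose imaginary part is `component`, with the derivatives of `f`, `f'` as
separate arguments. -/
def complexComponent (d ε U γ γ' b b' : ℝ) (f df f' df' : Circle → ℂ) (w : Circle) : ℂ :=
  2 * U * w * (1 + ε * b * df w) - γ * df w
    + ε * b * γ * w * (1 + ε * b * df w) *
      circleMean (fun τ =>
        let A : ℂ := τ - w
        let B : ℂ := f τ - f w
        (A * conj B - conj A * B) / (A * (A + ε * b * B)) * (df τ - B / A))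
    + γ' * w * (1 + ε * b * df w) *
      circleMean (fun τ =>
        (conj (τ : ℂ) + ε * b' * conj (f' τ)) * (1 + ε * b' * df' τ) /
          (ε * (b' * τ + b * w) + ε ^ 2 * (b' ^ 2 * f' τ + b ^ 2 * f w) - d))

lemma component_eq_im (d ε U γ γ' b b' : ℝ) (f f' : Circle → ℂ) (w : Circle) :
    component d ε U γ γ' b b' f f' w =
      (complexComponent d ε U γ γ' b b' f (circleDeriv f) f' (circleDeriv f') w).im := rfl

section Smooth

variable {E : Type*} [NormedAddCommGroup E] [NormedSpace ℝ E]

lemma ContDiffAt.ringInverse {R : Type*} [NormedRing R] [NormedAlgebra ℝ R] [CompleteSpace R]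
    {u : E → R} {e : E} (hu : ContDiffAt ℝ 1 u e) (h : IsUnit (u e)) :
    ContDiffAt ℝ 1 (fun y => Ring.inverse (u y)) e := by
  obtain ⟨v, hv⟩ := h
  have h1 : ContDiffAt ℝ 1 Ring.inverse (u e) := hv ▸ contDiffAt_ringInverse ℝ v
  exact h1.comp e hu

lemma isUnit_neg_smul_one {d : ℝ} (hd : d ≠ 0) : IsUnit (-(d • (1 : C(Circle, Wiener)))) := by
  rw [← Algebra.algebraMap_eq_smul_one]
  exact ((isUnit_iff_ne_zero.2 hd).map (algebraMap ℝ C(Circle, Wiener))).neg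

lemma mutualDenom_zero (d b b' : ℝ) (x x' : Coef) :
    mutualDenom d b b' 0 x x' = -(d • (1 : C(Circle, Wiener))) := by
  simp [mutualDenom]

/-- Smoothness is required only where the amplitude `s` vanishes. There the element to be inverted
is `1`, and inversion in a Banach algebra is smooth at units. -/
lemma contDiffAt_selfIntegrand {s : E → ℝ} {x : E → Coef} {e : E} (hs : ContDiffAt ℝ 1 s e)
    (hx : ContDiffAt ℝ 1 x e) (h : s e = 0) :
    ContDiffAt ℝ 1 (fun y => selfIntegrand (s y) (x y)) e := by
  have h1 := quotMap.contDiff.contDiffAt.comp e hx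
  have h2 := conjQuotMap.contDiff.contDiffAt.comp e hx
  have h3 := rotDerivMap.contDiff.contDiffAt.comp e hx
  have h4 : ContDiffAt ℝ 1 (fun y => Ring.inverse (1 + s y • (monMap (-1) * quotMap (x y)))) e := by
    apply ContDiffAt.ringInverse
    · exact contDiffAt_const.add (hs.smul (contDiffAt_const.mul h1))
    · rw [h, zero_smul, add_zero]; exact isUnit_one
  exact contDiffAt_const.mul ((((contDiffAt_const.mul h2).add (contDiffAt_const.mul h1)).mul h4).mul
    (h3.sub (contDiffAt_const.mul h1)))

lemma contDiffAt_mutualDenom (d b b' : ℝ) {ε : E → ℝ} {x x' : E → Coef} {e : E}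
    (hε : ContDiffAt ℝ 1 ε e) (hx : ContDiffAt ℝ 1 x e) (hx' : ContDiffAt ℝ 1 x' e) :
    ContDiffAt ℝ 1 (fun y => mutualDenom d b b' (ε y) (x y) (x' y)) e := by
  have h1 := valueMap.contDiff.contDiffAt.comp e hx
  have h2 := constMap.contDiff.contDiffAt.comp e hx'
  exact ((hε.smul contDiffAt_const).add ((hε.pow 2).smul ((h2.const_smul _).add
    (h1.const_smul _)))).sub contDiffAt_const

lemma contDiffAt_mutualIntegrand {d : ℝ} (hd : d ≠ 0) (b b' : ℝ) {ε : E → ℝ} {x x' : E → Coef}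
    {e : E} (hε : ContDiffAt ℝ 1 ε e) (hx : ContDiffAt ℝ 1 x e) (hx' : ContDiffAt ℝ 1 x' e)
    (h : ε e = 0) : ContDiffAt ℝ 1 (fun y => mutualIntegrand d b b' (ε y) (x y) (x' y)) e := by
  have h1 := conjConstMap.contDiff.contDiffAt.comp e hx'
  have h2 := constDerivMap.contDiff.contDiffAt.comp e hx'
  have h3 : ContDiffAt ℝ 1 (fun y => Ring.inverse (mutualDenom d b b' (ε y) (x y) (x' y))) e := by
    apply ContDiffAt.ringInverse (contDiffAt_mutualDenom d b b' hε hx hx')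
    rw [h, mutualDenom_zero]
    exact isUnit_neg_smul_one hd
  have h4 : ContDiffAt ℝ 1 (fun y => ε y * b') e := hε.mul contDiffAt_const
  exact contDiffAt_const.mul (((contDiffAt_const.add (h4.smul h1)).mul
    (contDiffAt_const.add (h4.smul h2))).mul h3)

lemma contDiffAt_wienerComponent {d : ℝ} (hd : d ≠ 0) (b b' : ℝ) {ε U γ γ' : E → ℝ}
    {x x' : E → Coef} {e : E} (hε : ContDiffAt ℝ 1 ε e) (hU : ContDiffAt ℝ 1 U e)
    (hγ : ContDiffAt ℝ 1 γ e) (hγ' : ContDiffAt ℝ 1 γ' e) (hx : ContDiffAt ℝ 1 x e)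
    (hx' : ContDiffAt ℝ 1 x' e) (h : ε e = 0) :
    ContDiffAt ℝ 1
      (fun y => wienerComponent d b b' (ε y) (U y) (γ y) (γ' y) (x y) (x' y)) e := by
  have h1 := derivMap.contDiff.contDiffAt.comp e hx
  have h2 : ContDiffAt ℝ 1 (fun y => ε y * b) e := hε.mul contDiffAt_const
  have h3 := (average (E := Wiener)).restrictScalars ℝ |>.contDiff.contDiffAt.comp e
    (contDiffAt_selfIntegrand h2 hx (by rw [h, zero_mul]))
  have h4 := (average (E := Wiener)).restrictScalars ℝ |>.contDiff.contDiffAt.comp e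
    (contDiffAt_mutualIntegrand hd b b' hε hx hx' h)
  have h5 : ContDiffAt ℝ 1 (fun y => mon 1 * (1 + (ε y * b) • derivMap (x y))) e :=
    contDiffAt_const.mul (contDiffAt_const.add (h2.smul h1))
  exact ((((contDiffAt_const.mul hU).smul h5).sub (hγ.smul h1)).add
    ((h2.mul hγ).smul (h5.mul (contDiffAt_const.mul h3)))).add (hγ'.smul (h5.mul h4))

end Smooth

lemma paramMap_mul_conjParamMap : paramMap * conjParamMap = 1 := by
  ext σ : 1
  change (σ : ℂ) • (1 : Wiener) * (conj (σ : ℂ) • (1 : Wiener)) = 1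
  rw [smul_mul_smul_comm, mul_one, mul_comm, circle_conj_mul_self, one_smul]

lemma average_const (v : Wiener) : average (ContinuousMap.const Circle v) = v := by
  rw [average_apply]
  simp only [ContinuousMap.const_apply, intervalIntegral.integral_const, sub_zero]
  rw [← Complex.coe_smul (2 * π) v, smul_smul, Complex.ofReal_mul, Complex.ofReal_ofNat,
    inv_mul_cancel₀, one_smul]
  exact_mod_cast Real.two_pi_pos.ne'

/-- At `ε = 0` the self-interaction drops out and the mutual denominator is the constant `-d`, which
leaves the mean of `τ̄ dτ`, equal to `1`. -/
lemma wienerComponent_zero {d : ℝ} (hd : d ≠ 0) (b b' U γ γ' : ℝ) (x x' : Coef) :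
    wienerComponent d b b' 0 U γ γ' x x' = (2 * U - γ' / d) • mon 1 - γ • derivMap x := by
  have h1 : mutualIntegrand d b b' 0 x x' = ContinuousMap.const Circle ((-d⁻¹) • (1 : Wiener)) := by
    have h2 : Ring.inverse (-(d • (1 : C(Circle, Wiener)))) = (-d⁻¹) • 1 := by
      have h3 : -(d • (1 : C(Circle, Wiener))) * ((-d⁻¹) • 1) = 1 := by
        rw [← neg_smul, smul_mul_smul_comm, neg_mul_neg, mul_inv_cancel₀ hd, one_smul, one_mul]
      have h4 := Ring.inverse_mul_cancel _ (isUnit_neg_smul_one hd)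
      exact left_inv_eq_right_inv h4 h3
    rw [mutualIntegrand, mutualDenom_zero, h2]
    simp only [zero_mul, zero_smul, add_zero, mul_one]
    rw [← mul_assoc, paramMap_mul_conjParamMap, one_mul]
    rfl
  rw [wienerComponent, h1, average_const]
  simp only [zero_mul, zero_smul, add_zero, mul_one, mul_smul_comm, smul_smul]
  rw [sub_smul, div_eq_mul_inv, mul_neg, neg_smul]
  abel

/-! ### Back from the Wiener algebra to contour integrals -/

section Evaluate

lemma circleMean_eq (h : Circle → ℂ) :
    circleMean h = (2 * π : ℂ)⁻¹ *
      ∫ θ in (0 : ℝ)..(2 * π), (Circle.exp θ : ℂ) * h (Circle.exp θ) := by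
  rw [circleMean]
  have h1 : ∀ θ : ℝ, h (Circle.exp θ) * (Complex.I * (Circle.exp θ : ℂ)) =
      Complex.I * ((Circle.exp θ : ℂ) * h (Circle.exp θ)) := fun θ => by ring
  simp only [h1]
  rw [intervalIntegral.integral_const_mul, mul_inv, ← mul_assoc]
  congr 1
  rw [mul_assoc, inv_mul_cancel₀ Complex.I_ne_zero, mul_one]

lemma intervalIntegral_circle_rotate {E : Type*} [NormedAddCommGroup E] [NormedSpace ℝ E]
    (g : Circle → E) (w : Circle) :
    ∫ θ in (0 : ℝ)..(2 * π), g (w * Circle.exp θ) = ∫ θ in (0 : ℝ)..(2 * π), g (Circle.exp θ) := by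
  have hw : w = Circle.exp (Complex.arg w) := (Circle.exp_arg w).symm
  have hp : Function.Periodic (fun θ : ℝ => g (Circle.exp θ)) (2 * π) := by
    intro θ
    simp only [Circle.exp_add, Circle.exp_two_pi, mul_one]
  have h1 : ∀ θ : ℝ, g (w * Circle.exp θ) =
      (fun θ : ℝ => g (Circle.exp θ)) (Complex.arg w + θ) := by
    intro θ
    simp only [Circle.exp_add, ← hw]
  simp only [h1]
  rw [intervalIntegral.integral_comp_add_left (fun θ : ℝ => g (Circle.exp θ)), add_zero,
    hp.intervalIntegral_add_eq (Complex.arg w) 0, zero_add]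

/-- The substitution `τ = w σ` moves the singular point `τ = w` to the fixed point `σ = 1`; the
factor `w` comes from `dτ = w dσ`. -/
lemma circleMean_rotate (h : Circle → ℂ) (w : Circle) :
    circleMean h = w * circleMean fun σ => h (w * σ) := by
  rw [circleMean_eq, circleMean_eq,
    ← intervalIntegral_circle_rotate (fun τ => (τ : ℂ) * h τ) w, mul_left_comm (w : ℂ),
    ← intervalIntegral.integral_const_mul (w : ℂ)]
  congr 2
  funext θ
  rw [Circle.coe_mul, mul_assoc]

lemma circle_exp_ne_one {θ : ℝ} (h0 : 0 < θ) (h1 : θ < 2 * π) : Circle.exp θ ≠ 1 := by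
  intro h
  rw [Circle.exp_eq_one] at h
  obtain ⟨n, hn⟩ := h
  have h2 := Real.two_pi_pos
  have h3 : (0 : ℝ) < n := by by_contra h4; nlinarith
  have h4 : (n : ℝ) < 1 := by by_contra h5; nlinarith
  have h5 : 0 < n := by exact_mod_cast h3
  have h6 : n < 1 := by exact_mod_cast h4
  omega

/-- At `τ = w` the kernels contain a division by zero, whose conventional value carries no meaning.
A single point does not affect the integral. -/
lemma circleMean_congr {g h : Circle → ℂ} (w : Circle) (hgh : ∀ τ, τ ≠ w → g τ = h τ) :
    circleMean g = circleMean h := by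
  rw [circleMean_rotate g w, circleMean_rotate h w, circleMean_eq, circleMean_eq]
  congr 2
  apply intervalIntegral.integral_congr_ae
  -- On `(0, 2π]` the rotated parameter equals `1` only at the right endpoint.
  have h1 : ∀ᵐ θ : ℝ, θ ≠ 2 * π := by
    simp [MeasureTheory.ae_iff]
  filter_upwards [h1] with θ hθ hθ'
  rw [Set.uIoc_of_le Real.two_pi_pos.le] at hθ'
  rw [hgh]
  intro h2
  exact circle_exp_ne_one hθ'.1 (lt_of_le_of_ne hθ'.2 hθ) (mul_eq_left.1 h2)

lemma toFun_average (m : C(Circle, Wiener)) (w : Circle) :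
    toFun (average m) w = (2 * π : ℂ)⁻¹ * ∫ θ in (0 : ℝ)..(2 * π), toFun (m (Circle.exp θ)) w := by
  have h := clm_average ((ContinuousMap.evalCLM ℂ w).comp toFun) m
  exact h

lemma toFun_mul_apply (x y : Wiener) (w : Circle) : toFun (x * y) w = toFun x w * toFun y w := by
  rw [toFun_mul]; rfl

lemma toFun_real_smul (c : ℝ) (x : Wiener) (w : Circle) : toFun (c • x) w = c * toFun x w := by
  rw [← Complex.coe_smul, map_smul]; rfl

lemma toFun_add_apply (x y : Wiener) (w : Circle) : toFun (x + y) w = toFun x w + toFun y w := by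
  rw [map_add]; rfl

lemma toFun_sub_apply (x y : Wiener) (w : Circle) : toFun (x - y) w = toFun x w - toFun y w := by
  rw [map_sub]; rfl

lemma toFun_one_apply (w : Circle) : toFun 1 w = 1 := by rw [toFun_one]; rfl

lemma toFun_mon_natCast (n : ℕ) (w : Circle) : toFun (mon n) w = (w : ℂ) ^ n := by
  rw [toFun_mon, zpowMap_apply, coe_zpow_natCast]

lemma toFun_mon_neg_natCast (n : ℕ) (w : Circle) : toFun (mon (-(n : ℤ))) w = conj (w : ℂ) ^ n := by
  rw [toFun_mon, zpowMap_apply, coe_zpow_neg_natCast]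

lemma toFun_paramMap (σ w : Circle) : toFun (paramMap σ) w = σ := by
  change toFun ((σ : ℂ) • (1 : Wiener)) w = σ
  rw [map_smul, toFun_one]
  exact mul_one _

lemma toFun_conjParamMap (σ w : Circle) : toFun (conjParamMap σ) w = conj (σ : ℂ) := by
  change toFun (conj (σ : ℂ) • (1 : Wiener)) w = _
  rw [map_smul, toFun_one]
  exact mul_one _

/-- Evaluation is multiplicative, so for a unit the abstract inverse evaluates to the complex
reciprocal. For non-units `Ring.inverse` is zero, which is why invertibility has to be tracked along
the curve. -/
lemma isUnit_apply {m : C(Circle, Wiener)} (hm : IsUnit m) (σ w : Circle) :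
    toFun (m σ) w ≠ 0 ∧ toFun (Ring.inverse m σ) w = (toFun (m σ) w)⁻¹ := by
  have h1 := Ring.mul_inverse_cancel m hm
  have h2 : toFun (m σ) w * toFun (Ring.inverse m σ) w = 1 := by
    rw [← toFun_mul_apply, ← ContinuousMap.mul_apply, h1, ContinuousMap.one_apply, toFun_one_apply]
  exact ⟨left_ne_zero_of_mul_eq_one h2, eq_inv_of_mul_eq_one_right h2⟩

lemma toFun_derivMap (x : Coef) (w : Circle) : toFun (derivMap x) w = profileDeriv x w := by
  have h := toFun_rotDerivMap x 1 w
  rw [mul_one] at h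
  exact h

lemma toFun_average_selfIntegrand (s : ℝ) (x : Coef) (w : Circle)
    (hu : IsUnit (1 + s • (monMap (-1) * quotMap x))) :
    (w : ℂ) * toFun (average (selfIntegrand s x)) w = circleMean (fun τ =>
        let A : ℂ := τ - w
        let B : ℂ := profile x τ - profile x w
        (A * conj B - conj A * B) / (A * (A + s * B)) * (profileDeriv x τ - B / A)) := by
  rw [circleMean_rotate _ w]
  -- `circleMean` carries the factor `σ` of `dσ` while `average` does not; multiplication by `σ̄`
  -- compensates.
  have h0 : circleMean (fun σ => toFun ((conjParamMap * selfIntegrand s x) σ) w) =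
      toFun (average (selfIntegrand s x)) w := by
    rw [toFun_average, circleMean_eq]
    congr 2
    funext θ
    rw [ContinuousMap.mul_apply, toFun_mul_apply, toFun_conjParamMap, ← mul_assoc,
      mul_comm _ (conj _), circle_conj_mul_self, one_mul]
  rw [← h0]
  congr 1
  apply circleMean_congr 1
  intro σ hσ
  have hσ' : (σ : ℂ) - 1 ≠ 0 := by
    intro h
    apply hσ
    ext
    rw [Circle.coe_one]
    exact sub_eq_zero.1 h
  obtain ⟨hne, hinv⟩ := isUnit_apply hu σ w
  have hD := toFun_quotMap x σ w
  have hD' := toFun_conjQuotMap x σ w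
  have hR := toFun_rotDerivMap x σ w
  have hw := circle_conj_mul_self w
  have hs := circle_conj_mul_self σ
  have hw0 : (w : ℂ) ≠ 0 := Circle.coe_ne_zero w
  have hs0 : (σ : ℂ) ≠ 0 := Circle.coe_ne_zero σ
  have hm1 : toFun (mon (-1)) w = (w : ℂ)⁻¹ := by
    have := toFun_mon_neg_natCast 1 w
    rw [pow_one, ← Circle.coe_inv_eq_conj, Circle.coe_inv] at this
    exact this
  have hm3 : toFun (mon (-3)) w = (w : ℂ)⁻¹ ^ 3 := by
    have := toFun_mon_neg_natCast 3 w
    rw [← Circle.coe_inv_eq_conj, Circle.coe_inv] at this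
    exact this
  have hsinv : conj (σ : ℂ) = (σ : ℂ)⁻¹ := by rw [← Circle.coe_inv_eq_conj, Circle.coe_inv]
  have hwinv : conj (w : ℂ) = (w : ℂ)⁻¹ := by rw [← Circle.coe_inv_eq_conj, Circle.coe_inv]
  simp only [selfIntegrand, ContinuousMap.mul_apply, ContinuousMap.add_apply,
    ContinuousMap.sub_apply, ContinuousMap.smul_apply, ContinuousMap.one_apply, toFun_mul_apply,
    toFun_add_apply, toFun_sub_apply, toFun_real_smul, toFun_one_apply, monMap_apply,
    toFun_paramMap, toFun_conjParamMap, hinv, hm1, hm3, hR] at hne ⊢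
  rw [← map_sub] at hD'
  set D := toFun (quotMap x σ) w
  set D' := toFun (conjQuotMap x σ) w
  set R := profileDeriv x (w * σ)
  have hA : ((w * σ : Circle) : ℂ) - w = w * (σ - 1) := by rw [Circle.coe_mul]; ring
  have hB : profile x (w * σ) - profile x w = (σ - 1) * D := hD.symm
  have hB' : conj (profile x (w * σ) - profile x w) = (σ - 1) * D' := by rw [hD', map_sub]
  rw [hA, hB', hB, map_mul, map_sub, map_one, hsinv, hwinv]
  have hden : (w : ℂ) * (σ - 1) + s * ((σ - 1) * D) = w * (σ - 1) * (1 + s * ((w : ℂ)⁻¹ * D)) := by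
    field_simp
  rw [hden]
  have hne' : (w : ℂ) + s * D ≠ 0 := by
    intro h
    apply hne
    field_simp
    rw [h, mul_zero]
  field_simp
  ring

lemma toFun_average_mutualIntegrand (d b b' ε : ℝ) (x x' : Coef) (w : Circle)
    (hu : IsUnit (mutualDenom d b b' ε x x')) :
    toFun (average (mutualIntegrand d b b' ε x x')) w = circleMean (fun τ =>
      (conj (τ : ℂ) + ε * b' * conj (profile x' τ)) * (1 + ε * b' * profileDeriv x' τ) /
        (ε * (b' * τ + b * w) + ε ^ 2 * (b' ^ 2 * profile x' τ + b ^ 2 * profile x w) - d)) := by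
  rw [toFun_average, circleMean_eq]
  congr 2
  funext θ
  have hinv := (isUnit_apply hu (Circle.exp θ) w).2
  have hm1 : toFun (mon 1) w = (w : ℂ) := by
    have := toFun_mon_natCast 1 w
    rwa [pow_one] at this
  simp only [mutualIntegrand, ContinuousMap.mul_apply, ContinuousMap.add_apply,
    ContinuousMap.smul_apply, ContinuousMap.one_apply, toFun_mul_apply,
    toFun_add_apply, toFun_real_smul, toFun_one_apply,
    toFun_paramMap, toFun_conjParamMap, hinv, toFun_conjConstMap, toFun_constDerivMap, div_eq_mul_inv]
  simp only [mutualDenom, ContinuousMap.add_apply, ContinuousMap.sub_apply,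
    ContinuousMap.smul_apply, ContinuousMap.one_apply, toFun_add_apply, toFun_sub_apply,
    toFun_real_smul, toFun_one_apply, monMap_apply,
    toFun_paramMap, toFun_constMap, toFun_valueMap, hm1]
  push_cast
  ring

lemma toFun_wienerComponent (d b b' ε U γ γ' : ℝ) (x x' : Coef) (w : Circle)
    (hu : IsUnit (1 + (ε * b) • (monMap (-1) * quotMap x)))
    (hu' : IsUnit (mutualDenom d b b' ε x x')) :
    toFun (wienerComponent d b b' ε U γ γ' x x') w =
      complexComponent d ε U γ γ' b b' (profile x) (profileDeriv x) (profile x') (profileDeriv x')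
        w := by
  have hm1 : toFun (mon 1) w = (w : ℂ) := by
    have := toFun_mon_natCast 1 w
    rwa [pow_one] at this
  have h1 := toFun_average_selfIntegrand (ε * b) x w hu
  have h2 := toFun_average_mutualIntegrand d b b' ε x x' w hu'
  rw [complexComponent]
  rw [Complex.ofReal_mul] at h1
  rw [← h1, ← h2]
  simp only [wienerComponent, toFun_mul_apply, toFun_add_apply, toFun_sub_apply, toFun_real_smul,
    toFun_one_apply, toFun_derivMap, hm1]
  push_cast
  ring

end Evaluate

end VortexPair

namespace VortexPair
open Wiener

/-! ### Real Fourier coefficients -/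

section Parity

lemma intervalIntegral_circle_inv (g : Circle → ℂ) :
    ∫ θ in (0 : ℝ)..(2 * π), g (Circle.exp θ)⁻¹ = ∫ θ in (0 : ℝ)..(2 * π), g (Circle.exp θ) := by
  have hp : Function.Periodic (fun θ : ℝ => g (Circle.exp θ)) (2 * π) := by
    intro θ
    simp only [Circle.exp_add, Circle.exp_two_pi, mul_one]
  simp only [← Circle.exp_neg]
  rw [intervalIntegral.integral_comp_neg (fun θ : ℝ => g (Circle.exp θ)), neg_zero]
  have h := hp.intervalIntegral_add_eq (-(2 * π)) 0
  rwa [neg_add_cancel, zero_add] at h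

lemma intervalIntegral_conj (g : ℝ → ℂ) (a b : ℝ) :
    ∫ θ in a..b, conj (g θ) = conj (∫ θ in a..b, g θ) := by
  simp only [intervalIntegral, integral_conj, map_sub]

lemma circleMean_conj_inv (h : Circle → ℂ) :
    circleMean (fun τ => conj (h τ⁻¹)) = conj (circleMean h) := by
  rw [circleMean_eq, circleMean_eq,
    ← intervalIntegral_circle_inv (fun τ => (τ : ℂ) * h τ), map_mul, ← intervalIntegral_conj]
  congr 1
  · rw [map_inv₀, map_mul, map_ofNat, Complex.conj_ofReal]
  · congr 1
    funext θ
    rw [map_mul, Circle.coe_inv_eq_conj, Complex.conj_conj]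

/-- The relation `f(w̄) = conj (f w)` expresses that the Fourier coefficients of `f` are real. The
functional is built by operations and contour means that respect this relation, so its own
coefficients are real too. -/
lemma complexComponent_inv (d ε U γ γ' b b' : ℝ) {f df f' df' : Circle → ℂ}
    (hf : ∀ w, f w⁻¹ = conj (f w)) (hdf : ∀ w, df w⁻¹ = conj (df w))
    (hf' : ∀ w, f' w⁻¹ = conj (f' w)) (hdf' : ∀ w, df' w⁻¹ = conj (df' w)) (w : Circle) :
    complexComponent d ε U γ γ' b b' f df f' df' w⁻¹ =
      conj (complexComponent d ε U γ γ' b b' f df f' df' w) := by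
  simp only [complexComponent]
  have h1 : ∀ τ : Circle, f τ = conj (f τ⁻¹) := fun τ => by rw [hf, Complex.conj_conj]
  have h2 : ∀ τ : Circle, df τ = conj (df τ⁻¹) := fun τ => by rw [hdf, Complex.conj_conj]
  have h3 : ∀ τ : Circle, f' τ = conj (f' τ⁻¹) := fun τ => by rw [hf', Complex.conj_conj]
  have h4 : ∀ τ : Circle, df' τ = conj (df' τ⁻¹) := fun τ => by rw [hdf', Complex.conj_conj]
  simp only [map_add, map_sub, map_mul, ← circleMean_conj_inv, Complex.conj_ofReal,
    map_div₀, map_pow, Circle.coe_inv_eq_conj, hf, hdf, hf', hdf', Complex.conj_conj, map_one,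
    map_ofNat]

lemma profile_inv (x : Coef) (w : Circle) : profile x w⁻¹ = conj (profile x w) := by
  refine (profile_hasSum x w⁻¹).unique ?_
  convert conj_profile_hasSum x w using 2 with n
  rw [Circle.coe_inv_eq_conj, Complex.conj_conj]

lemma profileDeriv_inv (x : Coef) (w : Circle) : profileDeriv x w⁻¹ = conj (profileDeriv x w) := by
  refine (profileDeriv_hasSum x w⁻¹).unique ?_
  have h := (profileDeriv_hasSum x w).map (starRingEnd ℂ) Complex.continuous_conj
  convert h using 2 with n
  simp only [Function.comp_apply, map_mul, map_pow, Complex.conj_ofReal, Circle.coe_inv_eq_conj]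

lemma Wiener.coeff_im_eq_zero {G : Wiener} (hG : ∀ w, toFun G w⁻¹ = conj (toFun G w)) (k : ℤ) :
    (coeff k G).im = 0 := by
  have h1 := average_mul_toFun G k
  have h2 : conj (average (zpowMap (-k) * toFun G)) = average (zpowMap (-k) * toFun G) := by
    rw [average_apply, smul_eq_mul, map_mul, ← intervalIntegral_conj,
      ← intervalIntegral_circle_inv (fun τ => (zpowMap (-k) * toFun G) τ)]
    congr 1
    · rw [map_inv₀, map_mul, map_ofNat, Complex.conj_ofReal]
    · congr 1
      funext θ
      rw [ContinuousMap.mul_apply, ContinuousMap.mul_apply, map_mul, hG, zpowMap_apply,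
        zpowMap_apply, inv_zpow, Circle.coe_inv_eq_conj]
  rw [h1] at h2
  have h3 : (weight k : ℂ) ≠ 0 := by exact_mod_cast (weight_pos k).ne'
  rw [map_mul, map_inv₀, Complex.conj_ofReal] at h2
  exact Complex.conj_eq_iff_im.1 (mul_left_cancel₀ (inv_ne_zero h3) h2)

lemma Wiener.toFun_hasSum (G : Wiener) (w : Circle) :
    HasSum (fun k => coeff k G * ((weight k : ℂ)⁻¹ * ((w ^ k : Circle) : ℂ))) (toFun G w) := by
  have h := lift_hasSum (fun k => ((weight k)⁻¹ : ℂ) • zpowMap k) 1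
    (fun k => norm_weight_inv_smul_le k (norm_zpowMap_le k)) G
  exact (ContinuousMap.evalCLM ℂ w).hasSum h

lemma Wiener.toFun_inv_of_coeff_neg {G : Wiener} (hG : ∀ k, coeff (-k) G = coeff k G) (w : Circle) :
    toFun G w⁻¹ = toFun G w := by
  refine (toFun_hasSum G w⁻¹).unique ?_
  have h := (Equiv.neg ℤ).hasSum_iff.2 (toFun_hasSum G w)
  refine (hasSum_congr fun k => ?_).1 h
  simp only [Function.comp_apply, Equiv.neg_apply, hG, weight_neg, zpow_neg, inv_zpow]

end Parity

/-! ### The imaginary part as a sine series -/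

section SineCoefficients

lemma Wiener.hasSum_norm_coeff (G : Wiener) : HasSum (fun k => ‖coeff k G‖) ‖G‖ :=
  l1_hasSum_norm G

lemma Wiener.summable_norm_coeff_comp (G : Wiener) {k : ℕ → ℤ} (hk : Function.Injective k) :
    Summable (fun n => ‖coeff (k n) G‖) ∧ ∑' n, ‖coeff (k n) G‖ ≤ ‖G‖ := by
  have h := G.hasSum_norm_coeff
  have h1 : Summable (fun n => ‖coeff (k n) G‖) := h.summable.comp_injective hk
  refine ⟨h1, ?_⟩
  rw [← h.tsum_eq]
  exact tsum_comp_le_tsum_of_inj h.summable (fun _ => norm_nonneg _) hk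

lemma abs_re_sub_le (z w : ℂ) : |(z - w).re| ≤ ‖z‖ + ‖w‖ :=
  (Complex.abs_re_le_norm _).trans (norm_sub_le _ _)

lemma natCast_add_two_injective : Function.Injective fun n : ℕ => ((n + 2 : ℕ) : ℤ) :=
  fun a b h => by simpa using h

lemma neg_natCast_add_two_injective : Function.Injective fun n : ℕ => -((n + 2 : ℕ) : ℤ) :=
  fun a b h => by simpa using h

lemma summable_abs_sine (G : Wiener) :
    Summable fun n : ℕ => |(coeff ((n + 2 : ℕ) : ℤ) G - coeff (-((n + 2 : ℕ) : ℤ)) G).re| :=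
  Summable.of_nonneg_of_le (fun _ => abs_nonneg _) (fun _ => abs_re_sub_le _ _)
    ((G.summable_norm_coeff_comp natCast_add_two_injective).1.add
      (G.summable_norm_coeff_comp neg_natCast_add_two_injective).1)

/-- The normalised coefficients of `sin (n θ)`, `n ≥ 2`, of the imaginary part. -/
def highSine : Wiener →L[ℝ] Coef :=
  LinearMap.mkContinuous
    { toFun := fun G =>
        ⟨fun n => (coeff ((n + 2 : ℕ) : ℤ) G - coeff (-((n + 2 : ℕ) : ℤ)) G).re, by
          refine memℓp_gen ?_
          simpa using summable_abs_sine G⟩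
      map_add' := fun G G' => by
        ext n
        simp only [map_add, lp.coeFn_add, Pi.add_apply]
        rw [add_sub_add_comm, Complex.add_re]
      map_smul' := fun c G => by
        ext n
        simp only [lp.coeFn_smul, Pi.smul_apply, RingHom.id_apply]
        rw [← Complex.coe_smul, map_smul, map_smul, ← smul_sub, smul_eq_mul, Complex.re_ofReal_mul,
          smul_eq_mul] } 2
    (fun G => by
      rw [← Coef.tsum_abs]
      have h1 := G.summable_norm_coeff_comp natCast_add_two_injective
      have h2 := G.summable_norm_coeff_comp neg_natCast_add_two_injective
      refine ((summable_abs_sine G).tsum_le_tsum (fun n => abs_re_sub_le _ _)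
        (h1.1.add h2.1)).trans ?_
      rw [h1.1.tsum_add h2.1]
      linarith [h1.2, h2.2])

lemma highSine_apply (G : Wiener) (n : ℕ) :
    highSine G n = (coeff ((n + 2 : ℕ) : ℤ) G - coeff (-((n + 2 : ℕ) : ℤ)) G).re := rfl

/-- The normalised coefficients of `sin (n θ)`, `n ≥ 1`, of the imaginary part. -/
def sineCoeff : Wiener →L[ℝ] ℝ × Coef :=
  (Complex.reCLM.comp ((coeff 1 - coeff (-1)).restrictScalars ℝ)).prod highSine

lemma sineCoeff_apply (G : Wiener) :
    sineCoeff G = ((coeff 1 G - coeff (-1) G).re, highSine G) := rfl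

/-- For real coefficients `c_k` the imaginary part is `∑ (c_k - c_{-k}) sin (kθ)`. When these
differences vanish, `G(w̄)` equals both `G(w)` and its conjugate. -/
lemma toFun_im_eq_zero {G : Wiener} (hG : ∀ w, toFun G w⁻¹ = conj (toFun G w))
    (h : sineCoeff G = 0) (w : Circle) : (toFun G w).im = 0 := by
  rw [sineCoeff_apply, Prod.mk_eq_zero] at h
  have hnat : ∀ n : ℕ, coeff (-(n : ℤ)) G = coeff (n : ℤ) G := by
    intro n
    apply Complex.ext
    · match n with
      | 0 => simp
      | 1 =>
        have h1 := h.1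
        rw [Complex.sub_re, sub_eq_zero] at h1
        exact h1.symm
      | n + 2 =>
        have h1 := highSine_apply G n
        rw [h.2, lp.coeFn_zero, Pi.zero_apply, Complex.sub_re] at h1
        linarith
    · rw [coeff_im_eq_zero hG, coeff_im_eq_zero hG]
  have hneg : ∀ k : ℤ, coeff (-k) G = coeff k G := by
    intro k
    obtain ⟨n, rfl | rfl⟩ := k.eq_nat_or_neg
    · exact hnat n
    · rw [neg_neg, hnat n]
  have h2 := toFun_inv_of_coeff_neg hneg w
  rw [hG] at h2
  exact Complex.conj_eq_iff_im.1 h2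

lemma coeff_mon (j k : ℤ) : coeff j (mon k) = if j = k then (weight k : ℂ) else 0 := by
  rw [mon, map_smul, coeff_basis]
  split_ifs <;> simp

lemma sineCoeff_mon_one : sineCoeff (mon 1) = (2, 0) := by
  rw [sineCoeff_apply]
  congr 1
  · simp only [coeff_mon]
    norm_num [weight]
  · ext n
    rw [highSine_apply, coeff_mon, coeff_mon, if_neg (by omega), if_neg (by omega)]
    simp

lemma coeff_derivMap (x : Coef) (j : ℤ) :
    HasSum (fun n : ℕ => if j = -((n + 2 : ℕ) : ℤ) then (-x n : ℂ) else 0) (coeff j (derivMap x)) := by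
  let T : C(Circle, Wiener) →L[ℝ] ℂ :=
    ((coeff j).restrictScalars ℝ).comp (ContinuousMap.evalCLM ℝ (1 : Circle))
  have h := T.hasSum (l1Lift_hasSum (𝕜 := ℝ) (fun n : ℕ => (⟨fun σ =>
      (((-1 : ℝ) : ℂ) • zpowMap (-((n + 2 : ℕ) : ℤ))) σ • basis (-((n + 2 : ℕ) : ℤ)),
      ((((-1 : ℝ) : ℂ) • zpowMap (-((n + 2 : ℕ) : ℤ))).continuous.smul continuous_const)⟩ : C(Circle, Wiener))) 1
    (fun n => (ContinuousMap.norm_le _ zero_le_one).2 fun σ => by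
      rw [ContinuousMap.coe_mk, norm_smul, norm_basis, mul_one]
      exact (ContinuousMap.norm_coe_le_norm _ σ).trans
        (norm_real_smul_zpowMap_le _ (by simp))) x)
  refine (hasSum_congr fun n => ?_).2 h
  rw [map_smul, Complex.real_smul]
  change _ = _ * coeff j ((((-1 : ℝ) : ℂ) • zpowMap (-((n + 2 : ℕ) : ℤ))) 1 •
    basis (-((n + 2 : ℕ) : ℤ)))
  rw [map_smul, coeff_basis, ContinuousMap.smul_apply, zpowMap_apply, one_zpow, Circle.coe_one]
  split_ifs <;> simp

/-- The frequency `-(n+2)` of `f'` has weight `n+3`, which cancels the denominator left after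
differentiation. In these normalised coordinates differentiation becomes the identity on `Coef`, so
the linearised problem is solvable without loss of regularity. -/
lemma sineCoeff_derivMap (x : Coef) : sineCoeff (derivMap x) = (0, x) := by
  have h0 : ∀ j : ℤ, -1 ≤ j → coeff j (derivMap x) = 0 := by
    intro j hj
    refine (coeff_derivMap x j).unique ?_
    convert hasSum_zero with n
    exact if_neg (by omega)
  rw [sineCoeff_apply, h0 1 (by omega), h0 (-1) (by omega)]
  congr 1
  · simp
  · ext n
    rw [highSine_apply, h0 _ (by omega), zero_sub]
    have h1 : coeff (-((n + 2 : ℕ) : ℤ)) (derivMap x) = -x n := by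
      refine (coeff_derivMap x _).unique ?_
      convert hasSum_ite_eq n (-x n : ℂ) using 2 with m
      by_cases hm : m = n
      · subst hm; simp
      · rw [if_neg (by omega), if_neg hm]
    rw [h1, neg_neg, Complex.ofReal_re]

end SineCoefficients

/-! ### The implicit function theorem at the point vortex pair -/

section ImplicitFunction

/-- The sine coefficients of the translating-pair functional. -/
def pairMap (b₁ b₂ d γ₁ : ℝ) (p : ℝ × (ℝ × ℝ × (Coef × Coef))) : (ℝ × Coef) × (ℝ × Coef) :=
  (sineCoeff (wienerComponent d b₁ b₂ p.1 p.2.1 γ₁ p.2.2.1 p.2.2.2.1 p.2.2.2.2),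
    sineCoeff (wienerComponent d b₂ b₁ p.1 p.2.1 p.2.2.1 γ₁ p.2.2.2.2 p.2.2.2.1))

/-- The point vortex pair. -/
def basePoint (d γ₁ : ℝ) : ℝ × ℝ × (Coef × Coef) := (γ₁ / (2 * d), γ₁, (0, 0))

lemma contDiffAt_pairMap (b₁ b₂ γ₁ : ℝ) {d : ℝ} (hd : d ≠ 0) (y : ℝ × ℝ × (Coef × Coef)) :
    ContDiffAt ℝ 1 (pairMap b₁ b₂ d γ₁) (0, y) := by
  apply ContDiffAt.prodMk
  · exact sineCoeff.contDiff.contDiffAt.comp _ (contDiffAt_wienerComponent hd b₁ b₂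
      (by fun_prop) (by fun_prop) (by fun_prop) (by fun_prop) (by fun_prop) (by fun_prop) rfl)
  · exact sineCoeff.contDiff.contDiffAt.comp _ (contDiffAt_wienerComponent hd b₂ b₁
      (by fun_prop) (by fun_prop) (by fun_prop) (by fun_prop) (by fun_prop) (by fun_prop) rfl)

lemma pairMap_zero (b₁ b₂ γ₁ : ℝ) {d : ℝ} (hd : d ≠ 0) (y : ℝ × ℝ × (Coef × Coef)) :
    pairMap b₁ b₂ d γ₁ (0, y) =
      ((2 * (2 * y.1 - y.2.1 / d), -(γ₁ • y.2.2.1)), (2 * (2 * y.1 - γ₁ / d), -(y.2.1 • y.2.2.2))) := by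
  simp only [pairMap, wienerComponent_zero hd, map_sub, map_smul, sineCoeff_mon_one,
    sineCoeff_derivMap, Prod.smul_mk, Prod.mk_sub_mk, smul_zero, zero_sub, smul_eq_mul]
  ring_nf

/-- The derivative of `pairMap` in the unknowns at the point vortex pair. -/
def linearization (d γ₁ : ℝ) : (ℝ × ℝ × (Coef × Coef)) →L[ℝ] (ℝ × Coef) × (ℝ × Coef) :=
  let pU := ContinuousLinearMap.fst ℝ ℝ (ℝ × (Coef × Coef))
  let q := ContinuousLinearMap.snd ℝ ℝ (ℝ × (Coef × Coef))
  let pγ := (ContinuousLinearMap.fst ℝ ℝ (Coef × Coef)).comp q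
  let r := (ContinuousLinearMap.snd ℝ ℝ (Coef × Coef)).comp q
  let p₁ := (ContinuousLinearMap.fst ℝ Coef Coef).comp r
  let p₂ := (ContinuousLinearMap.snd ℝ Coef Coef).comp r
  (((4 : ℝ) • pU - (2 / d) • pγ).prod ((-γ₁) • p₁)).prod (((4 : ℝ) • pU).prod ((-γ₁) • p₂))

lemma linearization_apply (d γ₁ : ℝ) (y : ℝ × ℝ × (Coef × Coef)) :
    linearization d γ₁ y =
      ((4 * y.1 - 2 / d * y.2.1, (-γ₁) • y.2.2.1), (4 * y.1, (-γ₁) • y.2.2.2)) := rfl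

/-- The first mode of the second equation determines `U`, the difference of the two first modes then
determines `γ₂`, and the higher modes determine the profiles after division by `-γ₁`. -/
lemma linearization_isInvertible {d γ₁ : ℝ} (hd : d ≠ 0) (hγ : γ₁ ≠ 0) :
    (linearization d γ₁).IsInvertible := by
  let p := ContinuousLinearMap.fst ℝ (ℝ × Coef) (ℝ × Coef)
  let q := ContinuousLinearMap.snd ℝ (ℝ × Coef) (ℝ × Coef)
  let s := ContinuousLinearMap.fst ℝ ℝ Coef
  let t := ContinuousLinearMap.snd ℝ ℝ Coef
  let K : (ℝ × Coef) × (ℝ × Coef) →L[ℝ] (ℝ × ℝ × (Coef × Coef)) :=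
    ((1 / 4 : ℝ) • s.comp q).prod (((d / 2) • (s.comp q - s.comp p)).prod
      (((-γ₁)⁻¹ • t.comp p).prod ((-γ₁)⁻¹ • t.comp q)))
  have hK : ∀ z, K z = (1 / 4 * z.2.1, d / 2 * (z.2.1 - z.1.1), ((-γ₁)⁻¹ • z.1.2, (-γ₁)⁻¹ • z.2.2)) :=
    fun z => rfl
  have hγ' : -γ₁ ≠ 0 := neg_ne_zero.2 hγ
  refine ContinuousLinearMap.IsInvertible.of_inverse (g := K) ?_ ?_
  · refine ContinuousLinearMap.ext fun z => ?_
    rw [ContinuousLinearMap.comp_apply, hK, linearization_apply, ContinuousLinearMap.id_apply]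
    simp only [smul_smul, mul_inv_cancel₀ hγ', one_smul]
    ext1
    · ext1
      · dsimp only; field_simp; ring
      · rfl
    · ext1
      · dsimp only; field_simp
      · rfl
  · refine ContinuousLinearMap.ext fun y => ?_
    rw [ContinuousLinearMap.comp_apply, linearization_apply, hK, ContinuousLinearMap.id_apply]
    simp only [smul_smul, inv_mul_cancel₀ hγ', one_smul]
    ext1
    · dsimp only; ring
    · ext1
      · dsimp only; field_simp; ring
      · rfl

lemma hasFDerivAt_pairMap_zero (b₁ b₂ γ₁ : ℝ) {d : ℝ} (hd : d ≠ 0) :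
    HasFDerivAt (fun y => pairMap b₁ b₂ d γ₁ ((0 : ℝ), y)) (linearization d γ₁)
      (basePoint d γ₁) := by
  simp only [pairMap_zero b₁ b₂ γ₁ hd]
  let pU := ContinuousLinearMap.fst ℝ ℝ (ℝ × (Coef × Coef))
  let q := ContinuousLinearMap.snd ℝ ℝ (ℝ × (Coef × Coef))
  let pγ := (ContinuousLinearMap.fst ℝ ℝ (Coef × Coef)).comp q
  let r := (ContinuousLinearMap.snd ℝ ℝ (Coef × Coef)).comp q
  let p₁ := (ContinuousLinearMap.fst ℝ Coef Coef).comp r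
  let p₂ := (ContinuousLinearMap.snd ℝ Coef Coef).comp r
  have h1 : HasFDerivAt (fun y : ℝ × ℝ × (Coef × Coef) => 2 * (2 * y.1 - y.2.1 / d))
      ((4 : ℝ) • pU - (2 / d) • pγ) (basePoint d γ₁) := by
    convert ((4 : ℝ) • pU - (2 / d) • pγ).hasFDerivAt using 1
    funext y
    change _ = 4 * y.1 - 2 / d * y.2.1
    ring
  have h2 : HasFDerivAt (fun y : ℝ × ℝ × (Coef × Coef) => -(γ₁ • y.2.2.1)) ((-γ₁) • p₁)
      (basePoint d γ₁) := by
    convert ((-γ₁) • p₁).hasFDerivAt using 1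
    funext y
    exact (neg_smul _ _).symm
  have h3 : HasFDerivAt (fun y : ℝ × ℝ × (Coef × Coef) => 2 * (2 * y.1 - γ₁ / d))
      ((4 : ℝ) • pU) (basePoint d γ₁) := by
    have h5 : (fun y : ℝ × ℝ × (Coef × Coef) => 2 * (2 * y.1 - γ₁ / d)) =
        fun y => ((4 : ℝ) • pU) y - 2 * (γ₁ / d) := by
      funext y
      change _ = 4 * y.1 - _
      ring
    rw [h5]
    exact ((4 : ℝ) • pU).hasFDerivAt.sub_const _
  -- The only nonlinear entry is the product of `γ₂` with the second profile. The profile vanishes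
  -- at the base point, so the variation of `γ₂` does not contribute.
  have h4 : HasFDerivAt (fun y : ℝ × ℝ × (Coef × Coef) => -(y.2.1 • y.2.2.2)) ((-γ₁) • p₂)
      (basePoint d γ₁) := by
    have h5 := (pγ.hasFDerivAt (x := basePoint d γ₁)).smul (p₂.hasFDerivAt (x := basePoint d γ₁))
    refine h5.neg.congr_fderiv ?_
    refine ContinuousLinearMap.ext fun y => ?_
    change -(γ₁ • y.2.2.2 + y.2.1 • (0 : Coef)) = (-γ₁) • y.2.2.2
    rw [smul_zero, add_zero, neg_smul]
  exact (h1.prodMk h2).prodMk (h3.prodMk h4)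

/-- The implicit function theorem produces zeros of the sine coefficients of the abstract
functional. To read them as zeros of the actual contour integrals, the elements inverted in the
integrands must still be units along the curve. -/
theorem exists_coef_curve (b₁ b₂ : ℝ) {d γ₁ : ℝ} (hd : d ≠ 0) (hγ : γ₁ ≠ 0) :
    ∃ ψ : ℝ → ℝ × ℝ × (Coef × Coef), ContDiffAt ℝ 1 ψ 0 ∧ ψ 0 = basePoint d γ₁ ∧
      ∀ᶠ ε in nhds 0, ∀ w : Circle,
        (complexComponent d ε (ψ ε).1 γ₁ (ψ ε).2.1 b₁ b₂ (profile (ψ ε).2.2.1)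
          (profileDeriv (ψ ε).2.2.1) (profile (ψ ε).2.2.2) (profileDeriv (ψ ε).2.2.2) w).im = 0 ∧
        (complexComponent d ε (ψ ε).1 (ψ ε).2.1 γ₁ b₂ b₁ (profile (ψ ε).2.2.2)
          (profileDeriv (ψ ε).2.2.2) (profile (ψ ε).2.2.1) (profileDeriv (ψ ε).2.2.1) w).im = 0 := by
  set u : ℝ × (ℝ × ℝ × (Coef × Coef)) := (0, basePoint d γ₁) with hu
  have hc : ContDiffAt ℝ 1 (pairMap b₁ b₂ d γ₁) u := contDiffAt_pairMap b₁ b₂ γ₁ hd _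
  have hu0 : pairMap b₁ b₂ d γ₁ u = 0 := by
    rw [hu, pairMap_zero b₁ b₂ γ₁ hd]
    simp only [basePoint, smul_zero, neg_zero]
    have : 2 * (2 * (γ₁ / (2 * d)) - γ₁ / d) = 0 := by field_simp; ring
    rw [this]
    rfl
  have hinv : (fderiv ℝ (pairMap b₁ b₂ d γ₁) u ∘L .inr ℝ ℝ (ℝ × ℝ × (Coef × Coef))).IsInvertible := by
    have h1 : HasFDerivAt (fun y => pairMap b₁ b₂ d γ₁ ((0 : ℝ), y))
        (fderiv ℝ (pairMap b₁ b₂ d γ₁) u ∘L .inr ℝ ℝ (ℝ × ℝ × (Coef × Coef))) (basePoint d γ₁) :=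
      (hc.differentiableAt one_ne_zero).hasFDerivAt.comp _ (hasFDerivAt_prodMk_right _ _)
    rw [h1.unique (hasFDerivAt_pairMap_zero b₁ b₂ γ₁ hd)]
    exact linearization_isInvertible hd hγ
  refine ⟨hc.implicitFunction one_ne_zero hinv, hc.contDiffAt_implicitFunction one_ne_zero hinv,
    hc.implicitFunction_apply_self one_ne_zero hinv, ?_⟩
  have h0 := hc.implicitFunction_apply_self one_ne_zero hinv
  have hcont := (hc.contDiffAt_implicitFunction one_ne_zero hinv).continuousAt
  have hsol := hc.eventually_apply_implicitFunction one_ne_zero hinv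
  rw [hu0] at hsol
  set ψ := hc.implicitFunction one_ne_zero hinv
  have h0u : (0, ψ 0) = u := congrArg (Prod.mk (0 : ℝ)) h0
  have hp : ContinuousAt (fun ε : ℝ => (ε, ψ ε)) 0 := continuousAt_id.prodMk hcont
  -- Units form an open set and the curve is continuous, so an element depending continuously on the
  -- data and invertible at the base point stays invertible for small `ε`.
  have hunit : ∀ {m : ℝ × (ℝ × ℝ × (Coef × Coef)) → C(Circle, Wiener)},
      ContinuousAt m u → IsUnit (m u) → ∀ᶠ ε in nhds (0 : ℝ), IsUnit (m (ε, ψ ε)) := by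
    intro m hm hmu
    have h1 : ContinuousAt (fun ε : ℝ => m (ε, ψ ε)) 0 :=
      ContinuousAt.comp (g := m) (by rw [h0u]; exact hm) hp
    refine h1.eventually (Units.isOpen.mem_nhds ?_)
    change IsUnit (m (0, ψ 0))
    rw [h0u]
    exact hmu
  have hs : ∀ (b : ℝ) (x : ℝ × (ℝ × ℝ × (Coef × Coef)) →L[ℝ] Coef), ∀ᶠ ε in nhds (0 : ℝ),
      IsUnit (1 + (ε * b) • (monMap (-1) * quotMap (x (ε, ψ ε)))) := by
    intro b x
    refine hunit (m := fun p => 1 + (p.1 * b) • (monMap (-1) * quotMap (x p))) ?_ ?_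
    · exact Continuous.continuousAt (by fun_prop)
    · simp [hu]
  have hm : ∀ (b b' : ℝ) (x x' : ℝ × (ℝ × ℝ × (Coef × Coef)) →L[ℝ] Coef), ∀ᶠ ε in nhds (0 : ℝ),
      IsUnit (mutualDenom d b b' ε (x (ε, ψ ε)) (x' (ε, ψ ε))) := by
    intro b b' x x'
    refine hunit (m := fun p => mutualDenom d b b' p.1 (x p) (x' p)) ?_ ?_
    · exact (contDiffAt_mutualDenom d b b' contDiffAt_fst x.contDiff.contDiffAt
        x'.contDiff.contDiffAt).continuousAt
    · simp only [hu, mutualDenom_zero]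
      exact isUnit_neg_smul_one hd
  let r : ℝ × (ℝ × ℝ × (Coef × Coef)) →L[ℝ] Coef × Coef :=
    (ContinuousLinearMap.snd ℝ ℝ (Coef × Coef)).comp
      ((ContinuousLinearMap.snd ℝ ℝ (ℝ × (Coef × Coef))).comp
        (ContinuousLinearMap.snd ℝ ℝ (ℝ × ℝ × (Coef × Coef))))
  let p₁ := (ContinuousLinearMap.fst ℝ Coef Coef).comp r
  let p₂ := (ContinuousLinearMap.snd ℝ Coef Coef).comp r
  filter_upwards [hsol, hs b₁ p₁, hs b₂ p₂, hm b₁ b₂ p₁ p₂, hm b₂ b₁ p₂ p₁] with ε h h1 h2 h3 h4 w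
  have key : ∀ (b b' γ γ' : ℝ) (x x' : Coef),
      IsUnit (1 + (ε * b) • (monMap (-1) * quotMap x)) → IsUnit (mutualDenom d b b' ε x x') →
      sineCoeff (wienerComponent d b b' ε (ψ ε).1 γ γ' x x') = 0 →
      (complexComponent d ε (ψ ε).1 γ γ' b b' (profile x) (profileDeriv x) (profile x')
        (profileDeriv x') w).im = 0 := by
    intro b b' γ γ' x x' hx hx' h0
    have h5 := fun w => toFun_wienerComponent d b b' ε (ψ ε).1 γ γ' x x' w hx hx'
    rw [← h5]
    refine toFun_im_eq_zero (fun v => ?_) h0 w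
    rw [h5, h5]
    exact complexComponent_inv _ _ _ _ _ _ _ (profile_inv x) (profileDeriv_inv x)
      (profile_inv x') (profileDeriv_inv x') v
  rw [pairMap, Prod.mk_eq_zero] at h
  exact ⟨key _ _ _ _ _ _ h1 h3 h.1, key _ _ _ _ _ _ h2 h4 h.2⟩

end ImplicitFunction

end VortexPair

/-! ### `C^{1,1}` bounds and the embedding into the Hölder space -/

namespace VortexPair

/-- Quantitative `C^{1,1}` bounds for a function `f` on the circle with derivative `df`. -/
structure C11Bound (N : ℝ) (f df : Circle → ℂ) : Prop where
  norm_le : ∀ w, ‖f w‖ ≤ N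
  deriv_norm_le : ∀ w, ‖df w‖ ≤ N
  lipschitz : ∀ τ w : Circle, ‖f τ - f w‖ ≤ N * ‖(τ : ℂ) - w‖
  deriv_lipschitz : ∀ τ w : Circle, ‖df τ - df w‖ ≤ N * ‖(τ : ℂ) - w‖
  taylor : ∀ τ w : Circle, ‖f τ - f w - df w * (τ - w)‖ ≤ N * ‖(τ : ℂ) - w‖ ^ 2

lemma norm_circle_exp_sub_one_le (t : ℝ) : ‖(Circle.exp t : ℂ) - 1‖ ≤ |t| := by
  have h := Real.norm_exp_I_mul_ofReal_sub_one_le (x := t)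
  rwa [Circle.coe_exp, mul_comm (t : ℂ)]

lemma hasDerivAt_circle_exp (t : ℝ) :
    HasDerivAt (fun t : ℝ => (Circle.exp t : ℂ)) (Complex.I * Circle.exp t) t := by
  simp only [Circle.coe_exp]
  have h := ((Complex.ofRealCLM.hasDerivAt (x := t)).mul_const Complex.I).cexp
  refine h.congr_deriv ?_
  rw [Complex.ofRealCLM_apply, Complex.ofRealCLM_apply, Complex.ofReal_one, one_mul, mul_comm]

lemma norm_circle_mul_exp_sub_le (w : Circle) (t : ℝ) :
    ‖((w * Circle.exp t : Circle) : ℂ) - w‖ ≤ |t| := by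
  have h : ((w * Circle.exp t : Circle) : ℂ) - w = w * ((Circle.exp t : ℂ) - 1) := by
    rw [Circle.coe_mul]; ring
  rw [h, norm_mul, Circle.norm_coe, one_mul]
  exact norm_circle_exp_sub_one_le t

lemma C11Bound.nonneg {N : ℝ} {f df : Circle → ℂ} (h : C11Bound N f df) : 0 ≤ N :=
  (norm_nonneg _).trans (h.norm_le 1)

/-- The affine approximation of `f` in the chord `w e^{it} - w` has the stated derivative, and the
Taylor remainder is `O(t²)` because a chord is no longer than its arc. -/
lemma C11Bound.hasDerivAt_zero {N : ℝ} {f df : Circle → ℂ} (h : C11Bound N f df) (w : Circle) :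
    HasDerivAt (fun t : ℝ => f (w * Circle.exp t)) (Complex.I * w * df w) 0 := by
  have h1 : HasDerivAt (fun t : ℝ => f w + df w * (((w * Circle.exp t : Circle) : ℂ) - w))
      (Complex.I * w * df w) 0 := by
    have h2 := (((hasDerivAt_circle_exp 0).const_mul (w : ℂ)).sub_const (w : ℂ)).const_mul (df w)
    have h3 := h2.const_add (f w)
    simp only [Circle.coe_mul]
    refine h3.congr_deriv ?_
    rw [Circle.exp_zero, Circle.coe_one]
    ring
  have h4 : HasDerivAt (fun t : ℝ => f (w * Circle.exp t) -
      (f w + df w * (((w * Circle.exp t : Circle) : ℂ) - w))) 0 0 := by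
    rw [hasDerivAt_iff_isLittleO_nhds_zero]
    have h5 : (fun t : ℝ => N * t ^ 2) =o[nhds 0] fun t => t := by
      have := (Asymptotics.isLittleO_pow_id (𝕜 := ℝ) (n := 2) (by norm_num)).const_mul_left N
      exact this
    refine Asymptotics.IsBigO.trans_isLittleO ?_ h5
    refine Asymptotics.IsBigO.of_bound 1 (Filter.Eventually.of_forall fun t => ?_)
    have h6 := h.taylor (w * Circle.exp t) w
    have h7 := norm_circle_mul_exp_sub_le w t
    have h8 : ‖((w * Circle.exp t : Circle) : ℂ) - w‖ ^ 2 ≤ t ^ 2 := by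
      rw [← sq_abs t]
      gcongr
    simp only [zero_add, Circle.exp_zero, mul_one, sub_self, mul_zero, add_zero, smul_zero,
      sub_zero, one_mul]
    rw [← sub_sub, Real.norm_of_nonneg (mul_nonneg h.nonneg (sq_nonneg t))]
    exact h6.trans (mul_le_mul_of_nonneg_left h8 h.nonneg)
  have h5 := h4.fun_add h1
  simpa only [zero_add, sub_add_cancel] using h5

lemma C11Bound.circleDifferentiable {N : ℝ} {f df : Circle → ℂ} (h : C11Bound N f df) :
    CircleDifferentiable f := fun w => (h.hasDerivAt_zero w).differentiableAt

lemma C11Bound.circleDeriv_eq {N : ℝ} {f df : Circle → ℂ} (h : C11Bound N f df) :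
    circleDeriv f = df := by
  funext w
  rw [circleDeriv, (h.hasDerivAt_zero w).deriv]
  have h1 : (w : ℂ) ≠ 0 := Circle.coe_ne_zero w
  field_simp

lemma circle_conj_sub (τ w : Circle) : ‖conj (τ : ℂ) - conj (w : ℂ)‖ = ‖(τ : ℂ) - w‖ := by
  rw [← map_sub, Complex.norm_conj]

lemma norm_pow_sub_pow_le {x y : ℂ} (hx : ‖x‖ = 1) (hy : ‖y‖ = 1) (n : ℕ) :
    ‖x ^ n - y ^ n‖ ≤ n * ‖x - y‖ := by
  induction n with
  | zero => simp
  | succ n ih =>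
    have h : x ^ (n + 1) - y ^ (n + 1) = x ^ n * (x - y) + (x ^ n - y ^ n) * y := by ring
    rw [h]
    refine (norm_add_le _ _).trans ?_
    rw [norm_mul, norm_mul, norm_pow, hx, hy, one_pow, one_mul, mul_one]
    push_cast
    linarith

lemma norm_pow_sub_taylor_le (τ w : Circle) (n : ℕ) :
    ‖conj (τ : ℂ) ^ n - conj (w : ℂ) ^ n + n * conj (w : ℂ) ^ (n + 1) * (τ - w)‖ ≤
      n * (n + 1) / 2 * ‖(τ : ℂ) - w‖ ^ 2 := by
  set x := conj (τ : ℂ)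
  set y := conj (w : ℂ)
  have hx : ‖x‖ = 1 := norm_conj_circle τ
  have hy : ‖y‖ = 1 := norm_conj_circle w
  have hxτ : x * τ = 1 := circle_conj_mul_self τ
  have hyw : y * w = 1 := circle_conj_mul_self w
  have hxy : ‖x - y‖ = ‖(τ : ℂ) - w‖ := circle_conj_sub τ w
  -- On the circle conjugates are inverses, which turns differences of conjugates into multiples of
  -- `τ - w`.
  have hd : x - y = -(x * y * (τ - w)) := by linear_combination y * hxτ - x * hyw
  induction n with
  | zero => simp
  | succ n ih =>
    have h : x ^ (n + 1) - y ^ (n + 1) + (n + 1 : ℕ) * y ^ (n + 1 + 1) * (τ - w) =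
        y * (x ^ n - y ^ n + n * y ^ (n + 1) * (τ - w)) - (x ^ (n + 1) - y ^ (n + 1)) * y * (τ - w) := by
      push_cast
      linear_combination x ^ n * hd
    rw [h]
    refine (norm_sub_le _ _).trans ?_
    have h1 := norm_pow_sub_pow_le hx hy (n + 1)
    rw [norm_mul, norm_mul, norm_mul, hy, one_mul, mul_one]
    rw [hxy] at h1
    have h2 : ‖x ^ (n + 1) - y ^ (n + 1)‖ * ‖(τ : ℂ) - w‖ ≤
        ((n + 1 : ℕ) * ‖(τ : ℂ) - w‖) * ‖(τ : ℂ) - w‖ := by gcongr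
    push_cast at h2 ⊢
    nlinarith

lemma norm_sub_le_of_hasSum {x : Coef} {g : ℕ → ℂ} {a : ℂ} (hg : HasSum g a) {C : ℝ}
    (h : ∀ n, ‖g n‖ ≤ |x n| * C) : ‖a‖ ≤ ‖x‖ * C := by
  have h1 : HasSum (fun n => |x n| * C) (‖x‖ * C) := by
    have := (l1_hasSum_norm x).mul_right C
    simpa using this
  rw [← hg.tsum_eq]
  exact tsum_of_norm_bounded h1 h

/-- The denominators `(n+1)(n+3)` absorb two derivatives: the second order Taylor remainder of
`w̄^(n+1)` costs `(n+1)(n+2)/2`. All five bounds thus reduce to the summability of `x`. -/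
lemma c11Bound_profile (x : Coef) : C11Bound ‖x‖ (profile x) (profileDeriv x) := by
  have habs1 : ∀ n : ℕ, |x n / ((n + 1) * (n + 3))| = |x n| / ((n + 1) * (n + 3)) := fun n => by
    rw [abs_div, abs_of_pos (by positivity : (0 : ℝ) < (n + 1) * (n + 3))]
  have habs2 : ∀ n : ℕ, |-x n / ((n : ℝ) + 3)| = |x n| / (n + 3) := fun n => by
    rw [abs_div, abs_of_pos (by positivity : (0 : ℝ) < (n : ℝ) + 3), abs_neg]
  constructor
  · intro w
    rw [← mul_one ‖x‖]
    refine norm_sub_le_of_hasSum (profile_hasSum x w) fun n => ?_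
    rw [norm_mul, norm_pow, norm_conj_circle, one_pow, Complex.norm_real, Real.norm_eq_abs]
    refine mul_le_mul_of_nonneg_right (abs_div_le_of_one_le ?_) zero_le_one
    have : (0 : ℝ) ≤ n := n.cast_nonneg
    nlinarith
  · intro w
    rw [← mul_one ‖x‖]
    refine norm_sub_le_of_hasSum (profileDeriv_hasSum x w) fun n => ?_
    rw [norm_mul, norm_pow, norm_conj_circle, one_pow, Complex.norm_real, Real.norm_eq_abs,
      ← abs_neg (x n)]
    refine mul_le_mul_of_nonneg_right (abs_div_le_of_one_le ?_) zero_le_one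
    have : (0 : ℝ) ≤ n := n.cast_nonneg
    linarith
  · intro τ w
    refine norm_sub_le_of_hasSum ((profile_hasSum x τ).sub (profile_hasSum x w)) fun n => ?_
    have h := norm_pow_sub_pow_le (norm_conj_circle τ) (norm_conj_circle w) (n + 1)
    rw [← mul_sub, norm_mul, Complex.norm_real, Real.norm_eq_abs, habs1]
    rw [circle_conj_sub] at h
    have hn : (0 : ℝ) ≤ n := n.cast_nonneg
    calc _ ≤ |x n| / ((n + 1) * (n + 3)) * ((n + 1 : ℕ) * ‖(τ : ℂ) - w‖) := by gcongr
      _ = |x n| / (n + 3) * ‖(τ : ℂ) - w‖ := by push_cast; field_simp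
      _ ≤ |x n| * ‖(τ : ℂ) - w‖ := by
        gcongr
        exact div_le_self (abs_nonneg _) (by linarith)
  · intro τ w
    refine norm_sub_le_of_hasSum ((profileDeriv_hasSum x τ).sub (profileDeriv_hasSum x w))
      fun n => ?_
    have h := norm_pow_sub_pow_le (norm_conj_circle τ) (norm_conj_circle w) (n + 2)
    rw [← mul_sub, norm_mul, Complex.norm_real, Real.norm_eq_abs, habs2]
    rw [circle_conj_sub] at h
    have hn : (0 : ℝ) ≤ n := n.cast_nonneg
    calc _ ≤ |x n| / (n + 3) * ((n + 2 : ℕ) * ‖(τ : ℂ) - w‖) := by gcongr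
      _ = |x n| * (((n + 2) / (n + 3)) * ‖(τ : ℂ) - w‖) := by push_cast; field_simp
      _ ≤ |x n| * (1 * ‖(τ : ℂ) - w‖) := by
        gcongr
        exact div_le_one_of_le₀ (by linarith) (by linarith)
      _ = _ := by rw [one_mul]
  · intro τ w
    refine norm_sub_le_of_hasSum (((profile_hasSum x τ).sub (profile_hasSum x w)).sub
      ((profileDeriv_hasSum x w).mul_right ((τ : ℂ) - w))) fun n => ?_
    have h := norm_pow_sub_taylor_le τ w (n + 1)
    have hn : (0 : ℝ) ≤ n := n.cast_nonneg
    have hn1 := natCast_add_ne_zero n 0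
    have hn3 := natCast_add_ne_zero n 2
    have h1 : ((x n / ((n + 1) * (n + 3)) : ℝ) : ℂ) * conj (τ : ℂ) ^ (n + 1) -
        ((x n / ((n + 1) * (n + 3)) : ℝ) : ℂ) * conj (w : ℂ) ^ (n + 1) -
        ((-x n / (n + 3) : ℝ) : ℂ) * conj (w : ℂ) ^ (n + 2) * (τ - w) =
        ((x n / ((n + 1) * (n + 3)) : ℝ) : ℂ) * (conj (τ : ℂ) ^ (n + 1) - conj (w : ℂ) ^ (n + 1)
          + (n + 1 : ℕ) * conj (w : ℂ) ^ (n + 1 + 1) * (τ - w)) := by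
      push_cast at hn1 hn3 ⊢
      norm_num at hn1 hn3
      field_simp
      ring
    rw [h1, norm_mul, Complex.norm_real, Real.norm_eq_abs, habs1]
    calc _ ≤ |x n| / ((n + 1) * (n + 3)) *
          ((n + 1 : ℕ) * ((n + 1 : ℕ) + 1) / 2 * ‖(τ : ℂ) - w‖ ^ 2) := by gcongr
      _ = |x n| * (((n + 2) / (2 * (n + 3))) * ‖(τ : ℂ) - w‖ ^ 2) := by
        push_cast; field_simp; ring
      _ ≤ |x n| * (1 * ‖(τ : ℂ) - w‖ ^ 2) := by
        gcongr
        exact div_le_one_of_le₀ (by linarith) (by linarith)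
      _ = _ := by rw [one_mul]

section Inclusion

lemma circle_edist_le_two (τ w : Circle) : edist τ w ≤ (2 : ℝ≥0) := by
  have h1 : edist τ w = edist (τ : ℂ) (w : ℂ) := rfl
  rw [h1, edist_le_coe, ← NNReal.coe_le_coe, coe_nndist, dist_eq_norm]
  refine (norm_sub_le _ _).trans ?_
  rw [Circle.norm_coe, Circle.norm_coe]
  norm_num

lemma C11Bound.holderWith {N : ℝ} {f df : Circle → ℂ} (h : C11Bound N f df) {α : ℝ≥0}
    (hα : α < 1) : HolderWith (2 * N.toNNReal) α df := by
  have h1 : LipschitzWith N.toNNReal df := by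
    refine LipschitzWith.of_dist_le_mul fun τ w => ?_
    rw [Real.coe_toNNReal _ h.nonneg, dist_eq_norm]
    have h2 := h.deriv_lipschitz τ w
    rwa [← dist_eq_norm (τ : ℂ)] at h2
  have h2 := (holderWith_one.2 h1).of_le circle_edist_le_two hα.le
  refine h2.mono ?_
  rw [mul_comm]
  gcongr
  calc (2 : ℝ≥0) ^ ((1 : ℝ≥0) - α : ℝ) ≤ 2 ^ (1 : ℝ) :=
        NNReal.rpow_le_rpow_of_exponent_le (by norm_num) (by simp)
    _ = 2 := by simp

/-- Each of the two suprema contributes `N`. The Hölder seminorm contributes `2N`, since the circle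
has diameter `2` and `2^(1-α) ≤ 2`. -/
lemma c11Bound_norm_le {N : ℝ} {f df : Circle → ℂ} (h : C11Bound N f df) {α : ℝ≥0}
    (hα : α < 1) : c1HolderNorm α f ≤ 4 * N := by
  have h1 : (⨆ w, ‖f w‖) ≤ N := ciSup_le h.norm_le
  have h2 : (⨆ w, ‖circleDeriv f w‖) ≤ N := by
    rw [h.circleDeriv_eq]; exact ciSup_le h.deriv_norm_le
  have h3 : (nnHolderNorm α (circleDeriv f) : ℝ) ≤ 2 * N := by
    rw [h.circleDeriv_eq]
    have := NNReal.coe_le_coe.2 (h.holderWith hα).nnholderNorm_le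
    rwa [NNReal.coe_mul, Real.coe_toNNReal _ h.nonneg] at this
  rw [c1HolderNorm]
  linarith

lemma profile_mem (x : Coef) {α : ℝ≥0} (hα : α < 1) : profile x ∈ holderSubmodule α := by
  have h := c11Bound_profile x
  refine ⟨⟨h.circleDifferentiable, ?_⟩, _, profile_hasSum x⟩
  rw [h.circleDeriv_eq]
  exact (h.holderWith hα).memHolder

lemma profile_add (x y : Coef) : profile (x + y) = profile x + profile y := by
  funext w
  refine (profile_hasSum (x + y) w).unique ?_
  refine (hasSum_congr fun n => ?_).2 ((profile_hasSum x w).add (profile_hasSum y w))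
  rw [lp.coeFn_add, Pi.add_apply, ← add_mul, ← Complex.ofReal_add, add_div]

lemma profile_smul (c : ℝ) (x : Coef) : profile (c • x) = c • profile x := by
  funext w
  refine (profile_hasSum (c • x) w).unique ?_
  refine (hasSum_congr fun n => ?_).2 ((profile_hasSum x w).mul_left (c : ℂ))
  rw [lp.coeFn_smul, Pi.smul_apply, smul_eq_mul, ← mul_assoc, ← Complex.ofReal_mul, mul_div_assoc]

/-- The functions with summable coefficients as elements of `C^{1+α}`. -/
def inclusion {α : ℝ≥0} (hα : α < 1) : Coef →L[ℝ] HolderSpace α :=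
  LinearMap.mkContinuous
    { toFun := fun x => ⟨profile x, profile_mem x hα⟩
      map_add' := fun x y => Subtype.ext (profile_add x y)
      map_smul' := fun c x => Subtype.ext (profile_smul c x) } 4
    (fun x => c11Bound_norm_le (c11Bound_profile x) hα)

lemma circleDeriv_inclusion {α : ℝ≥0} (hα : α < 1) (x : Coef) :
    circleDeriv (inclusion hα x : HolderSpace α) = profileDeriv x :=
  (c11Bound_profile x).circleDeriv_eq

end Inclusion

end VortexPair

namespace VortexPair

/-! ### The perturbed circle, its interior and strict convexity -/

section Geometry

/-- The perturbed circle `w ↦ w + u w`. -/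
def perturb (u : Circle → ℂ) (w : Circle) : ℂ := w + u w

/-- The radial extension of `perturb u` to the plane, homogeneous of degree one. -/
def radialExt (u : Circle → ℂ) (z : ℂ) : ℂ := z + ‖z‖ * u (Circle.exp z.arg)

lemma norm_mul_circle_exp_arg (z : ℂ) : (‖z‖ : ℂ) * Circle.exp z.arg = z := by
  rw [Circle.coe_exp]
  exact Complex.norm_mul_exp_arg_mul_I z

lemma radialExt_eq (u : Circle → ℂ) (z : ℂ) :
    radialExt u z = ‖z‖ * perturb u (Circle.exp z.arg) := by
  rw [perturb, mul_add, norm_mul_circle_exp_arg, radialExt]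

lemma circle_exp_arg_real_mul {r : ℝ} (hr : 0 < r) (w : Circle) :
    Circle.exp ((r : ℂ) * w).arg = w := by
  rw [Complex.arg_real_mul _ hr, Circle.exp_arg]

lemma norm_real_mul_circle {r : ℝ} (hr : 0 ≤ r) (w : Circle) : ‖(r : ℂ) * w‖ = r := by
  rw [norm_mul, Circle.norm_coe, mul_one, Complex.norm_real, Real.norm_of_nonneg hr]

lemma radialExt_real_mul (u : Circle → ℂ) {r : ℝ} (hr : 0 ≤ r) (w : Circle) :
    radialExt u (r * w) = r * perturb u w := by
  rcases hr.eq_or_lt with rfl | hr'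
  · simp [radialExt]
  · rw [radialExt_eq, norm_real_mul_circle hr, circle_exp_arg_real_mul hr']

variable {N : ℝ} {u du : Circle → ℂ} (h : C11Bound N u du) (hN : N ≤ 1 / 20)
include h

/-- The deviation from the identity is `|z| u(z/|z|)`. The radial difference contributes `N`; the
angular one contributes `2N`, because `|z'|` times the chord between the two directions is at most
`2 |z - z'|`. -/
lemma C11Bound.approximatesLinearOn : ApproximatesLinearOn (radialExt u)
    ((ContinuousLinearEquiv.refl ℝ ℂ : ℂ ≃L[ℝ] ℂ) : ℂ →L[ℝ] ℂ) Set.univ (3 * N).toNNReal := by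
  refine ApproximatesLinearOn.approximatesLinearOn_iff_lipschitzOnWith.2 (LipschitzOnWith.of_dist_le_mul ?_)
  intro z _ z' _
  rw [Real.coe_toNNReal _ (by linarith [h.nonneg]), dist_eq_norm, dist_eq_norm]
  have h0 : ∀ z, (radialExt u - ((ContinuousLinearEquiv.refl ℝ ℂ : ℂ ≃L[ℝ] ℂ) : ℂ →L[ℝ] ℂ)) z =
      ‖z‖ * u (Circle.exp z.arg) := fun z => by
    change radialExt u z - z = _
    rw [radialExt]; ring
  rw [h0, h0]
  set τ := Circle.exp z.arg
  set w := Circle.exp z'.arg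
  have h1 : (‖z‖ : ℂ) * u τ - ‖z'‖ * u w = ((‖z‖ - ‖z'‖ : ℝ) : ℂ) * u τ + ‖z'‖ * (u τ - u w) := by
    push_cast; ring
  have h2 : ‖((‖z‖ - ‖z'‖ : ℝ) : ℂ)‖ ≤ ‖z - z'‖ := by
    rw [Complex.norm_real]
    exact abs_norm_sub_norm_le z z'
  have h3 : ‖z'‖ * ‖(τ : ℂ) - w‖ ≤ 2 * ‖z - z'‖ := by
    have h4 : (‖z'‖ : ℂ) * (τ - w) = (z - z') - ((‖z‖ - ‖z'‖ : ℝ) : ℂ) * τ := by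
      have h5 := norm_mul_circle_exp_arg z
      have h6 := norm_mul_circle_exp_arg z'
      push_cast
      linear_combination h5 - h6
    have h5 : ‖z'‖ * ‖(τ : ℂ) - w‖ = ‖(‖z'‖ : ℂ) * (τ - w)‖ := by
      rw [norm_mul, Complex.norm_real, norm_norm]
    rw [h5, h4]
    refine (norm_sub_le _ _).trans ?_
    rw [norm_mul, Circle.norm_coe, mul_one]
    linarith
  rw [h1]
  refine (norm_add_le _ _).trans ?_
  rw [norm_mul, norm_mul, Complex.norm_real ‖z'‖, norm_norm]
  have h4 := h.norm_le τ
  have h5 := h.lipschitz τ w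
  have h6 := h.nonneg
  calc _ ≤ ‖z - z'‖ * N + ‖z'‖ * (N * ‖(τ : ℂ) - w‖) := by gcongr
    _ = ‖z - z'‖ * N + N * (‖z'‖ * ‖(τ : ℂ) - w‖) := by ring
    _ ≤ ‖z - z'‖ * N + N * (2 * ‖z - z'‖) := by gcongr
    _ = 3 * N * ‖z - z'‖ := by ring

include hN

/-- A perturbation of the identity with Lipschitz constant `3N < 1` is a homeomorphism. This
replaces the Jordan curve theorem for these curves. -/
lemma C11Bound.exists_homeomorph : ∃ Φ : ℂ ≃ₜ ℂ, ∀ z, Φ z = radialExt u z := by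
  refine ⟨h.approximatesLinearOn.toHomeomorph _ (Or.inr ?_), fun z => rfl⟩
  have h1 : ‖(((ContinuousLinearEquiv.refl ℝ ℂ).symm : ℂ ≃L[ℝ] ℂ) : ℂ →L[ℝ] ℂ)‖₊ = 1 := by
    have : ‖ContinuousLinearMap.id ℝ ℂ‖₊ = 1 := by
      rw [← NNReal.coe_inj]; simp
    exact this
  rw [h1, inv_one, Real.toNNReal_lt_one]
  linarith

/-- The homeomorphism of the plane extending the perturbed circle. -/
def C11Bound.homeo : ℂ ≃ₜ ℂ := (h.exists_homeomorph hN).choose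

lemma C11Bound.homeo_apply (z : ℂ) : h.homeo hN z = radialExt u z :=
  (h.exists_homeomorph hN).choose_spec z

lemma C11Bound.homeo_real_mul {r : ℝ} (hr : 0 ≤ r) (w : Circle) :
    h.homeo hN (r * w) = r * perturb u w := by
  rw [h.homeo_apply hN, radialExt_real_mul u hr]

lemma C11Bound.image_sphere : h.homeo hN '' Metric.sphere 0 1 = Set.range (perturb u) := by
  ext z
  constructor
  · rintro ⟨y, hy, rfl⟩
    rw [mem_sphere_zero_iff_norm] at hy
    refine ⟨Circle.exp y.arg, ?_⟩
    rw [h.homeo_apply hN, radialExt_eq, hy, Complex.ofReal_one, one_mul]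
  · rintro ⟨w, rfl⟩
    refine ⟨w, by rw [mem_sphere_zero_iff_norm, Circle.norm_coe], ?_⟩
    have := h.homeo_real_mul hN zero_le_one w
    rwa [Complex.ofReal_one, one_mul, one_mul] at this

lemma C11Bound.norm_perturb_le (w : Circle) : ‖perturb u w‖ ≤ 21 / 20 := by
  refine (norm_add_le _ _).trans ?_
  rw [Circle.norm_coe]
  linarith [h.norm_le w]

lemma C11Bound.le_norm_perturb (w : Circle) : 19 / 20 ≤ ‖perturb u w‖ := by
  have h1 := norm_sub_norm_le (w : ℂ) (-u w)
  rw [sub_neg_eq_add, norm_neg, Circle.norm_coe] at h1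
  rw [perturb]
  linarith [h.norm_le w]

lemma C11Bound.norm_homeo_le (z : ℂ) : ‖h.homeo hN z‖ ≤ 21 / 20 * ‖z‖ := by
  rw [h.homeo_apply hN, radialExt_eq, norm_mul, Complex.norm_real, norm_norm, mul_comm]
  exact mul_le_mul_of_nonneg_right (h.norm_perturb_le hN _) (norm_nonneg _)

lemma C11Bound.le_norm_homeo (z : ℂ) : 19 / 20 * ‖z‖ ≤ ‖h.homeo hN z‖ := by
  rw [h.homeo_apply hN, radialExt_eq, norm_mul, Complex.norm_real, norm_norm, mul_comm]
  exact mul_le_mul_of_nonneg_left (h.le_norm_perturb hN _) (norm_nonneg _)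

omit h hN in
lemma isPreconnected_compl_closedBall : IsPreconnected (Metric.closedBall (0 : ℂ) 1)ᶜ := by
  have h1 : (Metric.closedBall (0 : ℂ) 1)ᶜ =
      (fun p : ℝ × ℝ => (p.1 : ℂ) * Circle.exp p.2) '' (Set.Ioi 1 ×ˢ Set.univ) := by
    ext z
    simp only [Set.mem_compl_iff, mem_closedBall_zero_iff, not_le, Set.mem_image, Set.mem_prod,
      Set.mem_Ioi, Set.mem_univ, and_true, Prod.exists]
    constructor
    · intro hz
      exact ⟨‖z‖, z.arg, hz, norm_mul_circle_exp_arg z⟩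
    · rintro ⟨r, t, hr, rfl⟩
      rwa [norm_real_mul_circle (by linarith)]
  rw [h1]
  refine (isPreconnected_Ioi.prod isPreconnected_univ).image _ (Continuous.continuousOn ?_)
  fun_prop

/-- The homeomorphism splits the complement of the curve into two disjoint open sets. The image of
the exterior is connected and unbounded, so it lies in unbounded components; the image of the ball
is bounded, and a component meeting it cannot leave it. -/
lemma C11Bound.enclosedDomain_eq :
    enclosedDomain (perturb u) = h.homeo hN '' Metric.ball 0 1 := by
  set Φ := h.homeo hN
  have hcompl : (Set.range (perturb u))ᶜ =
      Φ '' Metric.ball 0 1 ∪ Φ '' (Metric.closedBall 0 1)ᶜ := by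
    rw [← h.image_sphere hN, ← Set.image_compl_eq Φ.bijective, ← Set.image_union]
    congr 1
    ext z
    simp only [Set.mem_compl_iff, mem_sphere_zero_iff_norm, Set.mem_union, mem_ball_zero_iff,
      mem_closedBall_zero_iff, not_le]
    exact ne_iff_lt_or_gt
  have hopen1 : IsOpen (Φ '' Metric.ball 0 1) := Φ.isOpenMap _ Metric.isOpen_ball
  have hopen2 : IsOpen (Φ '' (Metric.closedBall 0 1)ᶜ) :=
    Φ.isOpenMap _ Metric.isClosed_closedBall.isOpen_compl
  have hdisj : Disjoint (Φ '' Metric.ball 0 1) (Φ '' (Metric.closedBall 0 1)ᶜ) := by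
    rw [Set.disjoint_image_iff Φ.injective, Set.disjoint_compl_right_iff_subset]
    exact Metric.ball_subset_closedBall
  ext z
  constructor
  · rintro ⟨hz, hb⟩
    have hz' : z ∈ (Set.range (perturb u))ᶜ := hz
    rw [hcompl] at hz'
    rcases hz' with h1 | h1
    · exact h1
    · exfalso
      have h2 : Φ '' (Metric.closedBall 0 1)ᶜ ⊆ connectedComponentIn (Set.range (perturb u))ᶜ z :=
        (isPreconnected_compl_closedBall.image _ Φ.continuous.continuousOn).subset_connectedComponentIn
          h1 (by rw [hcompl]; exact Set.subset_union_right)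
      obtain ⟨R, hR⟩ := (hb.subset h2).exists_norm_le
      have h3 : ((|R| + 1) * 2 : ℝ) ∈ {r : ℝ | 1 < r} := by
        have := abs_nonneg R
        simp only [Set.mem_ofPred_eq]
        linarith
      have h4 : (((|R| + 1) * 2 : ℝ) : ℂ) ∈ (Metric.closedBall (0 : ℂ) 1)ᶜ := by
        rw [Set.mem_compl_iff, mem_closedBall_zero_iff, not_le, Complex.norm_real,
          Real.norm_of_nonneg (by positivity)]
        exact h3
      have h5 := hR _ (Set.mem_image_of_mem Φ h4)
      have h6 := h.le_norm_homeo hN (((|R| + 1) * 2 : ℝ) : ℂ)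
      rw [Complex.norm_real, Real.norm_of_nonneg (by positivity)] at h6
      have h7 := le_abs_self R
      have h8 := abs_nonneg R
      linarith
  · intro hz
    have hz' : z ∈ (Set.range (perturb u))ᶜ := by rw [hcompl]; exact Or.inl hz
    refine ⟨hz', ?_⟩
    have h1 : connectedComponentIn (Set.range (perturb u))ᶜ z ⊆ Φ '' Metric.ball 0 1 := by
      refine isPreconnected_connectedComponentIn.subset_left_of_subset_union hopen1 hopen2 hdisj ?_
        ⟨z, mem_connectedComponentIn hz', hz⟩
      rw [← hcompl]
      exact connectedComponentIn_subset _ _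
    refine (Metric.isBounded_ball (x := (0 : ℂ)) (r := 2)).subset (h1.trans ?_)
    rintro _ ⟨y, hy, rfl⟩
    rw [mem_ball_zero_iff] at hy ⊢
    linarith [h.norm_homeo_le hN y]

lemma C11Bound.mem_domain_iff {z : ℂ} :
    z ∈ enclosedDomain (perturb u) ↔ ∃ r : ℝ, 0 ≤ r ∧ r < 1 ∧ ∃ w, z = r * perturb u w := by
  rw [h.enclosedDomain_eq hN]
  constructor
  · rintro ⟨y, hy, rfl⟩
    rw [mem_ball_zero_iff] at hy
    exact ⟨‖y‖, norm_nonneg _, hy, _, by rw [h.homeo_apply hN, radialExt_eq]⟩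
  · rintro ⟨r, hr0, hr1, w, rfl⟩
    refine ⟨r * w, ?_, h.homeo_real_mul hN hr0 w⟩
    rwa [mem_ball_zero_iff, norm_real_mul_circle hr0]

lemma C11Bound.closure_domain :
    closure (enclosedDomain (perturb u)) = h.homeo hN '' Metric.closedBall 0 1 := by
  rw [h.enclosedDomain_eq hN, ← (h.homeo hN).image_closure, closure_ball _ one_ne_zero]

lemma C11Bound.mem_closure_domain_iff {z : ℂ} :
    z ∈ closure (enclosedDomain (perturb u)) ↔
      ∃ r : ℝ, 0 ≤ r ∧ r ≤ 1 ∧ ∃ w, z = r * perturb u w := by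
  rw [h.closure_domain hN]
  constructor
  · rintro ⟨y, hy, rfl⟩
    rw [mem_closedBall_zero_iff] at hy
    exact ⟨‖y‖, norm_nonneg _, hy, _, by rw [h.homeo_apply hN, radialExt_eq]⟩
  · rintro ⟨r, hr0, hr1, w, rfl⟩
    refine ⟨r * w, ?_, h.homeo_real_mul hN hr0 w⟩
    rwa [mem_closedBall_zero_iff, norm_real_mul_circle hr0]

lemma C11Bound.isOpen_domain : IsOpen (enclosedDomain (perturb u)) := by
  rw [h.enclosedDomain_eq hN]
  exact (h.homeo hN).isOpenMap _ Metric.isOpen_ball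

lemma C11Bound.frontier_domain : frontier (enclosedDomain (perturb u)) = Set.range (perturb u) := by
  rw [h.enclosedDomain_eq hN, ← (h.homeo hN).image_frontier, frontier_ball _ one_ne_zero,
    h.image_sphere hN]

lemma C11Bound.perturb_injective : Function.Injective (perturb u) := by
  intro τ w hτw
  have h1 := h.homeo_real_mul hN zero_le_one τ
  have h2 := h.homeo_real_mul hN zero_le_one w
  rw [hτw, ← h2] at h1
  have h3 := (h.homeo hN).injective h1
  rw [Complex.ofReal_one, one_mul, one_mul] at h3
  exact Circle.ext h3

omit hN in
lemma C11Bound.perturb_sub (τ w : Circle) : ∃ ρ : ℂ, ‖ρ‖ ≤ N * ‖(τ : ℂ) - w‖ ^ 2 ∧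
    perturb u τ - perturb u w = (1 + du τ) * (τ - w) + ρ := by
  refine ⟨-(u w - u τ - du τ * (w - τ)), ?_, ?_⟩
  · rw [norm_neg, norm_sub_rev (τ : ℂ)]
    exact h.taylor w τ
  · rw [perturb, perturb]; ring

omit h hN in
lemma re_conj_mul_sub (τ w : Circle) :
    (conj (τ : ℂ) * ((τ : ℂ) - w)).re = ‖(τ : ℂ) - w‖ ^ 2 / 2 := by
  have h1 : ‖(τ : ℂ)‖ ^ 2 = 1 := by rw [Circle.norm_coe]; norm_num
  have h2 : ‖(w : ℂ)‖ ^ 2 = 1 := by rw [Circle.norm_coe]; norm_num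
  rw [Complex.sq_norm, Complex.normSq_apply] at h1 h2 ⊢
  simp only [Complex.mul_re, Complex.conj_re, Complex.conj_im, Complex.sub_re, Complex.sub_im]
  nlinarith

/-- The vector `τ (1 + u'(τ))` is an outward normal. The unit circle bends away from its tangent by
`|τ - w|² / 2`; the factor `|1 + u'|²` is at least `(19/20)²`, and the Taylor remainder costs at
most `(21/20)(1/20) |τ - w|²`, which leaves more than a quarter. -/
lemma C11Bound.support_lower_bound (τ w : Circle) :
    ‖(τ : ℂ) - w‖ ^ 2 / 4 ≤
      (conj ((τ : ℂ) * (1 + du τ)) * (perturb u τ - perturb u w)).re := by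
  obtain ⟨ρ, hρ, hsub⟩ := h.perturb_sub τ w
  have h1 : conj ((τ : ℂ) * (1 + du τ)) * (perturb u τ - perturb u w) =
      ((‖1 + du τ‖ ^ 2 : ℝ) : ℂ) * (conj (τ : ℂ) * (τ - w)) +
        conj ((τ : ℂ) * (1 + du τ)) * ρ := by
    rw [hsub, Complex.ofReal_pow, ← Complex.conj_mul', map_mul]
    ring
  have h2 : 19 / 20 ≤ ‖1 + du τ‖ := by
    have := norm_sub_norm_le (1 : ℂ) (-du τ)
    rw [sub_neg_eq_add, norm_neg, norm_one] at this
    linarith [h.deriv_norm_le τ]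
  have h3 : ‖1 + du τ‖ ≤ 21 / 20 := by
    refine (norm_add_le _ _).trans ?_
    rw [norm_one]
    linarith [h.deriv_norm_le τ]
  have h4 : |(conj ((τ : ℂ) * (1 + du τ)) * ρ).re| ≤ 21 / 20 * (1 / 20 * ‖(τ : ℂ) - w‖ ^ 2) := by
    refine (Complex.abs_re_le_norm _).trans ?_
    rw [norm_mul, Complex.norm_conj, norm_mul, Circle.norm_coe, one_mul]
    refine mul_le_mul h3 (hρ.trans ?_) (norm_nonneg _) (by norm_num)
    gcongr
  have h5 := (abs_le.1 h4).1
  rw [h1, Complex.add_re, Complex.re_ofReal_mul, re_conj_mul_sub]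
  have h6 : (19 / 20 : ℝ) ^ 2 ≤ ‖1 + du τ‖ ^ 2 := by gcongr
  have h7 := sq_nonneg ‖(τ : ℂ) - w‖
  nlinarith

lemma C11Bound.support_pos_zero (τ : Circle) :
    1 / 2 ≤ (conj ((τ : ℂ) * (1 + du τ)) * perturb u τ).re := by
  have h1 : conj ((τ : ℂ) * (1 + du τ)) * perturb u τ =
      1 + (conj (du τ) + conj (τ : ℂ) * u τ + conj (du τ) * (conj (τ : ℂ) * u τ)) := by
    rw [perturb, map_mul, map_add, map_one]
    linear_combination (1 + conj (du τ)) * circle_conj_mul_self τ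
  have h2 : ‖conj (du τ) + conj (τ : ℂ) * u τ + conj (du τ) * (conj (τ : ℂ) * u τ)‖ ≤
      1 / 20 + 1 / 20 + 1 / 20 * (1 / 20) := by
    have h3 := (h.norm_le τ).trans hN
    have h4 := (h.deriv_norm_le τ).trans hN
    refine (norm_add₃_le).trans ?_
    rw [norm_mul, norm_mul, norm_mul, Complex.norm_conj, norm_conj_circle, one_mul]
    gcongr
  have h3 := (abs_le.1 ((Complex.abs_re_le_norm _).trans h2)).1
  rw [h1, Complex.add_re, Complex.one_re]
  linarith

/-- A point of the closure is `r` times a boundary point, and the expression is the corresponding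
convex combination of its values at that boundary point and at the origin. Equality forces `r = 1`
and the boundary point to be that of `τ`. -/
lemma C11Bound.support_nonneg (τ : Circle) {z : ℂ}
    (hz : z ∈ closure (enclosedDomain (perturb u))) :
    0 ≤ (conj ((τ : ℂ) * (1 + du τ)) * (perturb u τ - z)).re ∧
      (z ≠ perturb u τ → 0 < (conj ((τ : ℂ) * (1 + du τ)) * (perturb u τ - z)).re) := by
  obtain ⟨r, hr0, hr1, w, rfl⟩ := (h.mem_closure_domain_iff hN).1 hz
  have h1 : conj ((τ : ℂ) * (1 + du τ)) * (perturb u τ - r * perturb u w) =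
      r * (conj ((τ : ℂ) * (1 + du τ)) * (perturb u τ - perturb u w)) +
        ((1 - r : ℝ) : ℂ) * (conj ((τ : ℂ) * (1 + du τ)) * perturb u τ) := by
    push_cast; ring
  have h2 := h.support_lower_bound hN τ w
  have h3 := h.support_pos_zero hN τ
  have h4 := sq_nonneg ‖(τ : ℂ) - w‖
  rw [h1, Complex.add_re, Complex.re_ofReal_mul, Complex.re_ofReal_mul]
  have h5 : 0 ≤ (conj ((τ : ℂ) * (1 + du τ)) * (perturb u τ - perturb u w)).re := by linarith
  refine ⟨by nlinarith, fun hne => ?_⟩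
  rcases hr1.lt_or_eq with hr | rfl
  · nlinarith
  · have h6 : (τ : ℂ) - w ≠ 0 := by
      intro h7
      apply hne
      rw [Complex.ofReal_one, one_mul, Circle.ext (sub_eq_zero.1 h7)]
    have h7 : 0 < ‖(τ : ℂ) - w‖ ^ 2 := by positivity
    linarith

/-- The domain is an intersection of open half-planes. A point outside it is `ρ` times a boundary
point with `ρ ≥ 1` and violates the inequality belonging to its own direction. -/
lemma C11Bound.domain_eq_support : enclosedDomain (perturb u) =
    {z | ∀ τ : Circle, 0 < (conj ((τ : ℂ) * (1 + du τ)) * (perturb u τ - z)).re} := by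
  ext z
  constructor
  · intro hz τ
    refine (h.support_nonneg hN τ (subset_closure hz)).2 ?_
    rintro rfl
    exact hz.1 ⟨τ, rfl⟩
  · intro hz
    obtain ⟨y, rfl⟩ := (h.homeo hN).surjective z
    rw [h.enclosedDomain_eq hN]
    refine ⟨y, ?_, rfl⟩
    rw [mem_ball_zero_iff]
    by_contra hy
    have h1 := hz (Circle.exp y.arg)
    have h3 := h.support_pos_zero hN (Circle.exp y.arg)
    rw [h.homeo_apply hN, radialExt_eq] at h1
    have h2 : ∀ a b : ℂ, a * (b - ‖y‖ * b) = ((1 - ‖y‖ : ℝ) : ℂ) * (a * b) := fun a b => by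
      push_cast; ring
    rw [h2, Complex.re_ofReal_mul] at h1
    nlinarith

/-- Each supporting line meets the closure only at its point of contact, so of two distinct points
at most one lies on it. -/
lemma C11Bound.convex_combination_mem {x y : ℂ}
    (hx : x ∈ closure (enclosedDomain (perturb u))) (hy : y ∈ closure (enclosedDomain (perturb u)))
    (hxy : x ≠ y) {a b : ℝ} (ha : 0 < a) (hb : 0 < b) (hab : a + b = 1) :
    a • x + b • y ∈ enclosedDomain (perturb u) := by
  rw [h.domain_eq_support hN]
  intro τ
  have h1 : conj ((τ : ℂ) * (1 + du τ)) * (perturb u τ - (a • x + b • y)) =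
      a * (conj ((τ : ℂ) * (1 + du τ)) * (perturb u τ - x)) +
        b * (conj ((τ : ℂ) * (1 + du τ)) * (perturb u τ - y)) := by
    have : (a : ℂ) + b = 1 := by exact_mod_cast hab
    rw [Complex.real_smul, Complex.real_smul]
    linear_combination (-(conj ((τ : ℂ) * (1 + du τ)) * perturb u τ)) * this
  obtain ⟨h2, h3⟩ := h.support_nonneg hN τ hx
  obtain ⟨h4, h5⟩ := h.support_nonneg hN τ hy
  rw [h1, Complex.add_re, Complex.re_ofReal_mul, Complex.re_ofReal_mul]
  by_cases hx' : x = perturb u τ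
  · have h6 := h5 (fun hy' => hxy (hx'.trans hy'.symm))
    have := mul_nonneg ha.le h2
    have := mul_pos hb h6
    linarith
  · have h6 := h3 hx'
    have := mul_nonneg hb.le h4
    have := mul_pos ha h6
    linarith

lemma C11Bound.zero_mem_domain : (0 : ℂ) ∈ enclosedDomain (perturb u) :=
  (h.mem_domain_iff hN).2 ⟨0, le_rfl, zero_lt_one, 1, by simp⟩

lemma C11Bound.norm_le_of_mem_closure {z : ℂ}
    (hz : z ∈ closure (enclosedDomain (perturb u))) : ‖z‖ ≤ 21 / 20 := by
  obtain ⟨r, hr0, hr1, w, rfl⟩ := (h.mem_closure_domain_iff hN).1 hz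
  rw [norm_mul, Complex.norm_real, Real.norm_of_nonneg hr0]
  have := h.norm_perturb_le hN w
  nlinarith [norm_nonneg (perturb u w)]

lemma C11Bound.isStrictlyConvexDomain : IsStrictlyConvexDomain (enclosedDomain (perturb u)) where
  isOpen := h.isOpen_domain hN
  nonempty := ⟨0, h.zero_mem_domain hN⟩
  convex := by
    intro x hx y hy a b ha hb hab
    rcases ha.eq_or_lt with rfl | ha'
    · rw [zero_add] at hab
      rw [zero_smul, zero_add, hab, one_smul]
      exact hy
    rcases hb.eq_or_lt with rfl | hb'
    · rw [add_zero] at hab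
      rw [zero_smul, add_zero, hab, one_smul]
      exact hx
    by_cases hxy : x = y
    · subst hxy
      rw [← add_smul, hab, one_smul]
      exact hx
    exact h.convex_combination_mem hN (subset_closure hx) (subset_closure hy) hxy ha' hb' hab
  strictConvex_closure := by
    intro x hx y hy hxy a b ha hb hab
    exact interior_mono subset_closure ((h.isOpen_domain hN).interior_eq.symm ▸
      h.convex_combination_mem hN hx hy hxy ha hb hab)

omit h hN in
lemma circleDifferentiable_coe : CircleDifferentiable (fun w => (w : ℂ)) := by
  intro w
  simp only [Circle.coe_mul]
  exact ((hasDerivAt_circle_exp 0).const_mul (w : ℂ)).differentiableAt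

omit h hN in
lemma circleDeriv_coe : circleDeriv (fun w => (w : ℂ)) = 1 := by
  funext w
  rw [circleDeriv]
  simp only [Circle.coe_mul]
  rw [((hasDerivAt_circle_exp 0).const_mul (w : ℂ)).deriv, Circle.exp_zero, Circle.coe_one]
  have h1 : (w : ℂ) ≠ 0 := Circle.coe_ne_zero w
  have h2 := Complex.I_ne_zero
  field_simp
  rfl

omit hN in
lemma C11Bound.circleDeriv_perturb : circleDeriv (perturb u) = fun w => 1 + du w := by
  have h1 : perturb u = (fun w : Circle => (w : ℂ)) + u := rfl
  rw [h1, circleDeriv_add circleDifferentiable_coe h.circleDifferentiable, circleDeriv_coe,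
    h.circleDeriv_eq]
  rfl

lemma C11Bound.one_add_ne_zero (w : Circle) : 1 + du w ≠ 0 := by
  intro h1
  have h2 := h.deriv_norm_le w
  have h3 : du w = -1 := by linear_combination h1
  rw [h3, norm_neg, norm_one] at h2
  linarith

omit hN in
lemma C11Bound.continuous : Continuous u := h.circleDifferentiable.continuous

omit hN in
lemma C11Bound.continuous_deriv : Continuous du := by
  have h1 : LipschitzWith N.toNNReal du := by
    refine LipschitzWith.of_dist_le_mul fun τ w => ?_
    rw [Real.coe_toNNReal _ h.nonneg, dist_eq_norm]
    have h2 := h.deriv_lipschitz τ w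
    rwa [← dist_eq_norm (τ : ℂ)] at h2
  exact h1.continuous

lemma C11Bound.isC1BoundaryOf : IsC1BoundaryOf (perturb u) (enclosedDomain (perturb u)) where
  injective := h.perturb_injective hN
  differentiable := fun w => (circleDifferentiable_coe w).fun_add (h.circleDifferentiable w)
  continuous_deriv := by
    rw [h.circleDeriv_perturb]
    exact continuous_const.add h.continuous_deriv
  deriv_ne_zero := fun w => by
    rw [h.circleDeriv_perturb]
    exact h.one_add_ne_zero hN w
  frontier_eq := h.frontier_domain hN

lemma C11Bound.domain_subset_ball : enclosedDomain (perturb u) ⊆ Metric.ball 0 2 := by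
  intro z hz
  rw [mem_ball_zero_iff]
  linarith [h.norm_le_of_mem_closure hN (subset_closure hz)]

end Geometry

end VortexPair

namespace VortexPair
open MeasureTheory

/-! ### Integration in cone coordinates -/

section ConeIntegral

lemma C11Bound.hasDerivAt {N : ℝ} {u du : Circle → ℂ} (h : C11Bound N u du) (t : ℝ) :
    HasDerivAt (fun t : ℝ => u (Circle.exp t)) (Complex.I * Circle.exp t * du (Circle.exp t)) t := by
  have h1 := h.hasDerivAt_zero (Circle.exp t)
  rw [← sub_self t] at h1
  have h2 := h1.comp_sub_const t t
  simpa only [← Circle.exp_add, add_sub_cancel] using h2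

/-- The tangent vector of the perturbed circle, with respect to the angle. -/
def tangent (du : Circle → ℂ) (t : ℝ) : ℂ := Complex.I * (Circle.exp t * (1 + du (Circle.exp t)))

lemma C11Bound.hasDerivAt_perturb {N : ℝ} {u du : Circle → ℂ} (h : C11Bound N u du) (t : ℝ) :
    HasDerivAt (fun t : ℝ => perturb u (Circle.exp t)) (tangent du t) t := by
  refine ((hasDerivAt_circle_exp t).fun_add (h.hasDerivAt t)).congr_deriv ?_
  rw [tangent]; ring

lemma exists_circle_exp_eq (w : Circle) : ∃ t ∈ Set.Ioc 0 (2 * π), Circle.exp t = w := by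
  have h1 := Complex.neg_pi_lt_arg (w : ℂ)
  have h2 := Complex.arg_le_pi (w : ℂ)
  by_cases h : 0 < Complex.arg (w : ℂ)
  · exact ⟨_, ⟨h, by linarith [Real.pi_pos]⟩, Circle.exp_arg w⟩
  · refine ⟨Complex.arg (w : ℂ) + 2 * π, ⟨by linarith, by linarith⟩, ?_⟩
    rw [Circle.exp_add, Circle.exp_two_pi, mul_one, Circle.exp_arg]

lemma circle_exp_injOn : Set.InjOn Circle.exp (Set.Ioc 0 (2 * π)) := by
  intro s hs t ht hst
  rw [Circle.exp_eq_exp] at hst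
  obtain ⟨m, hm⟩ := hst
  have h2 := Real.two_pi_pos
  have h3 : (-1 : ℝ) < m := by
    by_contra h4
    nlinarith [hs.1, hs.2, ht.1, ht.2]
  have h4 : (m : ℝ) < 1 := by
    by_contra h4
    nlinarith [hs.1, hs.2, ht.1, ht.2]
  have h5 : m = 0 := by
    have h6 : -1 < m := by exact_mod_cast h3
    have h7 : m < 1 := by exact_mod_cast h4
    omega
  rw [hm, h5]
  simp

/-- The real-linear map `v ↦ Re v • a + Im v • b` of the plane. -/
def columnMap (a b : ℂ) : ℂ →L[ℝ] ℂ :=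
  Complex.reCLM.smulRight a + Complex.imCLM.smulRight b

lemma columnMap_apply (a b v : ℂ) : columnMap a b v = v.re • a + v.im • b := rfl

lemma det_columnMap (a b : ℂ) : (columnMap a b).det = (conj a * b).im := by
  rw [ContinuousLinearMap.det, ← LinearMap.det_toMatrix Complex.basisOneI, Matrix.det_fin_two]
  simp only [LinearMap.toMatrix_apply, ContinuousLinearMap.coe_coe, columnMap_apply,
    Complex.coe_basisOneI, Complex.coe_basisOneI_repr, Matrix.cons_val_zero, Matrix.cons_val_one]
  simp
  ring

variable {N : ℝ} {u du : Circle → ℂ} (h : C11Bound N u du) (hN : N ≤ 1 / 20)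
include h

/-- The Jacobian of the cone over the perturbed circle with apex `p`. -/
def coneJacobian (u du : Circle → ℂ) (p : ℂ) (t : ℝ) : ℝ :=
  (conj (perturb u (Circle.exp t) - p) * tangent du t).im

/-- The cone over the perturbed circle with apex `p`, with complex variable `r + i t`. -/
def coneMap (u : Circle → ℂ) (p y : ℂ) : ℂ := p + y.re * (perturb u (Circle.exp y.im) - p)

lemma C11Bound.hasFDerivAt_coneMap (p y : ℂ) : HasFDerivAt (coneMap u p)
    (columnMap (perturb u (Circle.exp y.im) - p) (y.re * tangent du y.im)) y := by
  have h1 : HasFDerivAt (fun y : ℂ => (y.re : ℂ)) (Complex.ofRealCLM.comp Complex.reCLM) y :=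
    (Complex.ofRealCLM.comp Complex.reCLM).hasFDerivAt
  have h2 : HasFDerivAt (fun y : ℂ => perturb u (Circle.exp y.im) - p)
      (Complex.imCLM.smulRight (tangent du y.im)) y := by
    have h3 := (h.hasDerivAt_perturb y.im).hasFDerivAt.comp y Complex.imCLM.hasFDerivAt
    refine (h3.sub_const p).congr_fderiv ?_
    ext v
    simp
  refine ((h1.mul h2).const_add p).congr_fderiv ?_
  refine ContinuousLinearMap.ext fun v => ?_
  rw [columnMap_apply]
  change (y.re : ℂ) • (v.im • tangent du y.im) +
    (perturb u (Circle.exp y.im) - p) • (v.re : ℂ) = _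
  simp only [Complex.real_smul, smul_eq_mul]
  ring

omit h in
lemma det_coneMap (p y : ℂ) :
    (columnMap (perturb u (Circle.exp y.im) - p) (y.re * tangent du y.im)).det =
      y.re * coneJacobian u du p y.im := by
  rw [det_columnMap, coneJacobian, mul_left_comm, Complex.im_ofReal_mul]

omit h in
-- The Jacobian coincides with the supporting line expression, so convexity fixes its sign for every
-- apex in the closure.
lemma coneJacobian_eq (p : ℂ) (t : ℝ) : coneJacobian u du p t =
    (conj ((Circle.exp t : ℂ) * (1 + du (Circle.exp t))) * (perturb u (Circle.exp t) - p)).re := by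
  rw [coneJacobian, tangent, mul_left_comm, Complex.I_mul_im, ← Complex.conj_re, map_mul,
    Complex.conj_conj, mul_comm]

include hN

lemma C11Bound.coneJacobian_nonneg {p : ℂ} (hp : p ∈ closure (enclosedDomain (perturb u)))
    (t : ℝ) : 0 ≤ coneJacobian u du p t := by
  rw [coneJacobian_eq]
  exact (h.support_nonneg hN _ hp).1

/-- The parameter domain of the cone with apex `p`. -/
def coneDomain (u : Circle → ℂ) (p : ℂ) : Set ℂ :=
  {y | y.re ∈ Set.Ioo (0 : ℝ) 1 ∧ y.im ∈ Set.Ioc 0 (2 * π) ∧ perturb u (Circle.exp y.im) ≠ p}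

lemma C11Bound.perturb_mem_closure (w : Circle) :
    perturb u w ∈ closure (enclosedDomain (perturb u)) :=
  (h.mem_closure_domain_iff hN).2 ⟨1, zero_le_one, le_rfl, w, by simp⟩

lemma C11Bound.cone_mem {p q : ℂ} (hp : p ∈ closure (enclosedDomain (perturb u)))
    (hq : q ∈ closure (enclosedDomain (perturb u))) (hpq : q ≠ p) {r : ℝ} (hr0 : 0 < r)
    (hr1 : r < 1) : p + r * (q - p) ∈ enclosedDomain (perturb u) := by
  have h1 := h.convex_combination_mem hN hp hq hpq.symm (sub_pos.2 hr1) hr0 (sub_add_cancel 1 r)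
  convert h1 using 1
  rw [Complex.real_smul, Complex.real_smul]
  push_cast
  ring

/-- If one point were reached with two different radii, then a boundary point would lie strictly
between the apex and another boundary point, hence inside the domain. With equal radii, injectivity
of the boundary parametrization decides. -/
lemma C11Bound.injOn_coneMap {p : ℂ} (hp : p ∈ closure (enclosedDomain (perturb u))) :
    Set.InjOn (coneMap u p) (coneDomain u p) := by
  have key : ∀ {r r' t t' : ℝ}, 0 < r → r < r' →
      perturb u (Circle.exp t) ≠ p →
      (r : ℂ) * (perturb u (Circle.exp t) - p) = r' * (perturb u (Circle.exp t') - p) → False := by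
    intro r r' t t' hr hrr' hne heq
    have hr' : (r' : ℂ) ≠ 0 := by exact_mod_cast (hr.trans hrr').ne'
    have h1 := h.cone_mem hN hp (h.perturb_mem_closure hN _) hne (r := r / r')
      (div_pos hr (hr.trans hrr')) ((div_lt_one (hr.trans hrr')).2 hrr')
    have h2 : p + ((r / r' : ℝ) : ℂ) * (perturb u (Circle.exp t) - p) =
        perturb u (Circle.exp t') := by
      push_cast
      field_simp
      linear_combination heq
    rw [h2] at h1
    exact h1.1 ⟨_, rfl⟩
  rintro y ⟨⟨hy0, hy1⟩, hyt, hyne⟩ y' ⟨⟨hy0', hy1'⟩, hyt', hyne'⟩ heq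
  have heq' := add_left_cancel (a := p) heq
  rcases lt_trichotomy y.re y'.re with hlt | hre | hlt
  · exact (key hy0 hlt hyne heq').elim
  · have hr : (y'.re : ℂ) ≠ 0 := by exact_mod_cast hy0'.ne'
    rw [hre] at heq'
    have h1 := sub_left_injective (mul_left_cancel₀ hr heq')
    exact Complex.ext hre (circle_exp_injOn hyt hyt' (h.perturb_injective hN h1))
  · exact (key hy0' hlt hyne' heq'.symm).elim

/-- The coordinates of `z` are found by following the ray from the apex through `z` until it last
meets the closure. -/
lemma C11Bound.image_coneMap {p : ℂ} (hp : p ∈ closure (enclosedDomain (perturb u))) :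
    coneMap u p '' coneDomain u p = enclosedDomain (perturb u) \ {p} := by
  ext z
  constructor
  · rintro ⟨y, ⟨⟨hy0, hy1⟩, hyt, hyne⟩, rfl⟩
    refine ⟨h.cone_mem hN hp (h.perturb_mem_closure hN _) hyne hy0 hy1, fun h1 => ?_⟩
    have h2 : (y.re : ℂ) * (perturb u (Circle.exp y.im) - p) = 0 := by
      have : p + (y.re : ℂ) * (perturb u (Circle.exp y.im) - p) = p := h1
      linear_combination this
    rcases mul_eq_zero.1 h2 with h3 | h3
    · exact hy0.ne' (by exact_mod_cast h3)
    · exact hyne (sub_eq_zero.1 h3)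
  · rintro ⟨hz, hzp⟩
    have hzp' : z - p ≠ 0 := sub_ne_zero.2 hzp
    set K : Set ℝ := {t | p + t * (z - p) ∈ closure (enclosedDomain (perturb u))} with hK
    have hcont : Continuous fun t : ℝ => p + t * (z - p) := by fun_prop
    have hKc : IsClosed K := isClosed_closure.preimage hcont
    have h1K : (1 : ℝ) ∈ K := by
      have : p + ((1 : ℝ) : ℂ) * (z - p) = z := by push_cast; ring
      rw [hK, Set.mem_ofPred_eq, this]
      exact subset_closure hz
    have hKb : ∀ t ∈ K, |t| ≤ (21 / 20 + 21 / 20) / ‖z - p‖ := by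
      intro t ht
      rw [le_div_iff₀ (norm_pos_iff.2 hzp')]
      have h1 := h.norm_le_of_mem_closure hN ht
      have h2 := h.norm_le_of_mem_closure hN hp
      have h3 : (t : ℂ) * (z - p) = (p + t * (z - p)) - p := by ring
      calc |t| * ‖z - p‖ = ‖(t : ℂ) * (z - p)‖ := by
            rw [norm_mul, Complex.norm_real, Real.norm_eq_abs]
        _ ≤ _ := by rw [h3]; exact (norm_sub_le _ _).trans (add_le_add h1 h2)
    have hKcomp : IsCompact K :=
      Metric.isCompact_of_isClosed_isBounded hKc
        ((isBounded_iff_forall_norm_le).2 ⟨_, hKb⟩)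
    -- The exit parameter of the ray. The domain is open, so the exit point is on the boundary and
    -- lies strictly beyond `z`; the radial coordinate of `z` is then `T⁻¹`.
    obtain ⟨T, hTK, hT⟩ := hKcomp.exists_isMaxOn ⟨1, h1K⟩ continuousOn_id
    have hTmax : ∀ t ∈ K, t ≤ T := fun t ht => hT ht
    have hTnot : p + T * (z - p) ∉ enclosedDomain (perturb u) := by
      intro hmem
      have h1 : ∀ᶠ t : ℝ in nhds T, p + t * (z - p) ∈ enclosedDomain (perturb u) :=
        hcont.continuousAt.eventually ((h.isOpen_domain hN).mem_nhds hmem)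
      obtain ⟨t, ht, hTt⟩ := ((h1.filter_mono nhdsWithin_le_nhds).and
        (self_mem_nhdsWithin (s := Set.Ioi T))).exists
      exact absurd (hTmax t (subset_closure ht)) (not_le.2 hTt)
    have hT1 : 1 < T := by
      refine lt_of_le_of_ne (hTmax 1 h1K) ?_
      rintro rfl
      apply hTnot
      have : p + ((1 : ℝ) : ℂ) * (z - p) = z := by push_cast; ring
      rwa [this]
    have hfr : p + T * (z - p) ∈ Set.range (perturb u) := by
      rw [← h.frontier_domain hN, (h.isOpen_domain hN).frontier_eq]
      exact ⟨hTK, hTnot⟩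
    obtain ⟨w, hw⟩ := hfr
    obtain ⟨t, ht, rfl⟩ := exists_circle_exp_eq w
    have hT0 : (T : ℂ) ≠ 0 := by exact_mod_cast (by linarith : T ≠ 0)
    refine ⟨⟨T⁻¹, t⟩, ⟨⟨by positivity, inv_lt_one_of_one_lt₀ hT1⟩, ht, ?_⟩, ?_⟩
    · intro h1
      have h2 : (T : ℂ) * (z - p) = 0 := by
        change perturb u (Circle.exp t) = p at h1
        rw [h1] at hw
        linear_combination -hw
      exact mul_ne_zero hT0 hzp' h2
    · change p + ((T⁻¹ : ℝ) : ℂ) * (perturb u (Circle.exp t) - p) = z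
      rw [hw]
      push_cast
      field_simp
      ring

omit hN in
lemma C11Bound.continuous_perturb : Continuous (perturb u) :=
  continuous_subtype_val.add h.continuous

omit hN in
lemma C11Bound.measurableSet_coneDomain (p : ℂ) : MeasurableSet (coneDomain u p) := by
  have h1 : Measurable fun y : ℂ => perturb u (Circle.exp y.im) :=
    (h.continuous_perturb.comp (Circle.exp.continuous.comp Complex.continuous_im)).measurable
  exact (Complex.measurable_re measurableSet_Ioo).inter
    ((Complex.measurable_im measurableSet_Ioc).inter (h1 (measurableSet_singleton p).compl))

lemma C11Bound.measurableSet_domain : MeasurableSet (enclosedDomain (perturb u)) :=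
  (h.isOpen_domain hN).measurableSet

omit h hN in
lemma setOf_re_im_eq_preimage (s t : Set ℝ) :
    {y : ℂ | y.re ∈ s ∧ y.im ∈ t} = Complex.measurableEquivRealProd ⁻¹' (s ×ˢ t) := by
  ext y
  rfl

lemma C11Bound.abs_det_coneMap {p : ℂ} (hp : p ∈ closure (enclosedDomain (perturb u))) {y : ℂ}
    (hy : y ∈ coneDomain u p) :
    |(columnMap (perturb u (Circle.exp y.im) - p) (y.re * tangent du y.im)).det| =
      y.re * coneJacobian u du p y.im := by
  rw [det_coneMap, abs_of_nonneg]
  exact mul_nonneg hy.1.1.le (h.coneJacobian_nonneg hN hp _)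

/-- Integration over the domain in the coordinates of the cone with apex `p`. -/
lemma C11Bound.integral_domain {p : ℂ} (hp : p ∈ closure (enclosedDomain (perturb u)))
    (g : ℂ → ℂ) : ∫ z in enclosedDomain (perturb u), g z =
      ∫ y in Set.Ioo (0 : ℝ) 1 ×ˢ Set.Ioc 0 (2 * π),
        ((y.1 * coneJacobian u du p y.2 : ℝ) : ℂ) *
          g (p + y.1 * (perturb u (Circle.exp y.2) - p)) := by
  have h1 : ∫ z in enclosedDomain (perturb u), g z =
      ∫ z in coneMap u p '' coneDomain u p, g z := by
    rw [h.image_coneMap hN hp]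
    exact setIntegral_congr_set (sdiff_null_ae_eq_self (by simp)).symm
  rw [h1, integral_image_eq_integral_abs_det_fderiv_smul volume (h.measurableSet_coneDomain p)
    (fun y _ => (h.hasFDerivAt_coneMap p y).hasFDerivWithinAt) (h.injOn_coneMap hN hp)]
  rw [setIntegral_congr_fun (g := fun y : ℂ => ((y.re * coneJacobian u du p y.im : ℝ) : ℂ) *
    g (p + y.re * (perturb u (Circle.exp y.im) - p))) (h.measurableSet_coneDomain p)
    (fun y hy => by
      simp only
      rw [h.abs_det_coneMap hN hp hy, Complex.real_smul]
      rfl)]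
  rw [← Complex.volume_preserving_equiv_real_prod.setIntegral_preimage_emb
    Complex.measurableEquivRealProd.measurableEmbedding, ← setOf_re_im_eq_preimage]
  have hsub : coneDomain u p ⊆ {y : ℂ | y.re ∈ Set.Ioo (0 : ℝ) 1 ∧ y.im ∈ Set.Ioc 0 (2 * π)} :=
    fun y hy => ⟨hy.1, hy.2.1⟩
  -- The parameters whose boundary point is the apex were removed for injectivity. The Jacobian
  -- vanishes there, so they may be put back.
  refine (setIntegral_eq_of_subset_of_forall_sdiff_eq_zero ?_ hsub ?_).symm
  · exact (Complex.measurable_re measurableSet_Ioo).inter (Complex.measurable_im measurableSet_Ioc)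
  · rintro y ⟨⟨hy1, hy2⟩, hy3⟩
    have hy4 : perturb u (Circle.exp y.im) = p := by
      by_contra hne
      exact hy3 ⟨hy1, hy2, hne⟩
    have hy5 : coneJacobian u du p y.im = 0 := by
      rw [coneJacobian, hy4, sub_self, map_zero, zero_mul, Complex.zero_im]
    change ((y.re * coneJacobian u du p y.im : ℝ) : ℂ) * _ = 0
    rw [hy5, mul_zero, Complex.ofReal_zero, zero_mul]

/-- The purpose is a kernel with a simple pole at the apex: its growth is compensated by the
Jacobian, which makes the integrand bounded on a parameter set of finite measure. -/
lemma C11Bound.integrableOn_domain {p : ℂ} (hp : p ∈ closure (enclosedDomain (perturb u)))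
    {g : ℂ → ℂ} (hg : Measurable g) {C : ℝ} (hC : ∀ y ∈ coneDomain u p,
      y.re * coneJacobian u du p y.im * ‖g (coneMap u p y)‖ ≤ C) :
    IntegrableOn g (enclosedDomain (perturb u)) := by
  have h1 : IntegrableOn g (coneMap u p '' coneDomain u p) := by
    rw [integrableOn_image_iff_integrableOn_abs_det_fderiv_smul volume
      (h.measurableSet_coneDomain p)
      (fun y _ => (h.hasFDerivAt_coneMap p y).hasFDerivWithinAt) (h.injOn_coneMap hN hp)]
    have hP : Continuous fun y : ℂ => perturb u (Circle.exp y.im) :=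
      h.continuous_perturb.comp (Circle.exp.continuous.comp Complex.continuous_im)
    have hdu : Continuous fun y : ℂ => du (Circle.exp y.im) :=
      h.continuous_deriv.comp (Circle.exp.continuous.comp Complex.continuous_im)
    have hcone : Continuous (coneMap u p) := by
      unfold coneMap
      fun_prop
    have hdet : Measurable fun y : ℂ =>
        |(columnMap (perturb u (Circle.exp y.im) - p) (y.re * tangent du y.im)).det| := by
      simp only [det_columnMap, tangent]
      have he : Continuous fun y : ℂ => (Circle.exp y.im : ℂ) :=
        continuous_subtype_val.comp (Circle.exp.continuous.comp Complex.continuous_im)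
      have ht : Continuous fun y : ℂ =>
          y.re * (Complex.I * (Circle.exp y.im * (1 + du (Circle.exp y.im)))) :=
        (Complex.continuous_ofReal.comp Complex.continuous_re).mul
          (continuous_const.mul (he.mul (continuous_const.add hdu)))
      have hc := (Complex.continuous_im.comp
        ((Complex.continuous_conj.comp (hP.sub (continuous_const (y := p)))).mul ht)).abs
      exact hc.measurable
    have hm : Measurable fun y : ℂ =>
        |(columnMap (perturb u (Circle.exp y.im) - p) (y.re * tangent du y.im)).det| •
          g (coneMap u p y) := hdet.smul (hg.comp hcone.measurable)
    refine Measure.integrableOn_of_bounded (M := C) ?_ hm.aestronglyMeasurable ?_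
    · have h2 : coneDomain u p ⊆
          Complex.measurableEquivRealProd ⁻¹' (Set.Ioo (0 : ℝ) 1 ×ˢ Set.Ioc 0 (2 * π)) :=
        fun y hy => ⟨hy.1, hy.2.1⟩
      refine ((measure_mono h2).trans_lt ?_).ne
      rw [Complex.volume_preserving_equiv_real_prod.measure_preimage_emb
        Complex.measurableEquivRealProd.measurableEmbedding, Measure.volume_eq_prod,
        Measure.prod_prod]
      rw [Real.volume_Ioo, Real.volume_Ioc]
      exact ENNReal.mul_lt_top ENNReal.ofReal_lt_top ENNReal.ofReal_lt_top
    · filter_upwards [ae_restrict_mem (h.measurableSet_coneDomain p)] with y hy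
      rw [norm_smul, h.abs_det_coneMap hN hp hy, Real.norm_of_nonneg
        (mul_nonneg hy.1.1.le (h.coneJacobian_nonneg hN hp _))]
      exact hC y hy
  rw [h.image_coneMap hN hp] at h1
  exact h1.congr_set_ae (sdiff_null_ae_eq_self (by simp)).symm

end ConeIntegral

end VortexPair

namespace VortexPair
open MeasureTheory

/-! ### The Cauchy integral of a patch as a contour integral -/

section CauchyIntegral

variable {N : ℝ} {u du : Circle → ℂ} (h : C11Bound N u du) (hN : N ≤ 1 / 20)
include h

lemma C11Bound.continuous_perturb_exp : Continuous fun t : ℝ => perturb u (Circle.exp t) :=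
  h.continuous_perturb.comp Circle.exp.continuous

include hN

omit hN in
lemma C11Bound.continuous_tangent : Continuous (tangent du) := by
  have h1 : Continuous fun t : ℝ => (Circle.exp t : ℂ) :=
    continuous_subtype_val.comp Circle.exp.continuous
  exact continuous_const.mul (h1.mul (continuous_const.add
    (h.continuous_deriv.comp Circle.exp.continuous)))

lemma C11Bound.norm_tangent_le (t : ℝ) : ‖tangent du t‖ ≤ 21 / 20 := by
  rw [tangent, norm_mul, norm_mul, Complex.norm_I, Circle.norm_coe, one_mul, one_mul]
  refine (norm_add_le _ _).trans ?_
  rw [norm_one]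
  linarith [h.deriv_norm_le (Circle.exp t)]

omit h hN in
lemma coneJacobian_eq_sub (u du : Circle → ℂ) (p : ℂ) (t : ℝ) : (coneJacobian u du p t : ℂ) =
    (2 * Complex.I)⁻¹ * (conj (perturb u (Circle.exp t) - p) * tangent du t -
      (perturb u (Circle.exp t) - p) * conj (tangent du t)) := by
  rw [coneJacobian, Complex.im_eq_sub_conj, map_mul, Complex.conj_conj, div_eq_inv_mul]

lemma C11Bound.coneJacobian_le (p : ℂ) (t : ℝ) :
    coneJacobian u du p t ≤ ‖perturb u (Circle.exp t) - p‖ * (21 / 20) := by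
  refine (Complex.abs_im_le_norm _ |> (le_abs_self _).trans).trans ?_
  rw [norm_mul, Complex.norm_conj]
  exact mul_le_mul_of_nonneg_left (h.norm_tangent_le hN t) (norm_nonneg _)

/-- With the apex at the pole, `r` cancels against the radial factor of the kernel, and the Jacobian
is at most `21/20` times the distance of the boundary point from the apex. -/
lemma C11Bound.integrableOn_cauchy_boundary (w : Circle) :
    IntegrableOn (fun ζ => (ζ - perturb u w)⁻¹) (enclosedDomain (perturb u)) := by
  refine h.integrableOn_domain hN (h.perturb_mem_closure hN w)
    (measurable_id.sub_const _).inv (C := 21 / 20) fun y hy => ?_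
  have h1 : 0 < ‖perturb u (Circle.exp y.im) - perturb u w‖ :=
    norm_pos_iff.2 (sub_ne_zero.2 hy.2.2)
  have h2 := h.coneJacobian_le hN (perturb u w) y.im
  rw [coneMap, add_sub_cancel_left, norm_inv, norm_mul, Complex.norm_real,
    Real.norm_of_nonneg hy.1.1.le]
  have h3 := hy.1.1
  rw [mul_inv, mul_mul_mul_comm, mul_inv_cancel₀ h3.ne', one_mul, ← div_eq_mul_inv,
    div_le_iff₀ h1]
  linarith

omit hN in
lemma C11Bound.integral_tangent : ∫ t in (0 : ℝ)..(2 * π), tangent du t = 0 := by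
  rw [intervalIntegral.integral_eq_sub_of_hasDerivAt (fun t _ => h.hasDerivAt_perturb t)
    (h.continuous_tangent.intervalIntegrable _ _), Circle.exp_two_pi, Circle.exp_zero, sub_self]

lemma C11Bound.intervalIntegrable_conj_div (w : Circle) : IntervalIntegrable
    (fun t => conj (perturb u (Circle.exp t) - perturb u w) /
      (perturb u (Circle.exp t) - perturb u w) * tangent du t) volume 0 (2 * π) := by
  have h1 : Measurable fun t : ℝ => perturb u (Circle.exp t) - perturb u w :=
    h.continuous_perturb_exp.measurable.sub_const _
  rw [intervalIntegrable_iff]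
  refine Measure.integrableOn_of_bounded (M := 21 / 20) measure_Ioc_lt_top.ne
    (((Complex.continuous_conj.measurable.comp h1).div h1).mul
      h.continuous_tangent.measurable).aestronglyMeasurable
    (Filter.Eventually.of_forall fun t => ?_)
  rw [norm_mul, norm_div, Complex.norm_conj]
  have h2 := div_self_le_one ‖perturb u (Circle.exp t) - perturb u w‖
  have h3 := h.norm_tangent_le hN t
  calc _ ≤ 1 * (21 / 20 : ℝ) := mul_le_mul h2 h3 (norm_nonneg _) zero_le_one
    _ = _ := one_mul _

omit h hN in
lemma pi_mul_circleMean_mul (g : Circle → ℂ) (du : Circle → ℂ) :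
    π * circleMean (fun τ => g τ * (1 + du τ)) =
      (2 * Complex.I)⁻¹ * ∫ t in (0 : ℝ)..(2 * π), g (Circle.exp t) * tangent du t := by
  have h1 : ∀ t : ℝ, g (Circle.exp t) * tangent du t =
      Complex.I * ((Circle.exp t : ℂ) * (g (Circle.exp t) * (1 + du (Circle.exp t)))) := fun t => by
    rw [tangent]; ring
  simp only [h1]
  rw [circleMean_eq, intervalIntegral.integral_const_mul]
  have h2 : (π : ℂ) ≠ 0 := by exact_mod_cast Real.pi_ne_zero
  have h3 := Complex.I_ne_zero
  field_simp

/-- The Cauchy integral of the domain at a boundary point. -/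
lemma C11Bound.integral_cauchy_boundary (w : Circle) :
    ∫ ζ in enclosedDomain (perturb u), (ζ - perturb u w)⁻¹ =
      π * circleMean (fun τ => conj (perturb u τ - perturb u w) / (perturb u τ - perturb u w) *
        (1 + du τ)) := by
  rw [h.integral_domain hN (h.perturb_mem_closure hN w),
    pi_mul_circleMean_mul (fun τ => conj (perturb u τ - perturb u w) / (perturb u τ - perturb u w))]
  set p := perturb u w with hp
  -- The kernel at `p + r (P - p)` is `(r (P - p))⁻¹`, so the variable `r` disappears and only an
  -- integral over the boundary remains.
  rw [setIntegral_congr_fun (g := fun y : ℝ × ℝ => (1 : ℂ) *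
    ((coneJacobian u du p y.2 : ℂ) * (perturb u (Circle.exp y.2) - p)⁻¹))
    (measurableSet_Ioo.prod measurableSet_Ioc) (fun y hy => by
      have h1 : (y.1 : ℂ) ≠ 0 := by exact_mod_cast hy.1.1.ne'
      simp only [add_sub_cancel_left, mul_inv]
      push_cast
      field_simp)]
  rw [Measure.volume_eq_prod, setIntegral_prod_mul (fun _ : ℝ => (1 : ℂ))
    (fun t : ℝ => (coneJacobian u du p t : ℂ) * (perturb u (Circle.exp t) - p)⁻¹),
    ← intervalIntegral.integral_of_le Real.two_pi_pos.le]
  have h2 : ∫ _ in Set.Ioo (0 : ℝ) 1, (1 : ℂ) = 1 := by simp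
  -- Division of the Jacobian by `P - p` leaves the desired integrand minus the conjugate tangent.
  -- The latter integrates to zero because the curve closes up.
  have h3 : ∫ t in (0 : ℝ)..(2 * π), conj (tangent du t) = 0 := by
    rw [intervalIntegral_conj, h.integral_tangent, map_zero]
  have hTi : IntervalIntegrable (fun t => conj (tangent du t)) volume 0 (2 * π) :=
    (Complex.continuous_conj.comp h.continuous_tangent).intervalIntegrable _ _
  rw [h2, one_mul, ← sub_zero (∫ t in (0 : ℝ)..(2 * π), conj (_ - _) / _ * _), ← h3,
    ← intervalIntegral.integral_sub (h.intervalIntegrable_conj_div hN w)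
      hTi,
    ← intervalIntegral.integral_const_mul]
  apply intervalIntegral.integral_congr_ae
  obtain ⟨t₀, ht₀, rfl⟩ := exists_circle_exp_eq w
  have h4 : ∀ᵐ t : ℝ, t ≠ t₀ := by simp [ae_iff]
  filter_upwards [h4] with t ht htI
  rw [Set.uIoc_of_le Real.two_pi_pos.le] at htI
  have h5 : perturb u (Circle.exp t) - p ≠ 0 := by
    rw [hp, sub_ne_zero]
    exact fun h6 => ht (circle_exp_injOn htI ht₀ (h.perturb_injective hN h6))
  rw [coneJacobian_eq_sub, mul_assoc, sub_mul, mul_right_comm, ← div_eq_mul_inv _ (_ - p), mul_right_comm (_ - p),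
    mul_inv_cancel₀ h5, one_mul]

lemma C11Bound.integrableOn_cauchy_exterior {z : ℂ} (hz : 21 / 20 < ‖z‖) :
    IntegrableOn (fun ζ => (ζ - z)⁻¹) (enclosedDomain (perturb u)) := by
  refine Measure.integrableOn_of_bounded (M := (‖z‖ - 21 / 20)⁻¹) ?_
    (measurable_id.sub_const _).inv.aestronglyMeasurable ?_
  · exact ((measure_mono (h.domain_subset_ball hN)).trans_lt measure_ball_lt_top).ne
  · filter_upwards [ae_restrict_mem (h.measurableSet_domain hN)] with ζ hζ
    have h1 := h.norm_le_of_mem_closure hN (subset_closure hζ)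
    have h2 := norm_sub_norm_le z ζ
    rw [norm_inv, norm_sub_rev]
    exact inv_anti₀ (by linarith) (by linarith)

/-- The primitive `ξ + z log (1 - ξ / z)` of `ξ / (ξ - z)`. -/
def cauchyPrimitive (z ξ : ℂ) : ℂ := ξ + z * Complex.log (1 - ξ / z)

omit h hN in
lemma hasDerivAt_cauchyPrimitive {z ξ : ℂ} (h : ‖ξ‖ < ‖z‖) :
    HasDerivAt (cauchyPrimitive z) (ξ / (ξ - z)) ξ := by
  have hz : z ≠ 0 := norm_pos_iff.1 ((norm_nonneg _).trans_lt h)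
  have hξz : ξ - z ≠ 0 := by
    intro h1
    rw [sub_eq_zero.1 h1] at h
    exact h.false
  have h1 : 1 - ξ / z ∈ Complex.slitPlane := by
    rw [sub_eq_add_neg]
    apply Complex.mem_slitPlane_of_norm_lt_one
    rw [norm_neg, norm_div, div_lt_one ((norm_nonneg _).trans_lt h)]
    exact h
  have h2 := (((hasDerivAt_id ξ).div_const z).const_sub 1).clog h1
  refine ((hasDerivAt_id ξ).add (h2.const_mul z)).congr_deriv ?_
  have h3 : 1 - ξ / z = -(ξ - z) / z := by field_simp; ring
  simp only [id]
  rw [h3]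
  field_simp
  ring

omit h hN in
lemma cauchyPrimitive_zero (z : ℂ) : cauchyPrimitive z 0 = 0 := by simp [cauchyPrimitive]

omit h hN in
-- This is the radial integral in cone coordinates with apex `0`. The logarithm in the primitive
-- stays on its principal branch because the pole is farther from the origin than the segment.
lemma integral_mul_inv_sub {z ξ : ℂ} (h : ‖ξ‖ < ‖z‖) (hξ : ξ ≠ 0) :
    ∫ r in (0 : ℝ)..1, (r : ℂ) * ((r : ℂ) * ξ - z)⁻¹ = cauchyPrimitive z ξ / ξ ^ 2 := by
  have hlt : ∀ r ∈ Set.uIcc (0 : ℝ) 1, ‖(r : ℂ) * ξ‖ < ‖z‖ := by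
    intro r hr
    rw [Set.uIcc_of_le zero_le_one] at hr
    rw [norm_mul, Complex.norm_real, Real.norm_of_nonneg hr.1]
    exact (mul_le_of_le_one_left (norm_nonneg _) hr.2).trans_lt h
  have hne : ∀ r ∈ Set.uIcc (0 : ℝ) 1, (r : ℂ) * ξ - z ≠ 0 := by
    intro r hr h1
    have h2 := hlt r hr
    rw [sub_eq_zero.1 h1] at h2
    exact h2.false
  have h1 : ∀ r ∈ Set.uIcc (0 : ℝ) 1, HasDerivAt
      (fun r : ℝ => cauchyPrimitive z ((r : ℂ) * ξ) / ξ ^ 2) ((r : ℂ) * ((r : ℂ) * ξ - z)⁻¹) r := by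
    intro r hr
    have h2 : HasDerivAt (fun r : ℝ => (r : ℂ) * ξ) ξ r := by
      simpa using (Complex.ofRealCLM.hasDerivAt (x := r)).mul_const ξ
    refine (((hasDerivAt_cauchyPrimitive (hlt r hr)).comp r h2).div_const _).congr_deriv ?_
    have h3 := hne r hr
    field_simp
  rw [intervalIntegral.integral_eq_sub_of_hasDerivAt h1]
  · simp [cauchyPrimitive_zero]
  · apply ContinuousOn.intervalIntegrable
    refine Complex.continuous_ofReal.continuousOn.mul (ContinuousOn.inv₀ ?_ hne)
    fun_prop

/-- The Cauchy integral of the domain at an exterior point. -/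
lemma C11Bound.integral_cauchy_exterior {z : ℂ} (hz : 21 / 20 < ‖z‖) :
    ∫ ζ in enclosedDomain (perturb u), (ζ - z)⁻¹ =
      π * circleMean (fun τ => conj (perturb u τ) / (perturb u τ - z) * (1 + du τ)) := by
  rw [h.integral_domain hN (subset_closure (h.zero_mem_domain hN)),
    pi_mul_circleMean_mul (fun τ => conj (perturb u τ) / (perturb u τ - z))]
  simp only [sub_zero, zero_add]
  set P : ℝ → ℂ := fun t => perturb u (Circle.exp t) with hP
  have hPc : Continuous P := h.continuous_perturb_exp
  have hTc := h.continuous_tangent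
  have hlt : ∀ t, ‖P t‖ < ‖z‖ := fun t => (h.norm_perturb_le hN _).trans_lt hz
  have hP0 : ∀ t, P t ≠ 0 := fun t h0 => by
    have h1 := h.le_norm_perturb hN (Circle.exp t)
    change _ ≤ ‖P t‖ at h1
    rw [h0, norm_zero] at h1
    linarith
  have hPz : ∀ t, P t - z ≠ 0 := fun t h0 => by
    have h1 := hlt t
    rw [sub_eq_zero.1 h0] at h1
    exact h1.false
  have hJc : Continuous (coneJacobian u du 0) := by
    unfold coneJacobian
    simp only [sub_zero]
    exact Complex.continuous_im.comp ((Complex.continuous_conj.comp hPc).mul hTc)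
  have hint : IntegrableOn (fun y : ℝ × ℝ => ((y.1 * coneJacobian u du 0 y.2 : ℝ) : ℂ) *
      ((y.1 : ℂ) * P y.2 - z)⁻¹) (Set.Ioo (0 : ℝ) 1 ×ˢ Set.Ioc 0 (2 * π))
      (volume.prod volume) := by
    have hc : ContinuousOn (fun y : ℝ × ℝ => ((y.1 * coneJacobian u du 0 y.2 : ℝ) : ℂ) *
        ((y.1 : ℂ) * P y.2 - z)⁻¹) (Set.Icc (0 : ℝ) 1 ×ˢ Set.Icc 0 (2 * π)) := by
      refine ContinuousOn.mul ?_ (ContinuousOn.inv₀ ?_ ?_)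
      · exact (Complex.continuous_ofReal.comp
          (continuous_fst.mul (hJc.comp continuous_snd))).continuousOn
      · exact (((Complex.continuous_ofReal.comp continuous_fst).mul
          (hPc.comp continuous_snd)).sub continuous_const).continuousOn
      · rintro ⟨r, t⟩ ⟨hr, -⟩ h0
        have h1 : ‖(r : ℂ) * P t‖ < ‖z‖ := by
          rw [norm_mul, Complex.norm_real, Real.norm_of_nonneg hr.1]
          exact (mul_le_of_le_one_left (norm_nonneg _) hr.2).trans_lt (hlt t)
        rw [sub_eq_zero.1 h0] at h1
        exact h1.false
    exact (hc.integrableOn_compact (isCompact_Icc.prod isCompact_Icc)).mono_set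
      (Set.prod_mono Set.Ioo_subset_Icc_self Set.Ioc_subset_Icc_self)
  have hint' := hint
  rw [IntegrableOn, ← Measure.prod_restrict] at hint'
  rw [Measure.volume_eq_prod, ← Measure.prod_restrict, integral_prod_symm _ hint',
    ← intervalIntegral.integral_of_le Real.two_pi_pos.le]
  have hinner : ∀ t : ℝ, ∫ r in Set.Ioo (0 : ℝ) 1, ((r * coneJacobian u du 0 t : ℝ) : ℂ) *
      ((r : ℂ) * P t - z)⁻¹ = coneJacobian u du 0 t * (cauchyPrimitive z (P t) / P t ^ 2) := by
    intro t
    rw [← integral_mul_inv_sub (hlt t) (hP0 t), ← integral_Ioc_eq_integral_Ioo,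
      ← intervalIntegral.integral_of_le zero_le_one, ← intervalIntegral.integral_const_mul]
    congr 1
    funext r
    push_cast
    ring
  simp only [hinner]
  have hd1 : ∀ t, HasDerivAt P (tangent du t) t := h.hasDerivAt_perturb
  have hd2 : ∀ t, HasDerivAt (fun t => conj (P t)) (conj (tangent du t)) t := fun t =>
    (Complex.conjCLE.toContinuousLinearMap.hasFDerivAt.comp_hasDerivAt t (hd1 t))
  have hd3 : ∀ t, HasDerivAt (fun t => cauchyPrimitive z (P t))
      (P t / (P t - z) * tangent du t) t := fun t =>
    (hasDerivAt_cauchyPrimitive (hlt t)).comp t (hd1 t)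
  have hqc : Continuous fun t => cauchyPrimitive z (P t) :=
    continuous_iff_continuousAt.2 fun t => (hd3 t).continuousAt
  -- After the radial integration, the remaining density differs from the contour integrand by the
  -- derivative of the periodic function `P̄ Q(P) / P`, where `Q` is the primitive. Integrating over
  -- a period gives the formula without Green's theorem.
  have hd4 : ∀ t, HasDerivAt (fun t => conj (P t) * cauchyPrimitive z (P t) / P t)
      (conj (P t) / (P t - z) * tangent du t -
        2 * Complex.I * (coneJacobian u du 0 t * (cauchyPrimitive z (P t) / P t ^ 2))) t := by
    intro t
    refine (((hd2 t).fun_mul (hd3 t)).fun_div (hd1 t) (hP0 t)).congr_deriv ?_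
    rw [coneJacobian_eq_sub, sub_zero]
    change _ = conj (P t) / (P t - z) * tangent du t - 2 * Complex.I * ((2 * Complex.I)⁻¹ *
      (conj (P t) * tangent du t - P t * conj (tangent du t)) * (cauchyPrimitive z (P t) / P t ^ 2))
    have h1 := hP0 t
    have h2 := hPz t
    have h3 := Complex.I_ne_zero
    field_simp
    ring
  have hc1 : Continuous fun t => conj (P t) / (P t - z) * tangent du t :=
    ((Complex.continuous_conj.comp hPc).div (hPc.sub continuous_const) hPz).mul hTc
  have hc2 : Continuous fun t => (coneJacobian u du 0 t : ℂ) *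
      (cauchyPrimitive z (P t) / P t ^ 2) :=
    (Complex.continuous_ofReal.comp hJc).mul (hqc.div (hPc.pow 2) fun t => pow_ne_zero 2 (hP0 t))
  have hc3 : IntervalIntegrable (fun t => 2 * Complex.I * ((coneJacobian u du 0 t : ℂ) *
      (cauchyPrimitive z (P t) / P t ^ 2))) volume 0 (2 * π) :=
    (continuous_const.mul hc2).intervalIntegrable _ _
  have h5 := intervalIntegral.integral_eq_sub_of_hasDerivAt (a := 0) (b := 2 * π)
    (fun t _ => hd4 t) ((hc1.intervalIntegrable _ _).sub hc3)
  rw [intervalIntegral.integral_sub (hc1.intervalIntegrable _ _) hc3,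
    intervalIntegral.integral_const_mul] at h5
  have h6 : P (2 * π) = P 0 := by simp only [hP, Circle.exp_two_pi, Circle.exp_zero]
  rw [h6, sub_self, sub_eq_zero] at h5
  change _ = (2 * Complex.I)⁻¹ * ∫ t in (0 : ℝ)..(2 * π), conj (P t) / (P t - z) * tangent du t
  rw [h5, ← mul_assoc, inv_mul_cancel₀ (mul_ne_zero two_ne_zero Complex.I_ne_zero), one_mul]

end CauchyIntegral

/-! ### Dilations and translations of Cauchy integrals -/

section Rescaling

/-- Integration over the image of a set under a real dilation composed with a translation. -/
lemma integral_image_affine {R : ℝ} (hR : R ≠ 0) (a : ℂ) {D : Set ℂ} (hD : MeasurableSet D)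
    (g : ℂ → ℂ) : ∫ z in (fun z : ℂ => R * z + a) '' D, g z =
      R ^ 2 * ∫ z in D, g (R * z + a) := by
  have hd : ∀ z ∈ D, HasFDerivWithinAt (fun z : ℂ => R * z + a)
      (R • ContinuousLinearMap.id ℝ ℂ) D z := fun z _ =>
    (((R • ContinuousLinearMap.id ℝ ℂ).hasFDerivAt (x := z)).add_const a).hasFDerivWithinAt
  have hR' : (R : ℂ) ≠ 0 := by exact_mod_cast hR
  have hinj : Set.InjOn (fun z : ℂ => R * z + a) D := fun x _ y _ hxy =>
    mul_left_cancel₀ hR' (add_right_cancel hxy)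
  rw [integral_image_eq_integral_abs_det_fderiv_smul volume hD hd hinj]
  have hdet : |(R • ContinuousLinearMap.id ℝ ℂ).det| = R ^ 2 := by
    rw [ContinuousLinearMap.det]
    simp [LinearMap.det_smul]
  rw [hdet, integral_smul, Complex.real_smul, Complex.ofReal_pow]

lemma integrableOn_image_affine {R : ℝ} (hR : R ≠ 0) (a : ℂ) {D : Set ℂ} (hD : MeasurableSet D)
    {g : ℂ → ℂ} (hg : IntegrableOn (fun z => g (R * z + a)) D) :
    IntegrableOn g ((fun z : ℂ => R * z + a) '' D) := by
  have hd : ∀ z ∈ D, HasFDerivWithinAt (fun z : ℂ => R * z + a)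
      (R • ContinuousLinearMap.id ℝ ℂ) D z := fun z _ =>
    (((R • ContinuousLinearMap.id ℝ ℂ).hasFDerivAt (x := z)).add_const a).hasFDerivWithinAt
  have hR' : (R : ℂ) ≠ 0 := by exact_mod_cast hR
  have hinj : Set.InjOn (fun z : ℂ => R * z + a) D := fun x _ y _ hxy =>
    mul_left_cancel₀ hR' (add_right_cancel hxy)
  rw [integrableOn_image_iff_integrableOn_abs_det_fderiv_smul volume hD hd hinj]
  exact hg.smul _

/-- The area scales by `R²` and the kernel by `R⁻¹`. The sign of `R` survives, which matters for the
second patch, where `R` is negative when `ε` is positive. -/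
lemma integral_cauchy_image_affine {R : ℝ} (hR : R ≠ 0) (a : ℂ) {D : Set ℂ}
    (hD : MeasurableSet D) (p : ℂ) : ∫ ζ in (fun z : ℂ => R * z + a) '' D, (ζ - (R * p + a))⁻¹ =
      R * ∫ ξ in D, (ξ - p)⁻¹ := by
  have hR' : (R : ℂ) ≠ 0 := by exact_mod_cast hR
  rw [integral_image_affine hR a hD]
  have h1 : ∀ ξ : ℂ, (R * ξ + a - (R * p + a))⁻¹ = (R : ℂ)⁻¹ * (ξ - p)⁻¹ := fun ξ => by
    rw [← mul_inv]; ring_nf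
  simp only [h1]
  rw [integral_const_mul]
  field_simp

lemma integrableOn_cauchy_image_affine {R : ℝ} (hR : R ≠ 0) (a : ℂ) {D : Set ℂ}
    (hD : MeasurableSet D) {p : ℂ} (hp : IntegrableOn (fun ξ => (ξ - p)⁻¹) D) :
    IntegrableOn (fun ζ => (ζ - (R * p + a))⁻¹) ((fun z : ℂ => R * z + a) '' D) := by
  apply integrableOn_image_affine hR a hD
  have h1 : ∀ ξ : ℂ, (R * ξ + a - (R * p + a))⁻¹ = (R : ℂ)⁻¹ * (ξ - p)⁻¹ := fun ξ => by
    rw [← mul_inv]; ring_nf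
  simp only [h1]
  exact hp.const_mul _

end Rescaling

end VortexPair

namespace VortexPair
open MeasureTheory Wiener

/-! ### The contour integral of a patch over its own boundary -/

section SelfTerm

lemma clm_family_eq_zero {F : Type*} [NormedAddCommGroup F] [NormedSpace ℝ F]
    (L : C(Circle, Wiener) →L[ℝ] F) (k : ℕ → ℤ) (c : ℕ → C(Circle, ℂ)) (hc : ∀ n, ‖c n‖ ≤ 1)
    (h : ∀ n, L ⟨fun σ => c n σ • basis (k n), (c n).continuous.smul continuous_const⟩ = 0)
    (x : Coef) : L (family k c hc x) = 0 := by
  have h1 := L.hasSum (l1Lift_hasSum (𝕜 := ℝ) (fun n => (⟨fun σ => c n σ • basis (k n),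
      (c n).continuous.smul continuous_const⟩ : C(Circle, Wiener))) 1
    (fun n => (ContinuousMap.norm_le _ zero_le_one).2 fun σ => by
      rw [ContinuousMap.coe_mk, norm_smul, norm_basis, mul_one]
      exact ((c n).norm_coe_le_norm σ).trans (hc n)) x)
  refine h1.unique ?_
  convert hasSum_zero with n
  rw [map_smul, h, smul_zero]

lemma average_smul_const (c : C(Circle, ℂ)) (v : Wiener) :
    average (⟨fun σ => c σ • v, c.continuous.smul continuous_const⟩ : C(Circle, Wiener)) =
      average c • v :=
  (clm_average (ContinuousLinearMap.toSpanSingleton ℂ v) c).symm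

/-- The difference quotient of a function of `w̄` contains only strictly negative powers of `σ`. -/
lemma average_quotMap (x : Coef) : average (quotMap x) = 0 := by
  refine clm_family_eq_zero ((average (E := Wiener)).restrictScalars ℝ) _ _ _ (fun n => ?_) x
  change average _ = 0
  rw [average_smul_const, map_smul, map_sum, Finset.sum_eq_zero, smul_zero, zero_smul]
  intro i _
  rw [average_zpowMap, if_neg (by omega)]

lemma average_rotDerivMap (x : Coef) : average (rotDerivMap x) = 0 := by
  refine clm_family_eq_zero ((average (E := Wiener)).restrictScalars ℝ) _ _ _ (fun n => ?_) x
  change average _ = 0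
  rw [average_smul_const, map_smul, average_zpowMap, if_neg (by omega), smul_zero, zero_smul]

lemma zpowMap_mul (j k : ℤ) : zpowMap j * zpowMap k = zpowMap (j + k) := by
  ext w
  rw [ContinuousMap.mul_apply, zpowMap_apply, zpowMap_apply, zpowMap_apply, ← Circle.coe_mul,
    ← zpow_add]

/-- The conjugate difference quotient contains only nonnegative powers of `σ`; the extra factor `σ`
makes all of them positive. -/
lemma average_paramMap_mul_conjQuotMap (x : Coef) : average (paramMap * conjQuotMap x) = 0 := by
  let L : C(Circle, Wiener) →L[ℝ] Wiener := ((average (E := Wiener)).restrictScalars ℝ).comp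
    ((ContinuousLinearMap.mul ℂ C(Circle, Wiener) paramMap).restrictScalars ℝ)
  have hL : ∀ m, L m = average (paramMap * m) := fun m => rfl
  rw [← hL, conjQuotMap]
  refine clm_family_eq_zero L _ _ _ (fun n => ?_) x
  rw [hL]
  set c : C(Circle, ℂ) := ((1 * ((n + 2) / ((n + 1) * (n + 3))) : ℝ) : ℂ) •
      ∑ i ∈ Finset.range (n + 1), zpowMap (i : ℤ) with hc
  have h1 : paramMap * (⟨fun σ => c σ • basis ((n + 1 : ℕ) : ℤ),
      c.continuous.smul continuous_const⟩ : C(Circle, Wiener)) =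
      ⟨fun σ => (zpowMap 1 * c) σ • basis ((n + 1 : ℕ) : ℤ),
        (zpowMap 1 * c).continuous.smul continuous_const⟩ := by
    ext σ : 1
    change ((σ : ℂ) • (1 : Wiener)) * (c σ • basis ((n + 1 : ℕ) : ℤ)) =
      (zpowMap 1 σ * c σ) • basis ((n + 1 : ℕ) : ℤ)
    rw [smul_mul_smul_comm, one_mul, zpowMap_apply, zpow_one]
  rw [h1, average_smul_const, hc, mul_smul_comm, map_smul, Finset.mul_sum, map_sum,
    Finset.sum_eq_zero, smul_zero, zero_smul]
  intro i _
  rw [zpowMap_mul, average_zpowMap, if_neg (by omega)]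

lemma continuous_toFun_apply (m : C(Circle, Wiener)) (w : Circle) :
    Continuous fun θ : ℝ => toFun (m (Circle.exp θ)) w :=
  ((ContinuousMap.evalCLM ℂ w).comp toFun).continuous.comp
    (m.continuous.comp Circle.exp.continuous)

lemma intervalIntegral_toFun (m : C(Circle, Wiener)) (w : Circle) :
    ∫ θ in (0 : ℝ)..(2 * π), toFun (m (Circle.exp θ)) w = 2 * π * toFun (average m) w := by
  rw [toFun_average, mul_inv_cancel_left₀]
  exact_mod_cast Real.two_pi_pos.ne'

lemma circle_conj_eq_inv (w : Circle) : conj (w : ℂ) = (w : ℂ)⁻¹ := by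
  rw [← Circle.coe_inv_eq_conj, Circle.coe_inv]

lemma circle_sub_ne_zero {τ w : Circle} (h : τ ≠ w) : (τ : ℂ) - w ≠ 0 := fun h1 =>
  h (Circle.ext (sub_eq_zero.1 h1))

/-- The Cauchy integral of the perturbed circle at one of its points, in terms of the
self-interaction term. -/
lemma circleMean_self (s : ℝ) (x : Coef) (w : Circle)
    (hs : C11Bound (|s| * ‖x‖) (fun τ => s * profile x τ) (fun τ => s * profileDeriv x τ))
    (hN : |s| * ‖x‖ ≤ 1 / 20) :
    circleMean (fun τ => conj (perturb (fun τ => s * profile x τ) τ -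
        perturb (fun τ => s * profile x τ) w) / (perturb (fun τ => s * profile x τ) τ -
        perturb (fun τ => s * profile x τ) w) * (1 + s * profileDeriv x τ)) =
      -conj (w : ℂ) + s ^ 2 * circleMean (fun τ =>
        let A : ℂ := τ - w
        let B : ℂ := profile x τ - profile x w
        (A * conj B - conj A * B) / (A * (A + s * B)) * (profileDeriv x τ - B / A)) := by
  set u : Circle → ℂ := fun τ => s * profile x τ with hu
  set T : Circle → ℂ := fun τ =>
        let A : ℂ := τ - w
        let B : ℂ := profile x τ - profile x w
        (A * conj B - conj A * B) / (A * (A + s * B)) * (profileDeriv x τ - B / A) with hT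
  have hw0 : (w : ℂ) ≠ 0 := Circle.coe_ne_zero w
  -- the three functions of the rotated parameter
  set H : Circle → ℂ := fun τ => conj (perturb u τ - perturb u w) / (perturb u τ - perturb u w) *
    (1 + s * profileDeriv x τ) with hH
  set m₁ : C(Circle, Wiener) := conjParamMap + s • (conjParamMap * rotDerivMap x) with hm₁
  set m₂ : C(Circle, Wiener) := paramMap * conjQuotMap x with hm₂
  -- Expanding in `s`, the integrand is `s²` times the self-interaction kernel plus terms linear in
  -- the families above. Those families have mean zero, so the only surviving term is `-w⁻²`, which
  -- becomes `-w̄` after multiplication by `w`.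
  have key : ∀ σ : Circle, σ ≠ 1 → (σ : ℂ) * H (w * σ) =
      s ^ 2 * ((σ : ℂ) * T (w * σ)) + (-(w : ℂ)⁻¹ ^ 2 * (1 + s * toFun (rotDerivMap x σ) w) +
      s * ((w : ℂ)⁻¹ * toFun (m₂ σ) w + (w : ℂ)⁻¹ ^ 3 * toFun (quotMap x σ) w)) := by
    intro σ hσ
    have hσ' : (σ : ℂ) - 1 ≠ 0 := by
      have := circle_sub_ne_zero hσ
      rwa [Circle.coe_one] at this
    have hs0 : (σ : ℂ) ≠ 0 := Circle.coe_ne_zero σ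
    have hD := toFun_quotMap x σ w
    have hD' := toFun_conjQuotMap x σ w
    have hR := toFun_rotDerivMap x σ w
    rw [← map_sub] at hD'
    have hne : perturb u (w * σ) - perturb u w ≠ 0 := by
      rw [sub_ne_zero]
      intro h1
      exact hσ (mul_eq_left.1 (hs.perturb_injective hN h1))
    simp only [hm₂, ContinuousMap.mul_apply, toFun_mul_apply, toFun_paramMap, hR, hH, hT]
    set D := toFun (quotMap x σ) w
    set D' := toFun (conjQuotMap x σ) w
    set R := profileDeriv x (w * σ)
    have hA : ((w * σ : Circle) : ℂ) - w = w * (σ - 1) := by rw [Circle.coe_mul]; ring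
    have hB : profile x (w * σ) - profile x w = (σ - 1) * D := hD.symm
    have hB' : conj (profile x (w * σ) - profile x w) = (σ - 1) * D' := by rw [hD', map_sub]
    have hE : perturb u (w * σ) - perturb u w = (σ - 1) * (w + s * D) := by
      simp only [perturb, hu]
      linear_combination hA + (s : ℂ) * hB
    have hE' : conj (perturb u (w * σ) - perturb u w) =
        (σ - 1) * (-(w : ℂ)⁻¹ * (σ : ℂ)⁻¹ + s * D') := by
      have h1 : perturb u (w * σ) - perturb u w =
          (((w * σ : Circle) : ℂ) - w) + s * (profile x (w * σ) - profile x w) := by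
        simp only [perturb, hu]; ring
      rw [h1, map_add, map_mul, hB', Complex.conj_ofReal, map_sub, circle_conj_eq_inv,
        circle_conj_eq_inv, Circle.coe_mul]
      field_simp
      ring
    rw [hE] at hne
    have hne' := right_ne_zero_of_mul hne
    have hden : (w : ℂ) * (σ - 1) + s * ((σ - 1) * D) = (σ - 1) * (w + s * D) := by ring
    rw [hE', hE, hB', hB, hA, hden, map_mul, map_sub, map_one, circle_conj_eq_inv,
      circle_conj_eq_inv]
    field_simp
    ring
  have hcm : ∀ f : Circle → ℂ, circleMean f = (w : ℂ) * ((2 * π : ℂ)⁻¹ *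
      ∫ θ in (0 : ℝ)..(2 * π), (Circle.exp θ : ℂ) * f (w * Circle.exp θ)) := fun f => by
    rw [circleMean_rotate f w, circleMean_eq]
  have hI₁ := intervalIntegral_toFun (rotDerivMap x) w
  have hI₂ := intervalIntegral_toFun m₂ w
  have hI₃ := intervalIntegral_toFun (quotMap x) w
  rw [average_rotDerivMap, map_zero, ContinuousMap.zero_apply, mul_zero] at hI₁
  rw [hm₂, average_paramMap_mul_conjQuotMap, map_zero, ContinuousMap.zero_apply, mul_zero,
    ← hm₂] at hI₂
  rw [average_quotMap, map_zero, ContinuousMap.zero_apply, mul_zero] at hI₃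
  have hc₁ := (continuous_toFun_apply (rotDerivMap x) w).intervalIntegrable (μ := volume) 0 (2 * π)
  have hc₂ := (continuous_toFun_apply m₂ w).intervalIntegrable (μ := volume) 0 (2 * π)
  have hc₃ := (continuous_toFun_apply (quotMap x) w).intervalIntegrable (μ := volume) 0 (2 * π)
  have hc₀ : IntervalIntegrable (fun _ : ℝ => (1 : ℂ)) volume 0 (2 * π) := intervalIntegrable_const
  set K : ℝ → ℂ := fun θ => -(w : ℂ)⁻¹ ^ 2 * (1 + s * toFun (rotDerivMap x (Circle.exp θ)) w) +
      s * ((w : ℂ)⁻¹ * toFun (m₂ (Circle.exp θ)) w +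
        (w : ℂ)⁻¹ ^ 3 * toFun (quotMap x (Circle.exp θ)) w) with hK
  have hKi : IntervalIntegrable K volume 0 (2 * π) :=
    ((hc₀.add (hc₁.const_mul _)).const_mul _).add
      (((hc₂.const_mul _).add (hc₃.const_mul _)).const_mul _)
  have hKint : ∫ θ in (0 : ℝ)..(2 * π), K θ = -(w : ℂ)⁻¹ ^ 2 * (2 * π) := by
    rw [hK, intervalIntegral.integral_add ((hc₀.add (hc₁.const_mul _)).const_mul _)
      (((hc₂.const_mul _).add (hc₃.const_mul _)).const_mul _),
      intervalIntegral.integral_const_mul, intervalIntegral.integral_const_mul,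
      intervalIntegral.integral_add hc₀ (hc₁.const_mul _),
      intervalIntegral.integral_add (hc₂.const_mul _) (hc₃.const_mul _),
      intervalIntegral.integral_const_mul, intervalIntegral.integral_const_mul,
      intervalIntegral.integral_const_mul, hI₁, hI₂, hI₃]
    simp
  -- The quotient of a number by its conjugate partner has modulus at most `1`, so the integrand is
  -- bounded in spite of the vanishing denominator.
  have hHi : IntervalIntegrable (fun θ => (Circle.exp θ : ℂ) * H (w * Circle.exp θ)) volume
      0 (2 * π) := by
    have hPc := hs.continuous_perturb
    have h1 : Continuous fun θ : ℝ => perturb u (w * Circle.exp θ) - perturb u w :=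
      (hPc.comp (continuous_const.mul Circle.exp.continuous)).sub continuous_const
    have h2 : Continuous fun θ : ℝ => 1 + (s : ℂ) * profileDeriv x (w * Circle.exp θ) :=
      continuous_const.add (hs.continuous_deriv.comp
        (continuous_const.mul Circle.exp.continuous))
    have h3 : Continuous fun θ : ℝ => (Circle.exp θ : ℂ) :=
      continuous_subtype_val.comp Circle.exp.continuous
    rw [intervalIntegrable_iff]
    refine Measure.integrableOn_of_bounded (M := 21 / 20) measure_Ioc_lt_top.ne
      (h3.measurable.mul (((Complex.continuous_conj.comp h1).measurable.div h1.measurable).mul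
        h2.measurable)).aestronglyMeasurable (Filter.Eventually.of_forall fun θ => ?_)
    simp only [hH]
    rw [norm_mul, norm_mul, norm_div, Complex.norm_conj, Circle.norm_coe, one_mul]
    have h4 := div_self_le_one ‖perturb u (w * Circle.exp θ) - perturb u w‖
    have h5 : ‖1 + (s : ℂ) * profileDeriv x (w * Circle.exp θ)‖ ≤ 21 / 20 := by
      refine (norm_add_le _ _).trans ?_
      rw [norm_one]
      linarith [hs.deriv_norm_le (w * Circle.exp θ)]
    calc _ ≤ 1 * (21 / 20 : ℝ) := mul_le_mul h4 h5 (norm_nonneg _) zero_le_one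
      _ = _ := one_mul _
  have hfinal : (∫ θ in (0 : ℝ)..(2 * π), (Circle.exp θ : ℂ) * H (w * Circle.exp θ)) -
      ∫ θ in (0 : ℝ)..(2 * π), K θ =
      s ^ 2 * ∫ θ in (0 : ℝ)..(2 * π), (Circle.exp θ : ℂ) * T (w * Circle.exp θ) := by
    rw [← intervalIntegral.integral_sub hHi hKi, ← intervalIntegral.integral_const_mul]
    apply intervalIntegral.integral_congr_ae
    have h1 : ∀ᵐ θ : ℝ, θ ≠ 2 * π := by simp [ae_iff]
    filter_upwards [h1] with θ hθ hθ'
    rw [Set.uIoc_of_le Real.two_pi_pos.le] at hθ'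
    rw [key _ (circle_exp_ne_one hθ'.1 (lt_of_le_of_ne hθ'.2 hθ)), hK]
    ring
  rw [hKint, sub_eq_iff_eq_add] at hfinal
  rw [hcm H, hcm T, hfinal, circle_conj_eq_inv]
  have h2 : (π : ℂ) ≠ 0 := by exact_mod_cast Real.pi_ne_zero
  field_simp
  ring

end SelfTerm

end VortexPair

namespace VortexPair
open MeasureTheory

/-! ### From zeros of the functional to translating pairs -/

section Velocity

lemma C11Bound.const_mul {N : ℝ} {f df : Circle → ℂ} (h : C11Bound N f df) (s : ℝ) :
    C11Bound (|s| * N) (fun w => s * f w) (fun w => s * df w) := by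
  have key : ∀ {z : ℂ} {r : ℝ}, ‖z‖ ≤ N * r → ‖(s : ℂ) * z‖ ≤ |s| * N * r := fun {z r} hz => by
    rw [norm_mul, Complex.norm_real, Real.norm_eq_abs, mul_assoc]
    exact mul_le_mul_of_nonneg_left hz (abs_nonneg s)
  refine ⟨fun w => ?_, fun w => ?_, fun τ w => ?_, fun τ w => ?_, fun τ w => ?_⟩
  · simpa using key (r := 1) (by simpa using h.norm_le w)
  · simpa using key (r := 1) (by simpa using h.deriv_norm_le w)
  · rw [← mul_sub]
    exact key (h.lipschitz τ w)
  · rw [← mul_sub]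
    exact key (h.deriv_lipschitz τ w)
  · rw [← mul_sub, mul_assoc, ← mul_sub]
    exact key (h.taylor τ w)

lemma circleMean_const_mul (c : ℂ) (f : Circle → ℂ) :
    circleMean (fun τ => c * f τ) = c * circleMean f := by
  rw [circleMean_eq, circleMean_eq, mul_left_comm c, ← intervalIntegral.integral_const_mul c]
  congr 2
  funext θ
  ring

lemma boundaryMap_eq_perturb (ε b : ℝ) (f : Circle → ℂ) :
    boundaryMap ε b f = perturb (fun τ => ((ε * b : ℝ) : ℂ) * f τ) := by
  funext w
  rw [boundaryMap, perturb, Complex.ofReal_mul]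

lemma conj_velocity (ω : ℂ → ℝ) (z : ℂ) : conj (velocity ω z) =
    Complex.I / (2 * π) * ∫ ζ : ℂ, (ω ζ : ℂ) * (ζ - z)⁻¹ := by
  rw [velocity, map_mul, ← integral_conj, map_div₀, Complex.conj_I, map_mul, Complex.conj_ofReal,
    map_ofNat, neg_div, neg_mul, ← mul_neg, ← integral_neg]
  congr 2
  funext ζ
  rw [map_div₀, Complex.conj_ofReal, map_sub, Complex.conj_conj, Complex.conj_conj,
    ← neg_sub ζ z, div_neg, neg_neg, div_eq_mul_inv]


/-- The image of a set under a real dilation composed with a translation. -/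
def affineImage (R : ℝ) (a : ℂ) (D : Set ℂ) : Set ℂ := (fun z : ℂ => R * z + a) '' D

lemma patch₁_eq (ε b : ℝ) (D : Set ℂ) : patch₁ ε b D = affineImage (ε * b) 0 D := by
  simp only [patch₁, affineImage, add_zero, Complex.ofReal_mul]

lemma patch₂_eq (ε b d : ℝ) (D : Set ℂ) : patch₂ ε b d D = affineImage (-(ε * b)) d D := by
  simp only [patch₂, affineImage, Complex.ofReal_neg, Complex.ofReal_mul, neg_mul]

lemma measurableSet_affineImage {R : ℝ} (hR : R ≠ 0) (a : ℂ) {D : Set ℂ}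
    (hD : MeasurableSet D) : MeasurableSet (affineImage R a D) := by
  have hR' : (R : ℂ) ≠ 0 := by exact_mod_cast hR
  have h1 : affineImage R a D = (fun z : ℂ => (z - a) / R) ⁻¹' D := by
    ext z
    constructor
    · rintro ⟨y, hy, rfl⟩
      simpa [hR'] using hy
    · intro hz
      refine ⟨_, hz, ?_⟩
      simp only
      rw [mul_div_cancel₀ _ hR', sub_add_cancel]
  rw [h1]
  exact ((measurable_id.sub_const a).div_const _) hD

lemma integral_vorticity {P₁ P₂ : Set ℂ} (hP₁ : MeasurableSet P₁) (hP₂ : MeasurableSet P₂)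
    (ε b₁ b₂ γ₁ γ₂ : ℝ) {g : ℂ → ℂ} (h₁ : IntegrableOn g P₁) (h₂ : IntegrableOn g P₂) :
    ∫ ζ : ℂ, (vorticity ε b₁ b₂ γ₁ γ₂ P₁ P₂ ζ : ℂ) * g ζ =
      γ₁ / (ε * b₁) ^ 2 * (∫ ζ in P₁, g ζ) - γ₂ / (ε * b₂) ^ 2 * ∫ ζ in P₂, g ζ := by
  have h3 : ∀ ζ, (vorticity ε b₁ b₂ γ₁ γ₂ P₁ P₂ ζ : ℂ) * g ζ =
      P₁.indicator (fun ζ => γ₁ / (ε * b₁ : ℂ) ^ 2 * g ζ) ζ -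
        P₂.indicator (fun ζ => γ₂ / (ε * b₂ : ℂ) ^ 2 * g ζ) ζ := fun ζ => by
    by_cases h4 : ζ ∈ P₁ <;> by_cases h5 : ζ ∈ P₂ <;> 
      simp [vorticity, h4, h5, mul_pow, sub_mul]
  simp only [h3]
  rw [integral_sub ((integrable_indicator_iff hP₁).2 (h₁.const_mul _))
    ((integrable_indicator_iff hP₂).2 (h₂.const_mul _)), integral_indicator hP₁,
    integral_indicator hP₂, integral_const_mul, integral_const_mul]

/-- The integral over a rescaled patch of the Cauchy kernel with pole on another patch. -/
lemma integral_cauchy_other {s s' d : ℝ} (hs' : s' ≠ 0) {x' : Coef} {z : ℂ}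
    (h' : C11Bound (|s'| * ‖x'‖) (fun τ => s' * profile x' τ) (fun τ => s' * profileDeriv x' τ))
    (hN' : |s'| * ‖x'‖ ≤ 1 / 20) (hz : 21 / 20 < ‖(d - s * z) / s'‖) :
    ∫ ξ in enclosedDomain (perturb fun τ => s' * profile x' τ), (ξ - (d - s * z) / s')⁻¹ =
      s' * (π * circleMean (fun τ =>
        (conj (τ : ℂ) + s' * conj (profile x' τ)) * (1 + s' * profileDeriv x' τ) /
          (s' * (τ + s' * profile x' τ) + s * z - d))) := by
  have hs : (s' : ℂ) ≠ 0 := by exact_mod_cast hs'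
  rw [h'.integral_cauchy_exterior hN' hz, mul_left_comm, ← circleMean_const_mul (s' : ℂ)]
  congr 2
  funext τ
  have h1 : perturb (fun τ => (s' : ℂ) * profile x' τ) τ - (d - s * z) / s' =
      (s' * (τ + s' * profile x' τ) + s * z - d) / s' := by
    rw [perturb]
    field_simp
    ring
  rw [h1, perturb, map_add, map_mul, Complex.conj_ofReal, div_div_eq_mul_div]
  ring

/-- The Cauchy integral of the vorticity at a boundary point of a patch. -/
lemma cauchy_combination {d ε U γ γ' b b' : ℝ} (hε : ε ≠ 0) (hb : b ≠ 0) (hb' : b' ≠ 0)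
    {x x' : Coef} (w : Circle)
    (h : C11Bound (|ε * b| * ‖x‖) (fun τ => (ε * b : ℝ) * profile x τ)
      (fun τ => (ε * b : ℝ) * profileDeriv x τ)) (hN : |ε * b| * ‖x‖ ≤ 1 / 20)
    (h' : C11Bound (|ε * b'| * ‖x'‖) (fun τ => (ε * b' : ℝ) * profile x' τ)
      (fun τ => (ε * b' : ℝ) * profileDeriv x' τ)) (hN' : |ε * b'| * ‖x'‖ ≤ 1 / 20)
    (hz : 21 / 20 < ‖(d - (ε * b : ℝ) * boundaryMap ε b (profile x) w) / (ε * b' : ℝ)‖) :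
    (w : ℂ) * (1 + ε * b * profileDeriv x w) * (Complex.I / (2 * π) *
      ((γ / (ε * b) : ℂ) * (∫ ξ in enclosedDomain (boundaryMap ε b (profile x)),
          (ξ - boundaryMap ε b (profile x) w)⁻¹) +
        (γ' / (ε * b') : ℂ) * (∫ ξ in enclosedDomain (boundaryMap ε b' (profile x')),
          (ξ - (d - (ε * b : ℝ) * boundaryMap ε b (profile x) w) / (ε * b' : ℝ))⁻¹)) +
        Complex.I * U) =
    Complex.I / 2 * (complexComponent d ε U γ γ' b b' (profile x) (profileDeriv x) (profile x')
      (profileDeriv x') w - γ / (ε * b)) := by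
  have hεc : (ε : ℂ) ≠ 0 := by exact_mod_cast hε
  have hbc : (b : ℂ) ≠ 0 := by exact_mod_cast hb
  have hbc' : (b' : ℂ) ≠ 0 := by exact_mod_cast hb'
  have hs' : ε * b' ≠ 0 := mul_ne_zero hε hb'
  have hpi : (π : ℂ) ≠ 0 := by exact_mod_cast Real.pi_ne_zero
  have hw : (w : ℂ) ≠ 0 := Circle.coe_ne_zero w
  have h1 := h.integral_cauchy_boundary hN w
  rw [circleMean_self (ε * b) x w h hN] at h1
  have h2 := integral_cauchy_other hs' h' hN' hz
  rw [boundaryMap_eq_perturb ε b, boundaryMap_eq_perturb ε b', h1,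
    ← boundaryMap_eq_perturb ε b, h2, complexComponent]
  have h3 : (fun τ : Circle => (conj (τ : ℂ) + (ε * b' : ℝ) * conj (profile x' τ)) *
      (1 + (ε * b' : ℝ) * profileDeriv x' τ) / ((ε * b' : ℝ) * (τ + (ε * b' : ℝ) * profile x' τ) +
        (ε * b : ℝ) * boundaryMap ε b (profile x) w - d)) = fun τ : Circle =>
      (conj (τ : ℂ) + ε * b' * conj (profile x' τ)) * (1 + ε * b' * profileDeriv x' τ) /
        (ε * (b' * τ + b * w) + ε ^ 2 * (b' ^ 2 * profile x' τ + b ^ 2 * profile x w) - d) := by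
    funext τ
    rw [boundaryMap]
    push_cast
    congr 1
    ring
  rw [h3]
  simp only [Complex.ofReal_mul]
  -- What remains is algebra. Multiplied by `w (1 + εb f') γ/(εb)`, the term `-w̄` of the self
  -- integral gives `-γ f'`, which belongs to the functional, and the constant `-γ/(εb)`, which is
  -- real and hence invisible to the imaginary part.
  generalize circleMean (fun τ : Circle =>
      (conj (τ : ℂ) + ε * b' * conj (profile x' τ)) * (1 + ε * b' * profileDeriv x' τ) /
        (ε * (b' * τ + b * w) + ε ^ 2 * (b' ^ 2 * profile x' τ + b ^ 2 * profile x w) - d)) = M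
  generalize circleMean _ = T
  rw [circle_conj_eq_inv]
  field_simp
  ring

lemma affineImage_subset_closedBall {R : ℝ} {a : ℂ} {D : Set ℂ} {r : ℝ}
    (hD : ∀ z ∈ D, ‖z‖ ≤ r) : affineImage R a D ⊆ Metric.closedBall a (|R| * r) := by
  rintro _ ⟨z, hz, rfl⟩
  rw [Metric.mem_closedBall, dist_eq_norm, add_sub_cancel_right, norm_mul, Complex.norm_real,
    Real.norm_eq_abs]
  exact mul_le_mul_of_nonneg_left (hD z hz) (abs_nonneg R)

/-- Seen in the rescaled coordinates of one patch, a boundary point of the other lies outside the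
disc of radius `21/20` that contains the patch. This makes the exterior Cauchy formula applicable.
-/
lemma lt_norm_sub_div {s s' d : ℝ} (hs' : s' ≠ 0) (hd : 21 / 20 * (|s| + |s'|) < d) {z : ℂ}
    (hz : ‖z‖ ≤ 21 / 20) : 21 / 20 < ‖(d - s * z) / s'‖ := by
  rw [norm_div, Complex.norm_real, Real.norm_eq_abs, lt_div_iff₀ (abs_pos.2 hs')]
  have h1 := norm_sub_norm_le (d : ℂ) (s * z)
  rw [norm_mul, Complex.norm_real, Complex.norm_real, Real.norm_eq_abs, Real.norm_eq_abs] at h1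
  have h2 := mul_le_mul_of_nonneg_left hz (abs_nonneg s)
  linarith [le_abs_self d]

/-- The normal is a real multiple of `w φ'(w)`, so the product is a real multiple of `i (X - r)`,
whose real part is `-Im X`. -/
lemma re_mul_outerNormal_eq_zero {c dφ : Circle → ℂ} {w : Circle} {R r : ℝ} {V X : ℂ}
    (hc : circleDeriv c w = R * dφ w) (hV : w * dφ w * V = Complex.I / 2 * (X - r))
    (hX : X.im = 0) : (V * outerNormal c w).re = 0 := by
  have h1 : V * outerNormal c w = (R / ‖circleDeriv c w‖ : ℝ) * (Complex.I / 2 * (X - r)) := by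
    rw [outerNormal, ← hV, Complex.ofReal_div]
    nth_rewrite 1 [hc]
    ring
  rw [h1, Complex.re_ofReal_mul]
  have h2 : Complex.I / 2 * (X - r) = ((1 / 2 : ℝ) : ℂ) * (Complex.I * (X - r)) := by
    push_cast
    ring
  rw [h2, Complex.re_ofReal_mul, Complex.I_mul_re, Complex.sub_im, Complex.ofReal_im, hX]
  simp

lemma circleDeriv_affine {φ : Circle → ℂ} (hφ : CircleDifferentiable φ) (R : ℝ) (a : ℂ)
    (w : Circle) : circleDeriv (fun w => R * φ w + a) w = R * circleDeriv φ w := by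
  have h := ((hφ w).hasDerivAt.const_mul (R : ℂ)).add_const a
  rw [circleDeriv, circleDeriv, h.deriv, mul_div_assoc]

/-- A zero of the functional gives a translating pair. -/
theorem isTranslatingPair_of_im_eq_zero {b₁ b₂ d γ₁ ε U γ₂ : ℝ} (hε : ε ≠ 0) (hb₁ : b₁ ≠ 0)
    (hb₂ : b₂ ≠ 0) {x₁ x₂ : Coef} (hd : 21 / 20 * (|ε * b₁| + |ε * b₂|) < d)
    (hN₁ : |ε * b₁| * ‖x₁‖ ≤ 1 / 20) (hN₂ : |ε * b₂| * ‖x₂‖ ≤ 1 / 20)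
    (h₁ : ∀ w, (complexComponent d ε U γ₁ γ₂ b₁ b₂ (profile x₁) (profileDeriv x₁) (profile x₂)
      (profileDeriv x₂) w).im = 0)
    (h₂ : ∀ w, (complexComponent d ε U γ₂ γ₁ b₂ b₁ (profile x₂) (profileDeriv x₂) (profile x₁)
      (profileDeriv x₁) w).im = 0) :
    IsTranslatingPair b₁ b₂ d γ₁ ε U γ₂ (boundaryMap ε b₁ (profile x₁))
      (boundaryMap ε b₂ (profile x₂)) (enclosedDomain (boundaryMap ε b₁ (profile x₁)))
      (enclosedDomain (boundaryMap ε b₂ (profile x₂))) := by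
  have hC₁ := (c11Bound_profile x₁).const_mul (ε * b₁)
  have hC₂ := (c11Bound_profile x₂).const_mul (ε * b₂)
  have hs₁ : ε * b₁ ≠ 0 := mul_ne_zero hε hb₁
  have hs₂ : ε * b₂ ≠ 0 := mul_ne_zero hε hb₂
  have hs₂' : -(ε * b₂) ≠ 0 := neg_ne_zero.2 hs₂
  have hφ₁ := boundaryMap_eq_perturb ε b₁ (profile x₁)
  have hφ₂ := boundaryMap_eq_perturb ε b₂ (profile x₂)
  have hD₁ := hC₁.measurableSet_domain hN₁
  have hD₂ := hC₂.measurableSet_domain hN₂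
  have hin₁ := fun w => hC₁.integrableOn_cauchy_boundary hN₁ w
  have hin₂ := fun w => hC₂.integrableOn_cauchy_boundary hN₂ w
  have hex₁ := fun z hz => hC₁.integrableOn_cauchy_exterior hN₁ (z := z) hz
  have hex₂ := fun z hz => hC₂.integrableOn_cauchy_exterior hN₂ (z := z) hz
  have hn₁ := hC₁.norm_perturb_le hN₁
  have hn₂ := hC₂.norm_perturb_le hN₂
  have hm₁ := fun z hz => hC₁.norm_le_of_mem_closure hN₁ (z := z) hz
  have hm₂ := fun z hz => hC₂.norm_le_of_mem_closure hN₂ (z := z) hz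
  have hdf₁ := (hC₁.isC1BoundaryOf hN₁).differentiable
  have hdf₂ := (hC₂.isC1BoundaryOf hN₂).differentiable
  have hdv₁ := hC₁.circleDeriv_perturb
  have hdv₂ := hC₂.circleDeriv_perturb
  have hz₁ : ∀ w, 21 / 20 < ‖(d - (ε * b₁ : ℝ) * boundaryMap ε b₁ (profile x₁) w) / (ε * b₂ : ℝ)‖ :=
    fun w => lt_norm_sub_div hs₂ hd (by rw [hφ₁]; exact hn₁ w)
  have hz₂ : ∀ w, 21 / 20 < ‖(d - (ε * b₂ : ℝ) * boundaryMap ε b₂ (profile x₂) w) / (ε * b₁ : ℝ)‖ :=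
    fun w => lt_norm_sub_div hs₁ (by rwa [add_comm]) (by rw [hφ₂]; exact hn₂ w)
  have hcc₁ := fun w => cauchy_combination (U := U) (γ := γ₁) (γ' := γ₂) hε hb₁ hb₂ w hC₁ hN₁
    hC₂ hN₂ (hz₁ w)
  have hcc₂ := fun w => cauchy_combination (U := U) (γ := γ₂) (γ' := γ₁) hε hb₂ hb₁ w hC₂ hN₂
    hC₁ hN₁ (hz₂ w)
  rw [← hφ₁] at hD₁ hin₁ hex₁ hm₁ hdf₁ hdv₁
  rw [← hφ₂] at hD₂ hin₂ hex₂ hm₂ hdf₂ hdv₂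
  set φ₁ := boundaryMap ε b₁ (profile x₁)
  set φ₂ := boundaryMap ε b₂ (profile x₂)
  have hR₁ : ((ε * b₁ : ℝ) : ℂ) ≠ 0 := by exact_mod_cast hs₁
  have hR₂ : ((ε * b₂ : ℝ) : ℂ) ≠ 0 := by exact_mod_cast hs₂
  -- The vorticity has density `γ/s²` and the rescaled Cauchy integral contributes one factor `s`.
  have hsc : ∀ s : ℝ, (s : ℂ) ≠ 0 → ∀ γ : ℝ, ∀ J : ℂ, γ / (s : ℂ) ^ 2 * (s * J) = γ / s * J :=
    fun s hs γ J => by field_simp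
  refine ⟨?_, fun w => ?_, fun w => ?_⟩
  · rw [patch₁_eq, patch₂_eq]
    have hB₁ := closure_minimal (affineImage_subset_closedBall (R := ε * b₁) (a := 0)
      fun z hz => hm₁ z (subset_closure hz)) Metric.isClosed_closedBall
    have hB₂ := closure_minimal (affineImage_subset_closedBall (R := -(ε * b₂)) (a := d)
      fun z hz => hm₂ z (subset_closure hz)) Metric.isClosed_closedBall
    refine (Metric.closedBall_disjoint_closedBall ?_).mono hB₁ hB₂
    rw [dist_zero_left, Complex.norm_real, Real.norm_eq_abs, abs_neg]
    linarith [le_abs_self d]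
  · rw [patch₁_eq, patch₂_eq]
    have hcw : circleDeriv (fun w => ε * b₁ * φ₁ w) w =
        (ε * b₁ : ℝ) * (1 + ε * b₁ * profileDeriv x₁ w) := by
      have h3 := circleDeriv_affine hdf₁ (ε * b₁) 0 w
      simp only [add_zero, Complex.ofReal_mul] at h3
      rw [h3, hdv₁]
      push_cast
      ring
    refine re_mul_outerNormal_eq_zero (dφ := fun w => 1 + ε * b₁ * profileDeriv x₁ w)
      (r := γ₁ / (ε * b₁)) hcw ?_ (h₁ w)
    have e₁ : (ε * b₁ * φ₁ w : ℂ) = (ε * b₁ : ℝ) * φ₁ w + 0 := by push_cast; ring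
    -- The same boundary point, written in the coordinates of the other patch, whose dilation factor
    -- is `-εb₂`.
    have e₂ : (ε * b₁ * φ₁ w : ℂ) =
        (-(ε * b₂) : ℝ) * ((d - (ε * b₁ : ℝ) * φ₁ w) / (ε * b₂ : ℝ)) + d := by
      rw [Complex.ofReal_neg, neg_mul, mul_div_cancel₀ _ hR₂]
      push_cast
      ring
    have i₁ := integrableOn_cauchy_image_affine hs₁ 0 hD₁ (hin₁ w)
    have i₂ := integrableOn_cauchy_image_affine hs₂' (d : ℂ) hD₂ (hex₂ _ (hz₁ w))
    have j₁ := integral_cauchy_image_affine hs₁ 0 hD₁ (φ₁ w)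
    have j₂ := integral_cauchy_image_affine hs₂' (d : ℂ) hD₂
      ((d - (ε * b₁ : ℝ) * φ₁ w) / (ε * b₂ : ℝ))
    rw [← e₁] at i₁ j₁
    rw [← e₂] at i₂ j₂
    rw [conj_velocity, integral_vorticity (measurableSet_affineImage hs₁ _ hD₁)
      (measurableSet_affineImage hs₂' _ hD₂) _ _ _ _ _ i₁ i₂, affineImage, affineImage, j₁, j₂]
    have k := hcc₁ w
    rw [← Complex.ofReal_mul ε b₁, ← Complex.ofReal_mul ε b₂] at k ⊢
    -- The minus sign of the second vorticity cancels against the negative dilation factor, so the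
    -- two contributions add.
    rw [hsc _ hR₁, Complex.ofReal_neg, neg_mul, mul_neg, sub_neg_eq_add, hsc _ hR₂,
      Complex.ofReal_div]
    exact k
  · rw [patch₁_eq, patch₂_eq]
    have hcw : circleDeriv (fun w => -(ε * b₂ * φ₂ w) + d) w =
        (-(ε * b₂) : ℝ) * (1 + ε * b₂ * profileDeriv x₂ w) := by
      have h3 := circleDeriv_affine hdf₂ (-(ε * b₂)) d w
      simp only [Complex.ofReal_mul, Complex.ofReal_neg, neg_mul] at h3
      rw [h3, hdv₂]
      push_cast
      ring
    refine re_mul_outerNormal_eq_zero (dφ := fun w => 1 + ε * b₂ * profileDeriv x₂ w)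
      (r := γ₂ / (ε * b₂)) hcw ?_ (h₂ w)
    have e₁ : (-(ε * b₂ * φ₂ w) + d : ℂ) = (-(ε * b₂) : ℝ) * φ₂ w + d := by push_cast; ring
    have e₂ : (-(ε * b₂ * φ₂ w) + d : ℂ) =
        (ε * b₁ : ℝ) * ((d - (ε * b₂ : ℝ) * φ₂ w) / (ε * b₁ : ℝ)) + 0 := by
      rw [mul_div_cancel₀ _ hR₁]
      push_cast
      ring
    have i₂ := integrableOn_cauchy_image_affine hs₂' (d : ℂ) hD₂ (hin₂ w)
    have i₁ := integrableOn_cauchy_image_affine hs₁ 0 hD₁ (hex₁ _ (hz₂ w))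
    have j₂ := integral_cauchy_image_affine hs₂' (d : ℂ) hD₂ (φ₂ w)
    have j₁ := integral_cauchy_image_affine hs₁ 0 hD₁
      ((d - (ε * b₂ : ℝ) * φ₂ w) / (ε * b₁ : ℝ))
    rw [← e₁] at i₂ j₂
    rw [← e₂] at i₁ j₁
    rw [conj_velocity, integral_vorticity (measurableSet_affineImage hs₁ _ hD₁)
      (measurableSet_affineImage hs₂' _ hD₂) _ _ _ _ _ i₁ i₂, affineImage, affineImage, j₁, j₂]
    have k := hcc₂ w
    rw [← Complex.ofReal_mul ε b₁, ← Complex.ofReal_mul ε b₂] at k ⊢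
    rw [hsc _ hR₁, Complex.ofReal_neg, neg_mul, mul_neg, sub_neg_eq_add, hsc _ hR₂,
      Complex.ofReal_div, add_comm ((γ₁ : ℂ) / _ * _)]
    exact k

end Velocity

end VortexPair

namespace VortexPair
open MeasureTheory Wiener

/-! ### Negative frequencies and the quadratic identity -/

section NegativeFrequencies

/-- The closed span of the negative powers `w^(-n-1)` in the continuous functions. -/
def negSpace : Submodule ℂ C(Circle, ℂ) :=
  (Submodule.span ℂ (Set.range fun n : ℕ => zpowMap (-((n + 1 : ℕ) : ℤ)))).topologicalClosure

lemma negSpace_le_ker (L : C(Circle, ℂ) →L[ℂ] ℂ)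
    (h : ∀ n : ℕ, L (zpowMap (-((n + 1 : ℕ) : ℤ))) = 0) {k : C(Circle, ℂ)} (hk : k ∈ negSpace) :
    L k = 0 := by
  have h1 : negSpace ≤ LinearMap.ker (L : C(Circle, ℂ) →ₗ[ℂ] ℂ) := by
    apply Submodule.topologicalClosure_minimal
    · rw [Submodule.span_le]
      rintro _ ⟨n, rfl⟩
      exact h n
    · exact L.isClosed_ker
  exact h1 hk

lemma average_zpowMap_mul_negSpace (j : ℕ) {k : C(Circle, ℂ)} (hk : k ∈ negSpace) :
    average (zpowMap (-(j : ℤ)) * k) = 0 := by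
  refine negSpace_le_ker (average.comp (ContinuousLinearMap.mul ℂ C(Circle, ℂ)
    (zpowMap (-(j : ℤ))))) (fun n => ?_) hk
  change average (zpowMap _ * zpowMap _) = 0
  rw [zpowMap_mul, average_zpowMap, if_neg (by omega)]

/-- By density in the last factor, that factor may be taken to be a negative power, which merges
with `w ^ (-j)`. -/
lemma average_zpowMap_mul_mul_negSpace (j : ℕ) {k l : C(Circle, ℂ)} (hk : k ∈ negSpace)
    (hl : l ∈ negSpace) : average (zpowMap (-(j : ℤ)) * k * l) = 0 := by
  refine negSpace_le_ker (average.comp (ContinuousLinearMap.mul ℂ C(Circle, ℂ)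
    (zpowMap (-(j : ℤ)) * k))) (fun n => ?_) hl
  change average (zpowMap _ * k * zpowMap _) = 0
  have h1 := average_zpowMap_mul_negSpace (j + (n + 1)) hk
  rw [mul_right_comm, zpowMap_mul]
  convert h1 using 4
  push_cast
  ring

lemma mem_negSpace_of_hasSum {g : C(Circle, ℂ)} {a : ℕ → ℂ}
    (ha : ∀ w : Circle, HasSum (fun n : ℕ => a n * conj (w : ℂ) ^ (n + 1)) (g w)) :
    g ∈ negSpace := by
  have h1 : Summable fun n => ‖a n‖ := by
    have h2 := (ha 1).summable.norm
    simpa using h2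
  have h3 : Summable fun n : ℕ => a n • zpowMap (-((n + 1 : ℕ) : ℤ)) := by
    refine Summable.of_norm_bounded h1 fun n => ?_
    rw [norm_smul]
    exact mul_le_of_le_one_right (norm_nonneg _) (norm_zpowMap_le _)
  have h4 : ∑' n : ℕ, a n • zpowMap (-((n + 1 : ℕ) : ℤ)) = g := by
    ext w
    have h5 := (ContinuousMap.evalCLM ℂ w).hasSum h3.hasSum
    refine h5.unique ?_
    convert ha w using 2 with n
    change a n * zpowMap (-((n + 1 : ℕ) : ℤ)) w = _
    rw [zpowMap_apply, coe_zpow_neg_natCast]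
  rw [← h4]
  refine (Submodule.isClosed_topologicalClosure _).mem_of_tendsto h3.hasSum
    (Filter.Eventually.of_forall fun s => ?_)
  exact Submodule.sum_mem _ fun n _ => Submodule.smul_mem _ _
    (Submodule.le_topologicalClosure _ (Submodule.subset_span ⟨n, rfl⟩))

variable {g : Circle → ℂ} (hg : CircleDifferentiable g)
include hg

lemma CircleDifferentiable.hasDerivAt (w : Circle) (t : ℝ) :
    HasDerivAt (fun t : ℝ => g (w * Circle.exp t))
      (Complex.I * (w * Circle.exp t : Circle) * circleDeriv g (w * Circle.exp t)) t := by
  have h1 : HasDerivAt (fun r : ℝ => g (w * Circle.exp t * Circle.exp r))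
      (Complex.I * (w * Circle.exp t : Circle) * circleDeriv g (w * Circle.exp t)) 0 := by
    have h2 : ((w * Circle.exp t : Circle) : ℂ) ≠ 0 := Circle.coe_ne_zero _
    rw [circleDeriv, mul_div_cancel₀ _ (mul_ne_zero Complex.I_ne_zero h2)]
    exact (hg (w * Circle.exp t)).hasDerivAt
  rw [← sub_self t] at h1
  have h3 := h1.comp_sub_const t t
  simpa only [mul_assoc, ← Circle.exp_add, add_sub_cancel] using h3

variable (hc : Continuous (circleDeriv g))
include hc

/-- The function `w g'(w)` inherits the negative frequencies of `g`. -/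
lemma mul_circleDeriv_mem_negSpace {a : ℕ → ℝ}
    (ha : ∀ w : Circle, HasSum (fun n : ℕ => (a n : ℂ) * conj (w : ℂ) ^ (n + 1)) (g w)) :
    (⟨fun w => w * circleDeriv g w, continuous_subtype_val.mul hc⟩ : C(Circle, ℂ)) ∈ negSpace := by
  set k : C(Circle, ℂ) := ⟨fun w => w * circleDeriv g w, continuous_subtype_val.mul hc⟩ with hk
  have hgt : ∀ t : ℝ, (⟨fun w => g (w * Circle.exp t), hg.continuous.comp
      (continuous_mul_const _)⟩ : C(Circle, ℂ)) ∈ negSpace := fun t =>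
    mem_negSpace_of_hasSum (a := fun n => a n * conj (Circle.exp t : ℂ) ^ (n + 1)) fun w => by
      convert ha (w * Circle.exp t) using 2 with n
      · rw [Circle.coe_mul, map_mul, mul_pow]
        ring
      · rfl
  have h0 : (⟨g, hg.continuous⟩ : C(Circle, ℂ)) ∈ negSpace :=
    mem_negSpace_of_hasSum (a := fun n => a n) ha
  have hclosed : IsClosed (negSpace : Set C(Circle, ℂ)) := Submodule.isClosed_topologicalClosure _
  have huc : UniformContinuous k := CompactSpace.uniformContinuous_of_continuous k.continuous
  -- Rotation preserves the negative frequencies. The difference quotients of the rotates of `g`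
  -- converge uniformly to `w g'`, so the limit stays in the closed span. Termwise differentiation
  -- of the series is not needed.
  have hmem : k ∈ closure (negSpace : Set C(Circle, ℂ)) := by
    rw [Metric.mem_closure_iff]
    intro η hη
    obtain ⟨δ, hδ, hδk⟩ := Metric.uniformContinuous_iff.1 huc (η / 2) (half_pos hη)
    set t : ℝ := δ / 2
    have ht : 0 < t := half_pos hδ
    refine ⟨(Complex.I * t)⁻¹ • ((⟨fun w => g (w * Circle.exp t), hg.continuous.comp
      (continuous_mul_const _)⟩ : C(Circle, ℂ)) - ⟨g, hg.continuous⟩),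
      Submodule.smul_mem _ _ (Submodule.sub_mem _ (hgt t) h0), ?_⟩
    refine lt_of_le_of_lt ((ContinuousMap.dist_le (half_pos hη).le).2 fun w => ?_) (half_lt_self hη)
    have h1 : ∀ r ∈ Set.Ico (0 : ℝ) t, ‖Complex.I * (w * Circle.exp r : Circle) *
        circleDeriv g (w * Circle.exp r) - Complex.I * k w‖ ≤ η / 2 := by
      intro r hr
      have h2 : dist (w * Circle.exp r) w < δ := by
        have h3 : dist (w * Circle.exp r) w = ‖((w * Circle.exp r : Circle) : ℂ) - w‖ := by
          rw [← dist_eq_norm]; rfl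
        rw [h3]
        refine (norm_circle_mul_exp_sub_le w r).trans_lt ?_
        rw [abs_of_nonneg hr.1]
        exact hr.2.trans (half_lt_self hδ)
      have h4 := (hδk h2).le
      rw [dist_eq_norm] at h4
      have h5 : Complex.I * (w * Circle.exp r : Circle) * circleDeriv g (w * Circle.exp r) -
          Complex.I * k w = Complex.I * (k (w * Circle.exp r) - k w) := by
        rw [mul_sub, mul_assoc]; rfl
      rw [h5, norm_mul, Complex.norm_I, one_mul]
      exact h4
    have h6 : ∀ r : ℝ, HasDerivAt (fun r : ℝ => g (w * Circle.exp r) - r * (Complex.I * k w))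
        (Complex.I * (w * Circle.exp r : Circle) * circleDeriv g (w * Circle.exp r) -
          Complex.I * k w) r := fun r => by
      have h7 := (Complex.ofRealCLM.hasDerivAt (x := r)).mul_const (Complex.I * k w)
      rw [Complex.ofRealCLM_apply, Complex.ofReal_one, one_mul] at h7
      exact (hg.hasDerivAt w r).fun_sub h7
    have h8 := norm_image_sub_le_of_norm_deriv_le_segment'
      (fun r _ => (h6 r).hasDerivWithinAt) h1 t (Set.right_mem_Icc.2 ht.le)
    simp only [Circle.exp_zero, mul_one, Complex.ofReal_zero, zero_mul, sub_zero] at h8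
    have htc : (t : ℂ) ≠ 0 := by exact_mod_cast ht.ne'
    have h9 : k w - (Complex.I * t)⁻¹ * (g (w * Circle.exp t) - g w) =
        -((Complex.I * t)⁻¹ * (g (w * Circle.exp t) - t * (Complex.I * k w) - g w)) := by
      have := Complex.I_ne_zero
      field_simp
      ring
    rw [dist_eq_norm]
    change ‖k w - (Complex.I * t)⁻¹ * (g (w * Circle.exp t) - g w)‖ ≤ η / 2
    rw [h9, norm_neg, norm_mul, norm_inv, norm_mul, Complex.norm_I, one_mul, Complex.norm_real,
      Real.norm_of_nonneg ht.le, inv_mul_le_iff₀ ht]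
    linarith
  rwa [hclosed.closure_eq] at hmem

/-- The function `w g'` has only frequencies at most `-1`, so `g'` has only frequencies at most
`-2`. Hence none of the three integrands has a constant term. -/
lemma integral_mul_circleDeriv_eq_zero {a : ℕ → ℝ}
    (ha : ∀ w : Circle, HasSum (fun n : ℕ => (a n : ℂ) * conj (w : ℂ) ^ (n + 1)) (g w)) :
    (∫ θ in (0 : ℝ)..(2 * π), (Circle.exp θ : ℂ) * circleDeriv g (Circle.exp θ) = 0) ∧
    (∫ θ in (0 : ℝ)..(2 * π), conj (Circle.exp θ : ℂ) * circleDeriv g (Circle.exp θ) = 0) ∧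
    (∫ θ in (0 : ℝ)..(2 * π), circleDeriv g (Circle.exp θ) ^ 2 = 0) := by
  have hk := mul_circleDeriv_mem_negSpace hg hc ha
  set k : C(Circle, ℂ) := ⟨fun w => w * circleDeriv g w, continuous_subtype_val.mul hc⟩ 
  have hpi : ((2 * π : ℂ)⁻¹) ≠ 0 := inv_ne_zero (by exact_mod_cast Real.two_pi_pos.ne')
  have key : ∀ m : C(Circle, ℂ), average m = 0 →
      ∫ θ in (0 : ℝ)..(2 * π), m (Circle.exp θ) = 0 := fun m hm => by
    rw [average_apply, smul_eq_mul] at hm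
    exact (mul_eq_zero.1 hm).resolve_left hpi
  have h1 := key _ (average_zpowMap_mul_negSpace 0 hk)
  have h2 := key _ (average_zpowMap_mul_negSpace 2 hk)
  have h3 := key _ (average_zpowMap_mul_mul_negSpace 2 hk hk)
  have hkw : ∀ w : Circle, k w = w * circleDeriv g w := fun _ => rfl
  simp only [ContinuousMap.mul_apply, zpowMap_apply, coe_zpow_neg_natCast, pow_zero, one_mul,
    hkw] at h1 h2 h3
  refine ⟨h1, ?_, ?_⟩
  · rw [← h2]
    congr 1
    funext θ
    linear_combination (-conj (Circle.exp θ : ℂ) * circleDeriv g (Circle.exp θ)) *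
      circle_conj_mul_self (Circle.exp θ)
  · rw [← h3]
    congr 1
    funext θ
    linear_combination (-circleDeriv g (Circle.exp θ) ^ 2 *
      (conj (Circle.exp θ : ℂ) * Circle.exp θ + 1)) * circle_conj_mul_self (Circle.exp θ)

/-- The quadratic identity behind the uniqueness of solutions. -/
lemma integral_sq_sub_im {a : ℕ → ℝ}
    (ha : ∀ w : Circle, HasSum (fun n : ℕ => (a n : ℂ) * conj (w : ℂ) ^ (n + 1)) (g w))
    (s γ : ℝ) : ∫ θ in (0 : ℝ)..(2 * π),
        (s * (Circle.exp θ : ℂ) - γ * circleDeriv g (Circle.exp θ)).im ^ 2 =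
      π * s ^ 2 + γ ^ 2 / 2 * ∫ θ in (0 : ℝ)..(2 * π), ‖circleDeriv g (Circle.exp θ)‖ ^ 2 := by
  obtain ⟨h1, h2, h3⟩ := integral_mul_circleDeriv_eq_zero hg hc ha
  set h : ℝ → ℂ := fun θ => circleDeriv g (Circle.exp θ) with hh
  have hhc : Continuous h := hc.comp Circle.exp.continuous
  have hec : Continuous fun θ : ℝ => (Circle.exp θ : ℂ) :=
    continuous_subtype_val.comp Circle.exp.continuous
  have hre : ∀ f : ℝ → ℂ, Continuous f → ∫ θ in (0 : ℝ)..(2 * π), f θ = 0 →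
      ∫ θ in (0 : ℝ)..(2 * π), (f θ).re = 0 := fun f hf h0 => by
    have h4 := Complex.reCLM.intervalIntegral_comp_comm (hf.intervalIntegrable (μ := volume) 0 (2 * π))
    rw [h0, map_zero] at h4
    exact h4
  have e1 : ∫ θ in (0 : ℝ)..(2 * π), ((Circle.exp θ : ℂ) * h θ).re = 0 :=
    hre _ (hec.mul hhc) h1
  have e2 : ∫ θ in (0 : ℝ)..(2 * π), (conj (Circle.exp θ : ℂ) * h θ).re = 0 :=
    hre _ ((Complex.continuous_conj.comp hec).mul hhc) h2
  have e3 : ∫ θ in (0 : ℝ)..(2 * π), (h θ ^ 2).re = 0 := hre _ (hhc.pow 2) h3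
  -- The cross term `2 sin θ Im h` is `Re (w̄ h) - Re (w h)` and `(Im h)²` is `(|h|² - Re h²) / 2`.
  -- The terms with `Re` have mean zero, so no loss occurs in the identity.
  have hpt : ∀ θ, (s * (Circle.exp θ : ℂ) - γ * h θ).im ^ 2 =
      s ^ 2 * Real.sin θ ^ 2 + s * γ * ((Circle.exp θ : ℂ) * h θ).re -
        s * γ * (conj (Circle.exp θ : ℂ) * h θ).re + γ ^ 2 / 2 * ‖h θ‖ ^ 2 -
        γ ^ 2 / 2 * (h θ ^ 2).re := fun θ => by
    rw [Complex.sub_im, Complex.im_ofReal_mul, Complex.im_ofReal_mul, Complex.mul_re,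
      Complex.mul_re, Complex.conj_re, Complex.conj_im, Circle.coe_exp, Complex.exp_ofReal_mul_I_im,
      Complex.exp_ofReal_mul_I_re, ← Complex.normSq_eq_norm_sq, Complex.normSq_apply, sq (h θ),
      Complex.mul_re]
    ring
  refine (intervalIntegral.integral_congr fun θ _ => hpt θ).trans ?_
  have c1 : Continuous fun θ : ℝ => s ^ 2 * Real.sin θ ^ 2 := by fun_prop
  have c2 : Continuous fun θ : ℝ => s * γ * ((Circle.exp θ : ℂ) * h θ).re :=
    continuous_const.mul (Complex.continuous_re.comp (hec.mul hhc))
  have c3 : Continuous fun θ : ℝ => s * γ * (conj (Circle.exp θ : ℂ) * h θ).re :=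
    continuous_const.mul (Complex.continuous_re.comp ((Complex.continuous_conj.comp hec).mul hhc))
  have c4 : Continuous fun θ : ℝ => γ ^ 2 / 2 * ‖h θ‖ ^ 2 :=
    continuous_const.mul (hhc.norm.pow 2)
  have c5 : Continuous fun θ : ℝ => γ ^ 2 / 2 * (h θ ^ 2).re :=
    continuous_const.mul (Complex.continuous_re.comp (hhc.pow 2))
  have i1 := c1.intervalIntegrable (μ := volume) 0 (2 * π)
  have i2 := c2.intervalIntegrable (μ := volume) 0 (2 * π)
  have i3 := c3.intervalIntegrable (μ := volume) 0 (2 * π)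
  have i4 := c4.intervalIntegrable (μ := volume) 0 (2 * π)
  have i5 := c5.intervalIntegrable (μ := volume) 0 (2 * π)
  rw [intervalIntegral.integral_sub (((i1.add i2).sub i3).add i4) i5,
    intervalIntegral.integral_add ((i1.add i2).sub i3) i4,
    intervalIntegral.integral_sub (i1.add i2) i3, intervalIntegral.integral_add i1 i2,
    intervalIntegral.integral_const_mul, intervalIntegral.integral_const_mul,
    intervalIntegral.integral_const_mul, intervalIntegral.integral_const_mul,
    intervalIntegral.integral_const_mul, e1, e2, e3, integral_sin_sq, Real.sin_zero, Real.sin_two_pi]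
  ring

end NegativeFrequencies

end VortexPair

namespace VortexPair
open MeasureTheory Wiener

/-! ### Control by the `L²` norm of the derivative -/

section SquareMean

/-- The `L²` norm with respect to the angle. -/
def l2Norm (h : Circle → ℂ) : ℝ := √(∫ θ in (0 : ℝ)..(2 * π), ‖h (Circle.exp θ)‖ ^ 2)

lemma l2Norm_nonneg (h : Circle → ℂ) : 0 ≤ l2Norm h := Real.sqrt_nonneg _

lemma l2Norm_sq (h : Circle → ℂ) :
    l2Norm h ^ 2 = ∫ θ in (0 : ℝ)..(2 * π), ‖h (Circle.exp θ)‖ ^ 2 :=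
  Real.sq_sqrt (intervalIntegral.integral_nonneg Real.two_pi_pos.le fun _ _ => sq_nonneg _)

lemma l2Norm_sq_rotate (h : Circle → ℂ) (w : Circle) :
    ∫ θ in (0 : ℝ)..(2 * π), ‖h (w * Circle.exp θ)‖ ^ 2 = l2Norm h ^ 2 := by
  rw [l2Norm_sq, intervalIntegral_circle_rotate (fun τ => ‖h τ‖ ^ 2) w]

/-- Cauchy–Schwarz against the constant function, obtained by expanding the nonnegative integral of
`((b - a) φ - J)²`, where `J` is the integral of `φ`. -/
lemma sq_integral_le {φ : ℝ → ℝ} (hφ : Continuous φ) {a b : ℝ} (hab : a ≤ b) :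
    (∫ t in a..b, φ t) ^ 2 ≤ (b - a) * ∫ t in a..b, φ t ^ 2 := by
  rcases hab.eq_or_lt with rfl | hab
  · simp
  set J := ∫ t in a..b, φ t with hJ
  have h1 : 0 ≤ ∫ t in a..b, ((b - a) * φ t - J) ^ 2 :=
    intervalIntegral.integral_nonneg hab.le fun _ _ => sq_nonneg _
  have h2 : ∀ t, ((b - a) * φ t - J) ^ 2 =
      (b - a) ^ 2 * φ t ^ 2 - 2 * (b - a) * J * φ t + J ^ 2 := fun t => by ring
  have i1 : IntervalIntegrable (fun t => (b - a) ^ 2 * φ t ^ 2) volume a b :=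
    (continuous_const.mul (hφ.pow 2)).intervalIntegrable _ _
  have i2 : IntervalIntegrable (fun t => 2 * (b - a) * J * φ t) volume a b :=
    (continuous_const.mul hφ).intervalIntegrable _ _
  simp only [h2] at h1
  rw [intervalIntegral.integral_add (i1.sub i2) intervalIntegrable_const,
    intervalIntegral.integral_sub i1 i2, intervalIntegral.integral_const_mul,
    intervalIntegral.integral_const_mul, ← hJ, intervalIntegral.integral_const, smul_eq_mul] at h1
  have h3 : 0 < b - a := sub_pos.2 hab
  nlinarith

lemma norm_circle_exp_sub_one_ge {θ : ℝ} (h0 : 0 ≤ θ) (h1 : θ ≤ π) :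
    2 / π * θ ≤ ‖(Circle.exp θ : ℂ) - 1‖ := by
  have h2 := Complex.norm_exp_I_mul_ofReal_sub_one θ
  rw [Circle.coe_exp, mul_comm (θ : ℂ), h2]
  have h3 := Real.mul_le_sin (x := θ / 2) (by linarith) (by linarith)
  refine le_trans ?_ (le_abs_self _)
  linarith

lemma norm_circle_exp_sub_one_reflect (θ : ℝ) :
    ‖(Circle.exp (2 * π - θ) : ℂ) - 1‖ = ‖(Circle.exp θ : ℂ) - 1‖ := by
  rw [Circle.exp_sub, Circle.exp_two_pi, one_div, Circle.coe_inv_eq_conj, ← Complex.norm_conj,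
    map_sub, Complex.conj_conj, map_one]

variable {g : Circle → ℂ} (hg : CircleDifferentiable g)
include hg

lemma norm_sub_le_of_deriv_le {M : ℝ} (hM : ∀ w, ‖circleDeriv g w‖ ≤ M) (w : Circle) {θ : ℝ}
    (h0 : 0 ≤ θ) : ‖g (w * Circle.exp θ) - g w‖ ≤ M * θ := by
  have h1 := norm_image_sub_le_of_norm_deriv_le_segment'
    (fun t _ => (hg.hasDerivAt w t).hasDerivWithinAt) (C := M) (fun t _ => by
      rw [norm_mul, norm_mul, Complex.norm_I, Circle.norm_coe, one_mul, one_mul]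
      exact hM _) θ (Set.right_mem_Icc.2 h0)
  simpa using h1

omit hg in
-- The same pair of points is joined by the complementary arc, traversed from the other endpoint.
lemma reflect_le {B : ℝ → ℝ} (h : ∀ w : Circle, ∀ θ, 0 ≤ θ → θ ≤ 2 * π →
    ‖g (w * Circle.exp θ) - g w‖ ≤ B θ) (w : Circle) {θ : ℝ} (h0 : 0 ≤ θ) (h1 : θ ≤ 2 * π) :
    ‖g (w * Circle.exp θ) - g w‖ ≤ B (2 * π - θ) := by
  have h2 := h (w * Circle.exp θ) (2 * π - θ) (by linarith) (by linarith)
  rw [mul_assoc, ← Circle.exp_add, add_sub_cancel, Circle.exp_two_pi, mul_one, norm_sub_rev] at h2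
  exact h2

lemma norm_sub_le_mul_chord {M : ℝ} (hM : ∀ w, ‖circleDeriv g w‖ ≤ M) (w : Circle) {θ : ℝ}
    (h0 : 0 ≤ θ) (h1 : θ ≤ 2 * π) :
    ‖g (w * Circle.exp θ) - g w‖ ≤ 2 * M * ‖(Circle.exp θ : ℂ) - 1‖ := by
  have hM0 : 0 ≤ M := (norm_nonneg _).trans (hM 1)
  have hpi := Real.pi_pos
  have key : ∀ θ : ℝ, 0 ≤ θ → θ ≤ π → M * θ ≤ 2 * M * ‖(Circle.exp θ : ℂ) - 1‖ := by
    intro θ h0 h1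
    have h2 := norm_circle_exp_sub_one_ge h0 h1
    rw [div_mul_eq_mul_div, div_le_iff₀ hpi] at h2
    have h3 : θ ≤ 2 * ‖(Circle.exp θ : ℂ) - 1‖ := by
      nlinarith [Real.pi_lt_four, norm_nonneg ((Circle.exp θ : ℂ) - 1)]
    nlinarith
  by_cases hθ : θ ≤ π
  · exact (norm_sub_le_of_deriv_le hg hM w h0).trans (key θ h0 hθ)
  · have h2 := reflect_le (B := fun θ => M * θ)
      (fun w θ h _ => norm_sub_le_of_deriv_le hg hM w h) w h0 h1
    rw [← norm_circle_exp_sub_one_reflect]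
    exact h2.trans (key _ (by linarith) (by linarith))

variable (hc : Continuous (circleDeriv g))

omit hg in
include hc in
lemma integral_norm_le_sqrt_mul (w : Circle) {θ : ℝ} (h0 : 0 ≤ θ) (h1 : θ ≤ 2 * π) :
    ∫ t in (0 : ℝ)..θ, ‖circleDeriv g (w * Circle.exp t)‖ ≤ √θ * l2Norm (circleDeriv g) := by
  have hcont : Continuous fun t : ℝ => ‖circleDeriv g (w * Circle.exp t)‖ :=
    (hc.comp (continuous_const.mul Circle.exp.continuous)).norm
  have h2 := sq_integral_le hcont h0
  have h3 : ∫ t in (0 : ℝ)..θ, ‖circleDeriv g (w * Circle.exp t)‖ ^ 2 ≤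
      l2Norm (circleDeriv g) ^ 2 := by
    rw [← l2Norm_sq_rotate _ w]
    exact intervalIntegral.integral_mono_interval le_rfl h0 h1
      (Filter.Eventually.of_forall fun _ => sq_nonneg _)
      ((hcont.pow 2).intervalIntegrable _ _)
  refine le_of_sq_le_sq ?_ (mul_nonneg (Real.sqrt_nonneg _) (l2Norm_nonneg _))
  rw [mul_pow, Real.sq_sqrt h0]
  rw [sub_zero] at h2
  exact h2.trans (mul_le_mul_of_nonneg_left h3 h0)

include hc

lemma norm_sub_le_sqrt_mul (w : Circle) {θ : ℝ} (h0 : 0 ≤ θ) (h1 : θ ≤ 2 * π) :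
    ‖g (w * Circle.exp θ) - g w‖ ≤ √θ * l2Norm (circleDeriv g) := by
  have hcont : Continuous fun t : ℝ => circleDeriv g (w * Circle.exp t) :=
    hc.comp (continuous_const.mul Circle.exp.continuous)
  have hcont' : Continuous fun t : ℝ => Complex.I * (w * Circle.exp t : Circle) *
      circleDeriv g (w * Circle.exp t) :=
    (continuous_const.mul (continuous_subtype_val.comp
      (continuous_const.mul Circle.exp.continuous))).mul hcont
  have h2 := intervalIntegral.integral_eq_sub_of_hasDerivAt (a := 0) (b := θ)
    (fun t _ => hg.hasDerivAt w t) (hcont'.intervalIntegrable _ _)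
  rw [Circle.exp_zero, mul_one] at h2
  rw [← h2]
  refine (intervalIntegral.norm_integral_le_integral_norm h0).trans ?_
  refine le_trans (le_of_eq ?_) (integral_norm_le_sqrt_mul hc w h0 h1)
  congr 1
  funext t
  rw [norm_mul, norm_mul, Complex.norm_I, Circle.norm_coe, one_mul, one_mul]

/-- The integrable majorant `θ^(-1/2) + (2π - θ)^(-1/2)`. -/
def rootKernel (θ : ℝ) : ℝ := θ ^ (-(1 / 2) : ℝ) + (2 * π - θ) ^ (-(1 / 2) : ℝ)

omit hg hc in
lemma intervalIntegrable_rootKernel : IntervalIntegrable rootKernel volume 0 (2 * π) := by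
  have h1 : IntervalIntegrable (fun θ : ℝ => θ ^ (-(1 / 2) : ℝ)) volume 0 (2 * π) :=
    intervalIntegral.intervalIntegrable_rpow' (by norm_num)
  have h2 := h1.comp_sub_left (2 * π)
  rw [sub_zero, sub_self] at h2
  exact h1.add h2.symm

omit hg hc in
lemma rootKernel_nonneg {θ : ℝ} (h0 : 0 ≤ θ) (h1 : θ ≤ 2 * π) : 0 ≤ rootKernel θ :=
  add_nonneg (Real.rpow_nonneg h0 _) (Real.rpow_nonneg (by linarith) _)

/-- Cauchy–Schwarz along the shorter arc gives a difference of order `√θ`, while the chord is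
comparable to `θ`. The difference quotient thus has only an inverse square root singularity, which
is integrable: this is what allows the self-interaction to be controlled by an `L²` norm. -/
lemma norm_sub_le_rootKernel (w : Circle) {θ : ℝ} (h0 : 0 < θ) (h1 : θ < 2 * π) :
    ‖g (w * Circle.exp θ) - g w‖ ≤
      2 * l2Norm (circleDeriv g) * rootKernel θ * ‖(Circle.exp θ : ℂ) - 1‖ := by
  have hn := l2Norm_nonneg (circleDeriv g)
  have hpi := Real.pi_pos
  have key : ∀ θ : ℝ, 0 < θ → θ ≤ π → √θ * l2Norm (circleDeriv g) ≤
      2 * l2Norm (circleDeriv g) * θ ^ (-(1 / 2) : ℝ) * ‖(Circle.exp θ : ℂ) - 1‖ := by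
    intro θ h0 h1
    have h2 := norm_circle_exp_sub_one_ge h0.le h1
    rw [div_mul_eq_mul_div, div_le_iff₀ hpi] at h2
    have h3 : θ ≤ 2 * ‖(Circle.exp θ : ℂ) - 1‖ := by
      nlinarith [Real.pi_lt_four, norm_nonneg ((Circle.exp θ : ℂ) - 1)]
    have h4 : √θ = θ ^ (-(1 / 2) : ℝ) * θ := by
      rw [Real.sqrt_eq_rpow]
      nth_rewrite 3 [← Real.rpow_one θ]
      rw [← Real.rpow_add h0]
      norm_num
    have h5 : 0 ≤ θ ^ (-(1 / 2) : ℝ) := Real.rpow_nonneg h0.le _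
    calc √θ * l2Norm (circleDeriv g) = l2Norm (circleDeriv g) * θ ^ (-(1 / 2) : ℝ) * θ := by
          rw [h4]; ring
      _ ≤ l2Norm (circleDeriv g) * θ ^ (-(1 / 2) : ℝ) * (2 * ‖(Circle.exp θ : ℂ) - 1‖) :=
          mul_le_mul_of_nonneg_left h3 (mul_nonneg hn h5)
      _ = _ := by ring
  have mono : ∀ a b c : ℝ, 0 ≤ b → 2 * l2Norm (circleDeriv g) * a * ‖(Circle.exp c : ℂ) - 1‖ ≤
      2 * l2Norm (circleDeriv g) * (a + b) * ‖(Circle.exp c : ℂ) - 1‖ := fun a b c hb => by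
    gcongr
    linarith
  by_cases hθ : θ ≤ π
  · exact ((norm_sub_le_sqrt_mul hg hc w h0.le h1.le).trans (key θ h0 hθ)).trans
      (mono _ _ _ (Real.rpow_nonneg (by linarith) _))
  · have h2 := reflect_le (B := fun θ => √θ * l2Norm (circleDeriv g))
      (fun w θ h h' => norm_sub_le_sqrt_mul hg hc w h h') w h0.le h1.le
    have h3 := key _ (sub_pos.2 h1) (by linarith)
    refine (h2.trans h3).trans ?_
    rw [norm_circle_exp_sub_one_reflect, rootKernel, add_comm (θ ^ _)]
    exact mono _ _ _ (Real.rpow_nonneg h0.le _)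

omit hg hc in
lemma sqrt_two_pi_le : √(2 * π) ≤ 3 := by
  rw [Real.sqrt_le_left (by norm_num)]
  linarith [Real.pi_lt_four, Real.pi_lt_d2]

omit hg in
lemma integral_norm_circleDeriv_le (w : Circle) :
    ∫ t in (0 : ℝ)..(2 * π), ‖circleDeriv g (w * Circle.exp t)‖ ≤ 3 * l2Norm (circleDeriv g) :=
  (integral_norm_le_sqrt_mul hc w Real.two_pi_pos.le le_rfl).trans
    (mul_le_mul_of_nonneg_right sqrt_two_pi_le (l2Norm_nonneg _))

lemma norm_sub_le_l2Norm (τ w : Circle) : ‖g τ - g w‖ ≤ 3 * l2Norm (circleDeriv g) := by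
  obtain ⟨θ, hθ, h1⟩ := exists_circle_exp_eq (w⁻¹ * τ)
  have h2 := norm_sub_le_sqrt_mul hg hc w hθ.1.le hθ.2
  rw [h1, mul_inv_cancel_left] at h2
  exact h2.trans (mul_le_mul_of_nonneg_right
    ((Real.sqrt_le_sqrt hθ.2).trans sqrt_two_pi_le) (l2Norm_nonneg _))

/-- A series in negative powers has mean zero, so the value at `w` is the mean of its differences to
the other values. -/
lemma norm_le_l2Norm {a : ℕ → ℝ}
    (ha : ∀ w : Circle, HasSum (fun n : ℕ => (a n : ℂ) * conj (w : ℂ) ^ (n + 1)) (g w))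
    (w : Circle) : ‖g w‖ ≤ 3 * l2Norm (circleDeriv g) := by
  have h1 := average_zpowMap_mul_negSpace 0
    (mem_negSpace_of_hasSum (g := ⟨g, hg.continuous⟩) (a := fun n => a n) ha)
  have h2 : average (⟨g, hg.continuous⟩ : C(Circle, ℂ)) = 0 := by
    convert h1 using 2
    ext w
    rw [ContinuousMap.mul_apply, zpowMap_apply]
    simp
  have h3 : g w = average (⟨fun τ => g w - g τ, continuous_const.sub hg.continuous⟩ : C(Circle, ℂ)) := by
    have h4 : (⟨fun τ => g w - g τ, continuous_const.sub hg.continuous⟩ : C(Circle, ℂ)) =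
        g w • zpowMap 0 - ⟨g, hg.continuous⟩ := by
      ext τ
      change g w - g τ = g w * zpowMap 0 τ - g τ
      rw [zpowMap_apply, zpow_zero, Circle.coe_one, mul_one]
    rw [h4, map_sub, h2, sub_zero, map_smul, average_zpowMap, if_pos rfl, smul_eq_mul, mul_one]
  rw [h3, average_apply, norm_smul, norm_inv]
  have h5 : ‖(2 * π : ℂ)‖ = 2 * π := by
    rw [norm_mul, Complex.norm_ofNat, Complex.norm_real, Real.norm_of_nonneg Real.pi_pos.le]
  have h6 := intervalIntegral.norm_integral_le_of_norm_le_const (a := 0) (b := 2 * π)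
    (f := fun θ : ℝ => g w - g (Circle.exp θ)) (C := 3 * l2Norm (circleDeriv g))
    fun θ _ => norm_sub_le_l2Norm hg hc w _
  rw [h5, inv_mul_le_iff₀ Real.two_pi_pos]
  rw [sub_zero, abs_of_pos Real.two_pi_pos, mul_comm (3 * _) (2 * π)] at h6
  exact h6

omit hg hc in
lemma norm_circleMean_le {h : Circle → ℂ} {k : ℝ → ℝ} (w : Circle)
    (hk : IntervalIntegrable k volume 0 (2 * π))
    (hhk : ∀ θ, 0 < θ → θ < 2 * π → ‖h (w * Circle.exp θ)‖ ≤ k θ) :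
    ‖circleMean h‖ ≤ ∫ θ in (0 : ℝ)..(2 * π), k θ := by
  have h5 : ‖(2 * π : ℂ)‖ = 2 * π := by
    rw [norm_mul, Complex.norm_ofNat, Complex.norm_real, Real.norm_of_nonneg Real.pi_pos.le]
  have hae : ∀ᵐ θ : ℝ, θ ∈ Set.Ioc 0 (2 * π) →
      ‖(Circle.exp θ : ℂ) * h (w * Circle.exp θ)‖ ≤ k θ := by
    have h1 : ∀ᵐ θ : ℝ, θ ≠ 2 * π := by simp [ae_iff]
    filter_upwards [h1] with θ hθ hθ'
    rw [norm_mul, Circle.norm_coe, one_mul]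
    exact hhk θ hθ'.1 (lt_of_le_of_ne hθ'.2 hθ)
  have h6 := intervalIntegral.norm_integral_le_of_norm_le Real.two_pi_pos.le hae hk
  rw [circleMean_rotate h w, circleMean_eq, norm_mul, norm_mul, Circle.norm_coe, one_mul, norm_inv,
    h5]
  refine le_trans (mul_le_of_le_one_left (norm_nonneg _) (inv_le_one_of_one_le₀ ?_)) h6
  linarith [Real.pi_gt_three]

end SquareMean

end VortexPair

namespace VortexPair
open MeasureTheory Wiener

/-! ### Pointwise Lipschitz bounds for the two kernels -/

section PointwiseBounds

lemma norm_mul_sub_mul_le {a a' b b' : ℂ} {x y P Q : ℝ} (ha : ‖a - a'‖ ≤ x) (hb : ‖b - b'‖ ≤ y)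
    (hP : ‖b‖ ≤ P) (hQ : ‖a'‖ ≤ Q) : ‖a * b - a' * b'‖ ≤ x * P + Q * y := by
  have h1 : a * b - a' * b' = (a - a') * b + a' * (b - b') := by ring
  rw [h1]
  refine (norm_add_le _ _).trans (add_le_add ?_ ?_)
  · rw [norm_mul]
    exact mul_le_mul ha hP (norm_nonneg _) ((norm_nonneg _).trans ha)
  · rw [norm_mul]
    exact mul_le_mul hQ hb (norm_nonneg _) ((norm_nonneg _).trans hQ)

lemma half_le_norm_one_add {s p : ℂ} (hs : ‖s‖ ≤ 1 / 4) (hp : ‖p‖ ≤ 2) : 1 / 2 ≤ ‖1 + s * p‖ := by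
  have h1 := norm_sub_norm_le (1 : ℂ) (-(s * p))
  rw [norm_neg, norm_mul, norm_one, sub_neg_eq_add] at h1
  nlinarith [norm_nonneg s, norm_nonneg p]

lemma norm_inv_one_add_le {s p : ℂ} (hs : ‖s‖ ≤ 1 / 4) (hp : ‖p‖ ≤ 2) : ‖(1 + s * p)⁻¹‖ ≤ 2 := by
  rw [norm_inv]
  have h1 := inv_anti₀ (by norm_num) (half_le_norm_one_add hs hp)
  norm_num at h1
  exact h1

lemma norm_inv_sub_inv_le {s p p' : ℂ} {x : ℝ} (hs : ‖s‖ ≤ 1 / 4) (hp : ‖p‖ ≤ 2) (hp' : ‖p'‖ ≤ 2)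
    (hx : ‖p - p'‖ ≤ x) : ‖(1 + s * p)⁻¹ - (1 + s * p')⁻¹‖ ≤ x := by
  have h1 : 1 + s * p ≠ 0 := norm_pos_iff.1 (by linarith [half_le_norm_one_add hs hp])
  have h2 : 1 + s * p' ≠ 0 := norm_pos_iff.1 (by linarith [half_le_norm_one_add hs hp'])
  have h3 : (1 + s * p)⁻¹ - (1 + s * p')⁻¹ = -(s * (p - p')) * ((1 + s * p)⁻¹ * (1 + s * p')⁻¹) := by
    field_simp
    ring
  rw [h3, norm_mul, norm_neg, norm_mul, norm_mul]
  have h4 := mul_le_mul (norm_inv_one_add_le hs hp) (norm_inv_one_add_le hs hp') (norm_nonneg _)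
    zero_le_two
  have h5 := mul_le_mul hs hx (norm_nonneg _) (by norm_num)
  have h6 := mul_le_mul h5 h4 (by positivity) (by linarith [(norm_nonneg _).trans hx])
  linarith

lemma norm_kernel_le {s p q r c : ℂ} (hs : ‖s‖ ≤ 1 / 4) (hp : ‖p‖ ≤ 2) (hq : ‖q‖ ≤ 2)
    (hr : ‖r‖ ≤ 1) (hc : ‖c‖ ≤ 1) : ‖(q - r * p) * (1 + s * p)⁻¹ * (c - p)‖ ≤ 24 := by
  have h1 : ‖q - r * p‖ ≤ 4 := by
    refine (norm_sub_le _ _).trans ?_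
    rw [norm_mul]
    nlinarith [norm_nonneg r, norm_nonneg p]
  have h2 : ‖c - p‖ ≤ 3 := (norm_sub_le _ _).trans (by linarith)
  rw [norm_mul, norm_mul]
  have h3 := mul_le_mul h1 (norm_inv_one_add_le hs hp) (norm_nonneg _) (by norm_num)
  have h4 := mul_le_mul h3 h2 (norm_nonneg _) (by norm_num)
  linarith

/-- Here `p = B/A`, `q = B̄/A`, `r = Ā/A` and `c = f'(τ)`. In these variables the kernel has no
singularity left; `32 x + 8 y` comes from the product rule with factors bounded by `4`, `2` and `3`.
-/
lemma norm_kernel_sub_le {s p q c p' q' c' r : ℂ} {x y : ℝ} (hs : ‖s‖ ≤ 1 / 4) (hp : ‖p‖ ≤ 2)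
    (hp' : ‖p'‖ ≤ 2) (hq' : ‖q'‖ ≤ 2) (hr : ‖r‖ ≤ 1) (hc : ‖c‖ ≤ 1)
    (hpx : ‖p - p'‖ ≤ x) (hqx : ‖q - q'‖ ≤ x) (hcy : ‖c - c'‖ ≤ y) :
    ‖(q - r * p) * (1 + s * p)⁻¹ * (c - p) - (q' - r * p') * (1 + s * p')⁻¹ * (c' - p')‖ ≤
      32 * x + 8 * y := by
  have hx : 0 ≤ x := (norm_nonneg _).trans hpx
  have h1 : ‖(q - r * p) - (q' - r * p')‖ ≤ 2 * x := by
    have h2 : (q - r * p) - (q' - r * p') = (q - q') - r * (p - p') := by ring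
    rw [h2]
    refine (norm_sub_le _ _).trans ?_
    rw [norm_mul]
    nlinarith [norm_nonneg r, norm_nonneg (p - p')]
  have h3 : ‖q' - r * p'‖ ≤ 4 := by
    refine (norm_sub_le _ _).trans ?_
    rw [norm_mul]
    nlinarith [norm_nonneg r, norm_nonneg p']
  have h4 := norm_mul_sub_mul_le h1 (norm_inv_sub_inv_le hs hp hp' hpx)
    (norm_inv_one_add_le hs hp) h3
  have h5 : ‖(c - p) - (c' - p')‖ ≤ y + x := by
    have h2 : (c - p) - (c' - p') = (c - c') - (p - p') := by ring
    rw [h2]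
    exact (norm_sub_le _ _).trans (add_le_add hcy hpx)
  have h6 : ‖c - p‖ ≤ 3 := (norm_sub_le _ _).trans (by linarith)
  have h7 : ‖(q' - r * p') * (1 + s * p')⁻¹‖ ≤ 4 * 2 := by
    rw [norm_mul]
    exact mul_le_mul h3 (norm_inv_one_add_le hs hp') (norm_nonneg _) (by norm_num)
  have h8 := norm_mul_sub_mul_le h4 h5 h6 h7
  linarith

lemma kernel_eq {A B s c : ℂ} (hA : A ≠ 0) (hs : ‖s‖ ≤ 1 / 4) (hB : ‖B / A‖ ≤ 2) :
    (A * conj B - conj A * B) / (A * (A + s * B)) * (c - B / A) =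
      (conj B / A - conj A / A * (B / A)) * (1 + s * (B / A))⁻¹ * (c - B / A) := by
  have h1 : 1 + s * (B / A) ≠ 0 := norm_pos_iff.1 (by linarith [half_le_norm_one_add hs hB])
  have h2 : A + s * B = A * (1 + s * (B / A)) := by field_simp
  rw [h2]
  field_simp

/-- The bounds for the quotient `N / D` of the mutual interaction term. -/
lemma norm_mutual_bounds {d σ : ℝ} {t w s s' k c f : ℂ} (hd : 0 < d) (hσ : σ ≤ 1 / 4)
    (hσd : σ ≤ d / 8) (hs : ‖s‖ ≤ σ) (hs' : ‖s'‖ ≤ σ) (ht : ‖t‖ = 1) (hw : ‖w‖ = 1)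
    (hk : ‖k‖ ≤ 1) (hc : ‖c‖ ≤ 1) (hf : ‖f‖ ≤ 1) :
    ‖(conj t + s' * conj k) * (1 + s' * c)‖ ≤ 2 ∧
    ‖(conj t + s' * conj k) * (1 + s' * c) - conj t‖ ≤ 3 * σ ∧
    ‖s' * (t + s' * k) + s * (w + s * f)‖ ≤ 4 * σ ∧
    d / 2 ≤ ‖s' * (t + s' * k) + s * (w + s * f) - d‖ := by
  have hσ0 : 0 ≤ σ := (norm_nonneg s).trans hs
  have hsf : ∀ {s f w : ℂ}, ‖s‖ ≤ σ → ‖f‖ ≤ 1 → ‖w‖ = 1 → ‖s * (w + s * f)‖ ≤ 2 * σ := by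
    intro s f w hs hf hw
    have h1 : ‖w + s * f‖ ≤ 2 := by
      refine (norm_add_le _ _).trans ?_
      rw [norm_mul]
      nlinarith [norm_nonneg s, norm_nonneg f]
    rw [norm_mul]
    nlinarith [norm_nonneg s, norm_nonneg (w + s * f)]
  have h3 : ‖s' * (t + s' * k) + s * (w + s * f)‖ ≤ 4 * σ :=
    (norm_add_le _ _).trans (by linarith [hsf hs' hk ht, hsf hs hf hw])
  have hsk : ‖s' * conj k‖ ≤ σ := by
    rw [norm_mul, Complex.norm_conj]
    nlinarith [norm_nonneg s', norm_nonneg k]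
  have hsc : ‖s' * c‖ ≤ σ := by
    rw [norm_mul]
    nlinarith [norm_nonneg s', norm_nonneg c]
  have h1 : ‖conj t + s' * conj k‖ ≤ 5 / 4 := by
    refine (norm_add_le _ _).trans ?_
    rw [Complex.norm_conj]
    linarith
  have h2 : ‖1 + s' * c‖ ≤ 5 / 4 := by
    refine (norm_add_le _ _).trans ?_
    rw [norm_one]
    linarith
  refine ⟨?_, ?_, h3, ?_⟩
  · rw [norm_mul]
    have := mul_le_mul h1 h2 (norm_nonneg _) (by norm_num)
    linarith
  · have h4 : (conj t + s' * conj k) * (1 + s' * c) - conj t =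
        s' * conj k + (conj t + s' * conj k) * (s' * c) := by ring
    rw [h4]
    refine (norm_add_le _ _).trans ?_
    rw [norm_mul (conj t + s' * conj k)]
    have := mul_le_mul h1 hsc (norm_nonneg _) (by norm_num)
    linarith
  · have h5 := norm_sub_norm_le (d : ℂ) (s' * (t + s' * k) + s * (w + s * f))
    rw [Complex.norm_real, Real.norm_of_nonneg hd.le, norm_sub_rev] at h5
    linarith

/-- Subtracting the value at `ε = 0`, which is `-t̄/d`, leaves a numerator of size `(3d + 4) σ` over
a denominator of size at least `d²/2`. -/
lemma norm_mutual_add_inv_le {d σ : ℝ} {n D t : ℂ} (hd : 0 < d) (hσ : 0 ≤ σ) (ht : ‖t‖ = 1)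
    (hn : ‖n - conj t‖ ≤ 3 * σ) (hD : ‖D‖ ≤ 4 * σ) (hDd : d / 2 ≤ ‖D - d‖) :
    ‖n / (D - d) + conj t * (d : ℂ)⁻¹‖ ≤ (6 / d + 8 / d ^ 2) * σ := by
  have hdc : (d : ℂ) ≠ 0 := by exact_mod_cast hd.ne'
  have hDc : D - d ≠ 0 := norm_pos_iff.1 (by linarith)
  have h1 : n / (D - d) + conj t * (d : ℂ)⁻¹ = (d * (n - conj t) + conj t * D) / (d * (D - d)) := by
    field_simp
    ring
  have h2 : ‖d * (n - conj t) + conj t * D‖ ≤ d * (3 * σ) + 4 * σ := by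
    refine (norm_add_le _ _).trans ?_
    rw [norm_mul, norm_mul, Complex.norm_conj, ht, one_mul, Complex.norm_real,
      Real.norm_of_nonneg hd.le]
    exact add_le_add (mul_le_mul_of_nonneg_left hn hd.le) hD
  rw [h1, norm_div, norm_mul, Complex.norm_real, Real.norm_of_nonneg hd.le,
    div_le_iff₀ (mul_pos hd (by linarith))]
  refine h2.trans ?_
  have h3 : (6 / d + 8 / d ^ 2) * σ * (d * (d / 2)) = d * (3 * σ) + 4 * σ := by
    field_simp
    ring
  rw [← h3]
  gcongr

lemma norm_mutual_sub_le {d : ℝ} {n D n' D' : ℂ} {x y : ℝ} (hd : 0 < d) (hn' : ‖n'‖ ≤ 2)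
    (hD : d / 2 ≤ ‖D - d‖) (hD' : d / 2 ≤ ‖D' - d‖) (hx : ‖n - n'‖ ≤ x) (hy : ‖D - D'‖ ≤ y) :
    ‖n / (D - d) - n' / (D' - d)‖ ≤ 2 / d * x + 8 / d ^ 2 * y := by
  have hDc : D - d ≠ 0 := norm_pos_iff.1 (by linarith)
  have hDc' : D' - d ≠ 0 := norm_pos_iff.1 (by linarith)
  have h1 : n / (D - d) - n' / (D' - d) = (n - n') * (D - d)⁻¹ -
      n' * (D - D') * ((D - d)⁻¹ * (D' - d)⁻¹) := by
    field_simp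
    ring
  have h2 : ∀ {z : ℂ}, d / 2 ≤ ‖z‖ → ‖z⁻¹‖ ≤ 2 / d := fun {z} hz => by
    rw [norm_inv, ← inv_div]
    exact inv_anti₀ (by positivity) hz
  have hd2 : 0 ≤ 2 / d := by positivity
  rw [h1]
  refine (norm_sub_le _ _).trans (add_le_add ?_ ?_)
  · rw [norm_mul, mul_comm]
    exact mul_le_mul (h2 hD) hx (norm_nonneg _) hd2
  · rw [norm_mul, norm_mul, norm_mul]
    have h3 := mul_le_mul (h2 hD) (h2 hD') (norm_nonneg _) hd2
    have h4 := mul_le_mul hn' hy (norm_nonneg _) zero_le_two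
    have h5 := mul_le_mul h4 h3 (by positivity) (by linarith [(norm_nonneg _).trans hy])
    refine h5.trans (le_of_eq ?_)
    field_simp
    ring

end PointwiseBounds

end VortexPair

namespace VortexPair
open MeasureTheory Wiener

/-! ### Bounds for the mean of the self-interaction -/

section MeanBounds

/-- The integrand of the self-interaction term. -/
def selfKernel (s : ℂ) (f df : Circle → ℂ) (w τ : Circle) : ℂ :=
  let A : ℂ := τ - w
  let B : ℂ := f τ - f w
  (A * conj B - conj A * B) / (A * (A + s * B)) * (df τ - B / A)

/-- The integrand of the mutual interaction term. -/
def mutualKernel (d : ℝ) (s s' : ℂ) (f f' df' : Circle → ℂ) (w τ : Circle) : ℂ :=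
  (conj (τ : ℂ) + s' * conj (f' τ)) * (1 + s' * df' τ) /
    (s' * (τ + s' * f' τ) + s * (w + s * f w) - d)

lemma complexComponent_eq (d ε U γ γ' b b' : ℝ) (f df f' df' : Circle → ℂ) (w : Circle) :
    complexComponent d ε U γ γ' b b' f df f' df' w =
      2 * U * w * (1 + (ε * b : ℝ) * df w) - γ * df w
        + (ε * b : ℝ) * γ * w * (1 + (ε * b : ℝ) * df w) *
          circleMean (selfKernel (ε * b : ℝ) f df w)
        + γ' * w * (1 + (ε * b : ℝ) * df w) *
          circleMean (mutualKernel d (ε * b : ℝ) (ε * b' : ℝ) f f' df' w) := by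
  have h1 : mutualKernel d (ε * b : ℝ) (ε * b' : ℝ) f f' df' w = fun τ : Circle =>
      (conj (τ : ℂ) + ε * b' * conj (f' τ)) * (1 + ε * b' * df' τ) /
        (ε * (b' * τ + b * w) + ε ^ 2 * (b' ^ 2 * f' τ + b ^ 2 * f w) - d) := by
    funext τ
    rw [mutualKernel]
    push_cast
    congr 1
    ring
  rw [h1]
  unfold selfKernel complexComponent
  simp only [Complex.ofReal_mul]

/-- Functions in the unit ball of `C¹`. -/
structure IsC1Unit (f : Circle → ℂ) : Prop where
  differentiable : CircleDifferentiable f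
  continuous_deriv : Continuous (circleDeriv f)
  norm_le : ∀ w, ‖f w‖ ≤ 1
  deriv_norm_le : ∀ w, ‖circleDeriv f w‖ ≤ 1

lemma circleDeriv_sub {f g : Circle → ℂ} (hf : CircleDifferentiable f)
    (hg : CircleDifferentiable g) : circleDeriv (f - g) = circleDeriv f - circleDeriv g := by
  funext w
  have h := deriv_fun_sub (hf w) (hg w)
  simp only [circleDeriv, Pi.sub_apply, h, sub_div]

lemma CircleDifferentiable.sub {f g : Circle → ℂ} (hf : CircleDifferentiable f)
    (hg : CircleDifferentiable g) : CircleDifferentiable (f - g) :=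
  fun w => (hf w).fun_sub (hg w)

lemma norm_circle_mul_exp_sub (w : Circle) (θ : ℝ) :
    ‖((w * Circle.exp θ : Circle) : ℂ) - w‖ = ‖(Circle.exp θ : ℂ) - 1‖ := by
  have h : ((w * Circle.exp θ : Circle) : ℂ) - w = w * ((Circle.exp θ : ℂ) - 1) := by
    rw [Circle.coe_mul]; ring
  rw [h, norm_mul, Circle.norm_coe, one_mul]

lemma intervalIntegrable_of_norm_le {h : ℝ → ℂ} {M : ℝ} (hm : Measurable h)
    (hM : ∀ θ, 0 < θ → θ < 2 * π → ‖h θ‖ ≤ M) : IntervalIntegrable h volume 0 (2 * π) := by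
  rw [intervalIntegrable_iff, Set.uIoc_of_le Real.two_pi_pos.le]
  refine Measure.integrableOn_of_bounded (M := M) measure_Ioc_lt_top.ne hm.aestronglyMeasurable ?_
  have h1 : ∀ᵐ θ : ℝ, θ ≠ 2 * π := by simp [ae_iff]
  filter_upwards [ae_restrict_of_ae h1, ae_restrict_mem measurableSet_Ioc] with θ hθ hθ'
  exact hM θ hθ'.1 (lt_of_le_of_ne hθ'.2 hθ)

lemma circleMean_sub (w : Circle) {h k : Circle → ℂ}
    (hh : IntervalIntegrable (fun θ : ℝ => h (w * Circle.exp θ)) volume 0 (2 * π))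
    (hk : IntervalIntegrable (fun θ : ℝ => k (w * Circle.exp θ)) volume 0 (2 * π)) :
    circleMean h - circleMean k = circleMean fun τ => h τ - k τ := by
  have he : Continuous fun θ : ℝ => (Circle.exp θ : ℂ) :=
    continuous_subtype_val.comp Circle.exp.continuous
  have hh' := hh.continuousOn_mul he.continuousOn
  have hk' := hk.continuousOn_mul he.continuousOn
  rw [circleMean_rotate h w, circleMean_rotate k w, circleMean_rotate (fun τ => h τ - k τ) w,
    circleMean_eq, circleMean_eq, circleMean_eq, ← mul_sub, ← mul_sub,
    ← intervalIntegral.integral_sub hh' hk']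
  simp only [mul_sub]

/-- The normalisation `1/(2π)` is simply discarded, and `7` bounds the length `2π` of the interval.
-/
lemma norm_circleMean_le_const {h : Circle → ℂ} {M : ℝ} (w : Circle) (hM0 : 0 ≤ M)
    (hM : ∀ θ, 0 < θ → θ < 2 * π → ‖h (w * Circle.exp θ)‖ ≤ M) : ‖circleMean h‖ ≤ 7 * M := by
  have h1 := norm_circleMean_le (k := fun _ => M) w intervalIntegrable_const hM
  rw [intervalIntegral.integral_const, sub_zero, smul_eq_mul] at h1
  refine h1.trans (mul_le_mul_of_nonneg_right ?_ hM0)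
  linarith [Real.pi_lt_d2]

variable {f f₀ : Circle → ℂ} (hf : IsC1Unit f) (hf₀ : IsC1Unit f₀)

include hf

lemma IsC1Unit.quotient_le (w : Circle) {θ : ℝ} (h0 : 0 < θ) (h1 : θ < 2 * π) :
    ‖(f (w * Circle.exp θ) - f w) / (((w * Circle.exp θ : Circle) : ℂ) - w)‖ ≤ 2 := by
  have h2 := norm_sub_le_mul_chord hf.differentiable hf.deriv_norm_le w h0.le h1.le
  rw [norm_div, norm_circle_mul_exp_sub]
  exact div_le_of_le_mul₀ (norm_nonneg _) zero_le_two (by linarith)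

lemma IsC1Unit.measurable_selfKernel (s : ℂ) (w : Circle) :
    Measurable fun θ : ℝ => selfKernel s f (circleDeriv f) w (w * Circle.exp θ) := by
  have he : Continuous fun θ : ℝ => w * Circle.exp θ :=
    continuous_const.mul Circle.exp.continuous
  have hA : Continuous fun θ : ℝ => ((w * Circle.exp θ : Circle) : ℂ) - w :=
    (continuous_subtype_val.comp he).sub continuous_const
  have hB : Continuous fun θ : ℝ => f (w * Circle.exp θ) - f w :=
    (hf.differentiable.continuous.comp he).sub continuous_const
  have hd : Continuous fun θ : ℝ => circleDeriv f (w * Circle.exp θ) :=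
    hf.continuous_deriv.comp he
  exact (((hA.mul (Complex.continuous_conj.comp hB)).sub
    ((Complex.continuous_conj.comp hA).mul hB)).measurable.div
    (hA.mul (hA.add (continuous_const.mul hB))).measurable).mul
    (hd.measurable.sub (hB.measurable.div hA.measurable))

omit hf in
lemma circle_mul_exp_ne (w : Circle) {θ : ℝ} (h0 : 0 < θ) (h1 : θ < 2 * π) :
    ((w * Circle.exp θ : Circle) : ℂ) - w ≠ 0 :=
  circle_sub_ne_zero fun h2 => circle_exp_ne_one h0 h1 (mul_eq_left.1 h2)

omit hf in
lemma norm_conj_div_self_le (A : ℂ) : ‖conj A / A‖ ≤ 1 := by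
  rw [norm_div, Complex.norm_conj]
  exact div_self_le_one _

omit hf in
lemma selfKernel_eq {s : ℂ} {df : Circle → ℂ} {τ w : Circle} (hA : (τ : ℂ) - w ≠ 0)
    (hs : ‖s‖ ≤ 1 / 4) (hB : ‖(f τ - f w) / (τ - w)‖ ≤ 2) : selfKernel s f df w τ =
      (conj (f τ - f w) / (τ - w) - conj ((τ : ℂ) - w) / (τ - w) * ((f τ - f w) / (τ - w))) *
        (1 + s * ((f τ - f w) / (τ - w)))⁻¹ * (df τ - (f τ - f w) / (τ - w)) :=
  kernel_eq hA hs hB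

lemma IsC1Unit.norm_selfKernel_le {s : ℂ} (hs : ‖s‖ ≤ 1 / 4) (w : Circle) {θ : ℝ} (h0 : 0 < θ)
    (h1 : θ < 2 * π) : ‖selfKernel s f (circleDeriv f) w (w * Circle.exp θ)‖ ≤ 24 := by
  have hq := hf.quotient_le w h0 h1
  rw [selfKernel_eq (circle_mul_exp_ne w h0 h1) hs hq]
  refine norm_kernel_le hs hq ?_ (norm_conj_div_self_le _) (hf.deriv_norm_le _)
  rw [norm_div, Complex.norm_conj, ← norm_div]
  exact hq

lemma IsC1Unit.norm_circleMean_selfKernel_le {s : ℂ} (hs : ‖s‖ ≤ 1 / 4) (w : Circle) :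
    ‖circleMean (selfKernel s f (circleDeriv f) w)‖ ≤ 168 :=
  (norm_circleMean_le_const w (by norm_num)
    fun _ h0 h1 => hf.norm_selfKernel_le hs w h0 h1).trans (by norm_num)

include hf₀

/-- The `L²` norm of the difference of the derivatives. -/
lemma IsC1Unit.norm_selfKernel_sub_le {s : ℂ} (hs : ‖s‖ ≤ 1 / 4) (w : Circle) {θ : ℝ}
    (h0 : 0 < θ) (h1 : θ < 2 * π) :
    ‖selfKernel s f (circleDeriv f) w (w * Circle.exp θ) -
      selfKernel s f₀ (circleDeriv f₀) w (w * Circle.exp θ)‖ ≤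
      32 * (2 * l2Norm (circleDeriv (f - f₀)) * rootKernel θ) +
        8 * ‖circleDeriv (f - f₀) (w * Circle.exp θ)‖ := by
  have hq := hf.quotient_le w h0 h1
  have hq₀ := hf₀.quotient_le w h0 h1
  have hA := circle_mul_exp_ne w h0 h1
  have hd := hf.differentiable.sub hf₀.differentiable
  have hde := circleDeriv_sub hf.differentiable hf₀.differentiable
  have hdc : Continuous (circleDeriv (f - f₀)) := by
    rw [hde]
    exact hf.continuous_deriv.sub hf₀.continuous_deriv
  have hg := norm_sub_le_rootKernel hd hdc w h0 h1
  rw [← norm_circle_mul_exp_sub w, ← div_le_iff₀ (norm_pos_iff.2 hA), ← norm_div] at hg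
  rw [selfKernel_eq hA hs hq, selfKernel_eq hA hs hq₀]
  have e1 : (f - f₀) (w * Circle.exp θ) - (f - f₀) w =
      (f (w * Circle.exp θ) - f w) - (f₀ (w * Circle.exp θ) - f₀ w) := by
    simp only [Pi.sub_apply]
    ring
  rw [e1, sub_div] at hg
  refine norm_kernel_sub_le hs hq hq₀ ?_ (norm_conj_div_self_le _) (hf.deriv_norm_le _) hg ?_ ?_
  · rw [norm_div, Complex.norm_conj, ← norm_div]
    exact hq₀
  · rw [← sub_div, ← map_sub, norm_div, Complex.norm_conj, ← norm_div, sub_div]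
    exact hg
  · rw [hde]
    exact le_rfl

lemma IsC1Unit.continuous_circleDeriv_sub : Continuous (circleDeriv (f - f₀)) := by
  rw [circleDeriv_sub hf.differentiable hf₀.differentiable]
  exact hf.continuous_deriv.sub hf₀.continuous_deriv

/-- Quotients of differences contribute through the integrable root kernel, with factor `32 · 2`.
The difference of the derivatives contributes through its `L¹` norm, with factor `8 · 3`. No Hölder
norm appears. -/
lemma IsC1Unit.norm_circleMean_selfKernel_sub_le {s : ℂ} (hs : ‖s‖ ≤ 1 / 4) (w : Circle) :
    ‖circleMean (selfKernel s f (circleDeriv f) w) -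
      circleMean (selfKernel s f₀ (circleDeriv f₀) w)‖ ≤
      (64 * (∫ θ in (0 : ℝ)..(2 * π), rootKernel θ) + 24) * l2Norm (circleDeriv (f - f₀)) := by
  have hdc := hf.continuous_circleDeriv_sub hf₀
  rw [circleMean_sub w
    (intervalIntegrable_of_norm_le (hf.measurable_selfKernel s w)
      fun θ h0 h1 => hf.norm_selfKernel_le hs w h0 h1)
    (intervalIntegrable_of_norm_le (hf₀.measurable_selfKernel s w)
      fun θ h0 h1 => hf₀.norm_selfKernel_le hs w h0 h1)]
  have i1 : IntervalIntegrable (fun θ => 32 * (2 * l2Norm (circleDeriv (f - f₀)) * rootKernel θ))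
      volume 0 (2 * π) := (intervalIntegrable_rootKernel.const_mul _).const_mul _
  have i2 : IntervalIntegrable (fun θ => 8 * ‖circleDeriv (f - f₀) (w * Circle.exp θ)‖)
      volume 0 (2 * π) :=
    (continuous_const.mul (hdc.comp
      (continuous_const.mul Circle.exp.continuous)).norm).intervalIntegrable _ _
  refine (norm_circleMean_le w (i1.add i2)
    fun θ h0 h1 => hf.norm_selfKernel_sub_le hf₀ hs w h0 h1).trans ?_
  rw [intervalIntegral.integral_add i1 i2, intervalIntegral.integral_const_mul,
    intervalIntegral.integral_const_mul, intervalIntegral.integral_const_mul]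
  have h1 := integral_norm_circleDeriv_le hdc w
  linarith

omit hf hf₀ in
lemma integral_rootKernel_nonneg : 0 ≤ ∫ θ in (0 : ℝ)..(2 * π), rootKernel θ :=
  intervalIntegral.integral_nonneg Real.two_pi_pos.le fun _ h => rootKernel_nonneg h.1 h.2

end MeanBounds

/-! ### Bounds for the mean of the mutual interaction -/

section MutualBounds

variable {d σ : ℝ} {s s' : ℂ} (hd : 0 < d) (hσ : σ ≤ 1 / 4) (hσd : σ ≤ d / 8) (hs : ‖s‖ ≤ σ)
  (hs' : ‖s'‖ ≤ σ)

lemma measurable_mutualKernel (d : ℝ) (s s' : ℂ) (f : Circle → ℂ) {k : Circle → ℂ}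
    (hk : IsC1Unit k) (w : Circle) :
    Measurable fun θ : ℝ => mutualKernel d s s' f k (circleDeriv k) w (w * Circle.exp θ) := by
  have he : Continuous fun θ : ℝ => w * Circle.exp θ :=
    continuous_const.mul Circle.exp.continuous
  have ht : Continuous fun θ : ℝ => ((w * Circle.exp θ : Circle) : ℂ) :=
    continuous_subtype_val.comp he
  have hB : Continuous fun θ : ℝ => k (w * Circle.exp θ) := hk.differentiable.continuous.comp he
  have hd : Continuous fun θ : ℝ => circleDeriv k (w * Circle.exp θ) :=
    hk.continuous_deriv.comp he
  exact ((((Complex.continuous_conj.comp ht).add (continuous_const.mul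
    (Complex.continuous_conj.comp hB))).mul (continuous_const.add
    (continuous_const.mul hd))).measurable).div
    (((continuous_const.mul (ht.add (continuous_const.mul hB))).add
      continuous_const).sub continuous_const).measurable

variable {f k f₀ k₀ : Circle → ℂ} (hf : IsC1Unit f) (hk : IsC1Unit k) (hf₀ : IsC1Unit f₀)
  (hk₀ : IsC1Unit k₀)
include hd hσ hσd hs hs' hf hk

lemma norm_mutualKernel_le (w τ : Circle) :
    ‖mutualKernel d s s' f k (circleDeriv k) w τ‖ ≤ 4 / d := by
  obtain ⟨h1, -, -, h4⟩ := norm_mutual_bounds hd hσ hσd hs hs' (Circle.norm_coe τ)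
    (Circle.norm_coe w) (hk.norm_le τ) (hk.deriv_norm_le τ) (hf.norm_le w)
  rw [mutualKernel, norm_div, div_le_div_iff₀ (by linarith) hd]
  nlinarith

lemma norm_circleMean_mutualKernel_le (w : Circle) :
    ‖circleMean (mutualKernel d s s' f k (circleDeriv k) w)‖ ≤ 28 / d :=
  (norm_circleMean_le_const w (by positivity)
    fun _ _ _ => norm_mutualKernel_le hd hσ hσd hs hs' hf hk w _).trans (le_of_eq (by ring))

lemma intervalIntegrable_mutualKernel (w : Circle) : IntervalIntegrable
    (fun θ : ℝ => mutualKernel d s s' f k (circleDeriv k) w (w * Circle.exp θ)) volume 0 (2 * π) :=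
  intervalIntegrable_of_norm_le (measurable_mutualKernel d s s' f hk w)
    fun _ _ _ => norm_mutualKernel_le hd hσ hσd hs hs' hf hk w _

/-- The mean of `τ̄` is `1`, so `-1/d` is the mean of the kernel at `ε = 0`, and the deviation is of
order `σ`. -/
lemma norm_circleMean_mutualKernel_add_le (w : Circle) :
    ‖circleMean (mutualKernel d s s' f k (circleDeriv k) w) + (d : ℂ)⁻¹‖ ≤
      7 * ((6 / d + 8 / d ^ 2) * σ) := by
  have hσ0 : 0 ≤ σ := (norm_nonneg s).trans hs
  have hm : circleMean (fun τ => -(conj (τ : ℂ) * (d : ℂ)⁻¹)) = -(d : ℂ)⁻¹ := by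
    have h1 : ∀ θ : ℝ, (Circle.exp θ : ℂ) * -(conj (Circle.exp θ : ℂ) * (d : ℂ)⁻¹) = -(d : ℂ)⁻¹ :=
      fun θ => by linear_combination (-(d : ℂ)⁻¹) * circle_conj_mul_self (Circle.exp θ)
    rw [circleMean_eq]
    simp only [h1]
    rw [intervalIntegral.integral_const, sub_zero, Complex.real_smul]
    have h2 : (π : ℂ) ≠ 0 := by exact_mod_cast Real.pi_ne_zero
    push_cast
    field_simp
  have hi : IntervalIntegrable (fun θ : ℝ => -(conj ((w * Circle.exp θ : Circle) : ℂ) * (d : ℂ)⁻¹))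
      volume 0 (2 * π) :=
    ((Complex.continuous_conj.comp (continuous_subtype_val.comp
      (continuous_const.mul Circle.exp.continuous))).mul continuous_const).neg.intervalIntegrable _ _
  have h3 := circleMean_sub (k := fun τ => -(conj (τ : ℂ) * (d : ℂ)⁻¹)) w
    (intervalIntegrable_mutualKernel hd hσ hσd hs hs' hf hk w) hi
  rw [hm, sub_neg_eq_add] at h3
  rw [h3]
  refine norm_circleMean_le_const w (by positivity) fun θ _ _ => ?_
  obtain ⟨-, h2, h3, h4⟩ := norm_mutual_bounds hd hσ hσd hs hs' (Circle.norm_coe (w * Circle.exp θ))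
    (Circle.norm_coe w) (hk.norm_le _) (hk.deriv_norm_le _) (hf.norm_le w)
  rw [sub_neg_eq_add]
  exact norm_mutual_add_inv_le hd hσ0 (Circle.norm_coe _) h2 h3 h4

include hf₀ hk₀

/-- Every occurrence of a profile or its derivative carries a factor of size `σ`. The constant is
`24 = 21 + 3`: the sup norms integrated over an interval of length below `7`, and the `L¹` norm of
the derivative. -/
lemma norm_circleMean_mutualKernel_sub_le (w : Circle) {m m' : ℝ}
    (hm : ∀ w, ‖f w - f₀ w‖ ≤ 3 * m) (hm' : ∀ w, ‖k w - k₀ w‖ ≤ 3 * m')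
    (hl : l2Norm (circleDeriv (k - k₀)) = m') :
    ‖circleMean (mutualKernel d s s' f k (circleDeriv k) w) -
      circleMean (mutualKernel d s s' f₀ k₀ (circleDeriv k₀) w)‖ ≤
      24 * ((6 / d + 8 / d ^ 2) * σ) * (m + m') := by
  have hσ0 : 0 ≤ σ := (norm_nonneg s).trans hs
  have hdc := hk.continuous_circleDeriv_sub hk₀
  rw [circleMean_sub w (intervalIntegrable_mutualKernel hd hσ hσd hs hs' hf hk w)
    (intervalIntegrable_mutualKernel hd hσ hσd hs hs' hf₀ hk₀ w)]
  set C := (6 / d + 8 / d ^ 2) * σ with hC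
  have hC0 : 0 ≤ C := by positivity
  have i2 : IntervalIntegrable (fun θ => C * ‖circleDeriv (k - k₀) (w * Circle.exp θ)‖)
      volume 0 (2 * π) :=
    (continuous_const.mul (hdc.comp
      (continuous_const.mul Circle.exp.continuous)).norm).intervalIntegrable _ _
  have i1 : IntervalIntegrable (fun _ : ℝ => C * (3 * m + 3 * m')) volume 0 (2 * π) :=
    intervalIntegrable_const
  refine (norm_circleMean_le w (i1.add i2) fun θ h0 h1 => ?_).trans ?_
  · set τ := w * Circle.exp θ
    obtain ⟨a1, -, -, a4⟩ := norm_mutual_bounds hd hσ hσd hs hs' (Circle.norm_coe τ)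
      (Circle.norm_coe w) (hk.norm_le τ) (hk.deriv_norm_le τ) (hf.norm_le w)
    obtain ⟨b1, -, -, b4⟩ := norm_mutual_bounds hd hσ hσd hs hs' (Circle.norm_coe τ)
      (Circle.norm_coe w) (hk₀.norm_le τ) (hk₀.deriv_norm_le τ) (hf₀.norm_le w)
    have e1 : circleDeriv (k - k₀) τ = circleDeriv k τ - circleDeriv k₀ τ := by
      rw [circleDeriv_sub hk.differentiable hk₀.differentiable]; rfl
    have hkτ := hm' τ
    have hfw := hm w
    set y := ‖circleDeriv (k - k₀) τ‖ with hy
    have hss : ∀ {s z : ℂ} {r : ℝ}, ‖s‖ ≤ σ → ‖z‖ ≤ r → ‖s * z‖ ≤ σ * r := fun {s z r} h2 h3 => by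
      rw [norm_mul]
      exact mul_le_mul h2 h3 (norm_nonneg _) hσ0
    have hn : ‖(conj (τ : ℂ) + s' * conj (k τ)) * (1 + s' * circleDeriv k τ) -
        (conj (τ : ℂ) + s' * conj (k₀ τ)) * (1 + s' * circleDeriv k₀ τ)‖ ≤
        σ * (3 * m') * 2 + 2 * (σ * y) := by
      refine norm_mul_sub_mul_le ?_ ?_ ?_ ?_
      · rw [add_sub_add_left_eq_sub, ← mul_sub, ← map_sub]
        exact hss hs' (by rwa [Complex.norm_conj])
      · rw [add_sub_add_left_eq_sub, ← mul_sub]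
        exact hss hs' (by rw [← e1])
      · refine (norm_add_le _ _).trans ?_
        rw [norm_one]
        linarith [hss hs' (hk.deriv_norm_le τ)]
      · refine (norm_add_le _ _).trans ?_
        rw [Complex.norm_conj, Circle.norm_coe]
        linarith [hss hs' ((Complex.norm_conj (k₀ τ)).trans_le (hk₀.norm_le τ))]
    have hD : ‖(s' * (τ + s' * k τ) + s * (w + s * f w)) -
        (s' * (τ + s' * k₀ τ) + s * (w + s * f₀ w))‖ ≤ σ * (σ * (3 * m')) + σ * (σ * (3 * m)) := by
      have e2 : (s' * (τ + s' * k τ) + s * (w + s * f w)) -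
        (s' * (τ + s' * k₀ τ) + s * (w + s * f₀ w)) =
          s' * (s' * (k τ - k₀ τ)) + s * (s * (f w - f₀ w)) := by ring
      rw [e2]
      exact (norm_add_le _ _).trans (add_le_add (hss hs' (hss hs' hkτ)) (hss hs (hss hs hfw)))
    have h2 := norm_mutual_sub_le hd b1 a4 b4 hn hD
    refine h2.trans ?_
    have hm0 : 0 ≤ 3 * m := (norm_nonneg _).trans hfw
    have hm0' : 0 ≤ 3 * m' := (norm_nonneg _).trans hkτ
    have hy0 : 0 ≤ y := norm_nonneg _
    have hσσ : σ * σ ≤ σ := by nlinarith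
    have h3 : 8 / d ^ 2 * (σ * (σ * (3 * m')) + σ * (σ * (3 * m))) ≤
        8 / d ^ 2 * (σ * (3 * m + 3 * m' + y)) := by
      refine mul_le_mul_of_nonneg_left ?_ (by positivity)
      nlinarith
    have h4 : 2 / d * (σ * (3 * m') * 2 + 2 * (σ * y)) ≤
        6 / d * (σ * (3 * m + 3 * m' + y)) := by
      have h5 : 2 / d * (σ * (3 * m') * 2 + 2 * (σ * y)) =
          1 / d * (σ * (4 * (3 * m') + 4 * y)) := by ring
      have h6 : 6 / d * (σ * (3 * m + 3 * m' + y)) =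
          1 / d * (σ * (6 * (3 * m + 3 * m' + y))) := by ring
      rw [h5, h6]
      refine mul_le_mul_of_nonneg_left (mul_le_mul_of_nonneg_left ?_ hσ0) (by positivity)
      linarith
    have h7 : C * (3 * m + 3 * m') + C * y = 6 / d * (σ * (3 * m + 3 * m' + y)) +
        8 / d ^ 2 * (σ * (3 * m + 3 * m' + y)) := by rw [hC]; ring
    rw [h7]
    linarith
  · rw [intervalIntegral.integral_add i1 i2, intervalIntegral.integral_const,
      intervalIntegral.integral_const_mul, sub_zero, smul_eq_mul]
    have h1 := integral_norm_circleDeriv_le hdc w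
    rw [hl] at h1
    have hm0 : 0 ≤ 3 * m := (norm_nonneg _).trans (hm 1)
    have hm0' : 0 ≤ 3 * m' := (norm_nonneg _).trans (hm' 1)
    have h2 : C * (∫ x in (0 : ℝ)..(2 * π), ‖circleDeriv (k - k₀) (w * Circle.exp x)‖) ≤
        C * (3 * m') := mul_le_mul_of_nonneg_left h1 hC0
    have h3 : 2 * π * (C * (3 * m + 3 * m')) ≤ 7 * (C * (3 * m + 3 * m')) :=
      mul_le_mul_of_nonneg_right (by linarith [Real.pi_lt_d2])
        (mul_nonneg hC0 (by linarith))
    have h4 : 0 ≤ C * m := mul_nonneg hC0 (by linarith)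
    linarith

end MutualBounds

end VortexPair

namespace VortexPair
open MeasureTheory Wiener

/-! ### The remainder estimate and the `L²` lower bound -/

section Uniqueness

/-- The constant in `norm_complexComponent_sub_le`. -/
def remainderConst (d Γ : ℝ) : ℝ :=
  (2 + 2 * Γ) + 1 + (336 + 168 * Γ + 2 * Γ * (64 * (∫ θ in (0 : ℝ)..(2 * π), rootKernel θ) + 24)) +
    (7 * (6 / d + 8 / d ^ 2) + 28 / d + 28 / d * Γ + 48 * Γ * (6 / d + 8 / d ^ 2))

lemma remainderConst_nonneg {d Γ : ℝ} (hd : 0 < d) (hΓ : 0 ≤ Γ) : 0 ≤ remainderConst d Γ := by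
  have := integral_rootKernel_nonneg
  unfold remainderConst
  positivity

/-- The functional at nearby arguments differs from its linearisation at the point vortex pair by a
small remainder. -/
lemma norm_complexComponent_sub_le {d σ η Γ ε b b' U U₀ γ γ₀ γ' γ₀' m m' : ℝ}
    {f f₀ k k₀ : Circle → ℂ} (hd : 0 < d) (hσ : σ ≤ 1 / 4) (hσd : σ ≤ d / 8)
    (hb : |ε * b| ≤ σ) (hb' : |ε * b'| ≤ σ) (hf : IsC1Unit f) (hf₀ : IsC1Unit f₀)
    (hk : IsC1Unit k) (hk₀ : IsC1Unit k₀) (hη : ∀ w, ‖circleDeriv f w‖ ≤ η)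
    (hU₀ : |U₀| ≤ Γ) (hγ₀ : |γ₀| ≤ Γ) (hγ₀' : |γ₀'| ≤ Γ)
    (hm : ∀ w, ‖f w - f₀ w‖ ≤ 3 * m) (hm' : ∀ w, ‖k w - k₀ w‖ ≤ 3 * m')
    (hlm : l2Norm (circleDeriv (f - f₀)) = m) (hlm' : l2Norm (circleDeriv (k - k₀)) = m')
    (w : Circle) :
    ‖complexComponent d ε U γ γ' b b' f (circleDeriv f) k (circleDeriv k) w -
      complexComponent d ε U₀ γ₀ γ₀' b b' f₀ (circleDeriv f₀) k₀ (circleDeriv k₀) w -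
      (((2 * (U - U₀) - (γ' - γ₀') / d : ℝ) : ℂ) * w - γ₀ * circleDeriv (f - f₀) w)‖ ≤
    remainderConst d Γ * (σ + η) * (|U - U₀| + |γ - γ₀| + |γ' - γ₀'| + m + m' +
      ‖circleDeriv (f - f₀) w‖) := by
  have hs : ‖((ε * b : ℝ) : ℂ)‖ ≤ σ := by rwa [Complex.norm_real]
  have hs' : ‖((ε * b' : ℝ) : ℂ)‖ ≤ σ := by rwa [Complex.norm_real]
  have hσ0 : 0 ≤ σ := (abs_nonneg _).trans hb
  have hη0 : 0 ≤ η := (norm_nonneg _).trans (hη 1)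
  have hΓ0 : 0 ≤ Γ := (abs_nonneg _).trans hU₀
  have hS := hf.norm_circleMean_selfKernel_le (hs.trans hσ) w
  have hSS := hf.norm_circleMean_selfKernel_sub_le hf₀ (hs.trans hσ) w
  have hM := norm_circleMean_mutualKernel_le hd hσ hσd hs hs' hf hk w
  have hMd := norm_circleMean_mutualKernel_add_le hd hσ hσd hs hs' hf hk w
  have hMM := norm_circleMean_mutualKernel_sub_le hd hσ hσd hs hs' hf hk hf₀ hk₀ w hm hm' hlm'
  have hdc : (d : ℂ) ≠ 0 := by exact_mod_cast hd.ne'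
  have he : circleDeriv f₀ w = circleDeriv f w - circleDeriv (f - f₀) w := by
    rw [circleDeriv_sub hf.differentiable hf₀.differentiable, Pi.sub_apply]
    ring
  have hfw := hf.deriv_norm_le w
  have hf₀w := hf₀.deriv_norm_le w
  have hηw := hη w
  have hJ := integral_rootKernel_nonneg
  rw [hlm] at hSS
  rw [complexComponent_eq, complexComponent_eq]
  set s : ℂ := ((ε * b : ℝ) : ℂ)
  set S := circleMean (selfKernel s f (circleDeriv f) w)
  set S₀ := circleMean (selfKernel s f₀ (circleDeriv f₀) w)
  set M := circleMean (mutualKernel d s (ε * b' : ℝ) f k (circleDeriv k) w)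
  set M₀ := circleMean (mutualKernel d s (ε * b' : ℝ) f₀ k₀ (circleDeriv k₀) w)
  set p := circleDeriv f w
  set p₀ := circleDeriv f₀ w
  set q := circleDeriv (f - f₀) w with hq
  set cS := 64 * (∫ θ in (0 : ℝ)..(2 * π), rootKernel θ) + 24 with hcS
  set cM := 6 / d + 8 / d ^ 2 with hcM
  have hcM0 : 0 ≤ cM := by positivity
  have hcS0 : 0 ≤ cS := by positivity
  have hm0 : 0 ≤ m := by rw [← hlm]; exact l2Norm_nonneg _
  have hm0' : 0 ≤ m' := by rw [← hlm']; exact l2Norm_nonneg _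
  have hw := Circle.norm_coe w
  have h1s : ∀ {z : ℂ}, ‖z‖ ≤ 1 → ‖1 + s * z‖ ≤ 2 := fun {z} hz => by
    refine (norm_add_le _ _).trans ?_
    rw [norm_one, norm_mul]
    nlinarith [norm_nonneg s, norm_nonneg z]
  -- Each term on the right pairs a difference of the unknowns with a small factor: `s`, the small
  -- derivative `p`, the mean `M + 1/d`, or the difference `M - M₀`, which itself carries a `σ`.
  have hid : 2 * (U : ℂ) * (w : ℂ) * (1 + s * p) - (γ : ℂ) * p +
        s * (γ : ℂ) * (w : ℂ) * (1 + s * p) * S + (γ' : ℂ) * (w : ℂ) * (1 + s * p) * M -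
      (2 * (U₀ : ℂ) * (w : ℂ) * (1 + s * p₀) - (γ₀ : ℂ) * p₀ +
        s * (γ₀ : ℂ) * (w : ℂ) * (1 + s * p₀) * S₀ +
        (γ₀' : ℂ) * (w : ℂ) * (1 + s * p₀) * M₀) -
      (((2 * (U - U₀) - (γ' - γ₀') / d : ℝ) : ℂ) * (w : ℂ) - (γ₀ : ℂ) * q) =
      (w : ℂ) * (2 * s * (((U - U₀ : ℝ) : ℂ) * p + (U₀ : ℂ) * q)) - ((γ - γ₀ : ℝ) : ℂ) * p +
      (w : ℂ) * (s * (((γ - γ₀ : ℝ) : ℂ) * ((1 + s * p) * S) + (γ₀ : ℂ) * (s * q * S) +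
        (γ₀ : ℂ) * ((1 + s * p₀) * (S - S₀)))) +
      (w : ℂ) * (((γ' - γ₀' : ℝ) : ℂ) * (M + (d : ℂ)⁻¹) + ((γ' - γ₀' : ℝ) : ℂ) * (s * p * M) +
        (γ₀' : ℂ) * (s * q * M) + (γ₀' : ℂ) * ((1 + s * p₀) * (M - M₀))) := by
    rw [he]
    push_cast
    rw [div_eq_mul_inv]
    ring
  rw [hid]
  set T := |U - U₀| + |γ - γ₀| + |γ' - γ₀'| + m + m' + ‖q‖ with hT
  have hq0 := norm_nonneg q
  have t1 : |U - U₀| ≤ T := by linarith [abs_nonneg (γ - γ₀), abs_nonneg (γ' - γ₀')]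
  have t2 : |γ - γ₀| ≤ T := by linarith [abs_nonneg (U - U₀), abs_nonneg (γ' - γ₀')]
  have t3 : |γ' - γ₀'| ≤ T := by linarith [abs_nonneg (U - U₀), abs_nonneg (γ - γ₀)]
  have t4 : m + m' ≤ T := by
    linarith [abs_nonneg (U - U₀), abs_nonneg (γ - γ₀), abs_nonneg (γ' - γ₀')]
  have t5 : ‖q‖ ≤ T := by
    linarith [abs_nonneg (U - U₀), abs_nonneg (γ - γ₀), abs_nonneg (γ' - γ₀')]
  have hT0 : 0 ≤ T := hq0.trans t5
  have hr : ∀ {x a : ℝ} {z : ℂ} {c : ℝ}, |x| ≤ a → ‖z‖ ≤ c → ‖(x : ℂ) * z‖ ≤ a * c :=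
    fun {x a z c} hx hz => by
      rw [norm_mul, Complex.norm_real]
      exact mul_le_mul hx hz (norm_nonneg _) ((abs_nonneg _).trans hx)
  have hsz : ∀ {z : ℂ} {c : ℝ}, ‖z‖ ≤ c → ‖s * z‖ ≤ σ * c := fun {z c} hz => by
    rw [norm_mul]
    exact mul_le_mul hs hz (norm_nonneg _) hσ0
  have hmul : ∀ {x y : ℂ} {a c : ℝ}, ‖x‖ ≤ a → ‖y‖ ≤ c → ‖x * y‖ ≤ a * c :=
    fun {x y a c} hx hy => by
      rw [norm_mul]
      exact mul_le_mul hx hy (norm_nonneg _) ((norm_nonneg _).trans hx)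
  have hS' : ‖S - S₀‖ ≤ cS * T := hSS.trans (mul_le_mul_of_nonneg_left (by linarith) hcS0)
  have hM' : ‖M - M₀‖ ≤ 24 * (cM * σ) * T :=
    hMM.trans (mul_le_mul_of_nonneg_left t4 (by positivity))
  have b1 : ‖(w : ℂ) * (2 * s * (((U - U₀ : ℝ) : ℂ) * p + U₀ * q))‖ ≤ 1 * (2 * σ * (T * 1 + Γ * T)) := by
    refine hmul hw.le (hmul ?_ (norm_add_le_of_le (hr t1 hfw) (hr hU₀ t5)))
    rw [norm_mul, Complex.norm_ofNat]
    linarith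
  have b2 : ‖((γ - γ₀ : ℝ) : ℂ) * p‖ ≤ T * η := hr t2 hηw
  have b3 : ‖(w : ℂ) * (s * (((γ - γ₀ : ℝ) : ℂ) * ((1 + s * p) * S) + γ₀ * (s * q * S) +
        γ₀ * ((1 + s * p₀) * (S - S₀))))‖ ≤
      1 * (σ * (T * (2 * 168) + Γ * (σ * T * 168) + Γ * (2 * (cS * T)))) :=
    hmul hw.le (hsz (norm_add_le_of_le (norm_add_le_of_le (hr t2 (hmul (h1s hfw) hS))
      (hr hγ₀ (hmul (hsz t5) hS))) (hr hγ₀ (hmul (h1s hf₀w) hS'))))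
  have b4 : ‖(w : ℂ) * (((γ' - γ₀' : ℝ) : ℂ) * (M + (d : ℂ)⁻¹) + ((γ' - γ₀' : ℝ) : ℂ) * (s * p * M) +
        γ₀' * (s * q * M) + γ₀' * ((1 + s * p₀) * (M - M₀)))‖ ≤
      1 * (T * (7 * (cM * σ)) + T * (σ * 1 * (28 / d)) + Γ * (σ * T * (28 / d)) +
        Γ * (2 * (24 * (cM * σ) * T))) :=
    hmul hw.le (norm_add_le_of_le (norm_add_le_of_le (norm_add_le_of_le (hr t3 hMd)
      (hr t3 (hmul (hsz hfw) hM))) (hr hγ₀' (hmul (hsz t5) hM))) (hr hγ₀' (hmul (h1s hf₀w) hM')))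
  refine (norm_add_le_of_le (norm_add_le_of_le (norm_sub_le_of_le b1 b2) b3) b4).trans ?_
  have hX : 0 ≤ (σ + η) * T := by positivity
  have hσX : σ * T ≤ (σ + η) * T := mul_le_mul_of_nonneg_right (by linarith) hT0
  have hηX : T * η ≤ (σ + η) * T := by
    rw [mul_comm]
    exact mul_le_mul_of_nonneg_right (by linarith) hT0
  have hσσ : σ * (Γ * (σ * T * 168)) ≤ 168 * Γ * ((σ + η) * T) := by
    have h1 : σ * (σ * T) ≤ 1 * (σ * T) :=
      mul_le_mul_of_nonneg_right (by linarith) (by positivity)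
    have h2 : 168 * Γ * (σ * (σ * T)) ≤ 168 * Γ * ((σ + η) * T) :=
      mul_le_mul_of_nonneg_left (by linarith) (by positivity)
    linarith
  have c1 := mul_le_mul_of_nonneg_left hσX (show 0 ≤ 2 + 2 * Γ by positivity)
  have c3 := mul_le_mul_of_nonneg_left hσX (show 0 ≤ 336 + 2 * Γ * cS by positivity)
  have c4 := mul_le_mul_of_nonneg_left hσX
    (show 0 ≤ 7 * cM + 28 / d + 28 / d * Γ + 48 * Γ * cM by positivity)
  have hfin : remainderConst d Γ * (σ + η) * T = (2 + 2 * Γ) * ((σ + η) * T) + (σ + η) * T +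
      ((336 + 2 * Γ * cS) * ((σ + η) * T) + 168 * Γ * ((σ + η) * T)) +
      (7 * cM + 28 / d + 28 / d * Γ + 48 * Γ * cM) * ((σ + η) * T) := by
    rw [remainderConst, ← hcS, ← hcM]
    ring
  rw [hfin]
  linarith

variable {g : Circle → ℂ}

/-- The quadratic identity turns a pointwise bound into bounds for the mode and the derivative. -/
lemma l2_bounds (hg : CircleDifferentiable g) (hc : Continuous (circleDeriv g)) {a : ℕ → ℝ}
    (ha : ∀ w : Circle, HasSum (fun n : ℕ => (a n : ℂ) * conj (w : ℂ) ^ (n + 1)) (g w))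
    {s γ K T : ℝ} (hK : 0 ≤ K) (hT : l2Norm (circleDeriv g) ≤ T)
    (h : ∀ w : Circle, |(s * (w : ℂ) - γ * circleDeriv g w).im| ≤ K * (T + ‖circleDeriv g w‖)) :
    |s| ≤ 4 * K * T ∧ |γ| * l2Norm (circleDeriv g) ≤ 6 * K * T := by
  have hT0 : 0 ≤ T := (l2Norm_nonneg _).trans hT
  have h1 := integral_sq_sub_im hg hc ha s γ
  rw [← l2Norm_sq] at h1
  have hcont : Continuous fun θ : ℝ => ‖circleDeriv g (Circle.exp θ)‖ ^ 2 :=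
    (hc.comp Circle.exp.continuous).norm.pow 2
  have hcont' : Continuous fun θ : ℝ =>
      (s * (Circle.exp θ : ℂ) - γ * circleDeriv g (Circle.exp θ)).im ^ 2 :=
    (Complex.continuous_im.comp ((continuous_const.mul (continuous_subtype_val.comp
      Circle.exp.continuous)).sub (continuous_const.mul (hc.comp Circle.exp.continuous)))).pow 2
  have i1 : IntervalIntegrable (fun θ : ℝ => 2 * K ^ 2 * ‖circleDeriv g (Circle.exp θ)‖ ^ 2)
      volume 0 (2 * π) := (continuous_const.mul hcont).intervalIntegrable _ _
  have i0 : IntervalIntegrable (fun _ : ℝ => 2 * K ^ 2 * T ^ 2) volume 0 (2 * π) :=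
    intervalIntegrable_const
  -- The pointwise bound is squared with `(a + b)² ≤ 2a² + 2b²` and integrated; the `|g'|²` that
  -- appears is absorbed by `T`.
  have h2 : ∫ θ in (0 : ℝ)..(2 * π),
        (s * (Circle.exp θ : ℂ) - γ * circleDeriv g (Circle.exp θ)).im ^ 2 ≤
      ∫ θ in (0 : ℝ)..(2 * π), (2 * K ^ 2 * T ^ 2 +
        2 * K ^ 2 * ‖circleDeriv g (Circle.exp θ)‖ ^ 2) := by
    refine intervalIntegral.integral_mono_on Real.two_pi_pos.le (hcont'.intervalIntegrable _ _)
      (i0.add i1) fun θ _ => ?_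
    have h3 := h (Circle.exp θ)
    have h4 := sq_le_sq' (by linarith [abs_nonneg ((s * (Circle.exp θ : ℂ) -
      γ * circleDeriv g (Circle.exp θ)).im), mul_nonneg hK (add_nonneg hT0
      (norm_nonneg (circleDeriv g (Circle.exp θ))))]) h3
    rw [sq_abs] at h4
    refine h4.trans ?_
    have h5 : 0 ≤ K ^ 2 * (T - ‖circleDeriv g (Circle.exp θ)‖) ^ 2 := by positivity
    nlinarith
  rw [intervalIntegral.integral_add i0 i1, intervalIntegral.integral_const,
    intervalIntegral.integral_const_mul, ← l2Norm_sq, sub_zero, smul_eq_mul] at h2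
  set n := l2Norm (circleDeriv g)
  have hn0 : 0 ≤ n := l2Norm_nonneg _
  have hn2 : n ^ 2 ≤ T ^ 2 := by gcongr
  have hX : 0 ≤ K ^ 2 * T ^ 2 := by positivity
  -- `16 = 14 + 2`, with `4π ≤ 14`. From `s² ≤ π s²` follows `|s| ≤ 4KT`, and from `γ²n² ≤ 32 K²T² ≤
  -- 36 K²T²` follows the second bound.
  have h6 : π * s ^ 2 + γ ^ 2 / 2 * n ^ 2 ≤ 16 * (K ^ 2 * T ^ 2) := by
    have h7 : 2 * π * (2 * K ^ 2 * T ^ 2) ≤ 14 * (K ^ 2 * T ^ 2) := by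
      have := mul_le_mul_of_nonneg_right (show 4 * π ≤ 14 by linarith [Real.pi_lt_d2]) hX
      linarith
    have h8 : 2 * K ^ 2 * n ^ 2 ≤ 2 * (K ^ 2 * T ^ 2) := by
      have := mul_le_mul_of_nonneg_left hn2 (show 0 ≤ 2 * K ^ 2 by positivity)
      linarith
    linarith
  constructor
  · refine abs_le_of_sq_le_sq ?_ (by positivity)
    have h9 : s ^ 2 ≤ π * s ^ 2 := le_mul_of_one_le_left (sq_nonneg s) (by linarith [Real.pi_gt_three])
    have h10 : 0 ≤ γ ^ 2 / 2 * n ^ 2 := by positivity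
    nlinarith
  · refine abs_le_of_sq_le_sq' ?_ (by positivity) |>.2
    rw [mul_pow, sq_abs]
    have h9 : 0 ≤ π * s ^ 2 := by positivity
    nlinarith

end Uniqueness

/-! ### Local uniqueness in the Hölder space -/

section HolderUniqueness

variable {α : ℝ≥0}

lemma HolderSpace.norm_apply_le (f : HolderSpace α) (w : Circle) : ‖f.1 w‖ ≤ ‖f‖ := by
  obtain ⟨⟨hf, hf'⟩, -⟩ := f.2
  rw [norm_def, c1HolderNorm]
  have h1 := le_ciSup hf.bddAbove_norm w
  have h2 : 0 ≤ ⨆ w, ‖circleDeriv f.1 w‖ := Real.iSup_nonneg fun _ => norm_nonneg _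
  have h3 := NNReal.coe_nonneg (nnHolderNorm α (circleDeriv f.1))
  linarith

lemma HolderSpace.norm_circleDeriv_le (f : HolderSpace α) (w : Circle) :
    ‖circleDeriv f.1 w‖ ≤ ‖f‖ := by
  obtain ⟨⟨hf, hf'⟩, -⟩ := f.2
  rw [norm_def, c1HolderNorm]
  have h1 := le_ciSup (MemHolder.bddAbove_norm hf') w
  have h2 : 0 ≤ ⨆ w, ‖f.1 w‖ := Real.iSup_nonneg fun _ => norm_nonneg _
  have h3 := NNReal.coe_nonneg (nnHolderNorm α (circleDeriv f.1))
  linarith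

lemma HolderSpace.isC1Unit (hα : 0 < α) {f : HolderSpace α} (hf : ‖f‖ ≤ 1) : IsC1Unit f.1 := by
  obtain ⟨⟨h1, C, hC⟩, -⟩ := f.2
  exact ⟨h1, hC.continuous hα, fun w => (f.norm_apply_le w).trans hf,
    fun w => (f.norm_circleDeriv_le w).trans hf⟩

lemma HolderSpace.ext_fun {f g : HolderSpace α} (h : ∀ w, f.1 w = g.1 w) : f = g :=
  Subtype.ext (funext h)

/-- The difference of two profiles again contains only negative powers. Hence the `L²` norm of the
derivative dominates the difference itself, and its vanishing forces equality. -/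
lemma HolderSpace.norm_sub_apply_le (hα : 0 < α) {f g : HolderSpace α} (hf : ‖f‖ ≤ 1)
    (hg : ‖g‖ ≤ 1) (w : Circle) : ‖f.1 w - g.1 w‖ ≤ 3 * l2Norm (circleDeriv (f.1 - g.1)) := by
  obtain ⟨-, a, ha⟩ := (f - g).2
  exact norm_le_l2Norm ((isC1Unit hα hf).differentiable.sub (isC1Unit hα hg).differentiable)
    ((isC1Unit hα hf).continuous_circleDeriv_sub (isC1Unit hα hg)) ha w

/-- Each of the four quantities is at most a multiple of `K` times their sum: `2` for `u`, `8d` for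
`v`, `6/G` and `12/G` for the profiles. Adding up bounds the sum by a factor below one times itself.
-/
lemma eq_zero_of_small_bounds {d G G' K u v m m' : ℝ} (hd : 0 < d) (hG : 0 < G)
    (hGG' : G / 2 ≤ G') (hm : 0 ≤ m) (hm' : 0 ≤ m')
    (q₁ : |2 * u - v / d| ≤ 4 * K * (|u| + |v| + m + m'))
    (q₂ : |2 * u| ≤ 4 * K * (|u| + |v| + m + m')) (r₁ : G * m ≤ 6 * K * (|u| + |v| + m + m'))
    (r₂ : G' * m' ≤ 6 * K * (|u| + |v| + m + m')) (hsmall : K * (2 + 8 * d + 18 / G) < 1) :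
    |u| + |v| + m + m' = 0 := by
  have hT0 : 0 ≤ |u| + |v| + m + m' := by positivity
  have x₁ : |u| ≤ 2 * (K * (|u| + |v| + m + m')) := by
    rw [abs_mul, abs_two] at q₂
    linarith only [q₂]
  have x₂ : |v| ≤ 8 * d * (K * (|u| + |v| + m + m')) := by
    have h6 : v = d * (2 * u - (2 * u - v / d)) := by
      field_simp
      ring
    have h7 : |v| = d * |2 * u - (2 * u - v / d)| := by
      rw [← abs_of_pos hd, ← abs_mul, abs_of_pos hd, ← h6]
    have h8 := abs_sub (2 * u) (2 * u - v / d)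
    calc |v| = d * |2 * u - (2 * u - v / d)| := h7
      _ ≤ d * (8 * (K * (|u| + |v| + m + m'))) :=
        mul_le_mul_of_nonneg_left (by linarith only [h8, q₁, q₂]) hd.le
      _ = _ := by ring
  have x₃ : m ≤ 6 / G * (K * (|u| + |v| + m + m')) := by
    rw [div_mul_eq_mul_div, le_div_iff₀ hG]
    linarith only [r₁]
  have x₄ : m' ≤ 12 / G * (K * (|u| + |v| + m + m')) := by
    rw [div_mul_eq_mul_div, le_div_iff₀ hG]
    have := mul_le_mul_of_nonneg_right hGG' hm'
    linarith only [r₂, this]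
  generalize hT : |u| + |v| + m + m' = T at *
  have h6 : T ≤ K * (2 + 8 * d + 18 / G) * T := by
    have h7 : K * (2 + 8 * d + 18 / G) * T = 2 * (K * T) + 8 * d * (K * T) + 6 / G * (K * T) +
        12 / G * (K * T) := by ring
    linarith only [x₁, x₂, x₃, x₄, h7, hT]
  by_contra h7
  have h8 : 0 < T := lt_of_le_of_ne hT0 (Ne.symm h7)
  have h9 := mul_lt_mul_of_pos_right hsmall h8
  linarith only [h6, h9]

set_option maxHeartbeats 1000000 in
/-- Near the point vortex pair, for each small `ε` there is at most one solution. -/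
theorem exists_local_uniqueness (hα : 0 < α) (b₁ b₂ : ℝ) {d γ₁ : ℝ} (hd : 0 < d) (hγ : γ₁ ≠ 0) :
    ∃ δ : ℝ, 0 < δ ∧ ∀ ε : ℝ, |ε| ≤ δ →
      ∀ z z₀ : ℝ × ℝ × (HolderSpace α × HolderSpace α),
        ‖z - (γ₁ / (2 * d), γ₁, (0, 0))‖ ≤ δ → ‖z₀ - (γ₁ / (2 * d), γ₁, (0, 0))‖ ≤ δ →
        IsSolution b₁ b₂ d γ₁ ε z.1 z.2.1 z.2.2.1 z.2.2.2 →
        IsSolution b₁ b₂ d γ₁ ε z₀.1 z₀.2.1 z₀.2.2.1 z₀.2.2.2 → z = z₀ := by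
  set Γ := |γ₁ / (2 * d)| + |γ₁| + 1 with hΓ
  set β := |b₁| + |b₂| with hβ
  set C := remainderConst d Γ with hC
  have hC0 : 0 ≤ C := remainderConst_nonneg hd (by positivity)
  have hβ0 : 0 ≤ β := by positivity
  have hγ' : 0 < |γ₁| := abs_pos.2 hγ
  have hev : ∀ a c : ℝ, 0 < c → ∀ᶠ δ in nhdsWithin (0 : ℝ) (Set.Ioi 0), δ * a < c := by
    intro a c hc
    have h1 : Filter.Tendsto (fun δ : ℝ => δ * a) (nhds 0) (nhds 0) := by
      have := (continuous_mul_const a).tendsto (0 : ℝ)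
      rwa [zero_mul] at this
    exact (h1.mono_left nhdsWithin_le_nhds).eventually (gt_mem_nhds hc)
  -- In order: the profiles lie in the unit ball; the two bounds on `σ = δβ` keep the denominators
  -- away from zero; `|γ₂|` stays above `|γ₁|/2`; the remainder is strictly smaller than the linear
  -- part.
  obtain ⟨δ, ⟨⟨⟨⟨h1, h2⟩, h3⟩, h4⟩, h5⟩, hδ⟩ :=
    (((((hev 1 1 one_pos).and (hev β (1 / 4) (by norm_num))).and
      (hev β (d / 8) (by positivity))).and (hev 1 (|γ₁| / 2) (by positivity))).and
      (hev (C * (β + 1) * (2 + 8 * d + 18 / |γ₁|)) 1 one_pos)).and self_mem_nhdsWithin |>.exists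
  have hδ0 : 0 < δ := hδ
  rw [mul_one] at h1 h4
  refine ⟨δ, hδ0, fun ε hε z z₀ hz hz₀ hsol hsol₀ => ?_⟩
  obtain ⟨U, γ, f, k⟩ := z
  obtain ⟨U₀, γ₀, f₀, k₀⟩ := z₀
  simp only [Prod.mk_sub_mk, Prod.norm_mk, sub_zero, max_le_iff, Real.norm_eq_abs] at hz hz₀ hsol hsol₀
  obtain ⟨hU, hγz, hf, hk⟩ := hz
  obtain ⟨hU₀, hγz₀, hf₀, hk₀⟩ := hz₀
  have hf1 := HolderSpace.isC1Unit hα (hf.trans h1.le)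
  have hk1 := HolderSpace.isC1Unit hα (hk.trans h1.le)
  have hf1₀ := HolderSpace.isC1Unit hα (hf₀.trans h1.le)
  have hk1₀ := HolderSpace.isC1Unit hα (hk₀.trans h1.le)
  have hm := HolderSpace.norm_sub_apply_le hα (hf.trans h1.le) (hf₀.trans h1.le)
  have hm' := HolderSpace.norm_sub_apply_le hα (hk.trans h1.le) (hk₀.trans h1.le)
  have hb₁ : |ε * b₁| ≤ δ * β := by
    rw [abs_mul]
    exact mul_le_mul hε (by linarith [abs_nonneg b₂]) (abs_nonneg _) hδ0.le
  have hb₂ : |ε * b₂| ≤ δ * β := by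
    rw [abs_mul]
    exact mul_le_mul hε (by linarith [abs_nonneg b₁]) (abs_nonneg _) hδ0.le
  have gU₀ : |U₀| ≤ Γ := by
    have := abs_sub_abs_le_abs_sub U₀ (γ₁ / (2 * d))
    linarith
  have gγ₀ : |γ₀| ≤ Γ := by
    have := abs_sub_abs_le_abs_sub γ₀ γ₁
    linarith [abs_nonneg (γ₁ / (2 * d))]
  have gγ₁ : |γ₁| ≤ Γ := by linarith [abs_nonneg (γ₁ / (2 * d))]
  have hγ₀l : |γ₁| / 2 ≤ |γ₀| := by
    have := abs_sub_abs_le_abs_sub γ₁ γ₀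
    rw [abs_sub_comm] at this
    linarith
  set m := l2Norm (circleDeriv (f.1 - f₀.1)) with hmdef
  set m' := l2Norm (circleDeriv (k.1 - k₀.1)) with hmdef'
  have hm0 : 0 ≤ m := l2Norm_nonneg _
  have hm0' : 0 ≤ m' := l2Norm_nonneg _
  set T := |U - U₀| + |γ - γ₀| + m + m' with hT
  have hT0 : 0 ≤ T := by positivity
  set K := C * (δ * β + δ) with hK
  have hK0 : 0 ≤ K := by positivity
  have e₁ : ∀ w, (complexComponent d ε U γ₁ γ b₁ b₂ f.1 (circleDeriv f.1) k.1 (circleDeriv k.1) w).im = 0 :=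
    fun w => congrArg Prod.fst (hsol w)
  have e₂ : ∀ w, (complexComponent d ε U γ γ₁ b₂ b₁ k.1 (circleDeriv k.1) f.1 (circleDeriv f.1) w).im = 0 :=
    fun w => congrArg Prod.snd (hsol w)
  have e₁₀ : ∀ w, (complexComponent d ε U₀ γ₁ γ₀ b₁ b₂ f₀.1 (circleDeriv f₀.1) k₀.1 (circleDeriv k₀.1) w).im = 0 :=
    fun w => congrArg Prod.fst (hsol₀ w)
  have e₂₀ : ∀ w, (complexComponent d ε U₀ γ₀ γ₁ b₂ b₁ k₀.1 (circleDeriv k₀.1) f₀.1 (circleDeriv f₀.1) w).im = 0 :=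
    fun w => congrArg Prod.snd (hsol₀ w)
  have him : ∀ {X X₀ Y : ℂ} {r : ℝ}, X.im = 0 → X₀.im = 0 → ‖X - X₀ - Y‖ ≤ r → |Y.im| ≤ r := by
    intro X X₀ Y r hX hX₀ h
    have h6 := (Complex.abs_im_le_norm (X - X₀ - Y)).trans h
    rwa [Complex.sub_im, Complex.sub_im, hX, hX₀, sub_zero, zero_sub, abs_neg] at h6
  obtain ⟨-, a, ha⟩ := (f - f₀).2
  obtain ⟨-, a', ha'⟩ := (k - k₀).2
  have p₁ := l2_bounds (hf1.differentiable.sub hf1₀.differentiable)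
    (hf1.continuous_circleDeriv_sub hf1₀) ha (s := 2 * (U - U₀) - (γ - γ₀) / d) (γ := γ₁) (K := K)
    (T := T) hK0 (by linarith only [hT, hm0, hm0', abs_nonneg (U - U₀), abs_nonneg (γ - γ₀)]) (fun w => by
      refine him (e₁ w) (e₁₀ w) ((norm_complexComponent_sub_le hd h2.le h3.le hb₁ hb₂ hf1 hf1₀ hk1
        hk1₀ (fun w => (f.norm_circleDeriv_le w).trans hf) gU₀ gγ₁ gγ₀ hm hm' rfl rfl w).trans
        (le_of_eq ?_))
      rw [sub_self, abs_zero, hT]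
      ring)
  -- In the second equation the strength of the other patch is the fixed `γ₁`, so the first mode
  -- sees `U` alone.
  have p₂ := l2_bounds (hk1.differentiable.sub hk1₀.differentiable)
    (hk1.continuous_circleDeriv_sub hk1₀) ha' (s := 2 * (U - U₀) - (γ₁ - γ₁) / d) (γ := γ₀) (K := K)
    (T := T) hK0 (by linarith only [hT, hm0, hm0', abs_nonneg (U - U₀), abs_nonneg (γ - γ₀)]) (fun w => by
      refine him (e₂ w) (e₂₀ w) ((norm_complexComponent_sub_le hd h2.le h3.le hb₂ hb₁ hk1 hk1₀ hf1
        hf1₀ (fun w => (k.norm_circleDeriv_le w).trans hk) gU₀ gγ₀ gγ₁ hm' hm rfl rfl w).trans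
        (le_of_eq ?_))
      rw [sub_self, abs_zero, hT]
      ring)
  rw [sub_self, zero_div, sub_zero] at p₂
  have hTz : T = 0 := eq_zero_of_small_bounds hd hγ' hγ₀l hm0 hm0' p₁.1 p₂.1 p₁.2 p₂.2
    ((le_of_eq (by rw [hK]; ring)).trans_lt h5)
  have y₁ : |U - U₀| = 0 := by linarith only [hT, hTz, hm0, hm0', abs_nonneg (U - U₀), abs_nonneg (γ - γ₀)]
  have y₂ : |γ - γ₀| = 0 := by linarith only [hT, hTz, hm0, hm0', abs_nonneg (U - U₀), abs_nonneg (γ - γ₀)]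
  have y₃ : m = 0 := by linarith only [hT, hTz, hm0, hm0', abs_nonneg (U - U₀), abs_nonneg (γ - γ₀)]
  have y₄ : m' = 0 := by linarith only [hT, hTz, hm0, hm0', abs_nonneg (U - U₀), abs_nonneg (γ - γ₀)]
  have z₁ : U = U₀ := sub_eq_zero.1 (abs_eq_zero.1 y₁)
  have z₂ : γ = γ₀ := sub_eq_zero.1 (abs_eq_zero.1 y₂)
  have z₃ : f = f₀ := HolderSpace.ext_fun fun w => by
    have h6 := hm w
    rw [y₃, mul_zero] at h6
    exact sub_eq_zero.1 (norm_le_zero_iff.1 h6)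
  have z₄ : k = k₀ := HolderSpace.ext_fun fun w => by
    have h6 := hm' w
    rw [y₄, mul_zero] at h6
    exact sub_eq_zero.1 (norm_le_zero_iff.1 h6)
  rw [z₁, z₂, z₃, z₄]

end HolderUniqueness

end VortexPair

namespace VortexPair

/-! ### The reflection symmetry -/

section Symmetry

lemma circleMean_comp_neg (h : Circle → ℂ) : circleMean (fun τ => h (-τ)) = -circleMean h := by
  have h1 := circleMean_rotate h (-1)
  simp only [neg_mul, one_mul, Circle.coe_neg, Circle.coe_one] at h1
  rw [h1, neg_neg]

lemma circleMean_neg (h : Circle → ℂ) : circleMean (fun τ => -h τ) = -circleMean h := by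
  simp only [circleMean, neg_mul, intervalIntegral.integral_neg, mul_neg]

/-- Under a simultaneous change of sign of `ε`, `τ` and `w`, the chord `A` changes sign and `B` does
not, so `A + εbB` changes sign as a whole. The mutual denominator is unchanged, since `ε` multiplies
points and `ε²` multiplies profiles. Derivatives and `dτ` change sign. -/
lemma component_reflect (d ε U γ γ' b b' : ℝ) (f k : Circle → ℂ) (w : Circle) :
    component d (-ε) U γ γ' b b' (fun z => f (-z)) (fun z => k (-z)) w =
      -component d ε U γ γ' b b' f k (-w) := by
  rw [component, component]
  simp only [HolderSpace.circleDeriv_comp_neg]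
  have h1 : circleMean (fun τ => (((τ : ℂ) - w) * conj (f (-τ) - f (-w)) -
        conj ((τ : ℂ) - w) * (f (-τ) - f (-w))) /
        (((τ : ℂ) - w) * ((τ : ℂ) - w + ((-ε : ℝ) : ℂ) * b * (f (-τ) - f (-w)))) *
        (-circleDeriv f (-τ) - (f (-τ) - f (-w)) / ((τ : ℂ) - w))) =
      -circleMean (fun τ => (((τ : ℂ) - (-w : Circle)) * conj (f τ - f (-w)) -
        conj ((τ : ℂ) - (-w : Circle)) * (f τ - f (-w))) /
        (((τ : ℂ) - (-w : Circle)) * ((τ : ℂ) - (-w : Circle) + (ε : ℂ) * b * (f τ - f (-w)))) *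
        (circleDeriv f τ - (f τ - f (-w)) / ((τ : ℂ) - (-w : Circle)))) := by
    rw [← circleMean_comp_neg]
    congr 1
    funext τ
    have hA : ((-τ : Circle) : ℂ) - ((-w : Circle) : ℂ) = -((τ : ℂ) - w) := by
      rw [Circle.coe_neg, Circle.coe_neg]
      ring
    rw [hA]
    generalize (τ : ℂ) - w = A
    generalize f (-τ) - f (-w) = B
    have hD : -A * (-A + (ε : ℂ) * b * B) = A * (A + ((-ε : ℝ) : ℂ) * b * B) := by
      push_cast
      ring
    rw [hD, div_neg, map_neg]
    ring
  have h2 : circleMean (fun τ =>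
        (conj (τ : ℂ) + ((-ε : ℝ) : ℂ) * b' * conj (k (-τ))) *
          (1 + ((-ε : ℝ) : ℂ) * b' * -circleDeriv k (-τ)) /
          (((-ε : ℝ) : ℂ) * (b' * τ + b * w) +
            ((-ε : ℝ) : ℂ) ^ 2 * (b' ^ 2 * k (-τ) + b ^ 2 * f (-w)) - d)) =
      circleMean (fun τ => (conj (τ : ℂ) + ε * b' * conj (k τ)) * (1 + ε * b' * circleDeriv k τ) /
          (ε * (b' * τ + b * (-w : Circle)) + ε ^ 2 * (b' ^ 2 * k τ + b ^ 2 * f (-w)) - d)) := by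
    rw [← neg_neg (circleMean fun τ => (conj (τ : ℂ) + ε * b' * conj (k τ)) * _ / _),
      ← circleMean_comp_neg, ← circleMean_neg]
    congr 1
    funext τ
    rw [← neg_div, Circle.coe_neg, Circle.coe_neg, map_neg]
    push_cast
    congr 1 <;> ring
  rw [h1, h2, ← Complex.neg_im, Circle.coe_neg]
  congr 1
  push_cast
  ring

lemma IsSolution.reflect {α : ℝ≥0} {b₁ b₂ d γ₁ ε U γ₂ : ℝ} {f₁ f₂ : HolderSpace α}
    (h : IsSolution b₁ b₂ d γ₁ ε U γ₂ f₁ f₂) :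
    IsSolution b₁ b₂ d γ₁ (-ε) U γ₂ f₁.reflect f₂.reflect := fun w => by
  have h1 := congrArg Prod.fst (h (-w))
  have h2 := congrArg Prod.snd (h (-w))
  simp only [pairFunctional, Prod.fst_zero, Prod.snd_zero] at h1 h2
  refine Prod.ext ?_ ?_
  · exact (component_reflect d ε U γ₁ γ₂ b₁ b₂ f₁ f₂ w).trans (by rw [h1, neg_zero]; rfl)
  · exact (component_reflect d ε U γ₂ γ₁ b₂ b₁ f₂ f₁ w).trans (by rw [h2, neg_zero]; rfl)

variable {α : ℝ≥0}

lemma HolderSpace.norm_reflect_le (f : HolderSpace α) : ‖f.reflect‖ ≤ ‖f‖ := by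
  obtain ⟨⟨hf, hf'⟩, -⟩ := f.2
  have h0 : (f.reflect : Circle → ℂ) = fun w => f.1 (-w) := rfl
  rw [norm_def, norm_def, c1HolderNorm, c1HolderNorm, h0]
  have hd : circleDeriv (fun w => f.1 (-w)) = fun w => -circleDeriv f.1 (-w) :=
    funext fun w => circleDeriv_comp_neg f.1 w
  rw [hd]
  have h1 : (⨆ w, ‖f.1 (-w)‖) ≤ ⨆ w, ‖f.1 w‖ := ciSup_le fun w => le_ciSup hf.bddAbove_norm (-w)
  have h2 : (⨆ w, ‖-circleDeriv f.1 (-w)‖) ≤ ⨆ w, ‖circleDeriv f.1 w‖ := ciSup_le fun w => by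
    rw [norm_neg]
    exact le_ciSup (MemHolder.bddAbove_norm hf') (-w)
  have h3 : nnHolderNorm α (fun w => -circleDeriv f.1 (-w)) ≤ nnHolderNorm α (circleDeriv f.1) := by
    refine HolderWith.nnholderNorm_le fun x y => ?_
    have h := hf'.holderWith (-x) (-y)
    have hxy : edist (-x) (-y) = edist x y := by
      have h1 : ∀ u v : Circle, edist u v = edist (u : ℂ) (v : ℂ) := fun _ _ => rfl
      rw [h1, h1, Circle.coe_neg, Circle.coe_neg, edist_neg_neg]
    rw [edist_neg_neg]
    rwa [hxy] at h
  have h4 := NNReal.coe_le_coe.2 h3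
  linarith

/-- Reflection as a continuous linear map. -/
def HolderSpace.reflectL (α : ℝ≥0) : HolderSpace α →L[ℝ] HolderSpace α :=
  LinearMap.mkContinuous
    { toFun := HolderSpace.reflect
      map_add' := fun _ _ => rfl
      map_smul' := fun _ _ => rfl } 1
    (fun f => (f.norm_reflect_le).trans_eq (one_mul _).symm)

/-- The reflection of a curve of solutions. -/
def reflectCurve (g : ℝ → ℝ × ℝ × (HolderSpace α × HolderSpace α)) (ε : ℝ) :
    ℝ × ℝ × (HolderSpace α × HolderSpace α) :=
  ((g (-ε)).1, (g (-ε)).2.1, ((g (-ε)).2.2.1.reflect, (g (-ε)).2.2.2.reflect))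

/-- The reflected curve competes with the original one in the uniqueness statement, which is how the
symmetry of the curve is obtained. -/
lemma IsSolutionCurve.reflectCurve {b₁ b₂ d γ₁ ε₀ : ℝ}
    {g : ℝ → ℝ × ℝ × (HolderSpace α × HolderSpace α)} (h : IsSolutionCurve b₁ b₂ d γ₁ ε₀ g) :
    IsSolutionCurve b₁ b₂ d γ₁ ε₀ (reflectCurve g) := by
  have hmem : ∀ {ε}, ε ∈ Set.Icc (-ε₀) ε₀ → -ε ∈ Set.Icc (-ε₀) ε₀ := fun {ε} hε =>
    ⟨by linarith [hε.2], by linarith [hε.1]⟩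
  refine ⟨?_, fun ε hε => ?_, fun ε hε => ?_, ?_⟩
  · have h1 : ContDiffOn ℝ 1 (fun ε => g (-ε)) (Set.Icc (-ε₀) ε₀) :=
      h.contDiffOn.comp contDiff_neg.contDiffOn fun ε hε => hmem hε
    exact h1.fst.prodMk (h1.snd.fst.prodMk
      (((HolderSpace.reflectL α).contDiff.comp_contDiffOn h1.snd.snd.fst).prodMk
        ((HolderSpace.reflectL α).contDiff.comp_contDiffOn h1.snd.snd.snd)))
  · have h1 := h.norm_le_one _ (hmem hε)
    rw [Prod.norm_def] at h1 ⊢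
    exact (max_le_max (HolderSpace.norm_reflect_le _) (HolderSpace.norm_reflect_le _)).trans h1
  · have h1 := (h.isSolution _ (hmem hε)).reflect
    rwa [neg_neg] at h1
  · have h0 : (0 : HolderSpace α).reflect = 0 := rfl
    rw [VortexPair.reflectCurve, neg_zero, h.initial, h0]

end Symmetry
end VortexPair

namespace VortexPair

/-! ### Assembly of the curve and its patches -/

section Final

lemma boundaryMap_properties {ε b : ℝ} {x : Coef} (hN : |ε * b| * ‖x‖ ≤ 1 / 20) {φ : Circle → ℂ}
    {D : Set ℂ} (hφ : φ = boundaryMap ε b (profile x)) (hD : D = enclosedDomain φ) :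
    IsStrictlyConvexDomain D ∧ IsC1BoundaryOf φ D ∧ 0 ∈ D ∧ D ⊆ Metric.ball 0 2 := by
  have h := (c11Bound_profile x).const_mul (ε * b)
  rw [boundaryMap_eq_perturb] at hφ
  subst hφ hD
  exact ⟨h.isStrictlyConvexDomain hN, h.isC1BoundaryOf hN, h.zero_mem_domain hN,
    h.domain_subset_ball hN⟩

variable {α : ℝ≥0}

/-- The assertion that a curve of solutions yields translating pairs of strictly convex patches. -/
def YieldsPairs (b₁ b₂ d γ₁ ε₀ : ℝ) (g : ℝ → ℝ × ℝ × (HolderSpace α × HolderSpace α)) : Prop :=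
  ∀ ε ∈ Set.Icc (-ε₀) ε₀, ε ≠ 0 → ∀ φ₁ φ₂ : Circle → ℂ, ∀ D₁ D₂ : Set ℂ,
    φ₁ = boundaryMap ε b₁ (g ε).2.2.1 → φ₂ = boundaryMap ε b₂ (g ε).2.2.2 →
    D₁ = enclosedDomain φ₁ → D₂ = enclosedDomain φ₂ →
    IsStrictlyConvexDomain D₁ ∧ IsStrictlyConvexDomain D₂ ∧
    IsC1BoundaryOf φ₁ D₁ ∧ IsC1BoundaryOf φ₂ D₂ ∧
    0 ∈ D₁ ∧ 0 ∈ D₂ ∧ D₁ ⊆ Metric.ball 0 2 ∧ D₂ ⊆ Metric.ball 0 2 ∧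
    IsTranslatingPair b₁ b₂ d γ₁ ε (g ε).1 (g ε).2.1 φ₁ φ₂ D₁ D₂

/-- The curve of `HolderSpace` data of a curve of coefficient data. -/
def includeCurve (hα : α < 1) (ψ : ℝ → ℝ × ℝ × (Coef × Coef)) (ε : ℝ) :
    ℝ × ℝ × (HolderSpace α × HolderSpace α) :=
  ((ψ ε).1, (ψ ε).2.1, (inclusion hα (ψ ε).2.2.1, inclusion hα (ψ ε).2.2.2))

/-- The coefficient data `y` solve the system at `ε`. -/
def SolvesCoef (b₁ b₂ d γ₁ ε : ℝ) (y : ℝ × ℝ × (Coef × Coef)) : Prop :=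
  ∀ w : Circle,
    (complexComponent d ε y.1 γ₁ y.2.1 b₁ b₂ (profile y.2.2.1)
      (profileDeriv y.2.2.1) (profile y.2.2.2) (profileDeriv y.2.2.2) w).im = 0 ∧
    (complexComponent d ε y.1 y.2.1 γ₁ b₂ b₁ (profile y.2.2.2)
      (profileDeriv y.2.2.2) (profile y.2.2.1) (profileDeriv y.2.2.1) w).im = 0

lemma yieldsPairs_includeCurve (hα : α < 1) {b₁ b₂ d γ₁ ε₀ : ℝ} (hb₁ : 0 < b₁) (hb₂ : 0 < b₂)
    (hd : b₁ + b₂ < d) (hε₀ : ε₀ < 1 / 2) {ψ : ℝ → ℝ × ℝ × (Coef × Coef)}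
    (hψ : ∀ ε ∈ Set.Icc (-ε₀) ε₀, SolvesCoef b₁ b₂ d γ₁ ε (ψ ε))
    (hN₁ : ∀ ε ∈ Set.Icc (-ε₀) ε₀, |ε * b₁| * ‖(ψ ε).2.2.1‖ ≤ 1 / 20)
    (hN₂ : ∀ ε ∈ Set.Icc (-ε₀) ε₀, |ε * b₂| * ‖(ψ ε).2.2.2‖ ≤ 1 / 20) :
    YieldsPairs b₁ b₂ d γ₁ ε₀ (includeCurve hα ψ) := by
  intro ε hε hε0 φ₁ φ₂ D₁ D₂ hφ₁ hφ₂ hD₁ hD₂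
  have hε1 : |ε| ≤ 1 / 2 := abs_le.2 ⟨by linarith [hε.1], by linarith [hε.2]⟩
  -- The patches lie in discs of radius `21/20` times their scale. Since `|ε| ≤ 1/2`, these radii
  -- add up to at most `(21/40)(b₁ + b₂)`, which is below `d`.
  have hsep : 21 / 20 * (|ε * b₁| + |ε * b₂|) < d := by
    rw [abs_mul, abs_mul, abs_of_pos hb₁, abs_of_pos hb₂, ← mul_add]
    have := mul_le_mul_of_nonneg_right hε1 (add_pos hb₁ hb₂).le
    linarith
  obtain ⟨a₁, a₂, a₃, a₄⟩ := boundaryMap_properties (hN₁ ε hε) hφ₁ hD₁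
  obtain ⟨c₁, c₂, c₃, c₄⟩ := boundaryMap_properties (hN₂ ε hε) hφ₂ hD₂
  refine ⟨a₁, c₁, a₂, c₂, a₃, c₃, a₄, c₄, ?_⟩
  subst hD₁ hD₂ hφ₁ hφ₂
  exact isTranslatingPair_of_im_eq_zero hε0 hb₁.ne' hb₂.ne' hsep (hN₁ ε hε) (hN₂ ε hε)
    (fun w => (hψ ε hε w).1) (fun w => (hψ ε hε w).2)

lemma SolvesCoef.isSolution (hα : α < 1) {b₁ b₂ d γ₁ ε : ℝ} {y : ℝ × ℝ × (Coef × Coef)}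
    (h : SolvesCoef b₁ b₂ d γ₁ ε y) :
    IsSolution b₁ b₂ d γ₁ ε y.1 y.2.1 (inclusion hα y.2.2.1 : HolderSpace α)
      (inclusion hα y.2.2.2 : HolderSpace α) := fun w => by
  refine Prod.ext ?_ ?_
  · rw [pairFunctional, component_eq_im, circleDeriv_inclusion, circleDeriv_inclusion]
    exact (h w).1
  · rw [pairFunctional, component_eq_im, component_eq_im, circleDeriv_inclusion,
      circleDeriv_inclusion]
    exact (h w).2

lemma solvesCoef_zero (b₁ b₂ d ε : ℝ) : SolvesCoef b₁ b₂ d 0 ε (0, 0, (0, 0)) := fun w => by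
  have h0 : profileDeriv 0 = 0 := by
    funext w
    simp [profileDeriv]
  simp [complexComponent, h0]

/-- Without circulation the trivial solution works for every `ε`: all strengths and the speed vanish
and both patches are discs. The length `1/4` of the interval is arbitrary below `1/2`. -/
lemma exists_curve_of_eq_zero (α : ℝ≥0) (hα : α < 1) {b₁ b₂ d : ℝ} (hb₁ : 0 < b₁) (hb₂ : 0 < b₂)
    (hd : b₁ + b₂ < d) :
    ∃ g : ℝ → ℝ × ℝ × (HolderSpace α × HolderSpace α), IsSolutionCurve b₁ b₂ d 0 (1 / 4) g ∧
      (∀ ε, g (-ε) = ((g ε).1, (g ε).2.1, ((g ε).2.2.1.reflect, (g ε).2.2.2.reflect))) ∧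
      YieldsPairs b₁ b₂ d 0 (1 / 4) g := by
  have h0 : includeCurve hα (fun _ => ((0 : ℝ), (0 : ℝ), ((0 : Coef), (0 : Coef)))) =
      fun _ => ((0 : ℝ), (0 : ℝ), ((0 : HolderSpace α), (0 : HolderSpace α))) := by
    funext ε
    simp only [includeCurve, map_zero]
  refine ⟨includeCurve hα fun _ => (0, 0, (0, 0)), ⟨?_, fun ε _ => ?_, fun ε _ => ?_, ?_⟩,
    fun ε => ?_, ?_⟩
  · rw [h0]
    exact contDiffOn_const
  · rw [h0]
    simp
  · exact (solvesCoef_zero b₁ b₂ d ε).isSolution hα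
  · rw [h0, zero_div]
  · rw [h0]
    rfl
  · exact yieldsPairs_includeCurve hα hb₁ hb₂ hd (by norm_num)
      (fun ε _ => solvesCoef_zero b₁ b₂ d ε) (fun ε _ => by simp) (fun ε _ => by simp)

/-- A continuous path on an interval around `0` that starts at the centre of a ball and stays in the
smaller half of the ball whenever it is in the ball, stays in the ball. -/
lemma norm_le_of_gap {E : Type*} [NormedAddCommGroup E] {ε₀ δ : ℝ} (hε₀ : 0 ≤ ε₀) (hδ : 0 < δ)
    {φ : ℝ → E} (hφ : ContinuousOn φ (Set.Icc (-ε₀) ε₀)) (h0 : φ 0 = 0)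
    (hgap : ∀ t ∈ Set.Icc (-ε₀) ε₀, ‖φ t‖ ≤ δ → ‖φ t‖ ≤ δ / 2) :
    ∀ t ∈ Set.Icc (-ε₀) ε₀, ‖φ t‖ ≤ δ := by
  intro t ht
  by_contra! hlt
  -- If the path left the ball, its norm would take the value `δ` exactly, by the intermediate value
  -- theorem, and this is excluded by the gap between `δ/2` and `δ`.
  have h1 : Set.OrdConnected ((fun t => ‖φ t‖) '' Set.Icc (-ε₀) ε₀) :=
    (isPreconnected_Icc.image _ hφ.norm).ordConnected
  obtain ⟨s, hs, hs'⟩ := h1.out ⟨0, ⟨by linarith, hε₀⟩, rfl⟩ ⟨t, ht, rfl⟩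
    (show δ ∈ _ from ⟨by simpa [h0] using hδ.le, hlt.le⟩)
  have h2 := hgap s hs (le_of_eq hs')
  simp only at hs'
  linarith

/-- The curve comes from the coefficient space, while uniqueness is proved among all Hölder curves.
The competitor is only known to be continuous and to start at the base point, so it must first be
shown to remain in the ball of local uniqueness. -/
lemma exists_curve_of_ne_zero (hα₀ : 0 < α) (hα : α < 1) {b₁ b₂ d γ₁ : ℝ} (hb₁ : 0 < b₁)
    (hb₂ : 0 < b₂) (hd : b₁ + b₂ < d) (hγ : γ₁ ≠ 0) :
    ∃ ε₀ : ℝ, 0 < ε₀ ∧ ε₀ < 1 / 2 ∧ ∃ g : ℝ → ℝ × ℝ × (HolderSpace α × HolderSpace α),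
      IsSolutionCurve b₁ b₂ d γ₁ ε₀ g ∧
      (∀ g' : ℝ → ℝ × ℝ × (HolderSpace α × HolderSpace α), IsSolutionCurve b₁ b₂ d γ₁ ε₀ g' →
        Set.EqOn g' g (Set.Icc (-ε₀) ε₀)) ∧
      YieldsPairs b₁ b₂ d γ₁ ε₀ g := by
  have hd0 : 0 < d := by linarith
  obtain ⟨ψ, hψc, hψ0, hψs⟩ := exists_coef_curve b₁ b₂ hd0.ne' hγ
  obtain ⟨δ, hδ, huniq⟩ := exists_local_uniqueness hα₀ b₁ b₂ hd0 hγ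
  have hg0 : includeCurve hα ψ 0 = (γ₁ / (2 * d), γ₁, (0, 0)) := by
    rw [includeCurve, hψ0, basePoint]
    simp only [map_zero]
  obtain ⟨u, hu, hψu⟩ := hψc.contDiffOn (m := 1) le_rfl (by simp)
  have hgu : ContDiffOn ℝ 1 (includeCurve hα ψ) u := by
    have h1 := hψu
    exact h1.fst.prodMk (h1.snd.fst.prodMk
      (((inclusion hα).contDiff.comp_contDiffOn h1.snd.snd.fst).prodMk
        ((inclusion hα).contDiff.comp_contDiffOn h1.snd.snd.snd)))
  have hgc : ContinuousAt (includeCurve hα ψ) 0 := hgu.continuousOn.continuousAt hu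
  have hclose : ∀ r : ℝ, 0 < r →
      ∀ᶠ ε in nhds 0, ‖includeCurve hα ψ ε - (γ₁ / (2 * d), γ₁, (0, 0))‖ ≤ r := by
    intro r hr
    have h1 := hgc.eventually (Metric.closedBall_mem_nhds _ hr)
    rw [hg0] at h1
    simpa only [Metric.mem_closedBall, dist_eq_norm] using h1
  have hsmall : ∀ b : ℝ, ∀ p : ℝ × ℝ × (Coef × Coef) → Coef, ContinuousAt p (ψ 0) →
      ∀ᶠ ε in nhds 0, |ε * b| * ‖p (ψ ε)‖ ≤ 1 / 20 := by
    intro b p hp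
    have h1 : ContinuousAt (fun ε => |ε * b| * ‖p (ψ ε)‖) 0 :=
      (continuous_mul_const b).abs.continuousAt.mul
        (ContinuousAt.comp (f := ψ) hp hψc.continuousAt).norm
    have h2 := h1.eventually_lt (continuousAt_const (y := (1 / 20 : ℝ))) (by norm_num)
    exact h2.mono fun _ => le_of_lt
  have hall := (((((Filter.eventually_mem_set.2 hu).and hψs).and (hclose 1 one_pos)).and
    (hclose (δ / 2) (half_pos hδ))).and (hsmall b₁ (fun y => y.2.2.1) (by fun_prop))).and
    (hsmall b₂ (fun y => y.2.2.2) (by fun_prop))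
  obtain ⟨r, hr, hball⟩ := Metric.eventually_nhds_iff.1 hall
  -- `r/2` keeps the interval inside the neighbourhood where all conditions hold, `1/4` ensures `ε₀
  -- < 1/2`, and `δ` is the range of local uniqueness.
  set ε₀ := min (r / 2) (min (1 / 4) δ) with hε₀
  have hε₀pos : 0 < ε₀ := by positivity
  have hle1 : ε₀ ≤ r / 2 := min_le_left _ _
  have hle2 : ε₀ ≤ 1 / 4 := (min_le_right _ _).trans (min_le_left _ _)
  have hle3 : ε₀ ≤ δ := (min_le_right _ _).trans (min_le_right _ _)
  have hIcc : ∀ {ε}, ε ∈ Set.Icc (-ε₀) ε₀ → |ε| ≤ ε₀ := fun {ε} hε => abs_le.2 hε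
  have hP := fun ε (hε : ε ∈ Set.Icc (-ε₀) ε₀) => hball (y := ε) (by
    rw [Real.dist_eq, sub_zero]
    linarith [hIcc hε])
  have hsol : ∀ ε ∈ Set.Icc (-ε₀) ε₀, SolvesCoef b₁ b₂ d γ₁ ε (ψ ε) := fun ε hε =>
    (hP ε hε).1.1.1.1.2
  have hnear := fun ε (hε : ε ∈ Set.Icc (-ε₀) ε₀) => (hP ε hε).1.1.2
  have hcurve : IsSolutionCurve b₁ b₂ d γ₁ ε₀ (includeCurve hα ψ) := by
    refine ⟨hgu.mono fun ε hε => (hP ε hε).1.1.1.1.1, fun ε hε => ?_,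
      fun ε hε => (hsol ε hε).isSolution hα, hg0⟩
    have h1 := (hP ε hε).1.1.1.2
    have h2 := (norm_snd_le _).trans ((norm_snd_le _).trans h1)
    rwa [Prod.snd_sub, Prod.snd_sub, Prod.mk_zero_zero, sub_zero] at h2
  refine ⟨ε₀, hε₀pos, by linarith, includeCurve hα ψ, hcurve, fun g' hg' => ?_,
    yieldsPairs_includeCurve hα hb₁ hb₂ hd (by linarith) hsol (fun ε hε => (hP ε hε).1.2)
      fun ε hε => (hP ε hε).2⟩
  have heq : ∀ ε ∈ Set.Icc (-ε₀) ε₀, ‖g' ε - (γ₁ / (2 * d), γ₁, (0, 0))‖ ≤ δ →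
      g' ε = includeCurve hα ψ ε := fun ε hε h =>
    huniq ε ((hIcc hε).trans hle3) _ _ h ((hnear ε hε).trans (by linarith)) (hg'.isSolution ε hε)
      (hcurve.isSolution ε hε)
  -- While the competitor is within `δ` of the base point it coincides with the constructed curve,
  -- which is within `δ/2`; this is the gap.
  have hstay := norm_le_of_gap hε₀pos.le hδ (φ := fun ε => g' ε - (γ₁ / (2 * d), γ₁, (0, 0)))
    (hg'.contDiffOn.continuousOn.sub continuousOn_const) (by simp only [hg'.initial, sub_self])
    fun ε hε h => by
      have h1 := hnear ε hε
      rwa [← heq ε hε h] at h1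
  exact fun ε hε => heq ε hε (hstay ε hε)

end Final

end VortexPair

end

theorem mainTheorem2 (α : ℝ≥0) (hα₀ : 0 < α) (hα₁ : α < 1) (b₁ b₂ d γ₁ : ℝ)
    (hb₁ : 0 < b₁) (hb₂ : 0 < b₂) (hd : b₁ + b₂ < d) :
    -- existence of the curve, and its uniqueness
    (∃ ε₀ : ℝ, 0 < ε₀ ∧ ε₀ < 1 / 2 ∧
      ∃ g : ℝ → ℝ × ℝ × (VortexPair.HolderSpace α × VortexPair.HolderSpace α),
        VortexPair.IsSolutionCurve b₁ b₂ d γ₁ ε₀ g ∧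
        (γ₁ ≠ 0 → ∀ g' : ℝ → ℝ × ℝ × (VortexPair.HolderSpace α × VortexPair.HolderSpace α),
          VortexPair.IsSolutionCurve b₁ b₂ d γ₁ ε₀ g' → Set.EqOn g' g (Set.Icc (-ε₀) ε₀)) ∧
        -- the curve is symmetric under `ε ↦ -ε`
        (∀ ε ∈ Set.Icc (-ε₀) ε₀,
          g (-ε) = ((g ε).1, (g ε).2.1, ((g ε).2.2.1.reflect, (g ε).2.2.2.reflect))) ∧
        -- for `ε ≠ 0` it gives translating pairs of strictly convex patches
        (∀ ε ∈ Set.Icc (-ε₀) ε₀, ε ≠ 0 →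
          ∀ φ₁ φ₂ : Circle → ℂ, ∀ D₁ D₂ : Set ℂ,
            φ₁ = VortexPair.boundaryMap ε b₁ (g ε).2.2.1 →
            φ₂ = VortexPair.boundaryMap ε b₂ (g ε).2.2.2 →
            D₁ = VortexPair.enclosedDomain φ₁ → D₂ = VortexPair.enclosedDomain φ₂ →
            VortexPair.IsStrictlyConvexDomain D₁ ∧ VortexPair.IsStrictlyConvexDomain D₂ ∧
            VortexPair.IsC1BoundaryOf φ₁ D₁ ∧ VortexPair.IsC1BoundaryOf φ₂ D₂ ∧
            0 ∈ D₁ ∧ 0 ∈ D₂ ∧ D₁ ⊆ Metric.ball 0 2 ∧ D₂ ⊆ Metric.ball 0 2 ∧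
            VortexPair.IsTranslatingPair b₁ b₂ d γ₁ ε (g ε).1 (g ε).2.1 φ₁ φ₂ D₁ D₂)) ∧
    -- the symmetry of the solution set
    (∀ (ε U γ₂ : ℝ) (f₁ f₂ : VortexPair.HolderSpace α),
      VortexPair.IsSolution b₁ b₂ d γ₁ ε U γ₂ f₁ f₂ →
      VortexPair.IsSolution b₁ b₂ d γ₁ (-ε) U γ₂ f₁.reflect f₂.reflect) := by
  refine ⟨?_, fun ε U γ₂ f₁ f₂ h => h.reflect⟩
  rcases eq_or_ne γ₁ 0 with rfl | hγ
  · obtain ⟨g, hg, hsymm, hpairs⟩ := VortexPair.exists_curve_of_eq_zero α hα₁ hb₁ hb₂ hd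
    exact ⟨1 / 4, by norm_num, by norm_num, g, hg, fun h => absurd rfl h, fun ε _ => hsymm ε,
      hpairs⟩
  · obtain ⟨ε₀, hε₀, hε₀', g, hg, huniq, hpairs⟩ :=
      VortexPair.exists_curve_of_ne_zero hα₀ hα₁ hb₁ hb₂ hd hγ
    refine ⟨ε₀, hε₀, hε₀', g, hg, fun _ => huniq, fun ε hε => ?_, hpairs⟩
    -- Uniqueness is used at `-ε`, where the reflected curve takes the reflected value of `g` at
    -- `ε`.
    have h := huniq _ hg.reflectCurve (show -ε ∈ Set.Icc (-ε₀) ε₀ from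
      ⟨by linarith [hε.2], by linarith [hε.1]⟩)
    rw [← h, VortexPair.reflectCurve, neg_neg]
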